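/- **Setting.** Let $\Omega=(0,1)^2$, $0<\varepsilon\le1$. Let $f$ be continuous on $\Omega\times\mathbb R$ with $f(\cdot;s)\in L_\infty(\Omega)$ for all $s\in\mathbb R$, and $f(x,y;v)-f(x,y;w)\ge C_f(v-w)$ for $v\ge w$, where $C_f\ge0$ and $C_f+\varepsilon^2\ge1$ (values of $f$ at boundary nodes, needed only for interpolation, are arbitrary). Let $u\in H^1_0(\Omega)\cap C(\bar\Omega)$ be the weak solution of $-\varepsilon^2\Delta u+f(x,y;u)=0$ in $\Omega$, $u=0$ on $\partial\Omega$. Let $\mathcal T$ be a conforming triangulation of $\bar\Omega$ with node set $\mathcal N$ and standard hat functions $\phi_z$, let $S_h\subset H^1_0(\Omega)\cap C(\bar\Omega)$ be the space of continuous functions that are linear on each $T\in\mathcal T$ and vanish on $\partial\Omega$, and let $u_h\in S_h$ satisfy $\varepsilon^2\langle\nabla u_h,\nabla v_h\rangle+\langle f_h^I,v_h\rangle=0$ for all $v_h\in S_h$, where $\langle\cdot,\cdot\rangle$ is the $L_2(\Omega)$ inner product, $f_h=f(\cdot;u_h)$ and $f_h^I$ is its piecewise linear Lagrange interpolant. Put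 $|||v|||=\{\varepsilon^2\|\nabla v\|_{2;\Omega}^2+\|v\|^2_{2;\Omega}\}^{1/2}$, assume $|||u_h-u|||>0$, and let $G=(u_h-u)/|||u_h-u|||$ and $g=G-G_h$ with any $G_h\in S_h$. For $z\in\mathcal N$ let $\omega_z$ be the union of the triangles with vertex $z$, $H_z=\operatorname{diam}\omega_z$, $h_z=|\omega_z|/H_z$, and $\gamma_z$ the set of edges originating at $z$ that do not lie on $\partial\Omega$. With a fixed constant $c_S>0$, let $\mathring\gamma_z=\{S\in\gamma_z:|S|\le c_S h_z\}$ (the short edges; those in $\gamma_z\setminus\mathring\gamma_z$ are long). For a triangle $T$ let $H_T$ be its longest edge length and $h_T=2|T|/H_T$. Let $[\![\nabla u_h]\!]\cdot\nu$ be the jump in the normal derivative of $u_h$ across an edge (the sum of the two outward normal derivatives), and let $\mathring J_z$ and $J_z$ be the maxima of its absolute value over $\mathring\gamma_z$ and over $\gamma_z\setminus\mathring\gamma_z$, respectively ($0$ if there are no such edges). For real numbers $\{\bar g_z\}_{z\in\mathcal N}$ with $\bar g_z=0$ whenever $z\in\partial\Omega$ set $$I=\sum_{z\in\mathcal N}\varepsilon^2\int_{\gamma_z}(g-\bar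 g_z)\phi_z[\![\nabla u_h]\!]\cdot\nu,\quad II=\sum_{z\in\mathcal N}\int_{\omega_z}f_h^I(g-\bar g_z)\phi_z,\quad \mathcal E_{\rm quad}=|\langle f_h-f_h^I,G\rangle|,$$ $$\Theta=\varepsilon^2\|\nabla g\|^2_{2;\Omega}+\sum_{z\in\mathcal N}(1+\varepsilon^2H_z^{-2})\|g\|^2_{2;\omega_z}.$$ **Mesh conditions**, with fixed constants $\kappa,\alpha_1,c_0>0$, $0<\alpha_0<\pi$, $M\in\mathbb N$; $a\sim b$ means $a\le\kappa b$ and $b\le\kappa a$. Standing assumptions: all angles of all triangles are at most $\alpha_0$; each node belongs to at most $M$ triangles; for each $z\in\mathcal N$ there is a rectangle $R_z\supseteq\omega_z$ with $|R_z|\le\kappa|\omega_z|$, and, if $z\in\partial\Omega$ is not a corner of $\Omega$, $R_z$ has a side parallel to the boundary edges at $z$. A1. There is a mesh $0=x_0<x_1<\dots<x_n=1$ such that each $T\in\mathcal T$, for some $i$, has its shortest edge on the line $x=x_i$ and a vertex on $x=x_{i+1}$ or $x=x_{i-1}$. A2. For every $z\in\mathcal N$: $h_z<c_0H_z$, and $h_T\sim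 h_z$, $H_T\sim H_z$ for all $T\subset\omega_z$. A3. The maximum angle of every $T\in\mathcal T$ is at most $\frac\pi2+\alpha_1\frac{h_T}{H_T}$. **Theorem.** There is a constant $C>0$ depending only on $\kappa,\alpha_0,\alpha_1,c_0,c_S,M$ (in particular, not on $\varepsilon$, $f$, or the diameters and aspect ratios of the mesh elements) such that the following holds. (a) For any $\{\bar g_z\}$ with $\bar g_z=0$ for $z\in\partial\Omega$, one has $|||u_h-u|||\le C\,(I+II+\mathcal E_{\rm quad})$. (b) If, moreover, the standing assumptions and A1–A3 hold and, for each interior node $z=(x_z,y_z)$ with $x_z=x_i$, $1\le i\le n-1$, the number $\bar g_z$ is defined by $$\int_{x_{i-1}}^{x_{i+1}}\bigl(g(x,y_z)-\bar g_z\bigr)\varphi_i(x)\,dx=0,$$ where $\varphi_i$ is the one-dimensional hat function of the mesh $\{x_i\}$ at $x_i$, then $$|I|\le C\Bigl\{\Theta\sum_{z\in\mathcal N}\Bigl[\min\{|\omega_z|,\varepsilon h_z\}(\varepsilon\mathring J_z)^2+\min\{|\omega_z|,\varepsilon H_z\}(\varepsilon J_z)^2\Bigr]\Bigr\}^{1/2}.$$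 -/

import Mathlib

namespace AnisoFE

open scoped Classical ContDiff
open MeasureTheory Set

/-- The Euclidean plane; the coordinates of a point `p` are `p 0` (`x`) and `p 1` (`y`). -/
abbrev Pt := EuclideanSpace ℝ (Fin 2)

/-- The open unit square `Ω = (0,1)²`. -/
def Ω : Set Pt := {p | ∀ i, p i ∈ Ioo (0 : ℝ) 1}

/-! ### Weak gradients, the energy norm, the boundary value problem -/

/-- `p` is a square-integrable weak (distributional) gradient of `v` in `Ω`. -/
def HasWeakGrad (v : Pt → ℝ) (p : Pt → Pt) : Prop :=
  MemLp p 2 (volume.restrict Ω) ∧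
  ∀ ψ : Pt → ℝ, ContDiff ℝ ∞ ψ → HasCompactSupport ψ → tsupport ψ ⊆ Ω → ∀ e : Pt,
    ∫ x in Ω, v x * fderiv ℝ ψ x e = - ∫ x in Ω, inner ℝ (p x) e * ψ x

/-- Membership in the Sobolev space `H¹(Ω) = W¹₂(Ω)`. -/
def MemH1 (v : Pt → ℝ) : Prop :=
  MemLp v 2 (volume.restrict Ω) ∧ ∃ p, HasWeakGrad v p

/-- The weak gradient in `Ω` (unique up to null sets) of a function of class `H¹(Ω)`. -/
noncomputable def weakGrad (v : Pt → ℝ) : Pt → Pt :=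
  if h : ∃ p, HasWeakGrad v p then h.choose else 0

/-- The space `H¹₀(Ω) ∩ C(Ω̄)`; values outside the closed square are irrelevant. -/
def MemH10C (v : Pt → ℝ) : Prop :=
  ContinuousOn v (closure Ω) ∧ (∀ x ∈ frontier Ω, v x = 0) ∧ MemH1 v

/-- The energy norm `(ε² ‖∇v‖² + ‖v‖²)^{1/2}` over `Ω`. -/
noncomputable def energyNorm (ε : ℝ) (v : Pt → ℝ) : ℝ :=
  Real.sqrt (ε ^ 2 * (∫ x in Ω, ‖weakGrad v x‖ ^ 2) + ∫ x in Ω, v x ^ 2)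

/-- Assumptions on the reaction term: `f` is continuous on `Ω × ℝ`, `f(·; s) ∈ L_∞(Ω)` for
every `s`, and `f` satisfies a one-sided Lipschitz condition with the constant `Cf ≥ 0`. -/
structure IsReaction (f : Pt → ℝ → ℝ) (Cf : ℝ) : Prop where
  continuousOn : ContinuousOn (Function.uncurry f) (Ω ×ˢ univ)
  memLp_top : ∀ s : ℝ, MemLp (fun x => f x s) ⊤ (volume.restrict Ω)
  nonneg : 0 ≤ Cf
  one_sided : ∀ x ∈ Ω, ∀ v w : ℝ, w ≤ v → Cf * (v - w) ≤ f x v - f x w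

/-- `u ∈ H¹₀(Ω) ∩ C(Ω̄)` is the (weak) solution of `-ε² Δu + f(x,y;u) = 0` in `Ω`,
`u = 0` on `∂Ω`. -/
def IsSolution (ε : ℝ) (f : Pt → ℝ → ℝ) (u : Pt → ℝ) : Prop :=
  MemH10C u ∧ ∀ v : Pt → ℝ, MemH10C v →
    ε ^ 2 * (∫ x in Ω, inner ℝ (weakGrad u x) (weakGrad v x)) + ∫ x in Ω, f x (u x) * v x = 0

/-! ### Triangulations -/

/-- A conforming (face-to-face) triangulation of the closed unit square; a triangle is given by
the set of its three vertices. -/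
structure Mesh where
  tri : Finset (Finset Pt)
  card_eq_three : ∀ T ∈ tri, T.card = 3
  indep : ∀ T ∈ tri, AffineIndependent ℝ (fun p : (T : Set Pt) => (p : Pt))
  inter : ∀ T ∈ tri, ∀ T' ∈ tri,
    convexHull ℝ (T : Set Pt) ∩ convexHull ℝ (T' : Set Pt) = convexHull ℝ ((T : Set Pt) ∩ T')
  cover : (⋃ T ∈ tri, convexHull ℝ (T : Set Pt)) = closure Ω

namespace Mesh

variable (K : Mesh)

/-- The set `𝒩` of nodes. -/
noncomputable def nodes : Finset Pt := K.tri.biUnion id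

/-- The triangles having `z` as a vertex. -/
noncomputable def triAt (z : Pt) : Finset (Finset Pt) := K.tri.filter (fun T => z ∈ T)

/-- The patch `ω_z` of elements surrounding `z`. -/
def patch (z : Pt) : Set Pt := ⋃ T ∈ K.triAt z, convexHull ℝ (T : Set Pt)

/-- The area `|ω_z|`. -/
noncomputable def patchArea (z : Pt) : ℝ := volume.real (K.patch z)

/-- `H_z = diam ω_z`. -/
noncomputable def Hz (z : Pt) : ℝ := Metric.diam (K.patch z)

/-- `h_z = |ω_z| / H_z`. -/
noncomputable def hz (z : Pt) : ℝ := K.patchArea z / K.Hz z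

/-- The edges `𝒮_z` originating at `z`, each represented by its other endpoint. -/
noncomputable def edgesAt (z : Pt) : Finset Pt :=
  K.nodes.filter (fun z' => z' ≠ z ∧ ∃ T ∈ K.tri, z ∈ T ∧ z' ∈ T)

/-- The edges `γ_z` at `z` that do not lie on the boundary. -/
noncomputable def gammaAt (z : Pt) : Finset Pt :=
  (K.edgesAt z).filter (fun z' => ¬ segment ℝ z z' ⊆ frontier Ω)

/-- The short edges at `z`: the edges `S ∈ γ_z` with `|S| ≤ c h_z`. -/
noncomputable def shortAt (c : ℝ) (z : Pt) : Finset Pt :=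
  (K.gammaAt z).filter (fun z' => dist z z' ≤ c * K.hz z)

/-- The long edges at `z`: the remaining edges of `γ_z`. -/
noncomputable def longAt (c : ℝ) (z : Pt) : Finset Pt := K.gammaAt z \ K.shortAt c z

/-- The barycentric coordinate system of a triangle of the mesh. -/
noncomputable def basis {T : Finset Pt} (hT : T ∈ K.tri) : AffineBasis (T : Set Pt) ℝ Pt :=
  ⟨fun p => (p : Pt), K.indep T hT, by
    rw [(K.indep T hT).affineSpan_eq_top_iff_card_eq_finrank_add_one]
    simp [K.card_eq_three T hT]⟩

/-- The piecewise linear hat function `φ_z` on the closed square: on a triangle with the vertex `z`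
it is the barycentric coordinate belonging to `z`, and it vanishes on all other triangles. -/
noncomputable def hat (z x : Pt) : ℝ :=
  if h : ∃ T, ∃ _ : T ∈ K.tri, z ∈ T ∧ x ∈ convexHull ℝ (T : Set Pt) then
    (K.basis h.choose_spec.choose).coord ⟨z, Finset.mem_coe.2 h.choose_spec.choose_spec.1⟩ x
  else 0

/-- The piecewise linear Lagrange interpolant. -/
noncomputable def interp (v : Pt → ℝ) (x : Pt) : ℝ := ∑ z ∈ K.nodes, v z * K.hat z x

/-- The finite element space `S_h ⊂ H¹₀(Ω) ∩ C(Ω̄)` of continuous piecewise linear functions. -/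
def MemSh (v : Pt → ℝ) : Prop :=
  ContinuousOn v (closure Ω) ∧ (∀ x ∈ frontier Ω, v x = 0) ∧
  ∀ T ∈ K.tri, ∃ A : Pt →ᵃ[ℝ] ℝ, EqOn v A (convexHull ℝ (T : Set Pt))

/-- `f_h^I`, the Lagrange interpolant of `f_h = f(·; u_h)`. -/
noncomputable def fhI (f : Pt → ℝ → ℝ) (uh : Pt → ℝ) : Pt → ℝ := K.interp (fun x => f x (uh x))

/-- `u_h ∈ S_h` is a computed solution:
`ε² ⟨∇u_h, ∇v_h⟩ + ⟨f_h^I, v_h⟩ = 0` for all `v_h ∈ S_h`. -/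
def IsDiscreteSolution (ε : ℝ) (f : Pt → ℝ → ℝ) (uh : Pt → ℝ) : Prop :=
  K.MemSh uh ∧ ∀ vh : Pt → ℝ, K.MemSh vh →
    ε ^ 2 * (∫ x in Ω, inner ℝ (weakGrad uh x) (weakGrad vh x))
      + ∫ x in Ω, K.fhI f uh x * vh x = 0

/-! ### Normal-derivative jumps and the terms of the error representation -/

/-- The constant gradient of a piecewise linear function on the triangle `T`
(the gradient at its barycentre). -/
noncomputable def elemGrad (v : Pt → ℝ) (T : Finset Pt) : Pt := gradient v (T.centroid ℝ id)

/-- The unit normal to the edge `zz'` of the triangle `zz'w`, outward for this triangle. -/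
noncomputable def outNormal (z z' w : Pt) : Pt :=
  let m : Pt := (inner ℝ (z' - z) (w - z) / ‖z' - z‖ ^ 2) • (z' - z) - (w - z)
  ‖m‖⁻¹ • m

/-- The jump `⟦∇v⟧ · ν` in the normal derivative across the edge `zz'`: the sum, over the
triangles sharing the edge, of the outward normal derivatives of `v`. -/
noncomputable def jump (v : Pt → ℝ) (z z' : Pt) : ℝ :=
  ∑ w ∈ K.nodes.filter (fun w => ({z, z', w} : Finset Pt) ∈ K.tri),
    inner ℝ (elemGrad v {z, z', w}) (outNormal z z' w)

/-- The integral of `F` over the segment `zz'` with respect to arc length. -/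
noncomputable def edgeIntegral (z z' : Pt) (F : Pt → ℝ) : ℝ :=
  dist z z' * ∫ t in (0 : ℝ)..1, F (AffineMap.lineMap z z' t)

/-- `I = ∑_z ε² ∫_{γ_z} (g - ḡ_z) φ_z ⟦∇u_h⟧ · ν`. -/
noncomputable def termI (ε : ℝ) (uh g gbar : Pt → ℝ) : ℝ :=
  ∑ z ∈ K.nodes, ε ^ 2 * ∑ z' ∈ K.gammaAt z,
    edgeIntegral z z' (fun x => (g x - gbar z) * K.hat z x * K.jump uh z z')

/-- `II = ∑_z ∫_{ω_z} f_h^I (g - ḡ_z) φ_z`. -/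
noncomputable def termII (f : Pt → ℝ → ℝ) (uh g gbar : Pt → ℝ) : ℝ :=
  ∑ z ∈ K.nodes, ∫ x in K.patch z, K.fhI f uh x * (g x - gbar z) * K.hat z x

/-- `E_quad = |⟨f_h - f_h^I, G⟩|`. -/
noncomputable def termQuad (f : Pt → ℝ → ℝ) (uh G : Pt → ℝ) : ℝ :=
  |∫ x in Ω, (f x (uh x) - K.fhI f uh x) * G x|

/-- The maximum of `|⟦∇u_h⟧|` over the short edges at `z` (zero if there are none). -/
noncomputable def Jshort (c : ℝ) (uh : Pt → ℝ) (z : Pt) : ℝ :=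
  ((K.shortAt c z).sup (fun z' => ‖K.jump uh z z'‖₊) : NNReal)

/-- The maximum of `|⟦∇u_h⟧|` over the long edges at `z` (zero if there are none). -/
noncomputable def Jlong (c : ℝ) (uh : Pt → ℝ) (z : Pt) : ℝ :=
  ((K.longAt c z).sup (fun z' => ‖K.jump uh z z'‖₊) : NNReal)

/-- `Θ = ε² ‖∇g‖²_Ω + ∑_z (1 + ε² H_z⁻²) ‖g‖²_{ω_z}`. -/
noncomputable def Theta (ε : ℝ) (g : Pt → ℝ) : ℝ :=
  ε ^ 2 * (∫ x in Ω, ‖weakGrad g x‖ ^ 2)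
    + ∑ z ∈ K.nodes, (1 + ε ^ 2 * ((K.Hz z)⁻¹) ^ 2) * ∫ x in K.patch z, g x ^ 2

/-- `∑_z [min{|ω_z|, ε h_z} (ε J̊_z)² + min{|ω_z|, ε H_z} (ε J_z)²]`, where `c` is the constant
in the definition of the short edges. -/
noncomputable def jumpEstimator (c ε : ℝ) (uh : Pt → ℝ) : ℝ :=
  ∑ z ∈ K.nodes,
    (min (K.patchArea z) (ε * K.hz z) * (ε * K.Jshort c uh z) ^ 2
      + min (K.patchArea z) (ε * K.Hz z) * (ε * K.Jlong c uh z) ^ 2)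

/-! ### Mesh assumptions -/

/-- The maximum edge length `H_T`. -/
noncomputable def HT (T : Finset Pt) : ℝ := Metric.diam (T : Set Pt)

/-- The minimum height `h_T = 2 |T| / H_T`. -/
noncomputable def hT (T : Finset Pt) : ℝ := 2 * volume.real (convexHull ℝ (T : Set Pt)) / HT T

/-- Every interior angle of the triangle `T` is at most `β`. -/
def AnglesLE (T : Finset Pt) (β : ℝ) : Prop :=
  ∀ a ∈ T, ∀ b ∈ T, ∀ c ∈ T, a ≠ b → b ≠ c → a ≠ c → EuclideanGeometry.angle a b c ≤ β

/-- Two positive quantities are equivalent up to the constant `κ`. -/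
def Equivalent (κ a b : ℝ) : Prop := a ≤ κ * b ∧ b ≤ κ * a

/-- The closed rectangle with a vertex `o` and with sides of lengths `a`, `b` in the orthogonal
directions `e₁`, `e₂`. -/
def rectangle (o e₁ e₂ : Pt) (a b : ℝ) : Set Pt :=
  {x | ∃ s ∈ Icc (0 : ℝ) a, ∃ t ∈ Icc (0 : ℝ) b, x = o + s • e₁ + t • e₂}

/-- Local element orientation: every patch `ω_z` lies in a rectangle `R_z` of comparable area; if
`z` is a boundary node but not a corner of `Ω`, then `R_z` has a side parallel to the part of
`∂Ω` formed by the boundary edges at `z`. -/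
def LocalOrientation (κ : ℝ) : Prop :=
  ∀ z ∈ K.nodes, ∃ (o e₁ e₂ : Pt) (a b : ℝ),
    ‖e₁‖ = 1 ∧ ‖e₂‖ = 1 ∧ inner ℝ e₁ e₂ = 0 ∧
    K.patch z ⊆ rectangle o e₁ e₂ a b ∧
    volume.real (rectangle o e₁ e₂ a b) ≤ κ * K.patchArea z ∧
    (z ∈ frontier Ω → ¬ (∀ i, z i = 0 ∨ z i = 1) →
      ∀ z' ∈ K.edgesAt z, segment ℝ z z' ⊆ frontier Ω →
        (∃ s : ℝ, z' - z = s • e₁) ∨ (∃ s : ℝ, z' - z = s • e₂))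

/-- The standing triangulation assumptions: maximum angle condition (with `α₀`), local element
orientation (with `κ`), at most `M` triangles at each node. -/
structure Standing (κ α₀ : ℝ) (M : ℕ) : Prop where
  max_angle : ∀ T ∈ K.tri, AnglesLE T α₀
  orientation : K.LocalOrientation κ
  valence : ∀ z ∈ K.nodes, (K.triAt z).card ≤ M

/-- `0 = X 0 < X 1 < ⋯ < X n = 1`: a mesh on the unit interval. -/
structure IsMesh1D (n : ℕ) (X : ℕ → ℝ) : Prop where
  left : X 0 = 0
  right : X n = 1
  lt : ∀ i < n, X i < X (i + 1)

/-- Condition A1: each triangle has, for some `i`, its shortest edge `ab` on the line `x = X i` and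
its third vertex `c` on the line `x = X (i + 1)` or `x = X (i - 1)`. -/
def CondA1 (n : ℕ) (X : ℕ → ℝ) : Prop :=
  ∀ T ∈ K.tri, ∃ i ≤ n, ∃ a b c : Pt, T = {a, b, c} ∧
    a 0 = X i ∧ b 0 = X i ∧ dist a b ≤ dist a c ∧ dist a b ≤ dist b c ∧
    ((i + 1 ≤ n ∧ c 0 = X (i + 1)) ∨ (1 ≤ i ∧ c 0 = X (i - 1)))

/-- Condition A2: every node is anisotropic, i.e. `h_z < c₀ H_z`, and `h_T ∼ h_z` and `H_T ∼ H_z`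
for all triangles `T ⊂ ω_z`. -/
def CondA2 (κ c₀ : ℝ) : Prop :=
  ∀ z ∈ K.nodes, K.hz z < c₀ * K.Hz z ∧
    ∀ T ∈ K.triAt z, Equivalent κ (hT T) (K.hz z) ∧ Equivalent κ (HT T) (K.Hz z)

/-- Condition A3: quasi-non-obtuse elements. -/
def CondA3 (α₁ : ℝ) : Prop :=
  ∀ T ∈ K.tri, AnglesLE T (Real.pi / 2 + α₁ * (hT T / HT T))

/-! ### The weighted averages `ḡ_z` -/

/-- For `1 ≤ i ≤ n - 1`, the one-dimensional hat function `φ_i` of the mesh `X`. -/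
noncomputable def hat1D (X : ℕ → ℝ) (i : ℕ) (x : ℝ) : ℝ :=
  max 0 (min ((x - X (i - 1)) / (X i - X (i - 1))) ((X (i + 1) - x) / (X (i + 1) - X i)))

/-- `∫_{x_{i-1}}^{x_{i+1}} (g(x, y_z) - ḡ_z) φ_i(x) dx = 0` for every interior node `z` on the line
`x = x_i`, `1 ≤ i ≤ n - 1`. -/
def IsHatAverage (n : ℕ) (X : ℕ → ℝ) (g gbar : Pt → ℝ) : Prop :=
  ∀ z ∈ K.nodes, z ∉ frontier Ω → ∀ i : ℕ, 1 ≤ i → i + 1 ≤ n → z 0 = X i →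
    ∫ x in (X (i - 1))..(X (i + 1)), (g !₂[x, z 1] - gbar z) * hat1D X i x = 0

end Mesh

end AnisoFE

/-!
# An a posteriori error estimate on anisotropic meshes for a singularly perturbed reaction-diffusion equation

The energy norm bound (`AnisoFE.energyNorm_le`, with the constant `2`) rests on an exact representation of the
residual. Integration by parts on each element turns `ε² ⟨∇u_h, ∇g⟩` into integrals of the jumps of the normal
derivative over the interior edges; distributed to the nodes by the hat functions, they form the term `I`, and
the nodal interpolant `∑ ḡ_z φ_z` may be subtracted from `g` by the Galerkin orthogonality
(`AnisoFE.Mesh.termI_eq`, `AnisoFE.Mesh.termII_eq`). The residual applied to `G` is therefore at most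
`I + II + E_quad`, and the monotonicity of `f` together with the Poincaré–Friedrichs inequality
(`AnisoFE.MemH10C.poincare`) bounds it from below by half of the energy norm of the error.

The bound for `I` is proved first for a continuously differentiable `g` with compact support in `Ω`, node by
node. The mesh conditions make every element a thin triangle with a vertical side of length of order `h_z` whose
third vertex lies on an adjacent line of the mesh `X`, at a distance of order `H_z`, and almost at the height of
the vertical side (`AnisoFE.Mesh.exists_shape`). The integrals of `g - ḡ_z` over the edges at `z` are estimated
by trace inequalities in elements (`AnisoFE.trace_le`), which suffices for vertical edges, and for slanted edges
if `ε ≤ h_z`. For a slanted edge with `h_z ≤ ε` this loses a power of the aspect ratio, and a cancellation is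
needed. The mean of `g` over such an edge is replaced with its mean over the horizontal segment that joins `z`
to the same vertical line; the error is an integral of `∂g/∂y` over the triangle between the two segments. By
the choice of `ḡ_z`, the means of `g - ḡ_z` over the two horizontal segments at `z`, multiplied by their signed
lengths, have a common value (`AnisoFE.Mesh.StripMesh.exists_common_value`), while the jumps at a node,
multiplied by the horizontal direction cosines of the edges, add up to zero
(`AnisoFE.Mesh.sum_gammaAt_jump`). What remains contains the square of the sine of the angle between the edge
and the horizontal direction, of order `(h_z / H_z)²` (`AnisoFE.Mesh.StripMesh.node_estimate`).

The triangles between the edges and the horizontal lines are not contained in the patches, but they overlap only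
boundedly: edges between the same vertical lines do not cross, and nodes on a vertical line are spaced by
multiples of `h_z` (`AnisoFE.Mesh.StripMesh.sum_region_le`). The sum over the nodes is then bounded by the
Cauchy–Schwarz inequality.

A function `g` of class `H¹₀(Ω) ∩ C(Ω̄)` is the uniform limit of test functions whose Dirichlet norms do not
exceed that of `g`, obtained by mollification followed by a truncation near zero
(`AnisoFE.exists_smooth_approx`). Uniform convergence suffices for the edge integrals, the averages `ḡ_z` and the
`L²` norms, so that the bound carries over (`AnisoFE.Mesh.StripMesh.abs_termI_le`).
-/

namespace AnisoFE

open scoped Classical ContDiff Topology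
open MeasureTheory Set Filter

/-! ### The plane: cross products, the unit square, integrals over triangles -/

/-- The two-dimensional cross product (twice the signed area of the triangle `0, p, q`). -/
def cross (p q : Pt) : ℝ := p 0 * q 1 - p 1 * q 0

lemma pt_ext {p q : Pt} (h0 : p 0 = q 0) (h1 : p 1 = q 1) : p = q := by
  ext i; fin_cases i <;> assumption

lemma norm_sq_pt (p : Pt) : ‖p‖ ^ 2 = p 0 ^ 2 + p 1 ^ 2 := by
  rw [EuclideanSpace.norm_sq_eq]; simp [Fin.sum_univ_two]

lemma inner_pt (p q : Pt) : inner ℝ p q = p 0 * q 0 + p 1 * q 1 := by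
  rw [PiLp.inner_apply]; simp [Fin.sum_univ_two, mul_comm]

lemma abs_coord_le_norm (p : Pt) (i : Fin 2) : |p i| ≤ ‖p‖ := by
  simpa using PiLp.norm_apply_le p i

lemma norm_le_abs_add_abs (p : Pt) : ‖p‖ ≤ |p 0| + |p 1| := by
  apply le_of_sq_le_sq _ (by positivity)
  rw [norm_sq_pt, add_sq, sq_abs, sq_abs]
  nlinarith [mul_nonneg (abs_nonneg (p 0)) (abs_nonneg (p 1))]

/-- The linear map of the plane with the columns `u` and `v`. -/
noncomputable def colMap (u v : Pt) : Pt →L[ℝ] Pt :=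
  (EuclideanSpace.proj (0 : Fin 2) : Pt →L[ℝ] ℝ).smulRight u +
    (EuclideanSpace.proj (1 : Fin 2) : Pt →L[ℝ] ℝ).smulRight v

@[simp] lemma colMap_apply (u v e : Pt) : colMap u v e = e 0 • u + e 1 • v := by
  simp [colMap]

lemma det_colMap (u v : Pt) : (colMap u v).det = cross u v := by
  rw [ContinuousLinearMap.det, ← LinearMap.det_toMatrix (EuclideanSpace.basisFun (Fin 2) ℝ).toBasis,
    Matrix.det_fin_two]
  simp [LinearMap.toMatrix_apply, cross]
  ring

lemma isOpen_Ω : IsOpen Ω := by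
  have : Ω = ⋂ i : Fin 2, (fun p : Pt => p i) ⁻¹' (Ioo (0 : ℝ) 1) := by
    ext p; simp [Ω]
  rw [this]
  exact isOpen_iInter_of_finite fun i => isOpen_Ioo.preimage (by fun_prop)

lemma measurableSet_Ω : MeasurableSet Ω := isOpen_Ω.measurableSet

lemma convex_Ω : Convex ℝ Ω := by
  have : Ω = ⋂ i : Fin 2, (EuclideanSpace.proj (𝕜 := ℝ) i : Pt →L[ℝ] ℝ) ⁻¹' (Ioo (0 : ℝ) 1) := by
    ext p; simp [Ω]
  rw [this]
  exact convex_iInter fun i =>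
    (convex_Ioo (0 : ℝ) 1).linear_preimage (EuclideanSpace.proj (𝕜 := ℝ) i : Pt →L[ℝ] ℝ).toLinearMap

lemma mem_Ω {p : Pt} : p ∈ Ω ↔ (0 < p 0 ∧ p 0 < 1) ∧ (0 < p 1 ∧ p 1 < 1) := by
  simp [Ω, Fin.forall_fin_two]

/-- The closed unit square in coordinates. -/
lemma mem_closure_Ω {p : Pt} :
    p ∈ closure Ω ↔ (0 ≤ p 0 ∧ p 0 ≤ 1) ∧ (0 ≤ p 1 ∧ p 1 ≤ 1) := by
  constructor
  · intro h
    have hc : IsClosed {p : Pt | (0 ≤ p 0 ∧ p 0 ≤ 1) ∧ (0 ≤ p 1 ∧ p 1 ≤ 1)} := by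
      simp only [ofPred_and]
      have h0 : Continuous fun p : Pt => p 0 := by fun_prop
      have h1 : Continuous fun p : Pt => p 1 := by fun_prop
      exact ((isClosed_le continuous_const h0).inter (isClosed_le h0 continuous_const)).inter
        ((isClosed_le continuous_const h1).inter (isClosed_le h1 continuous_const))
    refine closure_minimal (fun q hq => ?_) hc h
    rw [mem_Ω] at hq
    exact ⟨⟨hq.1.1.le, hq.1.2.le⟩, hq.2.1.le, hq.2.2.le⟩
  · rintro ⟨⟨h1, h2⟩, h3, h4⟩
    -- approach `p` along the segment to the centre of the square
    have ht : Tendsto (fun s : ℝ => p + s • (!₂[(1/2 : ℝ), 1/2] - p)) (𝓝[>] 0) (𝓝 p) := by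
      have : ContinuousWithinAt (fun s : ℝ => p + s • ((!₂[(1/2 : ℝ), 1/2] : Pt) - p)) (Ioi 0) 0 := by
        fun_prop
      simpa [ContinuousWithinAt] using this
    refine mem_closure_of_tendsto ht ?_
    filter_upwards [Ioo_mem_nhdsGT (zero_lt_one' ℝ)] with s hs
    rw [mem_Ω]
    simp
    obtain ⟨hs0, hs1⟩ := hs
    refine ⟨⟨?_, ?_⟩, ?_, ?_⟩ <;> nlinarith

lemma isCompact_closure_Ω : IsCompact (closure Ω) := by
  refine Metric.isCompact_of_isClosed_isBounded isClosed_closure ?_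
  refine (Metric.isBounded_closedBall (x := (0 : Pt)) (r := 2)).subset fun p hp => ?_
  rw [mem_closure_Ω] at hp
  rw [mem_closedBall_zero_iff]
  refine (norm_le_abs_add_abs p).trans ?_
  rw [abs_of_nonneg hp.1.1, abs_of_nonneg hp.2.1]
  linarith [hp.1.2, hp.2.2]

lemma volume_frontier_Ω : volume (frontier Ω) = 0 := convex_Ω.addHaar_frontier volume

lemma restrict_closure_Ω : (volume : Measure Pt).restrict (closure Ω) = volume.restrict Ω := by
  refine Measure.restrict_congr_set ?_
  have : closure Ω = Ω ∪ frontier Ω := closure_eq_self_union_frontier Ω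
  rw [this]
  exact union_ae_eq_left_of_ae_eq_empty (ae_eq_empty.2 volume_frontier_Ω)

lemma volume_Ω_lt_top : volume Ω < ⊤ :=
  (measure_mono subset_closure).trans_lt isCompact_closure_Ω.measure_lt_top

instance : IsFiniteMeasure ((volume : Measure Pt).restrict Ω) :=
  ⟨by simpa using volume_Ω_lt_top⟩

/-- The plane as a product. -/
noncomputable def ptEquiv : Pt ≃ᵐ ℝ × ℝ :=
  (MeasurableEquiv.toLp 2 (Fin 2 → ℝ)).symm.trans MeasurableEquiv.finTwoArrow

lemma ptEquiv_apply (p : Pt) : ptEquiv p = (p 0, p 1) := rfl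

lemma ptEquiv_symm_apply (x : ℝ × ℝ) : ptEquiv.symm x = !₂[x.1, x.2] := by
  rw [MeasurableEquiv.symm_apply_eq, ptEquiv_apply]; simp

lemma measurePreserving_ptEquiv : MeasurePreserving ptEquiv volume volume :=
  (EuclideanSpace.volume_preserving_symm_measurableEquiv_toLp (Fin 2)).trans
    (volume_preserving_finTwoArrow ℝ)

@[fun_prop] lemma continuous_mk_pt {X : Type*} [TopologicalSpace X] {f g : X → ℝ} (hf : Continuous f)
    (hg : Continuous g) : Continuous (fun x => (!₂[f x, g x] : Pt)) := by
  refine (PiLp.continuous_toLp 2 _).comp (continuous_pi fun i => ?_)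
  fin_cases i
  · simpa using hf
  · simpa using hg

/-- Fubini's theorem on the unit square. -/
lemma setIntegral_Ω {F : Pt → ℝ} (hF : IntegrableOn F Ω) :
    ∫ p in Ω, F p = ∫ x in (0 : ℝ)..1, ∫ y in (0 : ℝ)..1, F !₂[x, y] := by
  have hpre : ptEquiv ⁻¹' (Ioo (0 : ℝ) 1 ×ˢ Ioo (0 : ℝ) 1) = Ω := by
    ext p
    simp [ptEquiv_apply, Ω, Fin.forall_fin_two]
  have h1 := measurePreserving_ptEquiv.setIntegral_preimage_emb ptEquiv.measurableEmbedding
    (fun x => F (ptEquiv.symm x)) (Ioo (0 : ℝ) 1 ×ˢ Ioo (0 : ℝ) 1)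
  rw [hpre] at h1
  simp only [MeasurableEquiv.symm_apply_apply] at h1
  have h2 : IntegrableOn (fun x => F (ptEquiv.symm x)) (Ioo (0 : ℝ) 1 ×ˢ Ioo (0 : ℝ) 1)
      (volume.prod volume) := by
    have := (measurePreserving_ptEquiv.integrableOn_comp_preimage ptEquiv.measurableEmbedding
      (f := fun x => F (ptEquiv.symm x)) (s := Ioo (0 : ℝ) 1 ×ˢ Ioo (0 : ℝ) 1)).1
    rw [hpre] at this
    refine this ?_
    convert hF using 1
    ext p; simp
  rw [h1, Measure.volume_eq_prod, setIntegral_prod _ h2,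
    intervalIntegral.integral_of_le zero_le_one, ← integral_Ioc_eq_integral_Ioo]
  refine setIntegral_congr_fun measurableSet_Ioc fun x _ => ?_
  rw [intervalIntegral.integral_of_le zero_le_one, ← integral_Ioc_eq_integral_Ioo]
  simp [ptEquiv_symm_apply]

lemma affineSubspace_ne_top_of_coord {S : AffineSubspace ℝ Pt} {n : Pt} {c : ℝ} (hn : n ≠ 0)
    (h : ∀ p ∈ S, inner ℝ n p = c) : S ≠ ⊤ := by
  rintro rfl
  have h0 := h 0 (AffineSubspace.mem_top ..)
  have h1 := h n (AffineSubspace.mem_top ..)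
  rw [inner_zero_right] at h0
  rw [← h0] at h1
  exact hn (inner_self_eq_zero.1 h1)

/-- A line in the plane is a null set. -/
lemma volume_line {n : Pt} (hn : n ≠ 0) (c : ℝ) : volume {p : Pt | inner ℝ n p = c} = 0 := by
  let S : AffineSubspace ℝ Pt :=
    (AffineSubspace.mk' c (⊥ : Submodule ℝ ℝ)).comap ((innerSL ℝ n).toLinearMap.toAffineMap)
  have hS : (S : Set Pt) = {p : Pt | inner ℝ n p = c} := by
    ext p
    simp [S, sub_eq_zero]
  rw [← hS]
  refine Measure.addHaar_affineSubspace _ _ (affineSubspace_ne_top_of_coord (c := c) hn fun p hp => ?_)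
  have : p ∈ (S : Set Pt) := hp
  rw [hS] at this
  exact this

lemma volume_vertical_line (c : ℝ) : volume {p : Pt | p 0 = c} = 0 := by
  have := volume_line (n := !₂[1, 0]) (fun h => by simpa using congrArg (fun p : Pt => p 0) h) c
  simpa [inner_pt] using this

lemma cross_eq_zero_subset_line {u v : Pt} (h : cross u v = 0) :
    ∃ n : Pt, n ≠ 0 ∧ inner ℝ n u = 0 ∧ inner ℝ n v = 0 := by
  by_cases hu : u = 0
  · by_cases hv : v = 0
    · exact ⟨!₂[1, 0], fun h => by simpa using congrArg (fun p : Pt => p 0) h, by simp [hu], by simp [hv]⟩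
    · refine ⟨!₂[- v 1, v 0], fun h' => hv ?_, by simp [hu], by simp [inner_pt]; ring⟩
      have h0 := congrArg (fun p : Pt => p 0) h'
      have h1 := congrArg (fun p : Pt => p 1) h'
      simp at h0 h1
      exact pt_ext (by simpa using h1) (by simpa using h0)
  · refine ⟨!₂[- u 1, u 0], fun h' => hu ?_, by simp [inner_pt]; ring, ?_⟩
    · have h0 := congrArg (fun p : Pt => p 0) h'
      have h1 := congrArg (fun p : Pt => p 1) h'
      simp at h0 h1
      exact pt_ext (by simpa using h1) (by simpa using h0)
    · unfold cross at h; simp [inner_pt]; linarith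

lemma volume_convexHull_of_cross_eq_zero {P A B : Pt} (h : cross (A - P) (B - P) = 0) :
    volume (convexHull ℝ ({P, A, B} : Set Pt)) = 0 := by
  obtain ⟨n, hn, h1, h2⟩ := cross_eq_zero_subset_line h
  refine measure_mono_null (convexHull_min ?_ ?_) (volume_line hn (inner ℝ n P))
  · rw [inner_sub_right, sub_eq_zero] at h1 h2
    rintro p (rfl | rfl | rfl)
    · rfl
    · exact h1
    · exact h2
  · exact convex_hyperplane (f := fun p => inner ℝ n p)
      ⟨fun x y => inner_add_right .., fun c x => by simp [inner_smul_right]⟩ _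

lemma volume_segment (a b : Pt) : volume (segment ℝ a b) = 0 := by
  rw [← convexHull_pair]
  have := volume_convexHull_of_cross_eq_zero (P := a) (A := a) (B := b) (by simp [cross])
  simpa using this

/-- The parametrization of the triangle `P A B` by the unit square that collapses the side `t = 0`
to the vertex `P`. -/
noncomputable def duffy (P A B : Pt) (t r : ℝ) : Pt := P + t • ((1 - r) • (A - P) + r • (B - P))

lemma mem_convexHull_triple {P A B x : Pt} :
    x ∈ convexHull ℝ ({P, A, B} : Set Pt) ↔
      ∃ a b c : ℝ, 0 ≤ a ∧ 0 ≤ b ∧ 0 ≤ c ∧ a + b + c = 1 ∧ a • P + b • A + c • B = x := by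
  constructor
  · intro h
    rw [convexHull_insert (by simp), convexHull_pair] at h
    simp only [convexJoin_singleton_left, mem_iUnion] at h
    obtain ⟨y, hy, hx⟩ := h
    obtain ⟨u, v, hu, hv, huv, rfl⟩ := hy
    obtain ⟨s, t, hs, ht, hst, rfl⟩ := hx
    refine ⟨s, t * u, t * v, hs, by positivity, by positivity, by rw [add_assoc, ← mul_add, huv, mul_one, hst], ?_⟩
    simp [smul_add, smul_smul, add_assoc]
  · rintro ⟨a, b, c, ha, hb, hc, h, rfl⟩
    have hconv := convex_convexHull ℝ ({P, A, B} : Set Pt)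
    have := hconv.sum_mem (t := Finset.univ) (w := ![a, b, c]) (z := ![P, A, B])
      (by intro i _; fin_cases i <;> simpa) (by simp [Fin.sum_univ_three, h])
      (by intro i _; fin_cases i <;> exact subset_convexHull _ _ (by simp))
    simpa [Fin.sum_univ_three] using this

lemma duffy_mem_convexHull {P A B : Pt} {t r : ℝ} (ht : t ∈ Icc (0 : ℝ) 1) (hr : r ∈ Icc (0 : ℝ) 1) :
    duffy P A B t r ∈ convexHull ℝ ({P, A, B} : Set Pt) := by
  rw [mem_convexHull_triple]
  refine ⟨1 - t, t * (1 - r), t * r, by linarith [ht.2], mul_nonneg ht.1 (by linarith [hr.2]),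
    mul_nonneg ht.1 hr.1, by ring, ?_⟩
  unfold duffy
  module

lemma isCompact_convexHull_triple (P A B : Pt) : IsCompact (convexHull ℝ ({P, A, B} : Set Pt)) :=
  (Set.toFinite ({P, A, B} : Set Pt)).isCompact_convexHull ℝ

/-- Integration over a triangle in the coordinates `duffy`; degenerate triangles are allowed. -/
lemma setIntegral_triangle {F : Pt → ℝ} (hF : Continuous F) (P A B : Pt) :
    ∫ x in convexHull ℝ ({P, A, B} : Set Pt), F x =
      |cross (A - P) (B - P)| * ∫ t in (0 : ℝ)..1, ∫ r in (0 : ℝ)..1, t * F (duffy P A B t r) := by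
  by_cases hc : cross (A - P) (B - P) = 0
  · rw [hc, abs_zero, zero_mul]
    exact setIntegral_measure_zero _ (volume_convexHull_of_cross_eq_zero hc)
  set f : Pt → Pt := fun p => duffy P A B (p 0) (p 1) with hf
  set f' : Pt → Pt →L[ℝ] Pt := fun p =>
    colMap ((1 - p 1) • (A - P) + p 1 • (B - P)) (p 0 • (B - A)) with hf'
  have hder : ∀ p ∈ Ω, HasFDerivWithinAt f (f' p) Ω p := by
    intro p _
    have h0 : HasFDerivAt (fun p : Pt => p 0) (EuclideanSpace.proj (0 : Fin 2) : Pt →L[ℝ] ℝ) p :=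
      (EuclideanSpace.proj (0 : Fin 2) : Pt →L[ℝ] ℝ).hasFDerivAt
    have h1 : HasFDerivAt (fun p : Pt => p 1) (EuclideanSpace.proj (1 : Fin 2) : Pt →L[ℝ] ℝ) p :=
      (EuclideanSpace.proj (1 : Fin 2) : Pt →L[ℝ] ℝ).hasFDerivAt
    have h2 := (h0.smul (((h1.const_sub 1).smul_const (A - P)).add (h1.smul_const (B - P)))).const_add P
    refine HasFDerivAt.hasFDerivWithinAt ?_
    refine h2.congr_fderiv ?_
    ext e i
    simp [f', colMap]
    ring
  have hinj : InjOn f Ω := by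
    intro p hp q hq h
    rw [mem_Ω] at hp hq
    have h0 := congrArg (fun x : Pt => x 0) h
    have h1 := congrArg (fun x : Pt => x 1) h
    simp [f, duffy] at h0 h1
    unfold cross at hc
    simp at hc
    have e1 : (p 0 * p 1 - q 0 * q 1) * ((A 0 - P 0) * (B 1 - P 1) - (A 1 - P 1) * (B 0 - P 0)) = 0 := by
      linear_combination (A 0 - P 0) * h1 - (A 1 - P 1) * h0
    have e2 : (p 0 * (1 - p 1) - q 0 * (1 - q 1)) *
        ((A 0 - P 0) * (B 1 - P 1) - (A 1 - P 1) * (B 0 - P 0)) = 0 := by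
      linear_combination (B 1 - P 1) * h0 - (B 0 - P 0) * h1
    have e1' := (mul_eq_zero.1 e1).resolve_right hc
    have e2' := (mul_eq_zero.1 e2).resolve_right hc
    have e3 : p 0 = q 0 := by linarith
    refine pt_ext e3 ?_
    rw [← e3] at e1'
    have : p 0 * (p 1 - q 1) = 0 := by linarith
    have := (mul_eq_zero.1 this).resolve_left hp.1.1.ne'
    linarith
  have hdet : ∀ p ∈ Ω, |(f' p).det| = |cross (A - P) (B - P)| * p 0 := by
    intro p hp
    rw [mem_Ω] at hp
    simp only [f']
    rw [det_colMap, ← abs_of_pos hp.1.1, ← abs_mul, abs_of_pos hp.1.1]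
    congr 1
    simp [cross]
    ring
  have himg : (f '' Ω : Set Pt) =ᵐ[volume] convexHull ℝ ({P, A, B} : Set Pt) := by
    refine LE.le.eventuallyLE ?_ |>.antisymm ?_
    · rintro _ ⟨p, hp, rfl⟩
      rw [mem_Ω] at hp
      exact duffy_mem_convexHull ⟨hp.1.1.le, hp.1.2.le⟩ ⟨hp.2.1.le, hp.2.2.le⟩
    · rw [ae_le_set]
      refine measure_mono_null (t := segment ℝ A B ∪ (segment ℝ P B ∪ segment ℝ P A)) ?_ ?_
      · rintro x ⟨hx, hx'⟩
        obtain ⟨a, b, c, ha, hb, hc', habc, rfl⟩ := mem_convexHull_triple.1 hx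
        rcases ha.eq_or_lt with rfl | ha
        · left; exact ⟨b, c, hb, hc', by linarith, by simp⟩
        rcases hb.eq_or_lt with rfl | hb
        · right; left; exact ⟨a, c, ha.le, hc', by linarith, by simp⟩
        rcases hc'.eq_or_lt with rfl | hc'
        · right; right; exact ⟨a, b, ha.le, hb.le, by linarith, by simp⟩
        refine absurd ⟨!₂[b + c, c / (b + c)], ?_, ?_⟩ hx'
        · rw [mem_Ω]
          simp
          refine ⟨⟨by linarith, by linarith⟩, by positivity, ?_⟩
          rw [div_lt_one (by positivity)]; linarith
        · have hbc : b + c ≠ 0 := by positivity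
          have ha' : a = 1 - b - c := by linarith
          have hr : (b + c) * (1 - c / (b + c)) = b := by field_simp; ring
          have hr' : (b + c) * (c / (b + c)) = c := by field_simp
          simp only [f, duffy]
          simp only [Matrix.cons_val_zero, Matrix.cons_val_one, smul_add, smul_smul, hr, hr', ha']
          module
      · simp [volume_segment]
  have hFc : ∀ t : ℝ, ∫ r in (0 : ℝ)..1, t * F (duffy P A B t r) =
      ∫ r in (0:ℝ)..1, (!₂[t, r] : Pt) 0 * F (f !₂[t, r]) := fun t => by simp [f]
  have hcont : Continuous fun p : Pt => p 0 * F (f p) := by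
    have : Continuous f := by simp only [f, duffy]; fun_prop
    exact Continuous.mul (by fun_prop) (hF.comp this)
  rw [← setIntegral_congr_set himg, integral_image_eq_integral_abs_det_fderiv_smul volume
    measurableSet_Ω hder hinj F]
  have : ∀ p ∈ Ω, |(f' p).det| • F (f p) = |cross (A - P) (B - P)| * (p 0 * F (f p)) := by
    intro p hp; rw [hdet p hp, smul_eq_mul]; ring
  rw [setIntegral_congr_fun measurableSet_Ω this, integral_const_mul, setIntegral_Ω]
  · simp only [hFc]
  · exact (hcont.continuousOn.integrableOn_compact isCompact_closure_Ω).mono_set subset_closure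

lemma volume_real_triangle (P A B : Pt) :
    volume.real (convexHull ℝ ({P, A, B} : Set Pt)) = |cross (A - P) (B - P)| / 2 := by
  have := setIntegral_triangle (F := fun _ => 1) continuous_const P A B
  simp at this
  rw [this]
  ring

/-! ### Weak gradients and smooth approximation in the unit square -/

lemma HasWeakGrad.integrableOn {v : Pt → ℝ} {p : Pt → Pt} (h : HasWeakGrad v p) :
    IntegrableOn p Ω := h.1.integrable one_le_two

/-- Weak gradients are unique, by the fundamental lemma of the calculus of variations. -/
lemma HasWeakGrad.ae_eq {v : Pt → ℝ} {p q : Pt → Pt} (hp : HasWeakGrad v p)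
    (hq : HasWeakGrad v q) : p =ᵐ[volume.restrict Ω] q := by
  have hi : IntegrableOn (fun x => p x - q x) Ω := hp.integrableOn.sub hq.integrableOn
  have h := isOpen_Ω.ae_eq_zero_of_integral_contDiff_smul_eq_zero (μ := volume)
    (f := fun x => p x - q x) hi.locallyIntegrableOn ?_
  · rw [EventuallyEq, ae_restrict_iff' measurableSet_Ω]
    filter_upwards [h] with x hx hxΩ
    exact sub_eq_zero.1 (hx hxΩ)
  intro ψ hψ hψc hψs
  have hψ0 : ∀ x, x ∉ Ω → ψ x = 0 := fun x hx => image_eq_zero_of_notMem_tsupport fun h => hx (hψs h)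
  have e1 : ∫ x, ψ x • (p x - q x) = ∫ x in Ω, ψ x • (p x - q x) :=
    (setIntegral_eq_integral_of_forall_compl_eq_zero fun x hx => by simp [hψ0 x hx]).symm
  obtain ⟨C, hC⟩ := hψc.exists_bound_of_continuous hψ.continuous
  have hmul : ∀ {f : Pt → Pt}, IntegrableOn f Ω → Integrable (fun x => ψ x • f x) (volume.restrict Ω) :=
    fun hf => hf.bdd_smul C hψ.continuous.aestronglyMeasurable (ae_of_all _ hC)
  rw [e1]
  refine ext_inner_right ℝ fun e => ?_
  rw [inner_zero_left, real_inner_comm, ← integral_inner (hmul hi)]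
  have hI : ∀ {f : Pt → Pt}, IntegrableOn f Ω →
      Integrable (fun x => inner ℝ (f x) e * ψ x) (volume.restrict Ω) := fun hf => by
    refine ((hmul hf).inner_const e).congr (ae_of_all _ fun x => ?_)
    simp [inner_smul_left, mul_comm]
  have := (hp.2 ψ hψ hψc hψs e).symm.trans (hq.2 ψ hψ hψc hψs e)
  rw [neg_inj, ← sub_eq_zero, ← integral_sub (hI hp.integrableOn) (hI hq.integrableOn)] at this
  rw [← this]
  refine integral_congr_ae (ae_of_all _ fun x => ?_)
  simp only [inner_smul_right, inner_sub_right, real_inner_comm e]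
  ring

lemma HasWeakGrad.weakGrad_ae_eq {v : Pt → ℝ} {p : Pt → Pt} (hp : HasWeakGrad v p) :
    weakGrad v =ᵐ[volume.restrict Ω] p := by
  have h : ∃ p, HasWeakGrad v p := ⟨p, hp⟩
  rw [weakGrad, dif_pos h]
  exact h.choose_spec.ae_eq hp

lemma MemH1.hasWeakGrad {v : Pt → ℝ} (h : MemH1 v) : HasWeakGrad v (weakGrad v) := by
  rw [weakGrad, dif_pos h.2]
  exact h.2.choose_spec

lemma integrable_mul_fderiv {v : Pt → ℝ} (hv : MemLp v 2 (volume.restrict Ω)) {ψ : Pt → ℝ}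
    (hψ : ContDiff ℝ ∞ ψ) (hψc : HasCompactSupport ψ) (e : Pt) :
    IntegrableOn (fun x => v x * fderiv ℝ ψ x e) Ω := by
  have hcont : Continuous fun x => fderiv ℝ ψ x e :=
    (hψ.continuous_fderiv (by simp)).clm_apply continuous_const
  have hsupp : HasCompactSupport fun x => fderiv ℝ ψ x e :=
    (hψc.fderiv (𝕜 := ℝ)).comp_left (g := fun L : Pt →L[ℝ] ℝ => L e) (by simp)
  obtain ⟨C, hC⟩ := hsupp.exists_bound_of_continuous hcont
  exact (hv.integrable one_le_two).mul_bdd (c := C) hcont.aestronglyMeasurable (ae_of_all _ hC)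

lemma integrable_inner_mul {p : Pt → Pt} (hp : IntegrableOn p Ω) {ψ : Pt → ℝ}
    (hψ : Continuous ψ) (hψc : HasCompactSupport ψ) (e : Pt) :
    IntegrableOn (fun x => inner ℝ (p x) e * ψ x) Ω := by
  obtain ⟨C, hC⟩ := hψc.exists_bound_of_continuous hψ
  have : Integrable (fun x => inner ℝ (p x) e) (volume.restrict Ω) := hp.inner_const e
  exact this.mul_bdd (c := C) hψ.aestronglyMeasurable (ae_of_all _ hC)

/-- Linear combinations of functions of class `H¹(Ω)` and of their weak gradients. -/
lemma HasWeakGrad.linear_comb {v w : Pt → ℝ} {p q : Pt → Pt} (hv : MemLp v 2 (volume.restrict Ω))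
    (hw : MemLp w 2 (volume.restrict Ω)) (hp : HasWeakGrad v p) (hq : HasWeakGrad w q) (a b : ℝ) :
    HasWeakGrad (fun x => a * v x + b * w x) (fun x => a • p x + b • q x) := by
  refine ⟨(hp.1.const_smul a).add (hq.1.const_smul b), fun ψ hψ hψc hψs e => ?_⟩
  have h1 := integrable_mul_fderiv hv hψ hψc e
  have h2 := integrable_mul_fderiv hw hψ hψc e
  have h3 := integrable_inner_mul hp.integrableOn hψ.continuous hψc e
  have h4 := integrable_inner_mul hq.integrableOn hψ.continuous hψc e
  have e1 : ∀ x, (a * v x + b * w x) * fderiv ℝ ψ x e =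
      a * (v x * fderiv ℝ ψ x e) + b * (w x * fderiv ℝ ψ x e) := fun x => by ring
  have e2 : ∀ x, inner ℝ (a • p x + b • q x) e * ψ x =
      a * (inner ℝ (p x) e * ψ x) + b * (inner ℝ (q x) e * ψ x) := fun x => by
    simp only [inner_add_left, real_inner_smul_left]; ring
  simp only [e1, e2]
  rw [integral_add (h1.const_mul a) (h2.const_mul b), integral_add (h3.const_mul a) (h4.const_mul b)]
  simp only [integral_const_mul, hp.2 ψ hψ hψc hψs e, hq.2 ψ hψ hψc hψs e]
  ring

lemma MemH1.linear_comb {v w : Pt → ℝ} (hv : MemH1 v) (hw : MemH1 w) (a b : ℝ) :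
    MemH1 (fun x => a * v x + b * w x) :=
  ⟨(hv.1.const_smul a).add (hw.1.const_smul b), _,
    hv.hasWeakGrad.linear_comb hv.1 hw.1 hw.hasWeakGrad a b⟩

lemma MemH10C.linear_comb {v w : Pt → ℝ} (hv : MemH10C v) (hw : MemH10C w) (a b : ℝ) :
    MemH10C (fun x => a * v x + b * w x) :=
  ⟨(hv.1.const_smul a).add (hw.1.const_smul b), fun x hx => by simp [hv.2.1 x hx, hw.2.1 x hx],
    hv.2.2.linear_comb hw.2.2 a b⟩

lemma weakGrad_linear_comb {v w : Pt → ℝ} (hv : MemH1 v) (hw : MemH1 w) (a b : ℝ) :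
    weakGrad (fun x => a * v x + b * w x) =ᵐ[volume.restrict Ω]
      fun x => a • weakGrad v x + b • weakGrad w x :=
  (hv.hasWeakGrad.linear_comb hv.1 hw.1 hw.hasWeakGrad a b).weakGrad_ae_eq

lemma memLp_of_continuousOn {v : Pt → ℝ} (h : ContinuousOn v (closure Ω)) :
    MemLp v 2 (volume.restrict Ω) := by
  obtain ⟨C, hC⟩ := isCompact_closure_Ω.exists_bound_of_continuousOn h
  refine MemLp.of_bound ((h.mono subset_closure).aestronglyMeasurable measurableSet_Ω) C ?_
  filter_upwards [ae_restrict_mem measurableSet_Ω] with x hx using hC x (subset_closure hx)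

lemma integrableOn_of_continuousOn {v : Pt → ℝ} (h : ContinuousOn v (closure Ω)) :
    IntegrableOn v Ω :=
  (h.integrableOn_compact isCompact_closure_Ω).mono_set subset_closure

lemma inner_gradient (F : Pt → ℝ) (x e : Pt) : inner ℝ (gradient F x) e = fderiv ℝ F x e := by
  simp [gradient]

lemma norm_gradient (F : Pt → ℝ) (x : Pt) : ‖gradient F x‖ = ‖fderiv ℝ F x‖ := by
  simp [gradient]

/-- By Rademacher's theorem, a Lipschitz function is weakly differentiable and its weak gradient is
the classical one. -/
lemma hasWeakGrad_of_lipschitzWith {F : Pt → ℝ} {C : NNReal} (hF : LipschitzWith C F) :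
    HasWeakGrad F (gradient F) := by
  have hmeas : Measurable (gradient F) :=
    ((InnerProductSpace.toDual ℝ Pt).symm.continuous.measurable).comp (measurable_fderiv ℝ F)
  refine ⟨MemLp.of_bound hmeas.aestronglyMeasurable C (ae_of_all _ fun x => ?_), ?_⟩
  · rw [norm_gradient]; exact norm_fderiv_le_of_lipschitz ℝ hF
  intro ψ hψ hψc hψs e
  obtain ⟨D, hD⟩ := (hψ.of_le (by simp) : ContDiff ℝ 1 ψ).lipschitzWith_of_hasCompactSupport hψc (by simp)
  have h := hF.integral_lineDeriv_mul_eq (μ := volume) hD hψc e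
  have hψ0 : ∀ x, x ∉ Ω → x ∉ tsupport ψ := fun x hx h => hx (hψs h)
  rw [setIntegral_eq_integral_of_forall_compl_eq_zero, setIntegral_eq_integral_of_forall_compl_eq_zero]
  · have e1 : ∫ x, lineDeriv ℝ F x e * ψ x = ∫ x, inner ℝ (gradient F x) e * ψ x := by
      refine integral_congr_ae ?_
      filter_upwards [hF.ae_differentiableAt (μ := volume)] with x hx
      rw [hx.lineDeriv_eq_fderiv, inner_gradient]
    rw [← e1, h, ← integral_neg]
    refine integral_congr_ae (ae_of_all _ fun x => ?_)
    simp only [((hψ.differentiable (by simp)) x).lineDeriv_eq_fderiv, map_neg]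
    ring
  · intro x hx; rw [image_eq_zero_of_notMem_tsupport (hψ0 x hx), mul_zero]
  · intro x hx
    rw [image_eq_zero_of_notMem_tsupport (f := fderiv ℝ ψ) fun h => hψ0 x hx (tsupport_fderiv_subset ℝ h)]
    simp

/-- The square of an average is at most the average of the square. -/
lemma sq_integral_mul_le {α : Type*} [MeasurableSpace α] {μ : Measure α} {a φ : α → ℝ}
    (hφ : ∀ x, 0 ≤ φ x) (h0 : Integrable φ μ) (h1 : Integrable (fun x => a x * φ x) μ)
    (h2 : Integrable (fun x => a x ^ 2 * φ x) μ) (hφ1 : ∫ x, φ x ∂μ ≤ 1) :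
    (∫ x, a x * φ x ∂μ) ^ 2 ≤ ∫ x, a x ^ 2 * φ x ∂μ := by
  set m := ∫ x, a x * φ x ∂μ with hm
  have h : 0 ≤ ∫ x, (a x ^ 2 * φ x - 2 * m * (a x * φ x)) + m ^ 2 * φ x ∂μ := by
    refine integral_nonneg fun x => ?_
    have : 0 ≤ (a x - m) ^ 2 * φ x := mul_nonneg (sq_nonneg _) (hφ x)
    simp only [Pi.zero_apply]
    linarith [this]
  rw [integral_add (f := fun x => a x ^ 2 * φ x - 2 * m * (a x * φ x)) (h2.sub (h1.const_mul _))
    (h0.const_mul _), integral_sub h2 (h1.const_mul _),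
    integral_const_mul, integral_const_mul, ← hm] at h
  nlinarith [sq_nonneg m, mul_le_mul_of_nonneg_left hφ1 (sq_nonneg m)]

/-- The derivative `η` of the truncation `∫₀ˢ η`: it vanishes for `|τ| ≤ δ` and is `1` for
`|τ| ≥ 2 δ`. -/
noncomputable def cutSlope (δ τ : ℝ) : ℝ := min 1 (max 0 (|τ| / δ - 1))

lemma cutSlope_mem (δ τ : ℝ) : cutSlope δ τ ∈ Icc (0 : ℝ) 1 :=
  ⟨le_min zero_le_one (le_max_left _ _), min_le_left _ _⟩

lemma continuous_cutSlope (δ : ℝ) : Continuous (cutSlope δ) := by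
  unfold cutSlope; fun_prop

lemma cutSlope_eq_zero {δ τ : ℝ} (hδ : 0 < δ) (h : |τ| ≤ δ) : cutSlope δ τ = 0 := by
  have : |τ| / δ ≤ 1 := (div_le_one hδ).2 h
  rw [cutSlope, max_eq_left (by linarith), min_eq_right zero_le_one]

lemma cutSlope_eq_one {δ τ : ℝ} (hδ : 0 < δ) (h : 2 * δ ≤ |τ|) : cutSlope δ τ = 1 := by
  have : 2 ≤ |τ| / δ := (le_div_iff₀ hδ).2 h
  rw [cutSlope, max_eq_right (by linarith), min_eq_left (by linarith)]

/-- A `C¹` truncation of the identity that vanishes near zero. -/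
noncomputable def truncate (δ s : ℝ) : ℝ := ∫ τ in (0 : ℝ)..s, cutSlope δ τ

lemma hasDerivAt_truncate (δ s : ℝ) : HasDerivAt (truncate δ) (cutSlope δ s) s :=
  (continuous_cutSlope δ).integral_hasStrictDerivAt 0 s |>.hasDerivAt

lemma truncate_eq_zero {δ s : ℝ} (hδ : 0 < δ) (h : |s| ≤ δ) : truncate δ s = 0 := by
  rw [truncate, intervalIntegral.integral_congr (g := fun _ => (0 : ℝ))]
  · simp
  · intro τ hτ
    refine cutSlope_eq_zero hδ (le_trans ?_ h)
    simpa using abs_sub_left_of_mem_uIcc hτ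

lemma abs_truncate_sub_le {δ : ℝ} (hδ : 0 < δ) (s : ℝ) : |truncate δ s - s| ≤ 2 * δ := by
  have hd : ∀ s, HasDerivAt (fun s => truncate δ s - s) (cutSlope δ s - 1) s := fun s =>
    (hasDerivAt_truncate δ s).sub (hasDerivAt_id s)
  have hlip : ∀ a b : ℝ, |(truncate δ b - b) - (truncate δ a - a)| ≤ 1 * |b - a| := fun a b => by
    refine Convex.norm_image_sub_le_of_norm_hasDerivWithin_le (s := univ)
      (fun x _ => (hd x).hasDerivWithinAt) (fun x _ => ?_) convex_univ (mem_univ a) (mem_univ b)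
    rw [Real.norm_eq_abs, abs_le]
    constructor <;> linarith [(cutSlope_mem δ x).1, (cutSlope_mem δ x).2]
  have h0 : truncate δ 0 = 0 := by simp [truncate]
  have hsmall : ∀ s, |s| ≤ 2 * δ → |truncate δ s - s| ≤ 2 * δ := fun s hs => by
    have := hlip 0 s
    simp only [h0, sub_zero, one_mul] at this
    exact this.trans hs
  have hconst : ∀ S : Set ℝ, Convex ℝ S → (∀ x ∈ S, 2 * δ ≤ |x|) → ∀ a ∈ S, ∀ b ∈ S,
      truncate δ b - b = truncate δ a - a := fun S hS hS' a ha b hb => by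
    have := Convex.norm_image_sub_le_of_norm_hasDerivWithin_le (s := S) (C := 0)
      (fun x _ => (hd x).hasDerivWithinAt) (fun x hx => by simp [cutSlope_eq_one hδ (hS' x hx)]) hS ha hb
    rw [zero_mul, norm_le_zero_iff, sub_eq_zero] at this
    exact this
  rcases le_or_gt (|s|) (2 * δ) with h | h
  · exact hsmall s h
  rcases le_or_gt 0 s with hs | hs
  · rw [abs_of_nonneg hs] at h
    rw [hconst (Ici (2 * δ)) (convex_Ici _) (fun x hx => le_trans hx (le_abs_self x)) (2 * δ)
      self_mem_Ici s h.le]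
    exact hsmall _ (by rw [abs_of_pos (by linarith)])
  · rw [abs_of_neg hs] at h
    rw [hconst (Iic (-(2 * δ))) (convex_Iic _) (fun x hx => by
      have : x ≤ -(2 * δ) := hx
      linarith [neg_abs_le x]) (-(2 * δ)) self_mem_Iic s (by simp only [mem_Iic]; linarith)]
    exact hsmall _ (by rw [abs_neg, abs_of_pos (by linarith)])

/-- At a point whose `rOut`-neighbourhood lies in `Ω`, the mollification of `v` is differentiable
and the square of the norm of its derivative is at most the mollification of `‖∇v‖²`. -/
lemma norm_fderiv_mollify_sq_le {v : Pt → ℝ} {p : Pt → Pt} (hp : HasWeakGrad v p)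
    (hV : Continuous (Ω.indicator v)) (φ : ContDiffBump (0 : Pt)) {x : Pt}
    (hx : Metric.closedBall x φ.rOut ⊆ Ω) :
    ‖fderiv ℝ (convolution (φ.normed volume) (Ω.indicator v) (ContinuousLinearMap.lsmul ℝ ℝ) volume) x‖ ^ 2
      ≤ convolution (φ.normed volume) (Ω.indicator fun y => ‖p y‖ ^ 2)
          (ContinuousLinearMap.lsmul ℝ ℝ) volume x := by
  set k : Pt → ℝ := φ.normed volume with hk
  have hkc : HasCompactSupport k := φ.hasCompactSupport_normed
  have hks : ContDiff ℝ ∞ k := φ.contDiff_normed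
  have hd := hkc.hasFDerivAt_convolution_left (ContinuousLinearMap.lsmul ℝ ℝ)
    (hks.of_le (by simp) : ContDiff ℝ 1 k) (hV.locallyIntegrable (μ := volume)) x
  rw [hd.fderiv]
  have hcex := (hkc.fderiv (𝕜 := ℝ)).convolutionExists_left
    ((ContinuousLinearMap.lsmul ℝ ℝ : ℝ →L[ℝ] ℝ →L[ℝ] ℝ).precompL Pt) (hks.continuous_fderiv (by simp))
    (hV.locallyIntegrable (μ := volume)) x
  set ψ : Pt → ℝ := fun y => k (x - y) with hψ
  have hψd : ContDiff ℝ ∞ ψ := hks.comp (contDiff_const.sub contDiff_id)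
  have hψsupp : tsupport ψ ⊆ Metric.closedBall x φ.rOut := by
    refine closure_minimal (fun y hy => ?_) Metric.isClosed_closedBall
    have : x - y ∈ Function.support k := hy
    rw [hk, φ.support_normed_eq, mem_ball_zero_iff] at this
    rw [mem_closedBall_iff_norm, ← norm_neg, neg_sub]
    exact this.le
  have hψc : HasCompactSupport ψ := HasCompactSupport.of_support_subset_isCompact
    (isCompact_closedBall x φ.rOut) (subset_tsupport ψ |>.trans hψsupp)
  have hψ0 : ∀ y, y ∉ Ω → ψ y = 0 := fun y hy =>
    image_eq_zero_of_notMem_tsupport fun h => hy (hx (hψsupp h))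
  have hψn : ∀ y, 0 ≤ ψ y := fun y => φ.nonneg_normed _
  have hψ1 : ∫ y in Ω, ψ y ≤ 1 := by
    rw [setIntegral_eq_integral_of_forall_compl_eq_zero hψ0]
    simp only [hψ, hk]
    rw [integral_sub_left_eq_self (fun y => φ.normed volume y) volume x, φ.integral_normed]
  have hψder : ∀ y e, fderiv ℝ ψ y e = - fderiv ℝ k (x - y) e := fun y e => by
    have h1 : HasFDerivAt (fun y => x - y) (-ContinuousLinearMap.id ℝ Pt) y :=
      (hasFDerivAt_id y).const_sub x
    have h2 := ((hks.differentiable (by simp)) (x - y)).hasFDerivAt.comp y h1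
    have h3 : fderiv ℝ ψ y = (fderiv ℝ k (x - y)).comp (-ContinuousLinearMap.id ℝ Pt) := h2.fderiv
    rw [h3]
    simp
  obtain ⟨C, hC⟩ := hψc.exists_bound_of_continuous hψd.continuous
  have hbd : ∀ {f : Pt → ℝ}, IntegrableOn f Ω → IntegrableOn (fun y => f y * ψ y) Ω := fun hf =>
    Integrable.mul_bdd (c := C) hf hψd.continuous.aestronglyMeasurable (ae_of_all _ hC)
  have hp1 : IntegrableOn (fun y => ‖p y‖) Ω := hp.integrableOn.norm
  have hp2 : IntegrableOn (fun y => ‖p y‖ ^ 2) Ω := hp.1.integrable_norm_pow (by simp)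
  have hval : ∀ e, (convolution (fderiv ℝ k) (Ω.indicator v)
      ((ContinuousLinearMap.lsmul ℝ ℝ : ℝ →L[ℝ] ℝ →L[ℝ] ℝ).precompL Pt) volume x) e =
      ∫ y in Ω, inner ℝ (p y) e * ψ y := fun e => by
    rw [convolution_eq_swap, ContinuousLinearMap.integral_apply hcex.integrable_swap]
    have h1 := hp.2 ψ hψd hψc (hψsupp.trans hx) e
    rw [← neg_eq_iff_eq_neg.2 h1, ← integral_neg, ← integral_indicator measurableSet_Ω]
    refine integral_congr_ae (ae_of_all _ fun y => ?_)
    by_cases hy : y ∈ Ω <;> simp [hy, hψder, mul_comm]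
  have hq : convolution k (Ω.indicator fun y => ‖p y‖ ^ 2) (ContinuousLinearMap.lsmul ℝ ℝ) volume x =
      ∫ y in Ω, ‖p y‖ ^ 2 * ψ y := by
    rw [convolution_eq_swap, ← integral_indicator measurableSet_Ω]
    refine integral_congr_ae (ae_of_all _ fun y => ?_)
    by_cases hy : y ∈ Ω <;> simp [hy, hψ, mul_comm]
  rw [hq]
  -- the kernel `ψ` is supported in `Ω`, so that it is an admissible test function for the weak gradient
  have hle : (∫ y in Ω, ‖p y‖ * ψ y) ^ 2 ≤ ∫ y in Ω, ‖p y‖ ^ 2 * ψ y :=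
    sq_integral_mul_le hψn ((hψd.continuous.integrable_of_hasCompactSupport hψc).integrableOn)
      (hbd hp1) (hbd hp2) hψ1
  refine le_trans ?_ hle
  have hm : 0 ≤ ∫ y in Ω, ‖p y‖ * ψ y := integral_nonneg fun y => mul_nonneg (norm_nonneg _) (hψn y)
  refine pow_le_pow_left₀ (norm_nonneg _) (ContinuousLinearMap.opNorm_le_bound _ hm fun e => ?_) 2
  rw [hval, ← integral_mul_const]
  refine norm_integral_le_of_norm_le ((hbd hp1).mul_const _) (ae_of_all _ fun y => ?_)
  rw [norm_mul, Real.norm_of_nonneg (hψn y)]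
  calc ‖inner ℝ (p y) e‖ * ψ y ≤ (‖p y‖ * ‖e‖) * ψ y :=
        mul_le_mul_of_nonneg_right (norm_inner_le_norm _ _) (hψn y)
    _ = _ := by ring

/-- Functions of class `H¹(Ω)` that are continuous on the closed square and vanish on its boundary
are uniform limits of `C¹` functions with compact support in `Ω` whose Dirichlet integrals do not
exceed that of the limit. -/
lemma exists_smooth_approx {v : Pt → ℝ} {p : Pt → Pt} (hc : ContinuousOn v (closure Ω))
    (h0 : ∀ x ∈ frontier Ω, v x = 0) (hp : HasWeakGrad v p) {δ : ℝ} (hδ : 0 < δ) :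
    ∃ w : Pt → ℝ, ContDiff ℝ 1 w ∧ HasCompactSupport w ∧ tsupport w ⊆ Ω ∧
      (∀ x ∈ closure Ω, |w x - v x| ≤ 3 * δ) ∧
      ∫ x in Ω, ‖fderiv ℝ w x‖ ^ 2 ≤ ∫ x in Ω, ‖p x‖ ^ 2 := by
  set V := Ω.indicator v with hVdef
  have hV : Continuous V := continuous_indicator h0 hc
  have hVsupp : HasCompactSupport V := HasCompactSupport.of_support_subset_isCompact
    isCompact_closure_Ω (support_indicator_subset.trans subset_closure)
  have hVu : UniformContinuous V := hVsupp.uniformContinuous_of_continuous hV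
  -- the compact set outside which the truncation vanishes
  set Q : Set Pt := {x | δ / 2 ≤ |V x|} with hQ
  have hQclosed : IsClosed Q := isClosed_le continuous_const hV.abs
  have hQΩ : Q ⊆ Ω := fun x hx => by
    by_contra hx'
    have : δ / 2 ≤ |V x| := hx
    rw [hVdef, indicator_of_notMem hx', abs_zero] at this
    linarith
  have hQc : IsCompact Q := isCompact_closure_Ω.of_isClosed_subset hQclosed (hQΩ.trans subset_closure)
  obtain ⟨r₁, hr₁, hthick⟩ := hQc.exists_cthickening_subset_open isOpen_Ω hQΩ
  obtain ⟨r₂, hr₂, hunif⟩ := Metric.uniformContinuous_iff.1 hVu (δ / 2) (by linarith)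
  let φ : ContDiffBump (0 : Pt) := ⟨min r₁ r₂ / 2, min r₁ r₂, by positivity, by
    have : 0 < min r₁ r₂ := lt_min hr₁ hr₂
    linarith⟩
  have hφr : φ.rOut = min r₁ r₂ := rfl
  set c := convolution (φ.normed volume) V (ContinuousLinearMap.lsmul ℝ ℝ) volume with hcdef
  have hcV : ∀ x, |c x - V x| ≤ δ / 2 := fun x => by
    have := φ.dist_normed_convolution_le (μ := volume) (x₀ := x) (ε := δ / 2)
      hV.aestronglyMeasurable fun y hy => (hunif (lt_of_lt_of_le hy (by rw [hφr]; exact min_le_right _ _))).le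
    simpa [Real.dist_eq] using this
  have hcs : ContDiff ℝ 1 c := φ.hasCompactSupport_normed.contDiff_convolution_left _
    (φ.contDiff_normed) hV.locallyIntegrable
  have htr : ContDiff ℝ 1 (truncate δ) := by
    rw [contDiff_one_iff_deriv]
    refine ⟨fun s => (hasDerivAt_truncate δ s).differentiableAt, ?_⟩
    rw [funext fun s => (hasDerivAt_truncate δ s).deriv]
    exact continuous_cutSlope δ
  set w := fun x => truncate δ (c x) with hw
  have hws : ContDiff ℝ 1 w := htr.comp hcs
  have hcQ : ∀ x, x ∉ Q → |c x| ≤ δ := fun x hx => by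
    have h1 : |V x| < δ / 2 := not_le.1 hx
    have := abs_sub_abs_le_abs_sub (c x) (V x)
    linarith [hcV x]
  have hsupp : tsupport w ⊆ Q := closure_minimal (fun x hx => by
    by_contra hxQ
    exact hx (truncate_eq_zero hδ (hcQ x hxQ))) hQclosed
  have hwc : HasCompactSupport w := HasCompactSupport.of_support_subset_isCompact hQc
    ((subset_tsupport w).trans hsupp)
  refine ⟨w, hws, hwc, hsupp.trans hQΩ, fun x hx => ?_, ?_⟩
  · have hvV : v x = V x := by
      by_cases hxΩ : x ∈ Ω
      · rw [hVdef, indicator_of_mem hxΩ]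
      · rw [hVdef, indicator_of_notMem hxΩ]
        exact h0 x ⟨hx, fun h => hxΩ (interior_subset h)⟩
    rw [hvV]
    calc |w x - V x| = |(truncate δ (c x) - c x) + (c x - V x)| := by rw [hw]; ring_nf
      _ ≤ 2 * δ + δ / 2 := (abs_add_le _ _).trans (add_le_add (abs_truncate_sub_le hδ _) (hcV x))
      _ ≤ 3 * δ := by linarith
  set P : Pt → ℝ := Ω.indicator fun y => ‖p y‖ ^ 2 with hP
  have hPi : Integrable P := by
    rw [hP, integrable_indicator_iff measurableSet_Ω]
    exact hp.1.integrable_norm_pow (by simp)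
  set q := convolution (φ.normed volume) P (ContinuousLinearMap.lsmul ℝ ℝ) volume with hq
  have hki : Integrable (φ.normed (volume : Measure Pt)) := φ.integrable_normed
  have hqi : Integrable q := hki.integrable_convolution _ hPi
  have hq0 : ∀ x, 0 ≤ q x := fun x => by
    rw [hq, convolution_def]
    refine integral_nonneg fun y => ?_
    simp only [ContinuousLinearMap.lsmul_apply, smul_eq_mul, Pi.zero_apply]
    refine mul_nonneg (φ.nonneg_normed y) ?_
    rw [hP]
    exact indicator_nonneg (fun _ _ => by positivity) _
  have hqint : ∫ x, q x = ∫ x in Ω, ‖p x‖ ^ 2 := by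
    rw [hq, integral_convolution _ hki hPi, φ.integral_normed, hP, integral_indicator measurableSet_Ω]
    simp
  have hder : ∀ x, ‖fderiv ℝ w x‖ ^ 2 ≤ q x := fun x => by
    have h1 : fderiv ℝ w x = cutSlope δ (c x) • fderiv ℝ c x :=
      ((hasDerivAt_truncate δ (c x)).comp_hasFDerivAt x ((hcs.differentiable (by simp)) x).hasFDerivAt).fderiv
    rw [h1]
    by_cases hx : x ∈ Q
    · have hball : Metric.closedBall x φ.rOut ⊆ Ω := fun y hy => hthick
        (Metric.mem_cthickening_of_dist_le y x r₁ Q hx ((Metric.mem_closedBall.1 hy).trans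
          (by rw [hφr]; exact min_le_left _ _)))
      refine le_trans ?_ (norm_fderiv_mollify_sq_le hp hV φ hball)
      refine pow_le_pow_left₀ (norm_nonneg _) ?_ 2
      rw [norm_smul, Real.norm_of_nonneg (cutSlope_mem _ _).1]
      exact mul_le_of_le_one_left (norm_nonneg _) (cutSlope_mem _ _).2
    · rw [cutSlope_eq_zero hδ (hcQ x hx), zero_smul, norm_zero]
      simpa using hq0 x
  rw [← hqint]
  have hdi : IntegrableOn (fun x => ‖fderiv ℝ w x‖ ^ 2) Ω :=
    (((hws.continuous_fderiv (by simp)).norm.pow 2).continuousOn.integrableOn_compact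
      isCompact_closure_Ω).mono_set subset_closure
  exact (setIntegral_mono hdi hqi.integrableOn hder).trans
    (setIntegral_le_integral hqi (ae_of_all _ hq0))

/-- Weak convergence of a bounded sequence in a Hilbert space may be tested on a set whose span is
dense. -/
lemma tendsto_inner_of_dense {H : Type*} [NormedAddCommGroup H] [InnerProductSpace ℝ H]
    [CompleteSpace H] {x : ℕ → H} {y : H} {B : ℝ} (hB : ∀ n, ‖x n‖ ≤ B) {S : Set H}
    (hS : ∀ a : H, (∀ s ∈ S, inner ℝ s a = 0) → a = 0)
    (h : ∀ s ∈ S, Tendsto (fun n => inner ℝ (x n) s) atTop (𝓝 (inner ℝ y s))) (a : H) :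
    Tendsto (fun n => inner ℝ (x n) a) atTop (𝓝 (inner ℝ y a)) := by
  have hspan : ∀ s ∈ Submodule.span ℝ S, Tendsto (fun n => inner ℝ (x n) s) atTop (𝓝 (inner ℝ y s)) := by
    intro s hs
    induction hs using Submodule.span_induction with
    | mem s hs => exact h s hs
    | zero => simp
    | add s t _ _ h1 h2 => simpa only [inner_add_right] using h1.add h2
    | smul c s _ h1 => simpa only [inner_smul_right] using h1.const_mul c
  have htop : (Submodule.span ℝ S).topologicalClosure = ⊤ := by
    rw [Submodule.topologicalClosure_eq_top_iff, Submodule.eq_bot_iff]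
    intro b hb
    exact hS b fun s hs => (Submodule.mem_orthogonal _ b).1 hb s (Submodule.subset_span hs)
  have hB0 : 0 ≤ B := (norm_nonneg _).trans (hB 0)
  rw [Metric.tendsto_atTop]
  intro η hη
  have ha : a ∈ closure ((Submodule.span ℝ S : Submodule ℝ H) : Set H) := by
    rw [← Submodule.topologicalClosure_coe, htop]; trivial
  set θ := η / (2 * (B + ‖y‖ + 1)) with hθ
  have hden : 0 < 2 * (B + ‖y‖ + 1) := by positivity
  obtain ⟨s, hs, has⟩ := Metric.mem_closure_iff.1 ha θ (by positivity)
  obtain ⟨N, hN⟩ := Metric.tendsto_atTop.1 (hspan s hs) (η / 2) (by positivity)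
  refine ⟨N, fun n hn => ?_⟩
  have h1 := hN n hn
  rw [Real.dist_eq] at h1 ⊢
  have h2 : inner ℝ (x n) a - inner ℝ y a =
      inner ℝ (x n - y) (a - s) + (inner ℝ (x n) s - inner ℝ y s) := by
    simp only [inner_sub_left, inner_sub_right]; ring
  have h3 : |inner ℝ (x n - y) (a - s)| ≤ (B + ‖y‖ + 1) * θ := by
    refine (abs_real_inner_le_norm _ _).trans ?_
    rw [dist_eq_norm] at has
    exact mul_le_mul (by linarith [norm_sub_le (x n) y, hB n]) has.le (norm_nonneg _) (by positivity)
  have h4 : (B + ‖y‖ + 1) * θ = η / 2 := by rw [hθ]; field_simp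
  rw [h2]
  linarith [abs_add_le (inner ℝ (x n - y) (a - s)) (inner ℝ (x n) s - inner ℝ y s)]

/-- `C¹` functions with compact support in `Ω`. -/
structure IsTestFun (w : Pt → ℝ) : Prop where
  contDiff : ContDiff ℝ 1 w
  compact : HasCompactSupport w
  supp : tsupport w ⊆ Ω

lemma IsTestFun.continuous {w : Pt → ℝ} (hw : IsTestFun w) : Continuous w := hw.contDiff.continuous

lemma IsTestFun.continuous_fderiv {w : Pt → ℝ} (hw : IsTestFun w) : Continuous (fderiv ℝ w) :=
  hw.contDiff.continuous_fderiv (by simp)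

lemma IsTestFun.eq_zero {w : Pt → ℝ} (hw : IsTestFun w) {x : Pt} (hx : x ∉ Ω) : w x = 0 :=
  image_eq_zero_of_notMem_tsupport fun h => hx (hw.supp h)

lemma IsTestFun.hasWeakGrad {w : Pt → ℝ} (hw : IsTestFun w) : HasWeakGrad w (gradient w) := by
  obtain ⟨D, hD⟩ := hw.contDiff.lipschitzWith_of_hasCompactSupport hw.compact (by simp)
  exact hasWeakGrad_of_lipschitzWith hD

/-- Integrals of uniformly convergent sequences of continuous functions over a set of finite
measure. -/
lemma tendsto_setIntegral_of_uniform {w : ℕ → Pt → ℝ} {v : Pt → ℝ}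
    (hw : ∀ n, ContinuousOn (w n) (closure Ω)) (hv : ContinuousOn v (closure Ω))
    (hu : TendstoUniformlyOn w v atTop (closure Ω)) {Φ : Pt → ℝ → ℝ}
    (hΦ : ContinuousOn (fun q : Pt × ℝ => Φ q.1 q.2) (closure Ω ×ˢ univ)) {s : Set Pt}
    (hs : MeasurableSet s) (hsΩ : s ⊆ closure Ω) :
    Tendsto (fun n => ∫ x in s, Φ x (w n x)) atTop (𝓝 (∫ x in s, Φ x (v x))) := by
  obtain ⟨C, hC⟩ := isCompact_closure_Ω.exists_bound_of_continuousOn hv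
  have hcomp : IsCompact (closure Ω ×ˢ Icc (-(C + 1)) (C + 1)) := isCompact_closure_Ω.prod isCompact_Icc
  obtain ⟨D, hD⟩ := hcomp.exists_bound_of_continuousOn (hΦ.mono (prod_mono_right (subset_univ _)))
  have hfin : IsFiniteMeasure ((volume : Measure Pt).restrict s) :=
    ⟨by rw [Measure.restrict_apply_univ]; exact (measure_mono hsΩ).trans_lt isCompact_closure_Ω.measure_lt_top⟩
  have hcw : ∀ n, ContinuousOn (fun x => Φ x (w n x)) (closure Ω) := fun n =>
    hΦ.comp (f := fun x => (x, w n x)) (continuousOn_id.prodMk (hw n)) fun x hx => ⟨hx, trivial⟩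
  refine tendsto_integral_filter_of_dominated_convergence (fun _ => D)
    (Eventually.of_forall fun n => ((hcw n).mono hsΩ).aestronglyMeasurable hs) ?_
    (integrable_const D) ?_
  · filter_upwards [Metric.tendstoUniformlyOn_iff.1 hu 1 one_pos] with n hn
    filter_upwards [ae_restrict_mem hs] with x hx
    refine hD (x, w n x) ⟨hsΩ hx, ?_⟩
    have h1 := hn x (hsΩ hx)
    have h2 := hC x (hsΩ hx)
    rw [Real.dist_eq, abs_lt] at h1
    rw [Real.norm_eq_abs, abs_le] at h2
    constructor <;> linarith
  · filter_upwards [ae_restrict_mem hs] with x hx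
    have h1 : ContinuousWithinAt (fun q : Pt × ℝ => Φ q.1 q.2) (closure Ω ×ˢ univ) (x, v x) :=
      hΦ _ ⟨hsΩ hx, trivial⟩
    have h2 : Tendsto (fun n => (x, w n x)) atTop (𝓝[closure Ω ×ˢ univ] (x, v x)) := by
      refine tendsto_nhdsWithin_iff.2 ⟨?_, Eventually.of_forall fun n => ⟨hsΩ hx, trivial⟩⟩
      exact tendsto_const_nhds.prodMk_nhds (hu.tendsto_at (hsΩ hx))
    exact h1.tendsto.comp h2

/-- Every function of class `H¹₀(Ω) ∩ C(Ω̄)` is the uniform limit of test functions whose gradients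
converge weakly in `L²` and have no larger `L²` norm. -/
lemma MemH10C.exists_seq {v : Pt → ℝ} (hv : MemH10C v) :
    ∃ w : ℕ → Pt → ℝ, (∀ n, IsTestFun (w n)) ∧ TendstoUniformlyOn w v atTop (closure Ω) ∧
      (∀ n, ∫ x in Ω, ‖fderiv ℝ (w n) x‖ ^ 2 ≤ ∫ x in Ω, ‖weakGrad v x‖ ^ 2) ∧
      ∀ a : Pt → Pt, MemLp a 2 (volume.restrict Ω) →
        Tendsto (fun n => ∫ x in Ω, inner ℝ (gradient (w n) x) (a x)) atTop
          (𝓝 (∫ x in Ω, inner ℝ (weakGrad v x) (a x))) := by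
  obtain ⟨hc, h0, hH⟩ := hv
  have hp := hH.hasWeakGrad
  have hex := fun n : ℕ => exists_smooth_approx hc h0 hp (δ := 1 / (n + 1)) (by positivity)
  choose w h1 h2 h3 h4 h5 using hex
  have htest : ∀ n, IsTestFun (w n) := fun n => ⟨h1 n, h2 n, h3 n⟩
  have hunif : TendstoUniformlyOn w v atTop (closure Ω) := by
    rw [Metric.tendstoUniformlyOn_iff]
    intro η hη
    have ht : Tendsto (fun n : ℕ => 3 * (1 / ((n : ℝ) + 1))) atTop (𝓝 0) := by
      simpa using tendsto_one_div_add_atTop_nhds_zero_nat.const_mul (3 : ℝ)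
    filter_upwards [ht.eventually_lt_const hη] with n hn x hx
    rw [dist_comm, Real.dist_eq]
    exact (h4 n x hx).trans_lt hn
  refine ⟨w, htest, hunif, h5, fun a ha => ?_⟩
  set X : ℕ → Lp Pt 2 (volume.restrict Ω) := fun n => (htest n).hasWeakGrad.1.toLp _ with hX
  set Y : Lp Pt 2 (volume.restrict Ω) := hp.1.toLp _ with hY
  have hinner : ∀ {b c : Pt → Pt} (hb : MemLp b 2 (volume.restrict Ω)) (hc : MemLp c 2 (volume.restrict Ω)),
      inner ℝ (hb.toLp b) (hc.toLp c) = ∫ x in Ω, inner ℝ (b x) (c x) := fun hb hc => by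
    rw [L2.inner_def]
    refine integral_congr_ae ?_
    filter_upwards [hb.coeFn_toLp, hc.coeFn_toLp] with x hx hx'
    rw [hx, hx']
  have hbound : ∀ n, ‖X n‖ ≤ Real.sqrt (∫ x in Ω, ‖weakGrad v x‖ ^ 2) := fun n => by
    refine Real.le_sqrt_of_sq_le ?_
    rw [← real_inner_self_eq_norm_sq, hX, hinner]
    simp only [real_inner_self_eq_norm_sq, norm_gradient]
    exact h5 n
  have := tendsto_inner_of_dense (x := X) (y := Y) hbound
    (S := {s | ∃ (ψ : Pt → ℝ) (_ : ContDiff ℝ ∞ ψ) (_ : HasCompactSupport ψ) (_ : tsupport ψ ⊆ Ω) (e : Pt)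
      (hs : MemLp (fun x => ψ x • e) 2 (volume.restrict Ω)), s = hs.toLp _}) ?_ ?_ (ha.toLp a)
  · simpa only [hX, hY, hinner] using this
  · intro b hb
    have hbm : MemLp b 2 (volume.restrict Ω) := Lp.memLp b
    have hbi : IntegrableOn b Ω := hbm.integrable one_le_two
    have hz := isOpen_Ω.ae_eq_zero_of_integral_contDiff_smul_eq_zero (μ := volume)
      (f := b) hbi.locallyIntegrableOn ?_
    · refine Lp.ext ?_
      refine EventuallyEq.trans ?_ (Lp.coeFn_zero _ _ _).symm
      rw [EventuallyEq, ae_restrict_iff' measurableSet_Ω]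
      exact hz
    · intro ψ hψ hψc hψs
      obtain ⟨C, hC⟩ := hψc.exists_bound_of_continuous hψ.continuous
      have e1 : ∫ x, ψ x • b x = ∫ x in Ω, ψ x • b x :=
        (setIntegral_eq_integral_of_forall_compl_eq_zero fun x hx => by
          rw [image_eq_zero_of_notMem_tsupport (fun h => hx (hψs h)), zero_smul]).symm
      rw [e1]
      refine ext_inner_left ℝ fun e => ?_
      have hint : Integrable (fun x => ψ x • b x) (volume.restrict Ω) :=
        hbi.bdd_smul C hψ.continuous.aestronglyMeasurable (ae_of_all _ hC)
      rw [inner_zero_right, ← integral_inner hint]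
      have hm : MemLp (fun x => ψ x • e) 2 (volume.restrict Ω) := by
        refine MemLp.of_bound (hψ.continuous.smul continuous_const).aestronglyMeasurable (C * ‖e‖) (ae_of_all _ fun x => ?_)
        rw [norm_smul]
        exact mul_le_mul_of_nonneg_right (hC x) (norm_nonneg _)
      have := hb _ ⟨ψ, hψ, hψc, hψs, e, hm, rfl⟩
      rw [L2.inner_def] at this
      rw [← this]
      refine integral_congr_ae ?_
      filter_upwards [hm.coeFn_toLp] with x hx
      rw [hx, real_inner_smul_left, real_inner_smul_right]
  · rintro s ⟨ψ, hψ, hψc, hψs, e, hs, rfl⟩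
    simp only [hX, hY, hinner]
    have h6 : ∀ {u : Pt → ℝ} {q : Pt → Pt}, HasWeakGrad u q →
        ∫ x in Ω, inner ℝ (q x) (ψ x • e) = - ∫ x in Ω, u x * fderiv ℝ ψ x e := fun hu => by
      rw [hu.2 ψ hψ hψc hψs e, neg_neg]
      refine integral_congr_ae (ae_of_all _ fun x => ?_)
      simp only [real_inner_smul_right]; ring
    rw [h6 hp]
    simp only [fun n => h6 (htest n).hasWeakGrad]
    refine Tendsto.neg ?_
    have hψ' : Continuous fun x => fderiv ℝ ψ x e :=
      (hψ.continuous_fderiv (by simp)).clm_apply continuous_const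
    have := tendsto_setIntegral_of_uniform (fun n => (htest n).continuous.continuousOn) hc hunif
      (Φ := fun x s => s * fderiv ℝ ψ x e) (Continuous.continuousOn (by fun_prop)) measurableSet_Ω subset_closure
    exact this

lemma sq_intervalIntegral_le {f : ℝ → ℝ} (hf : Continuous f) {y : ℝ} (hy : y ∈ Icc (0 : ℝ) 1) :
    (∫ s in (0 : ℝ)..y, f s) ^ 2 ≤ ∫ s in (0 : ℝ)..1, f s ^ 2 := by
  rw [intervalIntegral.integral_of_le hy.1, intervalIntegral.integral_of_le zero_le_one]
  have hi : ∀ {g : ℝ → ℝ} (z : ℝ), Continuous g → IntegrableOn g (Ioc 0 z) := fun z hg =>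
    (hg.integrableOn_Icc (a := 0) (b := z)).mono_set Ioc_subset_Icc_self
  have := sq_integral_mul_le (μ := volume.restrict (Ioc 0 y)) (a := f) (φ := fun _ => 1)
    (fun _ => zero_le_one) (hi y continuous_const) (by simp only [mul_one]; exact hi y hf)
    (by simp only [mul_one]; exact hi y (hf.pow 2)) (by simpa [hy.1] using hy.2)
  simp only [mul_one] at this
  exact this.trans (setIntegral_mono_set (hi 1 (hf.pow 2)) (ae_of_all _ fun _ => sq_nonneg _)
    (Ioc_subset_Ioc_right hy.2).eventuallyLE)

lemma IsTestFun.poincare {w : Pt → ℝ} (hw : IsTestFun w) :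
    ∫ x in Ω, w x ^ 2 ≤ ∫ x in Ω, ‖fderiv ℝ w x‖ ^ 2 := by
  have hc1 : Continuous fun x => w x ^ 2 := hw.continuous.pow 2
  have hc2 : Continuous fun x => ‖fderiv ℝ w x‖ ^ 2 := hw.continuous_fderiv.norm.pow 2
  rw [setIntegral_Ω (integrableOn_of_continuousOn hc1.continuousOn),
    setIntegral_Ω (integrableOn_of_continuousOn hc2.continuousOn)]
  have hu1 : Continuous (Function.uncurry fun x y : ℝ => w !₂[x, y] ^ 2) :=
    hc1.comp (continuous_mk_pt continuous_fst continuous_snd)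
  have hu2 : Continuous (Function.uncurry fun x y : ℝ => ‖fderiv ℝ w !₂[x, y]‖ ^ 2) :=
    hc2.comp (continuous_mk_pt continuous_fst continuous_snd)
  refine intervalIntegral.integral_mono_on zero_le_one
    ((intervalIntegral.continuous_parametric_intervalIntegral_of_continuous' hu1 0 1).intervalIntegrable _ _)
    ((intervalIntegral.continuous_parametric_intervalIntegral_of_continuous' hu2 0 1).intervalIntegrable _ _)
    fun x hx => ?_
  have hline : ∀ y, HasDerivAt (fun y : ℝ => w !₂[x, y]) (fderiv ℝ w !₂[x, y] !₂[0, 1]) y := fun y => by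
    have h1 : HasDerivAt (fun y : ℝ => (!₂[x, 0] : Pt) + y • (!₂[0, 1] : Pt)) ((1 : ℝ) • (!₂[0, 1] : Pt)) y :=
      ((hasDerivAt_id y).smul_const _).const_add _
    have h2 : (fun y : ℝ => (!₂[x, 0] : Pt) + y • (!₂[0, 1] : Pt)) = fun y => !₂[x, y] := by
      ext y i; fin_cases i <;> simp
    rw [h2, one_smul] at h1
    exact ((hw.contDiff.differentiable (by simp)) _).hasFDerivAt.comp_hasDerivAt y h1
  have hdc : Continuous fun y : ℝ => fderiv ℝ w !₂[x, y] !₂[0, 1] :=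
    (hw.continuous_fderiv.comp (by fun_prop)).clm_apply continuous_const
  have hbound : ∀ y ∈ Icc (0 : ℝ) 1, w !₂[x, y] ^ 2 ≤ ∫ s in (0 : ℝ)..1, ‖fderiv ℝ w !₂[x, s]‖ ^ 2 := by
    intro y hy
    have h1 := intervalIntegral.integral_eq_sub_of_hasDerivAt (a := 0) (b := y) (fun s _ => hline s)
      (hdc.intervalIntegrable _ _)
    have h2 : w !₂[x, 0] = 0 := hw.eq_zero (by rw [mem_Ω]; simp)
    rw [h2, sub_zero] at h1
    rw [← h1]
    refine (sq_intervalIntegral_le hdc hy).trans ?_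
    refine intervalIntegral.integral_mono_on zero_le_one ((hdc.pow 2).intervalIntegrable _ _)
      (Continuous.intervalIntegrable (hu2.comp (by fun_prop : Continuous fun s : ℝ => (x, s))) _ _) fun s _ => ?_
    have h3 : ‖(!₂[0, 1] : Pt)‖ = 1 := by
      rw [← sq_eq_sq₀ (norm_nonneg _) zero_le_one, norm_sq_pt]; simp
    have h4 := (fderiv ℝ w !₂[x, s]).le_opNorm !₂[0, 1]
    rw [h3, mul_one, Real.norm_eq_abs] at h4
    rw [← sq_abs]
    exact pow_le_pow_left₀ (abs_nonneg _) h4 2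
  calc ∫ y in (0 : ℝ)..1, w !₂[x, y] ^ 2
      ≤ ∫ y in (0 : ℝ)..1, ∫ s in (0 : ℝ)..1, ‖fderiv ℝ w !₂[x, s]‖ ^ 2 :=
        intervalIntegral.integral_mono_on zero_le_one
          (Continuous.intervalIntegrable (hu1.comp (by fun_prop : Continuous fun s : ℝ => (x, s))) _ _)
          intervalIntegrable_const hbound
    _ = _ := by simp

/-- The Poincaré–Friedrichs inequality on the unit square. -/
lemma MemH10C.poincare {v : Pt → ℝ} (hv : MemH10C v) :
    ∫ x in Ω, v x ^ 2 ≤ ∫ x in Ω, ‖weakGrad v x‖ ^ 2 := by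
  obtain ⟨w, hw, hu, hb, -⟩ := hv.exists_seq
  refine le_of_tendsto (tendsto_setIntegral_of_uniform (fun n => (hw n).continuous.continuousOn) hv.1 hu
    (Φ := fun _ s => s ^ 2) (Continuous.continuousOn (by fun_prop)) measurableSet_Ω subset_closure)
    (Eventually.of_forall fun n => (hw n).poincare.trans (hb n))

/-! ### Barycentric coordinates and hat functions of a triangulation -/

namespace Mesh

variable {K : Mesh}

lemma exists_triple {T : Finset Pt} (hT : T ∈ K.tri) :
    ∃ a b c : Pt, a ≠ b ∧ a ≠ c ∧ b ≠ c ∧ T = {a, b, c} := Finset.card_eq_three.1 (K.card_eq_three T hT)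

/-- Finite linear combinations with unit weight sum commute with affine functionals. -/
lemma affine_sum {ι : Type*} (A : Pt →ᵃ[ℝ] ℝ) (s : Finset ι) (w : ι → ℝ) (x : ι → Pt)
    (h : ∑ i ∈ s, w i = 1) : A (∑ i ∈ s, w i • x i) = ∑ i ∈ s, w i * A (x i) := by
  have hA : ∀ y, A y = A.linear y + A 0 := fun y => by
    have := A.map_vadd 0 y
    simpa using this
  rw [hA, map_sum]
  simp_rw [hA (x _), mul_add, Finset.sum_add_distrib, ← Finset.sum_mul, h, one_mul, map_smul,
    smul_eq_mul]

/-- The barycentric coordinate of the triangle `T` belonging to the vertex `z`, as an affine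
function on the plane (zero if `z` is not a vertex of `T`). -/
noncomputable def lam (K : Mesh) (T : Finset Pt) (z : Pt) : Pt →ᵃ[ℝ] ℝ :=
  if h : ∃ _ : T ∈ K.tri, z ∈ T then
    (K.basis h.choose).coord ⟨z, Finset.mem_coe.2 h.choose_spec⟩ else 0

lemma lam_eq {T : Finset Pt} (hT : T ∈ K.tri) {z : Pt} (hz : z ∈ T) :
    K.lam T z = (K.basis hT).coord ⟨z, Finset.mem_coe.2 hz⟩ := by
  have h : ∃ _ : T ∈ K.tri, z ∈ T := ⟨hT, hz⟩
  rw [lam, dif_pos h]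

lemma lam_of_notMem {T : Finset Pt} {z : Pt} (hz : z ∉ T) : K.lam T z = 0 := by
  rw [lam, dif_neg]
  rintro ⟨_, h⟩
  exact hz h

lemma lam_apply {T : Finset Pt} (hT : T ∈ K.tri) {z w : Pt} (hw : w ∈ T) :
    K.lam T z w = if z = w then 1 else 0 := by
  by_cases hz : z ∈ T
  · have h := (K.basis hT).coord_apply ⟨z, Finset.mem_coe.2 hz⟩ ⟨w, Finset.mem_coe.2 hw⟩
    have h1 : (K.basis hT) ⟨w, Finset.mem_coe.2 hw⟩ = w := rfl
    rw [h1] at h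
    rw [lam_eq hT hz, h]
    simp
  · rw [lam_of_notMem hz, if_neg (show ¬ z = w from fun h => hz (h ▸ hw))]; simp

lemma sum_lam {T : Finset Pt} (hT : T ∈ K.tri) (x : Pt) : ∑ v ∈ T, K.lam T v x = 1 := by
  rw [← (K.basis hT).sum_coord_apply_eq_one x, ← Finset.sum_attach]
  exact Finset.sum_congr rfl fun v _ => by rw [lam_eq hT v.2]; rfl

lemma sum_lam_smul {T : Finset Pt} (hT : T ∈ K.tri) (x : Pt) : ∑ v ∈ T, K.lam T v x • v = x := by
  conv_rhs => rw [← (K.basis hT).linear_combination_coord_eq_self x]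
  rw [← Finset.sum_attach]
  exact Finset.sum_congr rfl fun v _ => by rw [lam_eq hT v.2]; rfl

lemma lam_sum {T : Finset Pt} (hT : T ∈ K.tri) {w : Pt → ℝ} (hw : ∑ v ∈ T, w v = 1) {z : Pt}
    (hz : z ∈ T) : K.lam T z (∑ v ∈ T, w v • v) = w z := by
  rw [affine_sum _ _ _ _ hw, Finset.sum_congr rfl fun v hv => by rw [lam_apply hT hv]]
  simp [hz]

lemma mem_convexHull_iff {T : Finset Pt} (hT : T ∈ K.tri) {x : Pt} :
    x ∈ convexHull ℝ (T : Set Pt) ↔ ∀ v ∈ T, 0 ≤ K.lam T v x := by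
  constructor
  · intro h v hv
    obtain ⟨w, hw0, hw1, rfl⟩ := Finset.mem_convexHull'.1 h
    rw [lam_sum hT hw1 hv]
    exact hw0 v hv
  · intro h
    exact Finset.mem_convexHull'.2 ⟨fun v => K.lam T v x, h, sum_lam hT x, sum_lam_smul hT x⟩

/-- Points of a face of a triangle have vanishing barycentric coordinates at the other vertices. -/
lemma lam_eq_zero_of_mem_face {T S : Finset Pt} (hT : T ∈ K.tri) (hST : S ⊆ T) {x : Pt}
    (hx : x ∈ convexHull ℝ (S : Set Pt)) {v : Pt} (hv : v ∉ S) : K.lam T v x = 0 := by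
  obtain ⟨w, hw0, hw1, rfl⟩ := Finset.mem_convexHull'.1 hx
  rw [affine_sum _ _ _ _ hw1]
  refine Finset.sum_eq_zero fun u hu => ?_
  rw [lam_apply hT (hST hu), if_neg fun h => hv (by rwa [h]), mul_zero]

lemma mem_convexHull_inter {T T' : Finset Pt} (hT : T ∈ K.tri) (hT' : T' ∈ K.tri) {x : Pt}
    (hx : x ∈ convexHull ℝ (T : Set Pt)) (hx' : x ∈ convexHull ℝ (T' : Set Pt)) :
    x ∈ convexHull ℝ ((T ∩ T' : Finset Pt) : Set Pt) := by
  rw [Finset.coe_inter, ← K.inter T hT T' hT']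
  exact ⟨hx, hx'⟩

/-- Conformity: a vertex with a positive barycentric coordinate at a common point of two triangles
is shared by them. -/
lemma mem_of_lam_ne_zero {T T' : Finset Pt} (hT : T ∈ K.tri) (hT' : T' ∈ K.tri) {x : Pt}
    (hx : x ∈ convexHull ℝ (T : Set Pt)) (hx' : x ∈ convexHull ℝ (T' : Set Pt)) {v : Pt}
    (hv : K.lam T v x ≠ 0) : v ∈ T' := by
  by_contra h
  exact hv (lam_eq_zero_of_mem_face hT Finset.inter_subset_left (mem_convexHull_inter hT hT' hx hx')
    fun h' => h (Finset.mem_inter.1 h').2)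

/-- Conformity: barycentric coordinates of two triangles agree at common points. -/
lemma lam_congr {T T' : Finset Pt} (hT : T ∈ K.tri) (hT' : T' ∈ K.tri) {x : Pt}
    (hx : x ∈ convexHull ℝ (T : Set Pt)) (hx' : x ∈ convexHull ℝ (T' : Set Pt)) (z : Pt) :
    K.lam T z x = K.lam T' z x := by
  obtain ⟨w, hw0, hw1, rfl⟩ := Finset.mem_convexHull'.1 (mem_convexHull_inter hT hT' hx hx')
  rw [affine_sum _ _ _ _ hw1, affine_sum _ _ _ _ hw1]
  refine Finset.sum_congr rfl fun u hu => ?_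
  rw [lam_apply hT (Finset.mem_inter.1 hu).1, lam_apply hT' (Finset.mem_inter.1 hu).2]

/-- Conformity: a node that lies in a triangle is one of its vertices. -/
lemma vertex_mem_of_mem_convexHull {T T' : Finset Pt} (hT : T ∈ K.tri) (hT' : T' ∈ K.tri) {z : Pt}
    (hz : z ∈ T) (hz' : z ∈ convexHull ℝ (T' : Set Pt)) : z ∈ T' :=
  mem_of_lam_ne_zero hT hT' (subset_convexHull ℝ _ hz) hz' (by rw [lam_apply hT hz]; simp)

lemma hat_eq {T : Finset Pt} (hT : T ∈ K.tri) {x : Pt} (hx : x ∈ convexHull ℝ (T : Set Pt)) (z : Pt) :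
    K.hat z x = K.lam T z x := by
  unfold hat
  split_ifs with h
  · rw [← lam_eq h.choose_spec.choose h.choose_spec.choose_spec.1]
    exact lam_congr h.choose_spec.choose hT h.choose_spec.choose_spec.2 hx z
  · rw [lam_of_notMem fun hz => h ⟨T, hT, hz, hx⟩]; rfl

lemma convexHull_subset {T : Finset Pt} (hT : T ∈ K.tri) : convexHull ℝ (T : Set Pt) ⊆ closure Ω := by
  rw [← K.cover]
  exact subset_biUnion_of_mem (u := fun T : Finset Pt => convexHull ℝ (T : Set Pt)) hT

lemma exists_tri {x : Pt} (hx : x ∈ closure Ω) : ∃ T ∈ K.tri, x ∈ convexHull ℝ (T : Set Pt) := by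
  rw [← K.cover] at hx
  simpa using hx

lemma mem_nodes {z : Pt} : z ∈ K.nodes ↔ ∃ T ∈ K.tri, z ∈ T := by simp [nodes]

lemma mem_triAt {z : Pt} {T : Finset Pt} : T ∈ K.triAt z ↔ T ∈ K.tri ∧ z ∈ T := by simp [triAt]

lemma subset_nodes {T : Finset Pt} (hT : T ∈ K.tri) : T ⊆ K.nodes := fun _ hz => mem_nodes.2 ⟨T, hT, hz⟩

lemma nodes_subset {z : Pt} (hz : z ∈ K.nodes) : z ∈ closure Ω := by
  obtain ⟨T, hT, h⟩ := mem_nodes.1 hz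
  exact convexHull_subset hT (subset_convexHull ℝ _ h)

lemma mem_frontier_of_notMem {z : Pt} (hz : z ∈ closure Ω) (h : z ∉ Ω) : z ∈ frontier Ω :=
  ⟨hz, by rwa [isOpen_Ω.interior_eq]⟩

lemma notMem_frontier {z : Pt} (h : z ∈ Ω) : z ∉ frontier Ω := fun h' =>
  h'.2 (by rwa [isOpen_Ω.interior_eq])

lemma isClosed_tri (T : Finset Pt) : IsClosed (convexHull ℝ (T : Set Pt)) :=
  (T.finite_toSet.isCompact_convexHull ℝ).isClosed

/-- Continuity on the closed square follows from continuity on each of the finitely many closed triangles. -/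
lemma continuousOn_of_tri {v : Pt → ℝ} (h : ∀ T ∈ K.tri, ContinuousOn v (convexHull ℝ (T : Set Pt))) :
    ContinuousOn v (closure Ω) := by
  have hc : closure Ω = ⋃ T : K.tri, convexHull ℝ ((T : Finset Pt) : Set Pt) := by
    rw [← K.cover, iUnion_subtype]
  rw [hc]
  exact (locallyFinite_of_finite _).continuousOn_iUnion (fun T => isClosed_tri _) fun T => h T T.2

lemma continuous_affine (A : Pt →ᵃ[ℝ] ℝ) : Continuous A := A.continuous_of_finiteDimensional

lemma continuousOn_hat (z : Pt) : ContinuousOn (K.hat z) (closure Ω) :=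
  continuousOn_of_tri fun T hT => (continuous_affine (K.lam T z)).continuousOn.congr
    fun _ hx => hat_eq hT hx z

lemma continuousOn_interp (v : Pt → ℝ) : ContinuousOn (K.interp v) (closure Ω) := by
  unfold interp
  exact continuousOn_finsetSum _ fun z _ => (continuousOn_hat z).const_smul (v z)

lemma sum_hat {x : Pt} (hx : x ∈ closure Ω) : ∑ z ∈ K.nodes, K.hat z x = 1 := by
  obtain ⟨T, hT, hxT⟩ := K.exists_tri hx
  simp only [hat_eq hT hxT]
  rw [← sum_lam hT x]
  refine (Finset.sum_subset (subset_nodes hT) fun z _ hz => ?_).symm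
  rw [lam_of_notMem hz]; simp

lemma hat_eq_zero_of_notMem_patch {z x : Pt} (hx : x ∈ closure Ω) (h : x ∉ K.patch z) :
    K.hat z x = 0 := by
  obtain ⟨T, hT, hxT⟩ := K.exists_tri hx
  rw [hat_eq hT hxT, lam_of_notMem fun hz => h ?_]; · simp
  exact mem_biUnion (mem_triAt.2 ⟨hT, hz⟩) hxT

lemma hat_eq_zero_of_mem_frontier {z x : Pt} (hz : z ∈ Ω) (hx : x ∈ frontier Ω) : K.hat z x = 0 := by
  have hxc : x ∈ closure Ω := frontier_subset_closure hx
  obtain ⟨T, hT, hxT⟩ := K.exists_tri hxc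
  rw [hat_eq hT hxT]
  by_cases hzT : z ∈ T
  swap
  · rw [lam_of_notMem hzT]; simp
  have h0 := (mem_convexHull_iff hT).1 hxT
  refine le_antisymm (not_lt.1 fun hpos => notMem_frontier ?_ hx) (h0 z hzT)
  have hv : ∀ v ∈ T, v ∈ closure Ω := fun v hv => convexHull_subset hT (subset_convexHull ℝ _ hv)
  have hco : ∀ i, x i = ∑ v ∈ T, K.lam T v x * v i := fun i => by
    conv_lhs => rw [← sum_lam_smul hT x]
    simp
  have hco' : ∀ i, 1 - x i = ∑ v ∈ T, K.lam T v x * (1 - v i) := fun i => by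
    simp_rw [mul_sub, Finset.sum_sub_distrib, mul_one, sum_lam hT, ← hco i]
  have hv0 : ∀ v ∈ T, ∀ i : Fin 2, 0 ≤ v i ∧ v i ≤ 1 := fun v hvT i => by
    have := mem_closure_Ω.1 (hv v hvT)
    fin_cases i
    · exact this.1
    · exact this.2
  intro i
  have hzi := hz i
  constructor
  · rw [hco i]
    exact (mul_pos hpos hzi.1).trans_le (Finset.single_le_sum (f := fun v => K.lam T v x * v i)
      (fun v hv => mul_nonneg (h0 v hv) (hv0 v hv i).1) hzT)
  · rw [← sub_pos, hco' i]
    exact (mul_pos hpos (by linarith [hzi.2])).trans_le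
      (Finset.single_le_sum (f := fun v => K.lam T v x * (1 - v i))
      (fun v hv => mul_nonneg (h0 v hv) (by linarith [(hv0 v hv i).2])) hzT)

/-! ### Piecewise linear functions are Lipschitz continuous -/

/-- If a family of points of the closed square is indexed along a filter, some triangle contains
the points frequently. -/
lemma exists_tri_frequently {ι : Type*} {l : Filter ι} [l.NeBot] {c : ι → Pt}
    (h : ∀ᶠ s in l, c s ∈ closure Ω) :
    ∃ T ∈ K.tri, ∃ᶠ s in l, c s ∈ convexHull ℝ (T : Set Pt) := by
  by_contra! hcon
  have h1 : ∀ᶠ s in l, ∀ T ∈ K.tri, c s ∉ convexHull ℝ (T : Set Pt) := by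
    rw [Filter.eventually_all_finset]
    exact hcon
  obtain ⟨s, hs, hs'⟩ := (h.and h1).exists
  obtain ⟨T, hT, hsT⟩ := K.exists_tri hs
  exact hs' T hT hsT

lemma exists_tri_frequently_of_tendsto {ι : Type*} {l : Filter ι} [l.NeBot] {c : ι → Pt} {x : Pt}
    (h : ∀ᶠ s in l, c s ∈ closure Ω) (hx : Tendsto c l (𝓝 x)) :
    ∃ T ∈ K.tri, x ∈ convexHull ℝ (T : Set Pt) ∧ ∃ᶠ s in l, c s ∈ convexHull ℝ (T : Set Pt) := by
  obtain ⟨T, hT, hf⟩ := exists_tri_frequently (K := K) h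
  exact ⟨T, hT, (isClosed_tri T).mem_of_frequently_of_tendsto hf hx, hf⟩

/-- A finite element function is the restriction of a Lipschitz function on the plane. Along a segment its
difference quotients are bounded by the largest of the elementwise gradients, since every point of the
segment has, in some fixed element, points of the segment that approach it. -/
lemma MemSh.exists_lipschitz {v : Pt → ℝ} (hv : K.MemSh v) :
    ∃ (C : NNReal) (F : Pt → ℝ), LipschitzWith C F ∧ EqOn v F (closure Ω) := by
  obtain ⟨hc, -, hA⟩ := hv
  choose! A hA using hA
  set L : Finset Pt → Pt →L[ℝ] ℝ := fun T => (A T).linear.toContinuousLinearMap with hL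
  set C : NNReal := K.tri.sup fun T => ‖L T‖₊ with hC
  have hLC : ∀ T ∈ K.tri, ‖L T‖ ≤ C := fun T hT => by
    have : ‖L T‖₊ ≤ C := Finset.le_sup (f := fun T => ‖L T‖₊) hT
    exact_mod_cast this
  have hAd : ∀ T (x y : Pt), A T x - A T y = L T (x - y) := fun T x y => by
    have := (A T).linearMap_vsub x y
    simpa [hL] using this.symm
  have key : ∀ x ∈ closure Ω, ∀ y ∈ closure Ω, v y - v x ≤ C * ‖y - x‖ := by
    intro x hx y hy
    set c : ℝ → Pt := fun t => x + t • (y - x) with hcdef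
    have hcc : Continuous c := by simp only [hcdef]; fun_prop
    have hcmem : ∀ t ∈ Icc (0 : ℝ) 1, c t ∈ closure Ω := fun t ht =>
      convex_Ω.closure.add_smul_sub_mem hx hy ht
    have h := image_le_of_liminf_slope_right_le_deriv_boundary (f := fun t => v (c t)) (a := 0) (b := 1)
      (hc.comp hcc.continuousOn fun t ht => hcmem t ht)
      (B := fun t => v x + t * (C * ‖y - x‖)) (B' := fun _ => C * ‖y - x‖)
      (by simp [hcdef]) (by fun_prop)
      (fun t _ => by
        have := (((hasDerivAt_id t).mul_const (C * ‖y - x‖)).const_add (v x)).hasDerivWithinAt (s := Ici t)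
        simpa using this) ?_ (right_mem_Icc.2 zero_le_one)
    · simp [hcdef] at h
      linarith
    intro t ht r hr
    have hev : ∀ᶠ s in 𝓝[>] t, c s ∈ closure Ω := by
      filter_upwards [Ioo_mem_nhdsGT ht.2] with s hs
      exact hcmem s ⟨ht.1.trans hs.1.le, hs.2.le⟩
    obtain ⟨T, hT, htT, hfr⟩ := exists_tri_frequently_of_tendsto (K := K) hev
      (hcc.continuousAt.tendsto.mono_left nhdsWithin_le_nhds)
    refine (hfr.and_eventually self_mem_nhdsWithin).mono fun s hs => ?_
    obtain ⟨hs, hst⟩ := hs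
    have hst : 0 < s - t := sub_pos.2 hst
    rw [slope_def_field, hA T hT hs, hA T hT htT, hAd]
    have : c s - c t = (s - t) • (y - x) := by simp only [hcdef]; module
    rw [this, map_smul, smul_eq_mul, mul_div_assoc, mul_comm, div_mul_cancel₀ _ hst.ne']
    refine lt_of_le_of_lt ?_ hr
    exact (le_abs_self _).trans (((L T).le_opNorm _).trans
      (mul_le_mul_of_nonneg_right (hLC T hT) (norm_nonneg _)))
  have hlip : LipschitzOnWith C v (closure Ω) := by
    refine LipschitzOnWith.of_dist_le_mul fun x hx y hy => ?_
    rw [Real.dist_eq, dist_eq_norm, abs_le]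
    constructor
    · have := key x hx y hy
      rw [← norm_neg, neg_sub] at this
      linarith
    · exact key y hy x hx
  obtain ⟨F, hF, hFv⟩ := hlip.extend_real
  exact ⟨C, F, hF, hFv⟩

end Mesh

lemma HasWeakGrad.congr {v w : Pt → ℝ} {p : Pt → Pt} (h : HasWeakGrad v p) (hvw : EqOn w v Ω) :
    HasWeakGrad w p := by
  refine ⟨h.1, fun ψ h1 h2 h3 e => ?_⟩
  rw [← h.2 ψ h1 h2 h3 e]
  exact setIntegral_congr_fun measurableSet_Ω fun x hx => by simp only [hvw hx]

namespace Mesh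

variable {K : Mesh}

lemma MemSh.memH10C {v : Pt → ℝ} (hv : K.MemSh v) : MemH10C v := by
  obtain ⟨C, F, hF, hvF⟩ := hv.exists_lipschitz
  exact ⟨hv.1, hv.2.1, memLp_of_continuousOn hv.1, _,
    (hasWeakGrad_of_lipschitzWith hF).congr (hvF.mono subset_closure)⟩

lemma centroid_mem_interior {T : Finset Pt} (hT : T ∈ K.tri) :
    T.centroid ℝ id ∈ interior (convexHull ℝ (T : Set Pt)) := by
  have := (K.basis hT).centroid_mem_interior_convexHull
  have h1 : range (K.basis hT) = (T : Set Pt) := Subtype.range_coe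
  rw [h1] at this
  convert this using 1
  exact (Finset.centroid_univ ℝ T).symm

lemma gradient_eq_elemGrad {v : Pt → ℝ} {T : Finset Pt} (hT : T ∈ K.tri) {A : Pt →ᵃ[ℝ] ℝ}
    (hA : EqOn v A (convexHull ℝ (T : Set Pt))) {x : Pt} (hx : x ∈ interior (convexHull ℝ (T : Set Pt))) :
    gradient v x = elemGrad v T := by
  have h : ∀ y ∈ interior (convexHull ℝ (T : Set Pt)), fderiv ℝ v y = A.linear.toContinuousLinearMap := by
    intro y hy
    have h1 : v =ᶠ[𝓝 y] A := by
      filter_upwards [mem_interior_iff_mem_nhds.1 hy] with z hz using hA hz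
    rw [h1.fderiv_eq]
    have : (A : Pt → ℝ) = fun y => A.linear.toContinuousLinearMap y + A 0 := by
      ext y
      have := A.map_vadd 0 y
      simpa using this
    rw [this]
    exact ((A.linear.toContinuousLinearMap.hasFDerivAt).add_const (A 0)).fderiv
  have hc := centroid_mem_interior hT
  rw [elemGrad, gradient, gradient, h x hx, h _ hc]

lemma elemGrad_inner {v : Pt → ℝ} {T : Finset Pt} (hT : T ∈ K.tri) {A : Pt →ᵃ[ℝ] ℝ}
    (hA : EqOn v A (convexHull ℝ (T : Set Pt))) {x y : Pt} (hx : x ∈ convexHull ℝ (T : Set Pt))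
    (hy : y ∈ convexHull ℝ (T : Set Pt)) : inner ℝ (elemGrad v T) (y - x) = v y - v x := by
  have hc := centroid_mem_interior hT
  have h1 : v =ᶠ[𝓝 (T.centroid ℝ id)] A := by
    filter_upwards [mem_interior_iff_mem_nhds.1 hc] with z hz using hA hz
  have h2 : (A : Pt → ℝ) = fun y => A.linear.toContinuousLinearMap y + A 0 := by
    ext y
    have := A.map_vadd 0 y
    simpa using this
  rw [elemGrad, inner_gradient, h1.fderiv_eq, hA hx, hA hy, h2,
    ((A.linear.toContinuousLinearMap.hasFDerivAt).add_const (A 0)).fderiv, map_sub]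
  ring

/-- The weak gradient of a finite element function is piecewise constant. -/
lemma MemSh.weakGrad_ae {v : Pt → ℝ} (hv : K.MemSh v) {T : Finset Pt} (hT : T ∈ K.tri) :
    ∀ᵐ x ∂(volume.restrict (convexHull ℝ (T : Set Pt))), weakGrad v x = elemGrad v T := by
  obtain ⟨C, F, hF, hvF⟩ := hv.exists_lipschitz
  have h1 := ((hasWeakGrad_of_lipschitzWith hF).congr (hvF.mono subset_closure)).weakGrad_ae_eq
  rw [← restrict_closure_Ω] at h1
  have h2 := ae_restrict_of_ae_restrict_of_subset (convexHull_subset hT) h1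
  have h3 : ∀ᵐ x : Pt, x ∉ frontier (convexHull ℝ (T : Set Pt)) :=
    compl_mem_ae_iff.2 ((convex_convexHull ℝ (T : Set Pt)).addHaar_frontier volume)
  obtain ⟨A, hA⟩ := hv.2.2 T hT
  filter_upwards [h2, ae_restrict_of_ae h3, ae_restrict_mem (isClosed_tri T).measurableSet] with x hx hx3 hxT
  have hxi : x ∈ interior (convexHull ℝ (T : Set Pt)) := by
    by_contra h
    exact hx3 ⟨subset_closure hxT, h⟩
  rw [hx, ← gradient_eq_elemGrad hT hA hxi, gradient, gradient]
  congr 1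
  refine Filter.EventuallyEq.fderiv_eq ?_
  filter_upwards [mem_interior_iff_mem_nhds.1 hxi] with y hy
  exact (hvF (convexHull_subset hT hy)).symm

/-! ### Integration over the triangulation -/

/-- Distinct triangles overlap in a null set, since their intersection lies in an edge. -/
lemma volume_inter_tri {T T' : Finset Pt} (hT : T ∈ K.tri) (hT' : T' ∈ K.tri) (hne : T ≠ T') :
    volume (convexHull ℝ (T : Set Pt) ∩ convexHull ℝ (T' : Set Pt)) = 0 := by
  rw [K.inter T hT T' hT', ← Finset.coe_inter]
  have hlt : (T ∩ T').card < 3 := by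
    rw [← K.card_eq_three T hT]
    refine Finset.card_lt_card (Finset.inter_subset_left.ssubset_of_ne fun h => hne ?_)
    rw [Finset.inter_eq_left] at h
    exact Finset.eq_of_subset_of_card_le h (by rw [K.card_eq_three T hT, K.card_eq_three T' hT'])
  obtain ⟨S, hS, -, hcard⟩ := Finset.exists_subsuperset_card_eq (s := T ∩ T') (t := T) (n := 2)
    Finset.inter_subset_left (by omega) (by rw [K.card_eq_three T hT]; norm_num)
  obtain ⟨a, b, -, rfl⟩ := Finset.card_eq_two.1 hcard
  refine measure_mono_null (convexHull_mono (t := ({a, b} : Set Pt)) ?_) ?_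
  · intro x hx
    have := hS (by exact_mod_cast hx)
    simpa using this
  · rw [convexHull_pair]; exact volume_segment a b

/-- The integral over the square is the sum of the integrals over the triangles. -/
lemma setIntegral_eq_sum_tri {F : Pt → ℝ} (hF : IntegrableOn F Ω) :
    ∫ x in Ω, F x = ∑ T ∈ K.tri, ∫ x in convexHull ℝ (T : Set Pt), F x := by
  have hF' : IntegrableOn F (closure Ω) := by
    unfold IntegrableOn; rw [restrict_closure_Ω]; exact hF
  have h1 : ∫ x in Ω, F x = ∫ x in closure Ω, F x := by rw [restrict_closure_Ω]
  have hc : closure Ω = ⋃ T : K.tri, convexHull ℝ ((T : Finset Pt) : Set Pt) := by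
    rw [← K.cover, iUnion_subtype]
  rw [h1, hc, integral_iUnion_ae (fun T => (isClosed_tri _).measurableSet.nullMeasurableSet)
    (fun T T' hne => volume_inter_tri T.2 T'.2 fun h => hne (Subtype.ext h)) (by rw [← hc]; exact hF'),
    tsum_fintype]
  exact Finset.sum_coe_sort K.tri fun T => ∫ x in convexHull ℝ (T : Set Pt), F x

end Mesh

/-! ### Integration by parts on a triangle -/

lemma integrable_inner_of_memLp {p q : Pt → Pt} (hp : MemLp p 2 (volume.restrict Ω))
    (hq : MemLp q 2 (volume.restrict Ω)) : IntegrableOn (fun x => inner ℝ (p x) (q x)) Ω := by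
  refine (L2.integrable_inner (𝕜 := ℝ) (hp.toLp p) (hq.toLp q)).congr ?_
  filter_upwards [hp.coeFn_toLp, hq.coeFn_toLp] with x hx hx'
  rw [hx, hx']

/-- The mean value of `w` over the segment `zz'`. -/
noncomputable def edgeAvg (w : Pt → ℝ) (z z' : Pt) : ℝ := ∫ t in (0 : ℝ)..1, w (AffineMap.lineMap z z' t)

lemma edgeAvg_symm (w : Pt → ℝ) (z z' : Pt) : edgeAvg w z z' = edgeAvg w z' z := by
  unfold edgeAvg
  have := intervalIntegral.integral_comp_sub_left (a := 0) (b := 1)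
    (fun t => w (AffineMap.lineMap z' z t)) (1 : ℝ)
  simp only [sub_zero, sub_self, AffineMap.lineMap_apply_one_sub] at this
  exact this

@[fun_prop] lemma continuous_duffy (P A B : Pt) : Continuous fun x : ℝ × ℝ => duffy P A B x.1 x.2 := by
  unfold duffy; fun_prop

lemma duffy_zero (P A B : Pt) (t : ℝ) : duffy P A B t 0 = AffineMap.lineMap P A t := by
  unfold duffy; simp [AffineMap.lineMap_apply]; abel_nf

lemma duffy_one (P A B : Pt) (t : ℝ) : duffy P A B t 1 = AffineMap.lineMap P B t := by
  unfold duffy; simp [AffineMap.lineMap_apply]; abel_nf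

lemma hasDerivAt_comp_duffy {w : Pt → ℝ} (hw : ContDiff ℝ 1 w) (P A B : Pt) (t r : ℝ) :
    HasDerivAt (fun r => w (duffy P A B t r)) (t * fderiv ℝ w (duffy P A B t r) (B - A)) r := by
  have h1 : HasDerivAt (fun r => duffy P A B t r) (t • (B - A)) r := by
    have h2 : (fun r => duffy P A B t r) = fun r => (P + t • (A - P)) + r • (t • (B - A)) := by
      ext1 r; unfold duffy; module
    rw [h2]
    simpa using ((hasDerivAt_id r).smul_const (t • (B - A))).const_add (P + t • (A - P))
  have h3 := ((hw.differentiable (by simp)) _).hasFDerivAt.comp_hasDerivAt r h1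
  rw [map_smul, smul_eq_mul] at h3
  exact h3

lemma continuous_fderiv_duffy {w : Pt → ℝ} (hw : ContDiff ℝ 1 w) (P A B : Pt) (t : ℝ) (v : Pt) :
    Continuous fun r => t * fderiv ℝ w (duffy P A B t r) v := by
  have hF : Continuous fun x => fderiv ℝ w x v := (hw.continuous_fderiv (by simp)).clm_apply continuous_const
  exact continuous_const.mul (hF.comp ((continuous_duffy P A B).comp (by fun_prop : Continuous fun r : ℝ => (t, r))))

/-- Integration of `∇w` along the lines parallel to the side `A B` of the triangle `P A B`. -/
lemma integral_fderiv_duffy {w : Pt → ℝ} (hw : ContDiff ℝ 1 w) (P A B : Pt) (t : ℝ) :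
    ∫ r in (0 : ℝ)..1, t * fderiv ℝ w (duffy P A B t r) (B - A) =
      w (AffineMap.lineMap P B t) - w (AffineMap.lineMap P A t) := by
  rw [intervalIntegral.integral_eq_sub_of_hasDerivAt (fun r _ => hasDerivAt_comp_duffy hw P A B t r)
    ((continuous_fderiv_duffy hw P A B t _).intervalIntegrable _ _), duffy_one, duffy_zero]

/-- The derivative of `w` along one side of a triangle has a total integral given by the mean
values of `w` over the two other sides. -/
lemma setIntegral_fderiv_side {w : Pt → ℝ} (hw : ContDiff ℝ 1 w) (a b c : Pt) :
    ∫ x in convexHull ℝ ({a, b, c} : Set Pt), fderiv ℝ w x (b - a) =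
      |cross (b - a) (c - a)| * (edgeAvg w b c - edgeAvg w a c) := by
  have hset : ({a, b, c} : Set Pt) = {c, a, b} := by ext; simp; tauto
  have hcr : cross (a - c) (b - c) = cross (b - a) (c - a) := by simp [cross]; ring
  have hF : Continuous fun x => fderiv ℝ w x (b - a) :=
    (hw.continuous_fderiv (by simp)).clm_apply continuous_const
  rw [hset, setIntegral_triangle hF, hcr]
  congr 1
  simp only [integral_fderiv_duffy hw]
  have hc : ∀ p : Pt, Continuous fun t : ℝ => w (AffineMap.lineMap c p t) := fun p =>
    hw.continuous.comp AffineMap.lineMap_continuous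
  rw [intervalIntegral.integral_sub ((hc b).intervalIntegrable _ _) ((hc a).intervalIntegrable _ _),
    edgeAvg_symm w b c, edgeAvg_symm w a c]
  rfl

/-- The outer normal of the triangle `z z' w` in terms of cross products. -/
lemma dist_mul_inner_outNormal {z z' w : Pt} (h : cross (z' - z) (w - z) ≠ 0) (v : Pt) :
    dist z z' * inner ℝ v (Mesh.outNormal z z' w) =
      - SignType.sign (cross (z' - z) (w - z)) * cross (z' - z) v := by
  set e := z' - z with he
  set d := w - z with hd
  have hdist : dist z z' = ‖e‖ := by rw [dist_comm, dist_eq_norm]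
  have he0 : e ≠ 0 := by rintro h0; rw [h0] at h; exact h (by simp [cross])
  have hen : 0 < ‖e‖ := norm_pos_iff.2 he0
  set m : Pt := (inner ℝ e d / ‖e‖ ^ 2) • e - d with hm
  have hE : ‖e‖ ^ 2 = e 0 ^ 2 + e 1 ^ 2 := norm_sq_pt e
  have hEne : e 0 ^ 2 + e 1 ^ 2 ≠ 0 := by rw [← hE]; positivity
  have hm0 : m 0 = cross e d * e 1 / ‖e‖ ^ 2 := by
    simp only [hm, inner_pt, hE, PiLp.sub_apply, PiLp.smul_apply, smul_eq_mul, cross]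
    field_simp
    ring
  have hm1 : m 1 = - cross e d * e 0 / ‖e‖ ^ 2 := by
    simp only [hm, inner_pt, hE, PiLp.sub_apply, PiLp.smul_apply, smul_eq_mul, cross]
    field_simp
    ring
  have hmn : ‖m‖ = |cross e d| / ‖e‖ := by
    rw [← sq_eq_sq₀ (norm_nonneg _) (by positivity), norm_sq_pt, hm0, hm1, div_pow, div_pow, div_pow,
      sq_abs, ← add_div, div_eq_div_iff (by positivity) (by positivity), hE]
    ring
  have hout : Mesh.outNormal z z' w = ‖m‖⁻¹ • m := rfl
  have hsign : (SignType.sign (cross e d) : ℝ) * |cross e d| = cross e d := sign_mul_abs _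
  have habs : |cross e d| ≠ 0 := abs_ne_zero.2 h
  have hsign' : (SignType.sign (cross e d) : ℝ) = cross e d / |cross e d| := by
    rw [eq_div_iff habs, hsign]
  rw [hout, hdist, inner_smul_right, hmn, inner_pt, hm0, hm1, hsign']
  have hne : ‖e‖ ≠ 0 := hen.ne'
  have : cross e v = e 0 * v 1 - e 1 * v 0 := rfl
  rw [this]
  field_simp
  ring

lemma cross_swap (z z' w : Pt) : cross (z - z') (w - z') = - cross (z' - z) (w - z) := by
  simp [cross]; ring

/-- The divergence theorem on a triangle for the field `w v` with a constant vector `v`. -/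
lemma setIntegral_fderiv_triangle {w : Pt → ℝ} (hw : ContDiff ℝ 1 w) {a b c : Pt}
    (h : cross (b - a) (c - a) ≠ 0) (v : Pt) :
    ∫ x in convexHull ℝ ({a, b, c} : Set Pt), fderiv ℝ w x v =
      dist a b * inner ℝ v (Mesh.outNormal a b c) * edgeAvg w a b +
      dist b c * inner ℝ v (Mesh.outNormal b c a) * edgeAvg w b c +
      dist a c * inner ℝ v (Mesh.outNormal a c b) * edgeAvg w a c := by
  set cr := cross (b - a) (c - a) with hcr
  have h1 : cross (c - b) (a - b) = cr := by simp [cross, hcr]; ring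
  have h2 : cross (c - a) (b - a) = -cr := by simp [cross, hcr]; ring
  have hi : ∀ e : Pt, IntegrableOn (fun x => fderiv ℝ w x e) (convexHull ℝ ({a, b, c} : Set Pt)) := fun e =>
    (((hw.continuous_fderiv (by simp)).clm_apply continuous_const).continuousOn).integrableOn_compact
      (isCompact_convexHull_triple a b c)
  obtain ⟨α, β, hv⟩ : ∃ α β : ℝ, v = α • (b - a) + β • (c - a) := by
    refine ⟨cross v (c - a) / cr, cross (b - a) v / cr, ?_⟩
    apply pt_ext
    · change v 0 = cross v (c - a) / cr * (b - a) 0 + cross (b - a) v / cr * (c - a) 0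
      rw [div_mul_eq_mul_div, div_mul_eq_mul_div, ← add_div, eq_div_iff h, hcr]
      simp [cross]; ring
    · change v 1 = cross v (c - a) / cr * (b - a) 1 + cross (b - a) v / cr * (c - a) 1
      rw [div_mul_eq_mul_div, div_mul_eq_mul_div, ← add_div, eq_div_iff h, hcr]
      simp [cross]; ring
  have hs1 := setIntegral_fderiv_side hw a b c
  have hs2 := setIntegral_fderiv_side hw a c b
  have hset : ({a, c, b} : Set Pt) = {a, b, c} := by ext; simp; tauto
  rw [hset, h2, abs_neg] at hs2
  rw [← hcr] at hs1
  have hsum : ∫ x in convexHull ℝ ({a, b, c} : Set Pt), fderiv ℝ w x v =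
      α * (∫ x in convexHull ℝ ({a, b, c} : Set Pt), fderiv ℝ w x (b - a)) +
      β * ∫ x in convexHull ℝ ({a, b, c} : Set Pt), fderiv ℝ w x (c - a) := by
    rw [← integral_const_mul, ← integral_const_mul, ← integral_add ((hi _).const_mul _) ((hi _).const_mul _)]
    simp only [hv, map_add, map_smul, smul_eq_mul]
  rw [hsum, hs1, hs2, dist_mul_inner_outNormal h, dist_mul_inner_outNormal (by rw [h1]; exact h),
    dist_mul_inner_outNormal (by rw [h2]; exact neg_ne_zero.2 h), h1, h2, ← hcr, Left.sign_neg,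
    edgeAvg_symm w c b]
  have hab : |cr| = SignType.sign cr * cr := (sign_mul_self cr).symm
  have hc1 : cross (b - a) v = β * cr := by rw [hv, hcr]; simp [cross]; ring
  have hc2 : cross (c - b) v = -(α + β) * cr := by rw [hv, hcr]; simp [cross]; ring
  have hc3 : cross (c - a) v = - α * cr := by rw [hv, hcr]; simp [cross]; ring
  rw [hc1, hc2, hc3, hab]
  push_cast
  ring

lemma edgeIntegral_eq (z z' : Pt) (F : Pt → ℝ) : Mesh.edgeIntegral z z' F = dist z z' * edgeAvg F z z' := rfl

namespace Mesh

variable {K : Mesh}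

lemma cross_ne_zero {a b c : Pt} (hT : ({a, b, c} : Finset Pt) ∈ K.tri) : cross (b - a) (c - a) ≠ 0 := by
  intro h
  have h1 := volume_convexHull_of_cross_eq_zero h
  have h2 : (interior (convexHull ℝ (({a, b, c} : Finset Pt) : Set Pt))).Nonempty :=
    ⟨_, centroid_mem_interior hT⟩
  rw [Finset.coe_insert, Finset.coe_insert, Finset.coe_singleton] at h2
  have := isOpen_interior.measure_pos volume h2
  exact (this.trans_le (measure_mono interior_subset)).ne' h1

lemma distinct_of_mem_tri {a b c : Pt} (hT : ({a, b, c} : Finset Pt) ∈ K.tri) : a ≠ b ∧ a ≠ c ∧ b ≠ c := by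
  have h := cross_ne_zero hT
  refine ⟨?_, ?_, ?_⟩ <;> rintro rfl <;> apply h <;> simp [cross, mul_comm]

/-- The outer normal of an edge does not depend on the orientation of the edge. -/
lemma inner_outNormal_symm {z z' w : Pt} (h : ({z, z', w} : Finset Pt) ∈ K.tri) (v : Pt) :
    inner ℝ v (outNormal z' z w) = inner ℝ v (outNormal z z' w) := by
  have hc := cross_ne_zero h
  have hd : dist z z' ≠ 0 := dist_ne_zero.2 (distinct_of_mem_tri h).1
  have h1 := dist_mul_inner_outNormal hc v
  have h2 := dist_mul_inner_outNormal (z := z') (z' := z) (w := w)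
    (by rw [cross_swap]; exact neg_ne_zero.2 hc) v
  rw [cross_swap, Left.sign_neg] at h2
  have h3 : cross (z - z') v = - cross (z' - z) v := by simp [cross]; ring
  rw [h3, dist_comm z' z] at h2
  apply mul_left_cancel₀ hd
  rw [h1, h2]; push_cast; ring

lemma coe_triple (a b c : Pt) : (({a, b, c} : Finset Pt) : Set Pt) = {a, b, c} := by simp

lemma lineMap_mem_tri {T : Finset Pt} {z z' : Pt} (hz : z ∈ T) (hz' : z' ∈ T) {t : ℝ}
    (ht : t ∈ Icc (0 : ℝ) 1) : AffineMap.lineMap z z' t ∈ convexHull ℝ (T : Set Pt) :=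
  (convex_convexHull ℝ _).lineMap_mem (subset_convexHull ℝ _ hz) (subset_convexHull ℝ _ hz') ht

/-- On an edge at `z` the hat function `φ_z` decays linearly from `1` to `0`. -/
lemma hat_lineMap {T : Finset Pt} (hT : T ∈ K.tri) {z z' : Pt} (hz : z ∈ T) (hz' : z' ∈ T) (hne : z ≠ z')
    {t : ℝ} (ht : t ∈ Icc (0 : ℝ) 1) : K.hat z (AffineMap.lineMap z z' t) = 1 - t := by
  rw [hat_eq hT (lineMap_mem_tri hz hz' ht), AffineMap.apply_lineMap, lam_apply hT hz, lam_apply hT hz',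
    if_neg hne, if_pos rfl, AffineMap.lineMap_apply]
  simp; ring

lemma hat_lineMap' {T : Finset Pt} (hT : T ∈ K.tri) {z z' : Pt} (hz : z ∈ T) (hz' : z' ∈ T) (hne : z ≠ z')
    {t : ℝ} (ht : t ∈ Icc (0 : ℝ) 1) : K.hat z' (AffineMap.lineMap z z' t) = t := by
  have := hat_lineMap hT hz' hz hne.symm (t := 1 - t) ⟨by linarith [ht.2], by linarith [ht.1]⟩
  rw [AffineMap.lineMap_apply_one_sub] at this
  rw [this]; ring

/-- The hat functions of the two endpoints split an edge integral. -/
lemma edgeIntegral_split {w : Pt → ℝ} (hw : Continuous w) {T : Finset Pt} (hT : T ∈ K.tri) {z z' : Pt}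
    (hz : z ∈ T) (hz' : z' ∈ T) (hne : z ≠ z') :
    edgeIntegral z z' (fun x => w x * K.hat z x) + edgeIntegral z' z (fun x => w x * K.hat z' x) =
      dist z z' * edgeAvg w z z' := by
  rw [edgeIntegral_eq, edgeIntegral_eq, edgeAvg_symm _ z' z, dist_comm z' z, ← mul_add]
  congr 1
  have hc : Continuous fun t : ℝ => w (AffineMap.lineMap z z' t) := hw.comp AffineMap.lineMap_continuous
  have h1 : edgeAvg (fun x => w x * K.hat z x) z z' =
      ∫ t in (0 : ℝ)..1, w (AffineMap.lineMap z z' t) * (1 - t) :=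
    intervalIntegral.integral_congr fun t ht => by
      rw [uIcc_of_le zero_le_one] at ht
      simp only [hat_lineMap hT hz hz' hne ht]
  have h2 : edgeAvg (fun x => w x * K.hat z' x) z z' =
      ∫ t in (0 : ℝ)..1, w (AffineMap.lineMap z z' t) * t :=
    intervalIntegral.integral_congr fun t ht => by
      rw [uIcc_of_le zero_le_one] at ht
      simp only [hat_lineMap' hT hz hz' hne ht]
  rw [h1, h2, ← intervalIntegral.integral_add
    (Continuous.intervalIntegrable (by fun_prop) _ _) (Continuous.intervalIntegrable (by fun_prop) _ _)]
  exact intervalIntegral.integral_congr fun t _ => by ring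

lemma triple_eq_iff {a b c : Pt} (hab : a ≠ b) (hac : a ≠ c) (hbc : b ≠ c) (z z' w : Pt) :
    ({z, z', w} : Finset Pt) = {a, b, c} ↔
      (z, z', w) ∈ ({(a, b, c), (a, c, b), (b, a, c), (b, c, a), (c, a, b), (c, b, a)} :
        Finset (Pt × Pt × Pt)) := by
  simp only [Finset.mem_insert, Finset.mem_singleton, Prod.mk.injEq]
  constructor
  · intro h
    have hz : z ∈ ({a, b, c} : Finset Pt) := h ▸ by simp
    have hz' : z' ∈ ({a, b, c} : Finset Pt) := h ▸ by simp
    have hw : w ∈ ({a, b, c} : Finset Pt) := h ▸ by simp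
    have ha : a ∈ ({z, z', w} : Finset Pt) := h ▸ by simp
    have hb : b ∈ ({z, z', w} : Finset Pt) := h ▸ by simp
    have hc : c ∈ ({z, z', w} : Finset Pt) := h ▸ by simp
    simp only [Finset.mem_insert, Finset.mem_singleton] at hz hz' hw ha hb hc
    grind
  · rintro (⟨rfl, rfl, rfl⟩ | ⟨rfl, rfl, rfl⟩ | ⟨rfl, rfl, rfl⟩ | ⟨rfl, rfl, rfl⟩ | ⟨rfl, rfl, rfl⟩ |
      ⟨rfl, rfl, rfl⟩) <;> ext x <;> simp <;> tauto

/-- A sum over nodes, edges at a node and triangles sharing an edge is a sum over triangles and the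
six orderings of their vertices. -/
lemma sum_edges_eq_sum_tri (f : Pt → Pt → Pt → ℝ) (g : Finset Pt → ℝ)
    (hg : ∀ a b c, ({a, b, c} : Finset Pt) ∈ K.tri →
      f a b c + f a c b + f b a c + f b c a + f c a b + f c b a = g {a, b, c}) :
    ∑ z ∈ K.nodes, ∑ z' ∈ K.edgesAt z, ∑ w ∈ K.nodes.filter (fun w => ({z, z', w} : Finset Pt) ∈ K.tri),
      f z z' w = ∑ T ∈ K.tri, g T := by
  have h1 : ∀ z ∈ K.nodes, ∑ z' ∈ K.edgesAt z,
      ∑ w ∈ K.nodes.filter (fun w => ({z, z', w} : Finset Pt) ∈ K.tri), f z z' w =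
      ∑ z' ∈ K.nodes, ∑ w ∈ K.nodes, if ({z, z', w} : Finset Pt) ∈ K.tri then f z z' w else 0 := by
    intro z _
    simp only [Finset.sum_filter]
    refine Finset.sum_subset (Finset.filter_subset _ _) fun z' hz' hz'e => ?_
    refine Finset.sum_eq_zero fun w _ => if_neg fun hT => hz'e ?_
    exact Finset.mem_filter.2 ⟨hz', (distinct_of_mem_tri hT).1.symm, _, hT, by simp, by simp⟩
  rw [Finset.sum_congr rfl h1]
  have h2 : ∀ z z' w, (if ({z, z', w} : Finset Pt) ∈ K.tri then f z z' w else 0) =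
      ∑ T ∈ K.tri, if ({z, z', w} : Finset Pt) = T then f z z' w else 0 := fun z z' w => by
    rw [Finset.sum_ite_eq]
  simp only [h2]
  have h3 : ∑ z ∈ K.nodes, ∑ z' ∈ K.nodes, ∑ w ∈ K.nodes, ∑ T ∈ K.tri,
      (if ({z, z', w} : Finset Pt) = T then f z z' w else 0) =
      ∑ T ∈ K.tri, ∑ p ∈ K.nodes ×ˢ K.nodes ×ˢ K.nodes,
        if ({p.1, p.2.1, p.2.2} : Finset Pt) = T then f p.1 p.2.1 p.2.2 else 0 := by
    rw [Finset.sum_comm]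
    simp only [Finset.sum_product]
    rw [Finset.sum_comm]
    rw [Finset.sum_comm (s := K.tri)]
    refine Finset.sum_congr rfl fun z _ => ?_
    rw [Finset.sum_comm (s := K.tri)]
    refine Finset.sum_congr rfl fun z' _ => ?_
    rw [Finset.sum_comm (s := K.tri)]
  rw [h3]
  refine Finset.sum_congr rfl fun T hT => ?_
  obtain ⟨a, b, c, hab, hac, hbc, rfl⟩ := exists_triple hT
  rw [← hg a b c hT, ← Finset.sum_filter]
  have ha := subset_nodes hT (show a ∈ _ by simp)
  have hb := subset_nodes hT (show b ∈ _ by simp)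
  have hc := subset_nodes hT (show c ∈ _ by simp)
  have h4 : (K.nodes ×ˢ K.nodes ×ˢ K.nodes).filter
      (fun p => ({p.1, p.2.1, p.2.2} : Finset Pt) = {a, b, c}) =
      {(a, b, c), (a, c, b), (b, a, c), (b, c, a), (c, a, b), (c, b, a)} := by
    ext ⟨z, z', w⟩
    rw [Finset.mem_filter, triple_eq_iff hab hac hbc]
    refine ⟨fun h => h.2, fun h => ⟨?_, h⟩⟩
    simp only [Finset.mem_insert, Finset.mem_singleton, Prod.mk.injEq] at h
    simp only [Finset.mem_product]
    rcases h with (⟨rfl, rfl, rfl⟩ | ⟨rfl, rfl, rfl⟩ | ⟨rfl, rfl, rfl⟩ | ⟨rfl, rfl, rfl⟩ | ⟨rfl, rfl, rfl⟩ |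
      ⟨rfl, rfl, rfl⟩) <;> exact ⟨by assumption, by assumption, by assumption⟩
  rw [h4, Finset.sum_insert, Finset.sum_insert, Finset.sum_insert, Finset.sum_insert, Finset.sum_insert,
    Finset.sum_singleton]
  · ring
  all_goals
    simp only [Finset.mem_insert, Finset.mem_singleton, Prod.mk.injEq]
    grind

lemma edgeIntegral_mul_const (z z' : Pt) (F : Pt → ℝ) (c : ℝ) :
    edgeIntegral z z' (fun x => F x * c) = edgeIntegral z z' F * c := by
  simp [edgeIntegral, mul_assoc]

/-- Elementwise integration by parts: the Dirichlet form of a finite element function and a test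
function is a sum of edge integrals of normal derivative jumps, distributed to the nodes by the hat
functions. -/
lemma dirichlet_eq_sum_edges {uh : Pt → ℝ} (hu : K.MemSh uh) {w : Pt → ℝ} (hw : ContDiff ℝ 1 w) :
    ∫ x in Ω, inner ℝ (gradient w x) (weakGrad uh x) =
      ∑ z ∈ K.nodes, ∑ z' ∈ K.edgesAt z, edgeIntegral z z' (fun x => w x * K.hat z x * K.jump uh z z') := by
  have hgw : MemLp (gradient w) 2 (volume.restrict Ω) := by
    have hc : Continuous (gradient w) :=
      (InnerProductSpace.toDual ℝ Pt).symm.continuous.comp (hw.continuous_fderiv (by simp))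
    obtain ⟨C, hC⟩ := isCompact_closure_Ω.exists_bound_of_continuousOn hc.continuousOn
    refine MemLp.of_bound hc.aestronglyMeasurable C ?_
    filter_upwards [ae_restrict_mem measurableSet_Ω] with x hx using hC x (subset_closure hx)
  have hint : IntegrableOn (fun x => inner ℝ (gradient w x) (weakGrad uh x)) Ω :=
    integrable_inner_of_memLp hgw hu.memH10C.2.2.hasWeakGrad.1
  rw [setIntegral_eq_sum_tri hint]
  have hT : ∀ T ∈ K.tri, ∫ x in convexHull ℝ (T : Set Pt), inner ℝ (gradient w x) (weakGrad uh x) =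
      ∫ x in convexHull ℝ (T : Set Pt), fderiv ℝ w x (elemGrad uh T) := fun T hT => by
    refine integral_congr_ae ?_
    filter_upwards [hu.weakGrad_ae hT] with x hx
    rw [hx, inner_gradient]
  rw [Finset.sum_congr rfl hT, ← sum_edges_eq_sum_tri
    (fun z z' v => edgeIntegral z z' (fun x => w x * K.hat z x) *
      inner ℝ (elemGrad uh {z, z', v}) (outNormal z z' v))]
  · refine Finset.sum_congr rfl fun z _ => Finset.sum_congr rfl fun z' _ => ?_
    rw [edgeIntegral_mul_const, ← Finset.mul_sum]
    rfl
  intro a b c hT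
  have hp := cross_ne_zero hT
  rw [coe_triple, setIntegral_fderiv_triangle hw hp]
  obtain ⟨hab, hac, hbc⟩ := distinct_of_mem_tri hT
  set G := elemGrad uh {a, b, c} with hG
  have e1 : ({a, c, b} : Finset Pt) = {a, b, c} := by ext; simp; tauto
  have e2 : ({b, a, c} : Finset Pt) = {a, b, c} := by ext; simp; tauto
  have e3 : ({b, c, a} : Finset Pt) = {a, b, c} := by ext; simp; tauto
  have e4 : ({c, a, b} : Finset Pt) = {a, b, c} := by ext; simp; tauto
  have e5 : ({c, b, a} : Finset Pt) = {a, b, c} := by ext; simp; tauto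
  have ha : a ∈ ({a, b, c} : Finset Pt) := by simp
  have hb : b ∈ ({a, b, c} : Finset Pt) := by simp
  have hc : c ∈ ({a, b, c} : Finset Pt) := by simp
  have s1 := edgeIntegral_split hw.continuous hT ha hb hab
  have s2 := edgeIntegral_split hw.continuous hT hb hc hbc
  have s3 := edgeIntegral_split hw.continuous hT ha hc hac
  rw [e1, e2, e3, e4, e5, ← hG, inner_outNormal_symm hT,
    inner_outNormal_symm (z := a) (z' := c) (w := b) (by rw [e1]; exact hT),
    inner_outNormal_symm (z := b) (z' := c) (w := a) (by rw [e3]; exact hT)]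
  linear_combination inner ℝ G (outNormal a b c) * s1 + inner ℝ G (outNormal b c a) * s2 +
    inner ℝ G (outNormal a c b) * s3

lemma gammaAt_subset (z : Pt) : K.gammaAt z ⊆ K.edgesAt z := Finset.filter_subset _ _

lemma mem_edgesAt {z z' : Pt} : z' ∈ K.edgesAt z ↔ z' ≠ z ∧ ∃ T ∈ K.tri, z ∈ T ∧ z' ∈ T := by
  simp only [edgesAt, Finset.mem_filter, and_iff_right_iff_imp]
  rintro ⟨_, T, hT, _, h⟩
  exact mem_nodes.2 ⟨T, hT, h⟩

lemma sum_edgesAt_eq {z : Pt} {F : Pt → Pt → ℝ} (hF : ∀ x ∈ frontier Ω, ∀ z', F z' x = 0) :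
    ∑ z' ∈ K.edgesAt z, edgeIntegral z z' (F z') = ∑ z' ∈ K.gammaAt z, edgeIntegral z z' (F z') := by
  refine (Finset.sum_subset (gammaAt_subset z) fun z' hz' hz'g => ?_).symm
  have hseg : segment ℝ z z' ⊆ frontier Ω := by
    by_contra h
    exact hz'g (Finset.mem_filter.2 ⟨hz', h⟩)
  rw [edgeIntegral, intervalIntegral.integral_congr (g := fun _ => (0 : ℝ))]
  · simp
  · intro t ht
    rw [uIcc_of_le zero_le_one] at ht
    refine hF _ (hseg ?_) z'
    rw [segment_eq_image_lineMap]
    exact mem_image_of_mem _ ht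

lemma tendsto_edgeIntegral {w : ℕ → Pt → ℝ} {v : Pt → ℝ} (hw : ∀ n, ContinuousOn (w n) (closure Ω))
    (hv : ContinuousOn v (closure Ω)) (hu : TendstoUniformlyOn w v atTop (closure Ω)) {β : ℕ → ℝ} {γ : ℝ}
    (hβ : Tendsto β atTop (𝓝 γ)) {c : Pt → ℝ} (hc : ContinuousOn c (closure Ω)) {z z' : Pt}
    (hz : z ∈ closure Ω) (hz' : z' ∈ closure Ω) :
    Tendsto (fun n => edgeIntegral z z' fun x => (w n x - β n) * c x) atTop
      (𝓝 (edgeIntegral z z' fun x => (v x - γ) * c x)) := by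
  have hmem : ∀ t ∈ uIcc (0 : ℝ) 1, AffineMap.lineMap z z' t ∈ closure Ω := fun t ht => by
    rw [uIcc_of_le zero_le_one] at ht
    exact convex_Ω.closure.lineMap_mem hz hz' ht
  have hl : Continuous fun t : ℝ => (AffineMap.lineMap z z' t : Pt) := AffineMap.lineMap_continuous
  unfold edgeIntegral
  refine Tendsto.const_mul _ ?_
  have hcomp : ∀ {f : Pt → ℝ}, ContinuousOn f (closure Ω) →
      ContinuousOn (fun t : ℝ => f (AffineMap.lineMap z z' t)) (uIcc 0 1) := fun hf =>
    hf.comp hl.continuousOn hmem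
  obtain ⟨C, hC⟩ := isCompact_closure_Ω.exists_bound_of_continuousOn hv
  obtain ⟨D, hD⟩ := isCompact_closure_Ω.exists_bound_of_continuousOn hc
  refine intervalIntegral.tendsto_integral_filter_of_dominated_convergence (fun _ => (C + 1 + (|γ| + 1)) * D)
    (Eventually.of_forall fun n => ?_) ?_ intervalIntegrable_const (ae_of_all _ fun t ht => ?_)
  · refine ContinuousOn.aestronglyMeasurable ?_ measurableSet_uIoc
    exact (((hcomp (hw n)).sub continuousOn_const).mul (hcomp hc)).mono uIoc_subset_uIcc
  · filter_upwards [Metric.tendstoUniformlyOn_iff.1 hu 1 one_pos, Metric.tendsto_nhds.1 hβ 1 one_pos] with n hn hn'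
    refine ae_of_all _ fun t ht => ?_
    have hx := hmem t (uIoc_subset_uIcc ht)
    have h1 := hn _ hx
    have h2 := hC _ hx
    rw [dist_comm, Real.dist_eq] at h1
    rw [Real.dist_eq] at hn'
    rw [Real.norm_eq_abs] at h2
    rw [norm_mul, Real.norm_eq_abs]
    have h0 := (abs_nonneg _).trans h2
    refine mul_le_mul ?_ (hD _ hx) (norm_nonneg _) (by positivity)
    have h3 := abs_sub_abs_le_abs_sub (w n (AffineMap.lineMap z z' t)) (v (AffineMap.lineMap z z' t))
    have h4 := abs_sub_abs_le_abs_sub (β n) γ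
    have h5 := abs_sub (w n (AffineMap.lineMap z z' t)) (β n)
    linarith
  · exact ((hu.tendsto_at (hmem t (uIoc_subset_uIcc ht))).sub hβ).mul tendsto_const_nhds

/-- The edge representation of the Dirichlet form for functions of class `H¹₀(Ω) ∩ C(Ω̄)`. -/
lemma dirichlet_eq_sum_gamma {uh : Pt → ℝ} (hu : K.MemSh uh) {v : Pt → ℝ} (hv : MemH10C v) :
    ∫ x in Ω, inner ℝ (weakGrad uh x) (weakGrad v x) =
      ∑ z ∈ K.nodes, ∑ z' ∈ K.gammaAt z, edgeIntegral z z' (fun x => v x * K.hat z x * K.jump uh z z') := by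
  obtain ⟨w, hw, hunif, -, hweak⟩ := hv.exists_seq
  have h1 := hweak _ hu.memH10C.2.2.hasWeakGrad.1
  simp only [real_inner_comm (weakGrad uh _)] at h1
  refine tendsto_nhds_unique h1 ?_
  have h2 : ∀ n, ∫ x in Ω, inner ℝ (weakGrad uh x) (gradient (w n) x) =
      ∑ z ∈ K.nodes, ∑ z' ∈ K.gammaAt z,
        edgeIntegral z z' (fun x => (w n x - 0) * (K.hat z x * K.jump uh z z')) := fun n => by
    simp only [← real_inner_comm (weakGrad uh _)]
    rw [dirichlet_eq_sum_edges hu (hw n).contDiff]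
    refine Finset.sum_congr rfl fun z _ => ?_
    rw [sum_edgesAt_eq (F := fun z' x => w n x * K.hat z x * K.jump uh z z')]
    · simp only [sub_zero, mul_assoc]
    · intro x hx z'
      rw [(hw n).eq_zero fun h => notMem_frontier h hx]; ring
  simp only [h2]
  have h3 : ∀ z z', (fun x => v x * K.hat z x * K.jump uh z z') =
      fun x => (v x - 0) * (K.hat z x * K.jump uh z z') := fun z z' => by
    ext x; ring
  simp only [h3]
  refine tendsto_finsetSum _ fun z hz => tendsto_finsetSum _ fun z' hz' => ?_
  refine tendsto_edgeIntegral (fun n => (hw n).continuous.continuousOn) hv.1 hunif tendsto_const_nhds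
    ((continuousOn_hat z).mul continuousOn_const) (nodes_subset hz) (nodes_subset (K := K) ?_)
  obtain ⟨-, T, hT, -, h⟩ := mem_edgesAt.1 (gammaAt_subset z hz')
  exact mem_nodes.2 ⟨T, hT, h⟩

end Mesh

/-! ### The error representation and the energy norm bound -/

namespace Mesh

variable {K : Mesh}

lemma jump_symm (v : Pt → ℝ) (z z' : Pt) : K.jump v z z' = K.jump v z' z := by
  unfold jump
  have hs : ∀ w : Pt, ({z', z, w} : Finset Pt) = {z, z', w} := fun w => by ext; simp; tauto
  simp only [hs]
  refine Finset.sum_congr rfl fun w hw => ?_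
  rw [inner_outNormal_symm (Finset.mem_filter.1 hw).2]

lemma mem_gammaAt {z z' : Pt} : z' ∈ K.gammaAt z ↔ z' ∈ K.edgesAt z ∧ ¬ segment ℝ z z' ⊆ frontier Ω := by
  simp [gammaAt]

lemma edgesAt_symm {z z' : Pt} (h : z' ∈ K.edgesAt z) : z ∈ K.edgesAt z' := by
  obtain ⟨h1, T, hT, h2, h3⟩ := mem_edgesAt.1 h
  exact mem_edgesAt.2 ⟨h1.symm, T, hT, h3, h2⟩

lemma gammaAt_symm {z z' : Pt} (h : z' ∈ K.gammaAt z) : z ∈ K.gammaAt z' := by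
  rw [mem_gammaAt] at h ⊢
  exact ⟨edgesAt_symm h.1, by rw [segment_symm]; exact h.2⟩

lemma mem_nodes_of_mem_gammaAt {z z' : Pt} (h : z' ∈ K.gammaAt z) : z ∈ K.nodes ∧ z' ∈ K.nodes := by
  obtain ⟨-, T, hT, h2, h3⟩ := mem_edgesAt.1 (gammaAt_subset z h)
  exact ⟨subset_nodes hT h2, subset_nodes hT h3⟩

/-- A sum over oriented interior edges of an antisymmetric quantity vanishes. -/
lemma sum_gamma_antisymm {a : Pt → Pt → ℝ} (ha : ∀ z z', z' ∈ K.gammaAt z → a z z' = - a z' z) :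
    ∑ z ∈ K.nodes, ∑ z' ∈ K.gammaAt z, a z z' = 0 := by
  have h1 : ∑ z ∈ K.nodes, ∑ z' ∈ K.gammaAt z, a z z' =
      ∑ z ∈ K.nodes, ∑ z' ∈ K.nodes, if z' ∈ K.gammaAt z then a z z' else 0 := by
    refine Finset.sum_congr rfl fun z _ => ?_
    rw [← Finset.sum_filter]
    refine Finset.sum_congr (Finset.ext fun z' => ?_) fun _ _ => rfl
    rw [Finset.mem_filter]
    exact ⟨fun h => ⟨(mem_nodes_of_mem_gammaAt h).2, h⟩, fun h => h.2⟩
  have h2 : ∑ z ∈ K.nodes, ∑ z' ∈ K.nodes, (if z' ∈ K.gammaAt z then a z z' else 0) =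
      - ∑ z ∈ K.nodes, ∑ z' ∈ K.nodes, if z' ∈ K.gammaAt z then a z z' else 0 := by
    conv_lhs => rw [Finset.sum_comm]
    simp only [← Finset.sum_neg_distrib]
    refine Finset.sum_congr rfl fun z _ => Finset.sum_congr rfl fun z' _ => ?_
    by_cases h : z' ∈ K.gammaAt z
    · rw [if_pos h, if_pos (gammaAt_symm h), ha z z' h, neg_neg]
    · rw [if_neg h, if_neg fun h' => h (gammaAt_symm h'), neg_zero]
  rw [h1]
  linarith

lemma interp_eq {T : Finset Pt} (hT : T ∈ K.tri) {x : Pt} (hx : x ∈ convexHull ℝ (T : Set Pt))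
    (v : Pt → ℝ) : K.interp v x = ∑ z ∈ K.nodes, v z * K.lam T z x := by
  simp only [interp, hat_eq hT hx]

lemma memSh_interp {v : Pt → ℝ} (hv : ∀ z ∈ K.nodes, z ∈ frontier Ω → v z = 0) : K.MemSh (K.interp v) := by
  refine ⟨continuousOn_interp v, fun x hx => Finset.sum_eq_zero fun z hz => ?_, fun T hT => ?_⟩
  · by_cases h : z ∈ Ω
    · rw [hat_eq_zero_of_mem_frontier h hx, mul_zero]
    · rw [hv z hz (mem_frontier_of_notMem (nodes_subset hz) h), zero_mul]
  · refine ⟨∑ z ∈ K.nodes, v z • K.lam T z, fun x hx => ?_⟩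
    rw [interp_eq hT hx]
    have : ∀ s : Finset Pt, (∑ z ∈ s, v z • K.lam T z : Pt →ᵃ[ℝ] ℝ) x = ∑ z ∈ s, v z * K.lam T z x := fun s => by
      induction s using Finset.induction_on with
      | empty => simp
      | insert a s ha ih => rw [Finset.sum_insert ha, Finset.sum_insert ha, ← ih]; simp
    rw [this]

lemma interp_lineMap {T : Finset Pt} (hT : T ∈ K.tri) {z z' : Pt} (hz : z ∈ T) (hz' : z' ∈ T) (hne : z ≠ z')
    (v : Pt → ℝ) {t : ℝ} (ht : t ∈ Icc (0 : ℝ) 1) :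
    K.interp v (AffineMap.lineMap z z' t) = v z * (1 - t) + v z' * t := by
  rw [interp_eq hT (lineMap_mem_tri hz hz' ht)]
  have : ∀ w ∈ K.nodes, v w * K.lam T w (AffineMap.lineMap z z' t) =
      (if w = z then v z * (1 - t) else 0) + (if w = z' then v z' * t else 0) := by
    intro w _
    rw [AffineMap.apply_lineMap, lam_apply hT hz, lam_apply hT hz', AffineMap.lineMap_apply]
    by_cases h1 : w = z
    · subst h1; simp [hne]; left; ring
    · by_cases h2 : w = z'
      · subst h2; simp [h1]
      · simp [h1, h2]
  rw [Finset.sum_congr rfl this, Finset.sum_add_distrib, Finset.sum_ite_eq', Finset.sum_ite_eq',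
    if_pos (subset_nodes hT hz), if_pos (subset_nodes hT hz')]

lemma edgeIntegral_add {F₁ F₂ : Pt → ℝ} (h1 : ContinuousOn F₁ (closure Ω)) (h2 : ContinuousOn F₂ (closure Ω))
    {z z' : Pt} (hz : z ∈ closure Ω) (hz' : z' ∈ closure Ω) :
    edgeIntegral z z' (fun x => F₁ x + F₂ x) = edgeIntegral z z' F₁ + edgeIntegral z z' F₂ := by
  have hi : ∀ {f : Pt → ℝ}, ContinuousOn f (closure Ω) →
      IntervalIntegrable (fun t : ℝ => f (AffineMap.lineMap z z' t)) volume 0 1 := fun hf => by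
    refine ContinuousOn.intervalIntegrable (hf.comp AffineMap.lineMap_continuous.continuousOn fun t ht => ?_)
    rw [uIcc_of_le zero_le_one] at ht
    exact convex_Ω.closure.lineMap_mem hz hz' ht
  unfold edgeIntegral
  rw [intervalIntegral.integral_add (hi h1) (hi h2), mul_add]

/-- The edge term `I` is the Dirichlet form of `u_h` with `g` minus its nodal interpolant `∑ ḡ_z φ_z`. -/
lemma termI_eq (ε : ℝ) {uh g gbar : Pt → ℝ} (hu : K.MemSh uh) (hg : MemH10C g)
    (hgbar : ∀ z ∈ K.nodes, z ∈ frontier Ω → gbar z = 0) :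
    K.termI ε uh g gbar = ε ^ 2 * (∫ x in Ω, inner ℝ (weakGrad uh x) (weakGrad g x)) -
      ε ^ 2 * ∫ x in Ω, inner ℝ (weakGrad uh x) (weakGrad (K.interp gbar) x) := by
  have hI := memSh_interp hgbar
  rw [dirichlet_eq_sum_gamma hu hg, dirichlet_eq_sum_gamma hu hI.memH10C, termI, ← Finset.mul_sum,
    ← mul_sub]
  congr 1
  have h0 : ∑ z ∈ K.nodes, ∑ z' ∈ K.gammaAt z,
      edgeIntegral z z' (fun x => (K.interp gbar x - gbar z) * K.hat z x * K.jump uh z z') = 0 := by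
    refine sum_gamma_antisymm fun z z' h => ?_
    obtain ⟨hne, T, hT, hz, hz'⟩ := mem_edgesAt.1 (gammaAt_subset z h)
    have hval : ∀ {p q : Pt}, p ∈ T → q ∈ T → p ≠ q →
        edgeIntegral p q (fun x => (K.interp gbar x - gbar p) * K.hat p x * K.jump uh p q) =
          dist p q * ((gbar q - gbar p) * K.jump uh p q * ∫ t in (0 : ℝ)..1, t * (1 - t)) := by
      intro p q hp hq hpq
      unfold edgeIntegral
      rw [← intervalIntegral.integral_const_mul ((gbar q - gbar p) * K.jump uh p q)]
      congr 1
      refine intervalIntegral.integral_congr fun t ht => ?_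
      rw [uIcc_of_le zero_le_one] at ht
      simp only [interp_lineMap hT hp hq hpq gbar ht, hat_lineMap hT hp hq hpq ht]
      ring
    rw [hval hz hz' hne.symm, hval hz' hz hne, jump_symm uh z' z, dist_comm z' z]
    ring
  suffices hsum : ∀ z ∈ K.nodes, ∀ z' ∈ K.gammaAt z,
      edgeIntegral z z' (fun x => (g x - gbar z) * K.hat z x * K.jump uh z z') =
        edgeIntegral z z' (fun x => g x * K.hat z x * K.jump uh z z') -
        edgeIntegral z z' (fun x => K.interp gbar x * K.hat z x * K.jump uh z z') +
        edgeIntegral z z' (fun x => (K.interp gbar x - gbar z) * K.hat z x * K.jump uh z z') by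
    rw [Finset.sum_congr rfl fun z hz => Finset.sum_congr rfl (hsum z hz)]
    simp only [Finset.sum_add_distrib, Finset.sum_sub_distrib]
    rw [h0, add_zero]
  intro z hz z' hz'
  have hzc := nodes_subset hz
  have hzc' := nodes_subset (mem_nodes_of_mem_gammaAt hz').2
  have hhat : ContinuousOn (K.hat z) (closure Ω) := continuousOn_hat z
  have e1 := edgeIntegral_add (z := z) (z' := z')
    (F₁ := fun x => (g x - gbar z) * K.hat z x * K.jump uh z z')
    (F₂ := fun x => gbar z * K.hat z x * K.jump uh z z')
    (((hg.1.sub continuousOn_const).mul hhat).mul continuousOn_const)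
    ((continuousOn_const.mul hhat).mul continuousOn_const) hzc hzc'
  have e2 := edgeIntegral_add (z := z) (z' := z')
    (F₁ := fun x => (K.interp gbar x - gbar z) * K.hat z x * K.jump uh z z')
    (F₂ := fun x => gbar z * K.hat z x * K.jump uh z z')
    ((((continuousOn_interp gbar).sub continuousOn_const).mul hhat).mul continuousOn_const)
    ((continuousOn_const.mul hhat).mul continuousOn_const) hzc hzc'
  have e3 : (fun x => (g x - gbar z) * K.hat z x * K.jump uh z z' + gbar z * K.hat z x * K.jump uh z z') =
      fun x => g x * K.hat z x * K.jump uh z z' := by ext x; ring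
  have e4 : (fun x => (K.interp gbar x - gbar z) * K.hat z x * K.jump uh z z' +
      gbar z * K.hat z x * K.jump uh z z') = fun x => K.interp gbar x * K.hat z x * K.jump uh z z' := by
    ext x; ring
  rw [e3] at e1
  rw [e4] at e2
  rw [e1, e2]; ring

lemma patch_subset (z : Pt) : K.patch z ⊆ closure Ω :=
  iUnion₂_subset fun _ hT => convexHull_subset (mem_triAt.1 hT).1

lemma isClosed_patch (z : Pt) : IsClosed (K.patch z) :=
  isClosed_biUnion_finset fun T _ => isClosed_tri T

/-- The term `II` is the pairing of `f_h^I` with `g` minus its nodal interpolant `∑ ḡ_z φ_z`. -/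
lemma termII_eq {f : Pt → ℝ → ℝ} {uh g gbar : Pt → ℝ} (hg : ContinuousOn g (closure Ω)) :
    K.termII f uh g gbar = (∫ x in Ω, K.fhI f uh x * g x) - ∫ x in Ω, K.fhI f uh x * K.interp gbar x := by
  have hf : ContinuousOn (K.fhI f uh) (closure Ω) := continuousOn_interp _
  have h1 : ∀ z ∈ K.nodes, ∫ x in K.patch z, K.fhI f uh x * (g x - gbar z) * K.hat z x =
      ∫ x in Ω, K.fhI f uh x * (g x - gbar z) * K.hat z x := fun z _ => by
    rw [← restrict_closure_Ω]
    refine (setIntegral_eq_of_subset_of_forall_sdiff_eq_zero isClosed_closure.measurableSet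
      (patch_subset z) fun x hx => ?_).symm
    rw [hat_eq_zero_of_notMem_patch hx.1 hx.2, mul_zero]
  have hi : ∀ {F : Pt → ℝ}, ContinuousOn F (closure Ω) → Integrable F (volume.restrict Ω) :=
    fun hF => integrableOn_of_continuousOn hF
  have i1 : ∀ z ∈ K.nodes, Integrable (fun x => K.fhI f uh x * (g x - gbar z) * K.hat z x)
      (volume.restrict Ω) := fun z _ =>
    hi ((hf.mul (hg.sub continuousOn_const)).mul (continuousOn_hat z))
  have i2 : Integrable (fun x => K.fhI f uh x * g x) (volume.restrict Ω) := hi (hf.mul hg)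
  have i3 : Integrable (fun x => K.fhI f uh x * K.interp gbar x) (volume.restrict Ω) :=
    hi (hf.mul (continuousOn_interp gbar))
  rw [termII, Finset.sum_congr rfl h1, ← integral_finsetSum _ i1, ← integral_sub i2 i3]
  refine setIntegral_congr_fun measurableSet_Ω fun x hx => ?_
  have h2 := sum_hat (K := K) (subset_closure hx)
  have h3 : K.interp gbar x = ∑ z ∈ K.nodes, gbar z * K.hat z x := rfl
  have h4 : ∑ z ∈ K.nodes, K.fhI f uh x * (g x - gbar z) * K.hat z x =
      K.fhI f uh x * (g x * ∑ z ∈ K.nodes, K.hat z x - ∑ z ∈ K.nodes, gbar z * K.hat z x) := by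
    rw [Finset.mul_sum, ← Finset.sum_sub_distrib, Finset.mul_sum]
    exact Finset.sum_congr rfl fun z _ => by ring
  simp only [h4, h2, h3]
  ring

end Mesh

/-- The reaction term is bounded along a continuous function on the closed square, since it is
monotone in its last argument. -/
lemma IsReaction.exists_bound {f : Pt → ℝ → ℝ} {Cf : ℝ} (hf : IsReaction f Cf) {v : Pt → ℝ}
    (hv : ContinuousOn v (closure Ω)) : MemLp (fun x => f x (v x)) ⊤ (volume.restrict Ω) := by
  obtain ⟨B, hB⟩ := isCompact_closure_Ω.exists_bound_of_continuousOn hv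
  have hm : AEStronglyMeasurable (fun x => f x (v x)) (volume.restrict Ω) := by
    refine ContinuousOn.aestronglyMeasurable ?_ measurableSet_Ω
    exact hf.continuousOn.comp (f := fun x => (x, v x)) (continuousOn_id.prodMk (hv.mono subset_closure))
      fun x hx => ⟨hx, trivial⟩
  have hmono : ∀ x ∈ Ω, ∀ s t : ℝ, s ≤ t → f x s ≤ f x t := fun x hx s t hst => by
    have := hf.one_sided x hx t s hst
    linarith [mul_nonneg hf.nonneg (sub_nonneg.2 hst)]
  refine MemLp.of_le ((hf.memLp_top B).norm.add (hf.memLp_top (-B)).norm) hm ?_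
  filter_upwards [ae_restrict_mem measurableSet_Ω] with x hx
  have h1 := abs_le.1 (hB x (subset_closure hx))
  have h2 := hmono x hx _ _ h1.1
  have h3 := hmono x hx _ _ h1.2
  simp only [Pi.add_apply, Real.norm_eq_abs]
  rw [abs_of_nonneg (by positivity : 0 ≤ |f x B| + |f x (-B)|), abs_le]
  constructor
  · linarith [neg_abs_le (f x (-B)), abs_nonneg (f x B)]
  · linarith [le_abs_self (f x B), abs_nonneg (f x (-B))]

lemma IsReaction.integrable_mul {f : Pt → ℝ → ℝ} {Cf : ℝ} (hf : IsReaction f Cf) {v w : Pt → ℝ}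
    (hv : ContinuousOn v (closure Ω)) (hw : ContinuousOn w (closure Ω)) :
    IntegrableOn (fun x => f x (v x) * w x) Ω := by
  have h1 : Integrable (fun x => f x (v x)) (volume.restrict Ω) := (hf.exists_bound hv).integrable le_top
  obtain ⟨B, hB⟩ := isCompact_closure_Ω.exists_bound_of_continuousOn hw
  refine h1.mul_bdd (c := B) ((hw.mono subset_closure).aestronglyMeasurable measurableSet_Ω) ?_
  filter_upwards [ae_restrict_mem measurableSet_Ω] with x hx using hB x (subset_closure hx)

lemma MemH1.integrable_inner {v w : Pt → ℝ} (hv : MemH1 v) (hw : MemH1 w) :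
    IntegrableOn (fun x => inner ℝ (weakGrad v x) (weakGrad w x)) Ω :=
  integrable_inner_of_memLp hv.hasWeakGrad.1 hw.hasWeakGrad.1

lemma integral_inner_linear_comb {v w q : Pt → ℝ} (hv : MemH1 v) (hw : MemH1 w) (hq : MemH1 q) (a b : ℝ) :
    ∫ x in Ω, inner ℝ (weakGrad q x) (weakGrad (fun y => a * v y + b * w y) x) =
      a * (∫ x in Ω, inner ℝ (weakGrad q x) (weakGrad v x)) +
        b * ∫ x in Ω, inner ℝ (weakGrad q x) (weakGrad w x) := by
  rw [← integral_const_mul, ← integral_const_mul, ← integral_add ((hq.integrable_inner hv).const_mul _)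
    ((hq.integrable_inner hw).const_mul _)]
  refine integral_congr_ae ?_
  filter_upwards [weakGrad_linear_comb hv hw a b] with x hx
  rw [hx, inner_add_right, real_inner_smul_right, real_inner_smul_right]

/-- The a posteriori bound of the energy norm by the terms of the error representation. The monotonicity of `f`
and half of the diffusion term, through the Poincaré–Friedrichs inequality, bound the squared energy norm
of the error by twice the residual; the Galerkin orthogonality removes the nodal interpolant of `ḡ`. -/
lemma energyNorm_le {ε : ℝ} {f : Pt → ℝ → ℝ} {Cf : ℝ} {u : Pt → ℝ} {K : Mesh} {uh G Gh g gbar : Pt → ℝ}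
    (hf : IsReaction f Cf) (hCf : 1 ≤ Cf + ε ^ 2) (hu : IsSolution ε f u)
    (huh : K.IsDiscreteSolution ε f uh) (hpos : 0 < energyNorm ε (fun x => uh x - u x))
    (hG : G = fun x => (uh x - u x) / energyNorm ε (fun y => uh y - u y)) (hGh : K.MemSh Gh)
    (hg : g = fun x => G x - Gh x) (hgbar : ∀ z ∈ K.nodes, z ∈ frontier Ω → gbar z = 0) :
    energyNorm ε (fun x => uh x - u x) ≤
      2 * (K.termI ε uh g gbar + K.termII f uh g gbar + K.termQuad f uh G) := by
  set E := energyNorm ε (fun x => uh x - u x) with hE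
  set e : Pt → ℝ := fun x => 1 * uh x + (-1) * u x with he
  have hee : (fun x => uh x - u x) = e := by ext x; simp only [he]; ring
  have huH := huh.1.memH10C
  have heH : MemH10C e := huH.linear_comb hu.1 1 (-1)
  have hGe : G = fun x => E⁻¹ * uh x + (-E⁻¹) * u x := by rw [hG]; ext x; simp only [div_eq_mul_inv]; ring
  have hGH : MemH10C G := by rw [hGe]; exact huH.linear_comb hu.1 _ _
  have hge : g = fun x => 1 * G x + (-1) * Gh x := by rw [hg]; ext x; ring
  have hgH : MemH10C g := by rw [hge]; exact hGH.linear_comb hGh.memH10C _ _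
  have hE2 : E ^ 2 = ε ^ 2 * (∫ x in Ω, ‖weakGrad e x‖ ^ 2) + ∫ x in Ω, e x ^ 2 := by
    have hEe : E = energyNorm ε e := by rw [hE, hee]
    rw [hEe, energyNorm]
    exact Real.sq_sqrt (add_nonneg (mul_nonneg (sq_nonneg _) (integral_nonneg fun _ => sq_nonneg _))
      (integral_nonneg fun _ => sq_nonneg _))
  have hpoin := heH.poincare
  have hGu := hu.2 G hGH
  -- the Galerkin orthogonality and the representation of the residual
  have hI := Mesh.memSh_interp (K := K) hgbar
  have hd1 := huh.2 Gh hGh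
  have hd2 := huh.2 _ hI
  have hII := K.termII_eq (f := f) (uh := uh) (gbar := gbar) hgH.1
  have hII' := Mesh.termI_eq ε huh.1 hgH hgbar
  have hfhI : ContinuousOn (K.fhI f uh) (closure Ω) := Mesh.continuousOn_interp _
  have i2 : IntegrableOn (fun x => K.fhI f uh x * G x) Ω := integrableOn_of_continuousOn (hfhI.mul hGH.1)
  have hgrad_g : ∫ x in Ω, inner ℝ (weakGrad uh x) (weakGrad g x) =
      (∫ x in Ω, inner ℝ (weakGrad uh x) (weakGrad G x)) -
        ∫ x in Ω, inner ℝ (weakGrad uh x) (weakGrad Gh x) := by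
    rw [hge, integral_inner_linear_comb hGH.2.2 hGh.memH10C.2.2 huH.2.2]; ring
  have hint_g : ∫ x in Ω, K.fhI f uh x * g x =
      (∫ x in Ω, K.fhI f uh x * G x) - ∫ x in Ω, K.fhI f uh x * Gh x := by
    have i1 : IntegrableOn (fun x => K.fhI f uh x * Gh x) Ω := integrableOn_of_continuousOn (hfhI.mul hGh.1)
    rw [← integral_sub i2 i1]
    exact integral_congr_ae (ae_of_all _ fun x => by simp only [hg]; ring)
  have hquad : (∫ x in Ω, f x (uh x) * G x) - ∫ x in Ω, K.fhI f uh x * G x ≤ K.termQuad f uh G := by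
    rw [← integral_sub (hf.integrable_mul huh.1.1 hGH.1) i2]
    refine le_trans (le_of_eq ?_) (le_abs_self _)
    exact integral_congr_ae (ae_of_all _ fun x => by ring)
  -- the monotonicity of the operator applied to the error
  have hgradG : ∫ x in Ω, inner ℝ (weakGrad uh x) (weakGrad G x) -
      inner ℝ (weakGrad u x) (weakGrad G x) = E⁻¹ * ∫ x in Ω, ‖weakGrad e x‖ ^ 2 := by
    rw [← integral_const_mul]
    refine integral_congr_ae ?_
    filter_upwards [weakGrad_linear_comb huH.2.2 hu.1.2.2 1 (-1),
      weakGrad_linear_comb huH.2.2 hu.1.2.2 E⁻¹ (-E⁻¹)] with x hx hx'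
    rw [hGe, he, hx, hx', ← real_inner_self_eq_norm_sq]
    simp only [inner_add_right, inner_add_left, real_inner_smul_right, real_inner_smul_left]
    ring
  rw [integral_sub (huH.2.2.integrable_inner hGH.2.2) (hu.1.2.2.integrable_inner hGH.2.2)] at hgradG
  have hreac : E⁻¹ * (Cf * ∫ x in Ω, e x ^ 2) ≤
      (∫ x in Ω, f x (uh x) * G x) - ∫ x in Ω, f x (u x) * G x := by
    rw [← integral_sub (hf.integrable_mul huh.1.1 hGH.1) (hf.integrable_mul hu.1.1 hGH.1),
      ← integral_const_mul, ← integral_const_mul]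
    refine setIntegral_mono_on ?_ ((hf.integrable_mul huh.1.1 hGH.1).sub (hf.integrable_mul hu.1.1 hGH.1))
      measurableSet_Ω fun x hx => ?_
    · exact ((integrableOn_of_continuousOn (heH.1.pow 2)).const_mul _).const_mul _
    · have hGx : G x = E⁻¹ * e x := by rw [hGe]; simp only [he]; ring
      have hex : e x = uh x - u x := by simp only [he]; ring
      rw [hGx]
      have hkey : Cf * e x ^ 2 ≤ (f x (uh x) - f x (u x)) * e x := by
        rw [hex]
        rcases le_total (u x) (uh x) with h | h
        · nlinarith [hf.one_sided x hx _ _ h]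
        · nlinarith [hf.one_sided x hx _ _ h]
      calc E⁻¹ * (Cf * e x ^ 2) ≤ E⁻¹ * ((f x (uh x) - f x (u x)) * e x) :=
            mul_le_mul_of_nonneg_left hkey (inv_nonneg.2 hpos.le)
        _ = _ := by ring
  set D := ∫ x in Ω, ‖weakGrad e x‖ ^ 2
  set N := ∫ x in Ω, e x ^ 2
  have hN : 0 ≤ N := integral_nonneg fun _ => sq_nonneg _
  have hmain : E⁻¹ * (ε ^ 2 * D + Cf * N) ≤
      K.termI ε uh g gbar + K.termII f uh g gbar + K.termQuad f uh G := by
    have h1 : E⁻¹ * (ε ^ 2 * D) = ε ^ 2 * (E⁻¹ * D) := by ring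
    rw [mul_add, h1, ← hgradG, hII, hII', hgrad_g, hint_g]
    linarith
  have hlow : E / 2 ≤ E⁻¹ * (ε ^ 2 * D + Cf * N) := by
    have h2 : E ^ 2 / 2 ≤ ε ^ 2 * D + Cf * N := by
      rw [hE2]
      have h3 := mul_le_mul_of_nonneg_left hpoin (sq_nonneg ε)
      have h4 := mul_le_mul_of_nonneg_right hCf hN
      nlinarith [mul_nonneg hf.nonneg hN]
    calc E / 2 = E⁻¹ * (E ^ 2 / 2) := by field_simp
      _ ≤ _ := mul_le_mul_of_nonneg_left h2 (inv_nonneg.2 hpos.le)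
  linarith

/-! ### Traces of smooth functions on the sides of a triangle -/

lemma continuous_duffy_left (P A B : Pt) (t : ℝ) : Continuous fun r => duffy P A B t r :=
  (continuous_duffy P A B).comp (by fun_prop : Continuous fun r : ℝ => (t, r))

lemma continuous_integral_duffy {F : Pt → ℝ} (hF : Continuous F) (P A B : Pt) :
    Continuous fun t : ℝ => ∫ r in (0 : ℝ)..1, t * F (duffy P A B t r) := by
  refine intervalIntegral.continuous_parametric_intervalIntegral_of_continuous' ?_ 0 1
  exact continuous_fst.mul (hF.comp (continuous_duffy P A B))

lemma abs_cross_of_vertical {P A B : Pt} (hAB : A 0 = B 0) :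
    |cross (A - P) (B - P)| = |A 0 - P 0| * ‖B - A‖ := by
  have h : ‖B - A‖ = |B 1 - A 1| := by
    rw [← abs_of_nonneg (norm_nonneg (B - A)), ← sq_eq_sq_iff_abs_eq_abs, norm_sq_pt]
    simp [hAB]
  rw [h, ← abs_mul]
  congr 1
  simp only [cross, PiLp.sub_apply, ← hAB]; ring

lemma continuous_norm_fderiv {g : Pt → ℝ} (hg : ContDiff ℝ 1 g) : Continuous fun x => ‖fderiv ℝ g x‖ :=
  (hg.continuous_fderiv (by simp)).norm

lemma fderiv_sq {g : Pt → ℝ} (hg : ContDiff ℝ 1 g) (x v : Pt) :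
    fderiv ℝ (fun y => g y ^ 2) x v = 2 * g x * fderiv ℝ g x v := by
  have := ((hg.differentiable (by simp)) x).hasFDerivAt.pow 2
  rw [this.fderiv]
  simp

/-- In a triangle with a vertical side `AB`, the difference of the traces of `G` on the other two
sides is controlled by the integral of `∂G/∂y` over the triangle. -/
lemma integral_abs_sub_le_of_vertical {G Φ : Pt → ℝ} (hG : ContDiff ℝ 1 G) (hΦ : Continuous Φ) {P A B : Pt}
    (hAB : A 0 = B 0) (h : ∀ x, |fderiv ℝ G x (B - A)| ≤ ‖B - A‖ * Φ x) :
    |A 0 - P 0| * ∫ t in (0 : ℝ)..1, |G (AffineMap.lineMap P B t) - G (AffineMap.lineMap P A t)| ≤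
      ∫ x in convexHull ℝ ({P, A, B} : Set Pt), Φ x := by
  rw [setIntegral_triangle hΦ, abs_cross_of_vertical hAB, mul_assoc]
  refine mul_le_mul_of_nonneg_left ?_ (abs_nonneg _)
  rw [← intervalIntegral.integral_const_mul]
  have hc : ∀ Q : Pt, Continuous fun t : ℝ => G (AffineMap.lineMap P Q t) := fun Q =>
    hG.continuous.comp AffineMap.lineMap_continuous
  refine intervalIntegral.integral_mono_on zero_le_one (((hc B).sub (hc A)).abs.intervalIntegrable _ _)
    ((continuous_const.mul (continuous_integral_duffy hΦ P A B)).intervalIntegrable _ _) fun t ht => ?_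
  rw [← integral_fderiv_duffy hG, ← intervalIntegral.integral_const_mul]
  refine (intervalIntegral.abs_integral_le_integral_abs zero_le_one).trans ?_
  refine intervalIntegral.integral_mono_on zero_le_one
    ((continuous_fderiv_duffy hG P A B t _).abs.intervalIntegrable _ _)
    ((continuous_const.mul (continuous_const.mul (hΦ.comp (continuous_duffy_left P A B t)))).intervalIntegrable _ _)
    fun r _ => ?_
  rw [abs_mul, abs_of_nonneg ht.1]
  have := mul_le_mul_of_nonneg_left (h (duffy P A B t r)) ht.1
  linarith

lemma abs_fderiv_le (g : Pt → ℝ) (x v : Pt) : |fderiv ℝ g x v| ≤ ‖v‖ * ‖fderiv ℝ g x‖ := by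
  rw [mul_comm, ← Real.norm_eq_abs]; exact (fderiv ℝ g x).le_opNorm v

lemma integral_abs_sq_sub_sq_le {g : Pt → ℝ} (hg : ContDiff ℝ 1 g) {P A B : Pt} (hAB : A 0 = B 0) :
    |A 0 - P 0| * ∫ t in (0 : ℝ)..1, |g (AffineMap.lineMap P B t) ^ 2 - g (AffineMap.lineMap P A t) ^ 2| ≤
      ∫ x in convexHull ℝ ({P, A, B} : Set Pt), 2 * (|g x| * ‖fderiv ℝ g x‖) := by
  have hΦ : Continuous fun x => 2 * (|g x| * ‖fderiv ℝ g x‖) :=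
    continuous_const.mul (hg.continuous.abs.mul (continuous_norm_fderiv hg))
  refine integral_abs_sub_le_of_vertical (hg.pow 2) hΦ hAB fun x => ?_
  rw [fderiv_sq hg, abs_mul, abs_mul, abs_two]
  have := mul_le_mul_of_nonneg_left (abs_fderiv_le g x (B - A)) (abs_nonneg (g x))
  linarith

/-- The squared difference of the traces of `g` on two sides that meet the third, vertical, side. -/
lemma integral_sq_sub_le {g : Pt → ℝ} (hg : ContDiff ℝ 1 g) {P A B : Pt} (hAB : A 0 = B 0) :
    |A 0 - P 0| * ∫ t in (0 : ℝ)..1, (g (AffineMap.lineMap P B t) - g (AffineMap.lineMap P A t)) ^ 2 ≤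
      ‖B - A‖ * ∫ x in convexHull ℝ ({P, A, B} : Set Pt), ‖fderiv ℝ g x‖ ^ 2 := by
  have hΦ : Continuous fun x => ‖fderiv ℝ g x‖ ^ 2 := (continuous_norm_fderiv hg).pow 2
  rw [setIntegral_triangle hΦ, abs_cross_of_vertical hAB, mul_assoc, mul_left_comm]
  refine mul_le_mul_of_nonneg_left ?_ (abs_nonneg _)
  rw [← intervalIntegral.integral_const_mul, ← intervalIntegral.integral_const_mul]
  have hc : ∀ Q : Pt, Continuous fun t : ℝ => g (AffineMap.lineMap P Q t) := fun Q =>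
    hg.continuous.comp AffineMap.lineMap_continuous
  refine intervalIntegral.integral_mono_on zero_le_one ((((hc B).sub (hc A)).pow 2).intervalIntegrable _ _)
    ((continuous_const.mul (continuous_const.mul (continuous_integral_duffy hΦ P A B))).intervalIntegrable _ _)
    fun t ht => ?_
  rw [← integral_fderiv_duffy hg, ← intervalIntegral.integral_const_mul, ← intervalIntegral.integral_const_mul]
  refine (sq_intervalIntegral_le (continuous_fderiv_duffy hg P A B t _) (right_mem_Icc.2 zero_le_one)).trans ?_
  refine intervalIntegral.integral_mono_on zero_le_one
    (((continuous_fderiv_duffy hg P A B t _).pow 2).intervalIntegrable _ _)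
    ((continuous_const.mul (continuous_const.mul (continuous_const.mul
      (hΦ.comp (continuous_duffy_left P A B t))))).intervalIntegrable _ _) fun r _ => ?_
  have h1 := pow_le_pow_left₀ (abs_nonneg _) (abs_fderiv_le g (duffy P A B t r) (B - A)) 2
  rw [sq_abs] at h1
  calc (t * fderiv ℝ g (duffy P A B t r) (B - A)) ^ 2
      = t ^ 2 * (fderiv ℝ g (duffy P A B t r) (B - A)) ^ 2 := by ring
    _ ≤ t * (‖B - A‖ * ‖fderiv ℝ g (duffy P A B t r)‖) ^ 2 :=
        mul_le_mul (by nlinarith [ht.1, ht.2]) h1 (sq_nonneg _) ht.1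
    _ = _ := by ring

/-- A weighted trace inequality on the side `PA` of a triangle `PAB`; only the derivative along `AB`
enters, whence the factor `‖B - A‖`. -/
lemma trace_le {g : Pt → ℝ} (hg : ContDiff ℝ 1 g) (P A B : Pt) :
    |cross (A - P) (B - P)| * ∫ t in (0 : ℝ)..1, t * g (AffineMap.lineMap P A t) ^ 2 ≤
      (∫ x in convexHull ℝ ({P, A, B} : Set Pt), g x ^ 2) +
        ‖B - A‖ * ∫ x in convexHull ℝ ({P, A, B} : Set Pt), 2 * (|g x| * ‖fderiv ℝ g x‖) := by
  have hΦ : Continuous fun x => 2 * (|g x| * ‖fderiv ℝ g x‖) :=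
    continuous_const.mul (hg.continuous.abs.mul (continuous_norm_fderiv hg))
  have hg2 : Continuous fun x => g x ^ 2 := hg.continuous.pow 2
  rw [setIntegral_triangle hΦ, setIntegral_triangle hg2, mul_left_comm, ← mul_add]
  refine mul_le_mul_of_nonneg_left ?_ (abs_nonneg _)
  have hc2 : Continuous fun t : ℝ => ‖B - A‖ * ∫ r in (0 : ℝ)..1,
      t * (2 * (|g (duffy P A B t r)| * ‖fderiv ℝ g (duffy P A B t r)‖)) :=
    continuous_const.mul (continuous_integral_duffy hΦ P A B)
  rw [← intervalIntegral.integral_const_mul, ← intervalIntegral.integral_add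
    ((continuous_integral_duffy hg2 P A B).intervalIntegrable _ _) (hc2.intervalIntegrable _ _)]
  have hc : Continuous fun t : ℝ => g (AffineMap.lineMap P A t) :=
    hg.continuous.comp AffineMap.lineMap_continuous
  refine intervalIntegral.integral_mono_on zero_le_one ((continuous_id.mul (hc.pow 2)).intervalIntegrable _ _)
    (((continuous_integral_duffy hg2 P A B).add hc2).intervalIntegrable _ _) fun t ht => ?_
  set ψ : ℝ → ℝ := fun r => t * fderiv ℝ (fun y => g y ^ 2) (duffy P A B t r) (B - A) with hψ
  have hψc : Continuous ψ := continuous_fderiv_duffy (hg.pow 2) P A B t (B - A)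
  have hψb : ∀ r, |ψ r| ≤ ‖B - A‖ * (t * (2 * (|g (duffy P A B t r)| * ‖fderiv ℝ g (duffy P A B t r)‖))) := by
    intro r
    simp only [hψ]
    rw [fderiv_sq hg, abs_mul, abs_mul, abs_mul, abs_two, abs_of_nonneg ht.1]
    have := mul_le_mul_of_nonneg_left (abs_fderiv_le g (duffy P A B t r) (B - A))
      (mul_nonneg ht.1 (abs_nonneg (g (duffy P A B t r))))
    linarith
  set D := ‖B - A‖ * ∫ r in (0 : ℝ)..1, t * (2 * (|g (duffy P A B t r)| * ‖fderiv ℝ g (duffy P A B t r)‖))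
    with hD
  have hcr : Continuous fun r => ‖B - A‖ * (t * (2 * (|g (duffy P A B t r)| * ‖fderiv ℝ g (duffy P A B t r)‖))) :=
    continuous_const.mul (continuous_const.mul (hΦ.comp (continuous_duffy_left P A B t)))
  have hpt : ∀ r ∈ Icc (0 : ℝ) 1, g (AffineMap.lineMap P A t) ^ 2 ≤ g (duffy P A B t r) ^ 2 + D := by
    intro r hr
    have h1 := intervalIntegral.integral_eq_sub_of_hasDerivAt
      (fun r _ => hasDerivAt_comp_duffy (hg.pow 2) P A B t r) (hψc.intervalIntegrable 0 r)
    rw [duffy_zero] at h1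
    have h2 : |∫ s in (0 : ℝ)..r, ψ s| ≤ D := by
      refine (intervalIntegral.abs_integral_le_integral_abs hr.1).trans ?_
      rw [hD, ← intervalIntegral.integral_const_mul]
      refine (intervalIntegral.integral_mono_on hr.1 (hψc.abs.intervalIntegrable _ _)
        (hcr.intervalIntegrable _ _) fun s _ => hψb s).trans ?_
      refine intervalIntegral.integral_mono_interval le_rfl hr.1 hr.2 (ae_of_all _ fun s => ?_)
        (hcr.intervalIntegrable _ _)
      exact (abs_nonneg _).trans (hψb s)
    have h3 := (abs_le.1 h2).1
    linarith
  have hD0 : 0 ≤ D := mul_nonneg (norm_nonneg _) (intervalIntegral.integral_nonneg zero_le_one fun r _ =>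
    mul_nonneg ht.1 (by positivity))
  have hint : ∫ r in (0 : ℝ)..1, t * g (AffineMap.lineMap P A t) ^ 2 ≤
      ∫ r in (0 : ℝ)..1, (t * g (duffy P A B t r) ^ 2 + D) := by
    refine intervalIntegral.integral_mono_on zero_le_one (continuous_const.intervalIntegrable _ _)
      (((continuous_const.mul (hg2.comp (continuous_duffy_left P A B t))).add continuous_const).intervalIntegrable _ _)
      fun r hr => ?_
    have h1 := mul_le_mul_of_nonneg_left (hpt r hr) ht.1
    have h2 : t * D ≤ D := mul_le_of_le_one_left hD0 ht.2
    linarith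
  have hc3 : Continuous fun r => t * g (duffy P A B t r) ^ 2 :=
    continuous_const.mul (hg2.comp (continuous_duffy_left P A B t))
  rw [intervalIntegral.integral_add (hc3.intervalIntegrable _ _) (continuous_const.intervalIntegrable _ _)]
    at hint
  simpa using hint

/-! ### Shapes of the elements of an anisotropic mesh with vertical short edges -/

/-- If the angle at `a` exceeds `π/2` by at most `s`, then the foot of `c` on the line `ab` lies
beyond `a` by at most `s |ac|`. -/
lemma neg_le_inner_of_angle_le {a b c : Pt} {s : ℝ} (hs : 0 ≤ s)
    (h : EuclideanGeometry.angle b a c ≤ Real.pi / 2 + s) :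
    -(‖b - a‖ * ‖c - a‖ * s) ≤ inner ℝ (b - a) (c - a) := by
  have h1 : -s ≤ Real.cos (EuclideanGeometry.angle b a c) := by
    set θ := EuclideanGeometry.angle b a c
    rcases le_total θ (Real.pi / 2) with hθ | hθ
    · have := Real.cos_nonneg_of_neg_pi_div_two_le_of_le
        (by linarith [EuclideanGeometry.angle_nonneg b a c, Real.pi_pos] : -(Real.pi / 2) ≤ θ) hθ
      linarith
    · have h2 := Real.sin_le (sub_nonneg.2 hθ)
      rw [Real.sin_sub_pi_div_two] at h2
      linarith
  have h2 := InnerProductGeometry.cos_angle_mul_norm_mul_norm (b - a) (c - a)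
  rw [← h2]
  have h3 : Real.cos (EuclideanGeometry.angle b a c) = Real.cos (InnerProductGeometry.angle (b - a) (c - a)) := rfl
  rw [h3] at h1
  nlinarith [mul_le_mul_of_nonneg_right h1 (mul_nonneg (norm_nonneg (b - a)) (norm_nonneg (c - a)))]

/-- A triangle with a vertical shortest side `ab` whose angles satisfy the quasi-non-obtuse condition:
its third vertex is at most at a distance of order `|ab|` from the horizontal lines through `a` and
`b`, and its width dominates `|ab|`. The numbers `ℓ`, `d` are the height and the width. -/
lemma apex_bounds {β γ d ℓ o α : ℝ} (hα : 0 < α) (hd : 0 ≤ d) (hβ : |β| = ℓ) (hℓ : 0 < ℓ)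
    (ho : 0 ≤ o) (hoℓ : o ≤ α * ℓ) (hod : o ≤ α * d)
    (h1 : -(ℓ * o) ≤ β * γ) (h2 : -(ℓ * o) ≤ (-β) * (γ - β))
    (h3 : ℓ ^ 2 ≤ d ^ 2 + γ ^ 2) (h4 : ℓ ^ 2 ≤ d ^ 2 + (γ - β) ^ 2) :
    |γ| ≤ (1 + α) * ℓ ∧ |γ - β| ≤ (1 + α) * ℓ ∧ ℓ ≤ 2 * (1 + α) * d := by
  wlog hpos : 0 ≤ β generalizing β γ
  · have := this (β := -β) (γ := -γ) (by rwa [abs_neg]) (by linarith) (by linarith) (by linarith)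
      (by nlinarith) (by linarith)
    rw [abs_neg] at this
    refine ⟨this.1, ?_, this.2.2⟩
    rw [← abs_neg]
    convert this.2.1 using 2; ring
  rw [abs_of_nonneg hpos] at hβ
  subst hβ
  have e1 : -o ≤ γ := by
    by_contra! h
    nlinarith
  have e2 : γ - β ≤ o := by
    by_contra! h
    nlinarith
  refine ⟨abs_le.2 ⟨by nlinarith, by nlinarith⟩, abs_le.2 ⟨by nlinarith, by nlinarith⟩, ?_⟩
  refine abs_le_of_sq_le_sq' ?_ (by positivity) |>.2
  have hod2 : o ^ 2 ≤ α ^ 2 * d ^ 2 := by rw [← mul_pow]; exact pow_le_pow_left₀ ho hod 2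
  have h5 : β ^ 2 ≤ d ^ 2 + (β ^ 2 / 4 + o ^ 2) := by
    rcases le_total γ (β / 2) with h | h
    · refine h3.trans (add_le_add_right ?_ _)
      rcases le_total 0 γ with h0 | h0
      · nlinarith
      · nlinarith
    · refine h4.trans (add_le_add_right ?_ _)
      rcases le_total 0 (γ - β) with h0 | h0
      · nlinarith
      · nlinarith
  nlinarith [mul_pos hα hα, sq_nonneg d, mul_nonneg hα.le (sq_nonneg d)]

namespace Mesh

variable {K : Mesh} {n : ℕ} {X : ℕ → ℝ} {A : ℝ}

/-- `s` and `t` are two consecutive points of the mesh `X`. -/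
def Neighbor (n : ℕ) (X : ℕ → ℝ) (s t : ℝ) : Prop :=
  ∃ i < n, (s = X i ∧ t = X (i + 1)) ∨ (s = X (i + 1) ∧ t = X i)

/-- The triangle `T = {a, b, c}` has the vertical side `ab` and its third vertex `c` on an adjacent
line of the mesh `X`; up to the constant `A`, the length of `ab` is `h_z`, the width of `T` is `H_z`,
and the height of `T` is bounded by `h_z`, for each vertex `z`. -/
structure Shape (K : Mesh) (n : ℕ) (X : ℕ → ℝ) (A : ℝ) (T : Finset Pt) (a b c : Pt) : Prop where
  eq : T = {a, b, c}
  base : a 0 = b 0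
  slab : Neighbor n X (a 0) (c 0)
  hz_le : ∀ z ∈ T, K.hz z ≤ A * |b 1 - a 1|
  le_hz : ∀ z ∈ T, |b 1 - a 1| ≤ A * K.hz z
  Hz_le : ∀ z ∈ T, K.Hz z ≤ A * |c 0 - a 0|
  le_Hz : ∀ z ∈ T, |c 0 - a 0| ≤ A * K.Hz z
  left_le : ∀ z ∈ T, |c 1 - a 1| ≤ A * K.hz z
  right_le : ∀ z ∈ T, |c 1 - b 1| ≤ A * K.hz z

lemma Shape.symm {T : Finset Pt} {a b c : Pt} (h : Shape K n X A T a b c) : Shape K n X A T b a c where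
  eq := by rw [h.eq]; ext; simp; tauto
  base := h.base.symm
  slab := by rw [← h.base]; exact h.slab
  hz_le := by rw [abs_sub_comm]; exact h.hz_le
  le_hz := by rw [abs_sub_comm]; exact h.le_hz
  Hz_le := by rw [← h.base]; exact h.Hz_le
  le_Hz := by rw [← h.base]; exact h.le_Hz
  left_le := h.right_le
  right_le := h.left_le

/-- The constant in `Shape` provided by the mesh conditions. -/
noncomputable def shapeConst (κ α₁ c₀ : ℝ) : ℝ := (1 + κ) * (1 + α₁) * (1 + 2 * (1 + α₁) ^ 2) + c₀

/-- The shape of a triangle in terms of its own dimensions: `h_T` and `H_T` are equivalent to the length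
of the vertical side and to the width. -/
lemma exists_shape_aux {α₁ : ℝ} (hα₁ : 0 < α₁) (h1 : K.CondA1 n X) (h3 : K.CondA3 α₁) {T : Finset Pt}
    (hmem : T ∈ K.tri) :
    ∃ a b c : Pt, T = {a, b, c} ∧ a 0 = b 0 ∧
      Neighbor n X (a 0) (c 0) ∧
      |c 1 - a 1| ≤ (1 + α₁) * |b 1 - a 1| ∧ |c 1 - b 1| ≤ (1 + α₁) * |b 1 - a 1| ∧
      (0 < hT T ∧ hT T ≤ |b 1 - a 1| ∧ |b 1 - a 1| ≤ (1 + 2 * (1 + α₁) ^ 2) * hT T) ∧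
      (0 < HT T ∧ |c 0 - a 0| ≤ HT T ∧ HT T ≤ (1 + 2 * (1 + α₁) ^ 2) * |c 0 - a 0|) := by
  obtain ⟨i, hi, a, b, c, rfl, ha, hb, hac, hbc, hc⟩ := h1 T hmem
  obtain ⟨nab, nac, nbc⟩ := distinct_of_mem_tri hmem
  have hcr := cross_ne_zero hmem
  have hba : a 0 = b 0 := ha.trans hb.symm
  have hslab : Neighbor n X (a 0) (c 0) := by
    rcases hc with ⟨hn, hc⟩ | ⟨hi1, hc⟩
    · exact ⟨i, hn, Or.inl ⟨ha, hc⟩⟩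
    · exact ⟨i - 1, by omega, Or.inr ⟨by rw [ha]; congr 1; omega, hc⟩⟩
  set ℓ := |b 1 - a 1| with hℓ
  set d := |c 0 - a 0| with hd
  have hnba : ‖b - a‖ = ℓ := by
    rw [← abs_of_nonneg (norm_nonneg (b - a)), ← sq_eq_sq_iff_abs_eq_abs, norm_sq_pt]; simp [hba]
  have hℓ0 : 0 < ℓ := by rw [← hnba]; exact norm_pos_iff.2 (sub_ne_zero.2 nab.symm)
  have harea : |cross (b - a) (c - a)| = ℓ * d := by
    rw [hℓ, hd, ← abs_mul, ← abs_neg]; congr 1; simp [cross, ← hba]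
  have hd0 : 0 < d := by
    have := abs_pos.2 hcr
    rw [harea] at this
    exact pos_of_mul_pos_right this hℓ0.le
  set T : Finset Pt := {a, b, c} with hTdef
  set L := HT T with hL
  have hbdd : Bornology.IsBounded (T : Set Pt) := T.finite_toSet.isBounded
  have haT : a ∈ T := by simp [hTdef]
  have hbT : b ∈ T := by simp [hTdef]
  have hcT : c ∈ T := by simp [hTdef]
  have hdist : ∀ x ∈ T, ∀ y ∈ T, ‖x - y‖ ≤ L := fun x hx y hy => by
    rw [← dist_eq_norm]; exact Metric.dist_le_diam_of_mem hbdd hx hy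
  have hℓL : ℓ ≤ L := hnba ▸ hdist b hbT a haT
  have hdL : d ≤ L := (abs_coord_le_norm (c - a) 0).trans (hdist c hcT a haT)
  have hL0 : 0 < L := hℓ0.trans_le hℓL
  have hhT : hT T = ℓ * d / L := by
    unfold hT
    rw [hTdef, coe_triple, volume_real_triangle, harea]; ring
  have hTℓ : hT T ≤ ℓ := by rw [hhT, div_le_iff₀ hL0]; exact mul_le_mul_of_nonneg_left hdL hℓ0.le
  have hTd : hT T ≤ d := by rw [hhT, div_le_iff₀ hL0, mul_comm]; exact mul_le_mul_of_nonneg_left hℓL hd0.le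
  have hT0 : 0 < hT T := by rw [hhT]; positivity
  set s := α₁ * (hT T / L) with hs
  have hs0 : 0 ≤ s := by positivity
  have hsL : L * s = α₁ * hT T := by rw [hs]; field_simp
  have a1 := neg_le_inner_of_angle_le hs0 (h3 T hmem b hbT a haT c hcT nab.symm nac nbc)
  have a2 := neg_le_inner_of_angle_le hs0 (h3 T hmem a haT b hbT c hcT nab nbc nac)
  rw [hnba] at a1
  rw [norm_sub_rev, hnba] at a2
  have i1 : inner ℝ (b - a) (c - a) = (b 1 - a 1) * (c 1 - a 1) := by rw [inner_pt]; simp [hba]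
  have i2 : inner ℝ (a - b) (c - b) = (-(b 1 - a 1)) * ((c 1 - a 1) - (b 1 - a 1)) := by
    rw [inner_pt]; simp [hba]
  rw [i1] at a1
  rw [i2] at a2
  have hle : ∀ x ∈ T, -(ℓ * (α₁ * hT T)) ≤ -(ℓ * ‖c - x‖ * s) := fun x hx => by
    rw [← hsL]
    have := mul_le_mul_of_nonneg_left (hdist c hcT x hx) (mul_nonneg hℓ0.le hs0)
    linarith
  have hsq : ∀ x : Pt, x 0 = a 0 → dist a b ≤ dist x c → ℓ ^ 2 ≤ d ^ 2 + (c 1 - x 1) ^ 2 := fun x hx h => by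
    rw [dist_comm, dist_eq_norm, hnba, dist_comm, dist_eq_norm] at h
    have := pow_le_pow_left₀ hℓ0.le h 2
    rw [norm_sq_pt] at this
    rw [hd, ← hx, sq_abs (c 0 - x 0)]
    exact this
  obtain ⟨b1, b2, b3⟩ := apex_bounds (β := b 1 - a 1) (γ := c 1 - a 1) (d := d) (ℓ := ℓ) (o := α₁ * hT T)
    hα₁ hd0.le rfl hℓ0 (by positivity) (mul_le_mul_of_nonneg_left hTℓ hα₁.le)
    (mul_le_mul_of_nonneg_left hTd hα₁.le) ((hle a haT).trans a1) ((hle b hbT).trans a2)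
    (hsq a rfl hac) (by convert hsq b hba.symm hbc using 2; ring)
  rw [show c 1 - a 1 - (b 1 - a 1) = c 1 - b 1 by ring] at b2
  have hLd : L ≤ (1 + 2 * (1 + α₁) ^ 2) * d := by
    have hB : ℓ ≤ (1 + α₁) * ℓ := by nlinarith
    have key : (1 + α₁) * ℓ + d ≤ (1 + 2 * (1 + α₁) ^ 2) * d := by
      have := mul_le_mul_of_nonneg_left b3 (by positivity : 0 ≤ 1 + α₁)
      nlinarith
    refine le_trans ?_ key
    have n1 : ‖c - a‖ ≤ (1 + α₁) * ℓ + d := by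
      refine (norm_le_abs_add_abs _).trans ?_
      rw [add_comm]
      exact add_le_add b1 le_rfl
    have n2 : ‖c - b‖ ≤ (1 + α₁) * ℓ + d := by
      refine (norm_le_abs_add_abs _).trans ?_
      rw [add_comm, PiLp.sub_apply, PiLp.sub_apply, ← hba]
      exact add_le_add b2 le_rfl
    have n3 : ‖b - a‖ ≤ (1 + α₁) * ℓ + d := by rw [hnba]; linarith
    refine Metric.diam_le_of_forall_dist_le (by positivity) fun x hx y hy => ?_
    rw [Finset.mem_coe, hTdef, Finset.mem_insert, Finset.mem_insert, Finset.mem_singleton] at hx hy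
    have n0 : (0 : ℝ) ≤ (1 + α₁) * ℓ + d := by positivity
    rw [dist_eq_norm]
    rcases hx with rfl | rfl | rfl <;> rcases hy with rfl | rfl | rfl <;>
      first
        | (rw [sub_self, norm_zero]; exact n0)
        | exact n1
        | exact n2
        | exact n3
        | (rw [norm_sub_rev]; first | exact n1 | exact n2 | exact n3)
  have hℓT : ℓ ≤ (1 + 2 * (1 + α₁) ^ 2) * hT T := by
    rw [hhT, mul_div_assoc', le_div_iff₀ hL0]
    have := mul_le_mul_of_nonneg_left hLd hℓ0.le
    linarith
  exact ⟨a, b, c, rfl, hba, hslab, b1, b2, ⟨hT0, hTℓ, hℓT⟩, hL0, hdL, hLd⟩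

/-- The mesh conditions give every element the shape described by `Shape`: the comparison of `h_T`, `H_T` with
`h_z`, `H_z` turns the dimensions of the element into those of the patches at its vertices. -/
lemma exists_shape {κ α₁ c₀ : ℝ} (hκ : 0 < κ) (hα₁ : 0 < α₁) (hc₀ : 0 < c₀)
    (h1 : K.CondA1 n X) (h2 : K.CondA2 κ c₀) (h3 : K.CondA3 α₁) {T : Finset Pt} (hmem : T ∈ K.tri) :
    ∃ a b c, Shape K n X (shapeConst κ α₁ c₀) T a b c := by
  obtain ⟨a, b, c, heq, hba, hslab, b1, b2, ⟨hT0, hTℓ, hℓT⟩, hL0, hdL, hLd⟩ := exists_shape_aux hα₁ h1 h3 hmem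
  generalize ha₁ : 1 + 2 * (1 + α₁) ^ 2 = a₁ at hℓT hLd
  have ha₁1 : 1 ≤ a₁ := by rw [← ha₁]; nlinarith [sq_nonneg (1 + α₁)]
  have hAκ : (1 + α₁) * (a₁ * κ) ≤ shapeConst κ α₁ c₀ := by
    unfold shapeConst; rw [ha₁]
    have : 0 ≤ (1 + α₁) * a₁ := by positivity
    linarith
  have hAκ2 : a₁ * κ ≤ shapeConst κ α₁ c₀ := by
    refine le_trans ?_ hAκ
    exact le_mul_of_one_le_left (by positivity) (by linarith)
  have hAκ3 : κ ≤ shapeConst κ α₁ c₀ := (le_mul_of_one_le_left hκ.le ha₁1).trans hAκ2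
  generalize shapeConst κ α₁ c₀ = A at *
  have hzT : ∀ z ∈ T, Equivalent κ (hT T) (K.hz z) ∧ Equivalent κ (HT T) (K.Hz z) := fun z hz =>
    (h2 z (subset_nodes hmem hz)).2 T (mem_triAt.2 ⟨hmem, hz⟩)
  have hz0 : ∀ z ∈ T, 0 < K.hz z := fun z hz =>
    pos_of_mul_pos_right (hT0.trans_le (hzT z hz).1.1) hκ.le
  have hH0 : ∀ z ∈ T, 0 < K.Hz z := fun z hz =>
    pos_of_mul_pos_right (hL0.trans_le (hzT z hz).2.1) hκ.le
  have hhgt : ∀ z ∈ T, (1 + α₁) * |b 1 - a 1| ≤ A * K.hz z := fun z hz => by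
    have e1 : a₁ * hT T ≤ a₁ * (κ * K.hz z) := mul_le_mul_of_nonneg_left (hzT z hz).1.1 (by linarith)
    have e2 := mul_le_mul_of_nonneg_left (hℓT.trans e1) (by linarith : 0 ≤ 1 + α₁)
    have e3 := mul_le_mul_of_nonneg_right hAκ (hz0 z hz).le
    linarith
  refine ⟨a, b, c, heq, hba, hslab, fun z hz => ?_, fun z hz => ?_, fun z hz => ?_, fun z hz => ?_,
    fun z hz => b1.trans (hhgt z hz), fun z hz => b2.trans (hhgt z hz)⟩
  · calc K.hz z ≤ κ * hT T := (hzT z hz).1.2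
      _ ≤ κ * |b 1 - a 1| := mul_le_mul_of_nonneg_left hTℓ hκ.le
      _ ≤ _ := mul_le_mul_of_nonneg_right hAκ3 (abs_nonneg _)
  · refine le_trans ?_ (hhgt z hz)
    exact le_mul_of_one_le_left (abs_nonneg _) (by linarith)
  · calc K.Hz z ≤ κ * HT T := (hzT z hz).2.2
      _ ≤ κ * (a₁ * |c 0 - a 0|) := mul_le_mul_of_nonneg_left hLd hκ.le
      _ = a₁ * κ * |c 0 - a 0| := by ring
      _ ≤ _ := mul_le_mul_of_nonneg_right hAκ2 (abs_nonneg _)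
  · calc |c 0 - a 0| ≤ HT T := hdL
      _ ≤ κ * K.Hz z := (hzT z hz).2.1
      _ ≤ _ := mul_le_mul_of_nonneg_right hAκ3 (hH0 z hz).le

end Mesh

/-! ### The combinatorics of a mesh with vertical short edges -/

namespace Mesh

variable {K : Mesh} {n : ℕ} {X : ℕ → ℝ} {A : ℝ} {M : ℕ}

lemma IsMesh1D.lt_of_lt (hX : IsMesh1D n X) {i j : ℕ} (hij : i < j) (hj : j ≤ n) : X i < X j := by
  induction j, hij using Nat.le_induction with
  | base => exact hX.lt i hj
  | succ j hij ih => exact (ih (by omega)).trans (hX.lt j hj)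

lemma IsMesh1D.lt_iff (hX : IsMesh1D n X) {i j : ℕ} (hi : i ≤ n) (hj : j ≤ n) : X i < X j ↔ i < j := by
  refine ⟨fun h => ?_, fun h => hX.lt_of_lt h hj⟩
  by_contra! h'
  rcases h'.lt_or_eq with h' | rfl
  · exact lt_asymm h (hX.lt_of_lt h' hi)
  · exact lt_irrefl _ h

lemma IsMesh1D.inj (hX : IsMesh1D n X) {i j : ℕ} (hi : i ≤ n) (hj : j ≤ n) (h : X i = X j) : i = j := by
  rcases lt_trichotomy i j with h' | h' | h'
  · exact absurd h (hX.lt_of_lt h' hj).ne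
  · exact h'
  · exact absurd h (hX.lt_of_lt h' hi).ne'

lemma Neighbor.symm {s t : ℝ} (h : Neighbor n X s t) : Neighbor n X t s := by
  obtain ⟨i, hi, h | h⟩ := h
  · exact ⟨i, hi, Or.inr ⟨h.2, h.1⟩⟩
  · exact ⟨i, hi, Or.inl ⟨h.2, h.1⟩⟩

/-- A point determines the interval of the mesh `X` that contains it in its interior. -/
lemma Neighbor.eq_of_mem (hX : IsMesh1D n X) {s t s' t' p : ℝ} (h : Neighbor n X s t) (h' : Neighbor n X s' t')
    (hs : s < p) (ht : p < t) (hs' : s' < p) (ht' : p < t') : s = s' ∧ t = t' := by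
  obtain ⟨i, hi, h | h⟩ := h
  · obtain ⟨j, hj, h' | h'⟩ := h'
    · have h1 : X i < X (j + 1) := by rw [← h.1, ← h'.2]; exact hs.trans ht'
      have h2 : X j < X (i + 1) := by rw [← h'.1, ← h.2]; exact hs'.trans ht
      rw [hX.lt_iff (by omega) (by omega)] at h1 h2
      obtain rfl : i = j := by omega
      exact ⟨h.1.trans h'.1.symm, h.2.trans h'.2.symm⟩
    · have := hX.lt j hj
      rw [← h'.1, ← h'.2] at this
      linarith
  · have := hX.lt i hi
    rw [← h.1, ← h.2] at this
    linarith

lemma Neighbor.unique (hX : IsMesh1D n X) {s t t' : ℝ} (h : Neighbor n X s t) (h' : Neighbor n X s t')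
    (hpos : 0 < (t - s) * (t' - s)) : t = t' := by
  rcases pos_and_pos_or_neg_and_neg_of_mul_pos hpos with ⟨h1, h2⟩ | ⟨h1, h2⟩
  · refine (h.eq_of_mem hX h' (p := s + min (t - s) (t' - s) / 2) ?_ ?_ ?_ ?_).2 <;>
      linarith [lt_min h1 h2, min_le_left (t - s) (t' - s), min_le_right (t - s) (t' - s)]
  · refine (h.symm.eq_of_mem hX h'.symm (p := s - min (s - t) (s - t') / 2) ?_ ?_ ?_ ?_).1 <;>
      linarith [lt_min (a := (0 : ℝ)) (b := s - t) (c := s - t') (by linarith) (by linarith),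
        min_le_left (s - t) (s - t'), min_le_right (s - t) (s - t')]

lemma IsMesh1D.mem_Icc (hX : IsMesh1D n X) {i : ℕ} (hi : i ≤ n) : X i ∈ Icc (0 : ℝ) 1 := by
  constructor
  · rw [← hX.left]
    rcases Nat.eq_zero_or_pos i with rfl | h
    · exact le_rfl
    · exact (hX.lt_of_lt h hi).le
  · rw [← hX.right]
    rcases hi.eq_or_lt with rfl | h
    · exact le_rfl
    · exact (hX.lt_of_lt h le_rfl).le

lemma Neighbor.mem_Icc (hX : IsMesh1D n X) {s t : ℝ} (h : Neighbor n X s t) : t ∈ Icc (0 : ℝ) 1 := by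
  obtain ⟨i, hi, h | h⟩ := h
  · rw [h.2]; exact hX.mem_Icc (by omega)
  · rw [h.2]; exact hX.mem_Icc (by omega)

lemma Neighbor.ne (hX : IsMesh1D n X) {s t : ℝ} (h : Neighbor n X s t) : t ≠ s := by
  obtain ⟨i, hi, h | h⟩ := h
  · rw [h.1, h.2]; exact (hX.lt i hi).ne'
  · rw [h.1, h.2]; exact (hX.lt i hi).ne

/-- A mesh all of whose elements have vertical short edges on the lines of the mesh `X` and comparable
dimensions within each patch. -/
structure StripMesh (K : Mesh) (n : ℕ) (X : ℕ → ℝ) (A : ℝ) (M : ℕ) : Prop where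
  mesh1D : IsMesh1D n X
  one_le : 1 ≤ A
  shape : ∀ T ∈ K.tri, ∃ a b c, Shape K n X A T a b c
  valence : ∀ z ∈ K.nodes, (K.triAt z).card ≤ M
  hz_le_Hz : ∀ z ∈ K.nodes, K.hz z ≤ A * K.Hz z

lemma Shape.height_pos {T : Finset Pt} (hT : T ∈ K.tri) {a b c : Pt} (h : Shape K n X A T a b c) :
    0 < |b 1 - a 1| := by
  have := (distinct_of_mem_tri (h.eq ▸ hT)).1
  refine abs_pos.2 fun h' => this (pt_ext h.base (by linarith))

lemma Shape.width_pos {T : Finset Pt} (hT : T ∈ K.tri) {a b c : Pt} (h : Shape K n X A T a b c) :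
    0 < |c 0 - a 0| := by
  have := cross_ne_zero (h.eq ▸ hT)
  refine abs_pos.2 fun h' => this ?_
  simp only [cross, PiLp.sub_apply, ← h.base, h']; ring

lemma Shape.abs_cross {T : Finset Pt} {a b c : Pt} (h : Shape K n X A T a b c) :
    |cross (b - a) (c - a)| = |b 1 - a 1| * |c 0 - a 0| := by
  rw [← abs_mul, ← abs_neg]; congr 1; simp [cross, ← h.base]

/-- Two edges that join the same two vertical lines do not cross: otherwise, by conformity, the four endpoints
would be vertices of one triangle. -/
lemma noncrossing {z z' w w' : Pt} (h : z' ∈ K.edgesAt z) (h' : w' ∈ K.edgesAt w) (h0 : z 0 = w 0)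
    (h0' : z' 0 = w' 0) (hne : z 0 ≠ z' 0) : 0 ≤ (w 1 - z 1) * (w' 1 - z' 1) := by
  by_contra! hneg
  obtain ⟨hzz, T, hT, hzT, hzT'⟩ := mem_edgesAt.1 h
  obtain ⟨hww, T', hT', hwT, hwT'⟩ := mem_edgesAt.1 h'
  set d := w 1 - z 1 with hd
  set d' := w' 1 - z' 1 with hd'
  have hdd : d - d' ≠ 0 := fun h => by
    have : d = d' := by linarith
    rw [this] at hneg; nlinarith [mul_self_nonneg d']
  set t := d / (d - d') with ht
  have h1t : 1 - t = -d' / (d - d') := by rw [ht]; field_simp; ring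
  have htpos : 0 < t := by
    rw [ht, ← mul_div_mul_right d _ hdd]
    exact div_pos (by nlinarith [mul_self_nonneg d]) (mul_self_pos.2 hdd)
  have ht1 : 0 < 1 - t := by
    rw [h1t, ← mul_div_mul_right (-d') _ hdd]
    exact div_pos (by nlinarith [mul_self_nonneg d']) (mul_self_pos.2 hdd)
  have htI : t ∈ Icc (0 : ℝ) 1 := ⟨htpos.le, by linarith⟩
  have hx : AffineMap.lineMap z z' t = AffineMap.lineMap w w' t := by
    refine pt_ext ?_ ?_
    · simp [AffineMap.lineMap_apply, h0, h0']
    · simp only [AffineMap.lineMap_apply, vsub_eq_sub, vadd_eq_add, PiLp.add_apply, PiLp.smul_apply,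
          PiLp.sub_apply, smul_eq_mul]
      have : (1 - t) * d + t * d' = 0 := by rw [h1t, ht]; field_simp; ring
      rw [hd, hd'] at this
      linarith
  have hxT := lineMap_mem_tri hzT hzT' htI
  have hxT' := lineMap_mem_tri hwT hwT' htI
  rw [← hx] at hxT'
  have hz1 : z ∈ T' := mem_of_lam_ne_zero hT hT' hxT hxT' (by
    rw [AffineMap.apply_lineMap, lam_apply hT hzT, lam_apply hT hzT', AffineMap.lineMap_apply]
    simp [hzz.symm]; linarith)
  have hz2 : z' ∈ T' := mem_of_lam_ne_zero hT hT' hxT hxT' (by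
    rw [AffineMap.apply_lineMap, lam_apply hT hzT, lam_apply hT hzT', AffineMap.lineMap_apply]
    simp [hzz, htpos.ne'])
  have n1 : z ≠ w := fun h => by rw [hd, h, sub_self, zero_mul] at hneg; exact lt_irrefl _ hneg
  have n2 : z' ≠ w' := fun h => by rw [hd', h, sub_self, mul_zero] at hneg; exact lt_irrefl _ hneg
  have n3 : z ≠ w' := fun h => hne (by rw [h, h0'])
  have n4 : w ≠ z' := fun h => hne (by rw [h0, h])
  have hsub : ({z, z', w, w'} : Finset Pt) ⊆ T' := by
    intro x hx
    simp only [Finset.mem_insert, Finset.mem_singleton] at hx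
    rcases hx with rfl | rfl | rfl | rfl <;> assumption
  have hcard := Finset.card_le_card hsub
  rw [K.card_eq_three T' hT', Finset.card_insert_of_notMem (by simp [hzz.symm, n1, n3]),
    Finset.card_insert_of_notMem (by simp [n4.symm, n2]), Finset.card_pair hww.symm] at hcard
  omega

namespace StripMesh

variable (hK : StripMesh K n X A M)
include hK

lemma A_pos : 0 < A := zero_lt_one.trans_le hK.one_le

lemma hz_pos {z : Pt} (hz : z ∈ K.nodes) : 0 < K.hz z := by
  obtain ⟨T, hT, hzT⟩ := mem_nodes.1 hz
  obtain ⟨a, b, c, h⟩ := hK.shape T hT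
  exact pos_of_mul_pos_right ((h.height_pos hT).trans_le (h.le_hz z hzT)) hK.A_pos.le

lemma Hz_pos {z : Pt} (hz : z ∈ K.nodes) : 0 < K.Hz z := by
  obtain ⟨T, hT, hzT⟩ := mem_nodes.1 hz
  obtain ⟨a, b, c, h⟩ := hK.shape T hT
  exact pos_of_mul_pos_right ((h.width_pos hT).trans_le (h.le_Hz z hzT)) hK.A_pos.le

lemma patchArea_eq {z : Pt} (hz : z ∈ K.nodes) : K.patchArea z = K.hz z * K.Hz z := by
  rw [Mesh.hz, div_mul_cancel₀ _ (hK.Hz_pos hz).ne']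

lemma hz_le_hz {T : Finset Pt} (hT : T ∈ K.tri) {z z' : Pt} (hz : z ∈ T) (hz' : z' ∈ T) :
    K.hz z ≤ A ^ 2 * K.hz z' := by
  obtain ⟨a, b, c, h⟩ := hK.shape T hT
  have := mul_le_mul_of_nonneg_left (h.le_hz z' hz') hK.A_pos.le
  linarith [h.hz_le z hz]

/-- A vertex of an element either belongs to its vertical side or is opposite to it. -/
lemma shape_cases {T : Finset Pt} (hT : T ∈ K.tri) {z : Pt} (hz : z ∈ T) :
    (∃ b w, Shape K n X A T z b w) ∨ ∃ a b, Shape K n X A T a b z := by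
  obtain ⟨a, b, c, h⟩ := hK.shape T hT
  have hz' := hz
  rw [h.eq] at hz'
  simp only [Finset.mem_insert, Finset.mem_singleton] at hz'
  rcases hz' with rfl | rfl | rfl
  · exact Or.inl ⟨b, c, h⟩
  · exact Or.inl ⟨a, c, h.symm⟩
  · exact Or.inr ⟨a, b, h⟩

/-- An edge either is the vertical side of an element or joins two adjacent lines of the mesh `X` with a rise at
most of order `h_z`. -/
lemma edge_cases {z z' : Pt} (h : z' ∈ K.edgesAt z) :
    (z' 0 = z 0 ∧ ∃ T ∈ K.tri, ∃ w, Shape K n X A T z z' w) ∨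
    (Neighbor n X (z 0) (z' 0) ∧ K.Hz z ≤ A * |z' 0 - z 0| ∧ |z' 0 - z 0| ≤ A * K.Hz z ∧
      |z' 1 - z 1| ≤ A * K.hz z) := by
  obtain ⟨hne, T, hT, hz, hz'⟩ := mem_edgesAt.1 h
  rcases hK.shape_cases hT hz with ⟨b, w, hs⟩ | ⟨a, b, hs⟩
  · rw [hs.eq] at hz'
    simp only [Finset.mem_insert, Finset.mem_singleton] at hz'
    rcases hz' with rfl | rfl | rfl
    · exact absurd rfl hne
    · exact Or.inl ⟨hs.base.symm, T, hT, w, hs⟩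
    · exact Or.inr ⟨hs.slab, hs.Hz_le z hz, hs.le_Hz z hz, hs.left_le z hz⟩
  · have key : ∀ {a b : Pt}, Shape K n X A T a b z →
        Neighbor n X (z 0) (a 0) ∧ K.Hz z ≤ A * |a 0 - z 0| ∧ |a 0 - z 0| ≤ A * K.Hz z ∧
          |a 1 - z 1| ≤ A * K.hz z := fun {a b} hs => by
      rw [abs_sub_comm (a 0), abs_sub_comm (a 1)]
      exact ⟨hs.slab.symm, hs.Hz_le z hz, hs.le_Hz z hz, hs.left_le z hz⟩
    rw [hs.eq] at hz'
    simp only [Finset.mem_insert, Finset.mem_singleton] at hz'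
    rcases hz' with rfl | rfl | rfl
    · exact Or.inr (key hs)
    · exact Or.inr (key hs.symm)
    · exact absurd rfl hne

lemma card_edgesAt_le {z : Pt} (hz : z ∈ K.nodes) : (K.edgesAt z).card ≤ 3 * M := by
  have h1 : K.edgesAt z ⊆ (K.triAt z).biUnion id := fun z' h => by
    obtain ⟨-, T, hT, h1, h2⟩ := mem_edgesAt.1 h
    exact Finset.mem_biUnion.2 ⟨T, mem_triAt.2 ⟨hT, h1⟩, h2⟩
  refine (Finset.card_le_card h1).trans ((Finset.card_biUnion_le_card_mul _ _ 3 fun T hT => ?_).trans ?_)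
  · exact (K.card_eq_three T (mem_triAt.1 hT).1).le
  · rw [mul_comm]; exact Nat.mul_le_mul_left 3 (hK.valence z hz)

/-- Distinct nodes `z`, `z'` on a vertical line are at least at a distance of order `h_z`. -/
lemma hz_le_dist {z z' : Pt} (hz : z ∈ K.nodes) (hz' : z' ∈ K.nodes) (h0 : z 0 = z' 0) (hne : z ≠ z') :
    K.hz z ≤ A * |z' 1 - z 1| := by
  have hlim : Tendsto (fun s : ℝ => AffineMap.lineMap z z' s) (𝓝[>] 0) (𝓝 z) := by
    have : Continuous fun s : ℝ => AffineMap.lineMap z z' s := AffineMap.lineMap_continuous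
    simpa using (this.tendsto 0).mono_left nhdsWithin_le_nhds
  have hmem : ∀ᶠ s in 𝓝[>] (0 : ℝ), AffineMap.lineMap z z' s ∈ closure Ω := by
    filter_upwards [Ioo_mem_nhdsGT (zero_lt_one (α := ℝ))] with s hs
    exact convex_Ω.closure.lineMap_mem (nodes_subset hz) (nodes_subset hz') ⟨hs.1.le, hs.2.le⟩
  obtain ⟨T, hT, hzT, hfr⟩ := exists_tri_frequently_of_tendsto (K := K) hmem hlim
  obtain ⟨T₀, hT₀, hzT₀⟩ := mem_nodes.1 hz
  replace hzT := vertex_mem_of_mem_convexHull hT₀ hT hzT₀ hzT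
  obtain ⟨s, hsT, hs⟩ := (hfr.and_eventually self_mem_nhdsWithin).exists
  change 0 < s at hs
  have hz1 : z' 1 - z 1 ≠ 0 := fun h => hne (pt_ext h0 (by linarith))
  have e0 : AffineMap.lineMap z z' s 0 = z 0 := by simp [AffineMap.lineMap_apply, h0]
  have e1 : AffineMap.lineMap z z' s 1 = z 1 + s * (z' 1 - z 1) := by
    simp [AffineMap.lineMap_apply]; ring
  rcases hK.shape_cases hT hzT with ⟨b, w, hsh⟩ | ⟨a, b, hsh⟩
  · have hw := hsh.width_pos hT
    have hsT' := hsT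
    rw [hsh.eq, coe_triple, mem_convexHull_triple] at hsT'
    obtain ⟨α, β, γ, hα, hβ, hγ, hsum, hx⟩ := hsT'
    have c0 := congrArg (fun p : Pt => p 0) hx
    have c1 := congrArg (fun p : Pt => p 1) hx
    simp only [PiLp.add_apply, PiLp.smul_apply, smul_eq_mul] at c0 c1
    rw [e0, ← hsh.base] at c0
    rw [e1] at c1
    have hγ0 : γ = 0 := by
      have : γ * (w 0 - z 0) = 0 := by linear_combination c0 - z 0 * hsum
      rcases mul_eq_zero.1 this with h | h
      · exact h
      · rw [h, abs_zero] at hw; exact absurd hw (lt_irrefl _)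
    have hdir : β * (b 1 - z 1) = s * (z' 1 - z 1) := by rw [hγ0] at c1 hsum; linear_combination c1 - z 1 * hsum
    have hzb := hsh.hz_le z hzT
    refine hzb.trans (mul_le_mul_of_nonneg_left ?_ hK.A_pos.le)
    by_contra! hlt
    -- the node `z'` would lie in the interior of the vertical side `zb`
    have hr : ∃ r : ℝ, 0 < r ∧ r < 1 ∧ z' 1 - z 1 = r * (b 1 - z 1) := by
      have hb : b 1 - z 1 ≠ 0 := fun h => by rw [h, abs_zero] at hlt; exact absurd hlt (abs_nonneg _).not_gt
      refine ⟨(z' 1 - z 1) / (b 1 - z 1), ?_, ?_, by field_simp⟩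
      · have hβ0 : 0 < β := by
          rcases hβ.lt_or_eq with h | h
          · exact h
          · rw [← h, zero_mul] at hdir; exact absurd hdir.symm (mul_ne_zero hs.ne' hz1)
        have : (z' 1 - z 1) / (b 1 - z 1) = β / s := by field_simp; linarith
        rw [this]; positivity
      · refine (le_abs_self _).trans_lt ?_
        rw [abs_div, div_lt_one (abs_pos.2 hb)]; exact hlt
    obtain ⟨r, hr0, hr1, hr⟩ := hr
    have hz'e : z' = AffineMap.lineMap z b r := by
      refine pt_ext ?_ ?_
      · simp [AffineMap.lineMap_apply, ← hsh.base, h0]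
      · simp only [AffineMap.lineMap_apply, vsub_eq_sub, vadd_eq_add, PiLp.add_apply, PiLp.smul_apply,
          PiLp.sub_apply, smul_eq_mul]
        linarith
    have hbT : b ∈ T := by rw [hsh.eq]; simp
    have hz'c : z' ∈ convexHull ℝ (T : Set Pt) := by rw [hz'e]; exact lineMap_mem_tri hzT hbT ⟨hr0.le, hr1.le⟩
    obtain ⟨T₁, hT₁, hzT₁⟩ := mem_nodes.1 hz'
    have hz'T := vertex_mem_of_mem_convexHull hT₁ hT hzT₁ hz'c
    rw [hsh.eq] at hz'T
    simp only [Finset.mem_insert, Finset.mem_singleton] at hz'T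
    rcases hz'T with h | h | h
    · exact hne h.symm
    · rw [h] at hlt; exact lt_irrefl _ hlt
    · rw [← h, ← h0, sub_self, abs_zero] at hw; exact lt_irrefl _ hw
  · exfalso
    have hw := hsh.width_pos hT
    rw [hsh.eq, coe_triple, mem_convexHull_triple] at hsT
    obtain ⟨α, β, γ, hα, hβ, hγ, hsum, hx⟩ := hsT
    have c0 := congrArg (fun p : Pt => p 0) hx
    have c1 := congrArg (fun p : Pt => p 1) hx
    simp only [PiLp.add_apply, PiLp.smul_apply, smul_eq_mul] at c0 c1
    rw [e0, ← hsh.base] at c0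
    rw [e1] at c1
    have hαβ : α + β = 0 := by
      have : (α + β) * (z 0 - a 0) = 0 := by linear_combination -c0 + z 0 * hsum
      rcases mul_eq_zero.1 this with h | h
      · exact h
      · rw [h, abs_zero] at hw; exact absurd hw (lt_irrefl _)
    have hα0 : α = 0 := by linarith
    have hβ0 : β = 0 := by linarith
    have hγ1 : γ = 1 := by linarith
    rw [hα0, hβ0, hγ1] at c1
    have : s * (z' 1 - z 1) = 0 := by linarith
    exact mul_ne_zero hs.ne' hz1 this

/-- On either side of a node away from the horizontal sides of the square there is an element whose vertical
side originates at the node. It is found on a parabola that is tangent to the vertical line through the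
node, since the elements that merely touch this line at the node stay away from the parabola. -/
lemma exists_base {z : Pt} (hz : z ∈ K.nodes) (h1 : 0 < z 1) (h1' : z 1 < 1) {ξ : ℝ}
    (hξ : Neighbor n X (z 0) ξ) :
    ∃ T ∈ K.tri, ∃ b w, Shape K n X A T z b w ∧ w 0 = ξ := by
  have hξ01 := hξ.mem_Icc hK.mesh1D
  have hz01 := hξ.symm.mem_Icc hK.mesh1D
  have hξz := hξ.ne hK.mesh1D
  set c : ℝ → Pt := fun s => z + !₂[s ^ 2 * (ξ - z 0), s] with hc
  have c0 : ∀ s, c s 0 = z 0 + s ^ 2 * (ξ - z 0) := fun s => by simp [hc]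
  have c1 : ∀ s, c s 1 = z 1 + s := fun s => by simp [hc]
  have hlim : Tendsto c (𝓝[>] 0) (𝓝 z) := by
    have h : Continuous c := by rw [hc]; fun_prop
    have h0 : c 0 = z := pt_ext (by rw [c0]; simp) (by rw [c1]; simp)
    have := (h.tendsto 0).mono_left (nhdsWithin_le_nhds (s := Ioi 0))
    rwa [h0] at this
  have hmem : ∀ᶠ s in 𝓝[>] (0 : ℝ), c s ∈ closure Ω := by
    filter_upwards [Ioo_mem_nhdsGT (zero_lt_one (α := ℝ)), Ioo_mem_nhdsGT (sub_pos.2 h1')] with s hs hs'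
    rw [mem_closure_Ω, c0, c1]
    have hs2 : s ^ 2 ≤ 1 := pow_le_one₀ hs.1.le hs.2.le
    refine ⟨⟨?_, ?_⟩, by linarith [hs.1], by linarith [hs'.2]⟩
    · nlinarith [mul_nonneg (sub_nonneg.2 hs2) hz01.1, mul_nonneg (sq_nonneg s) hξ01.1]
    · nlinarith [mul_nonneg (sub_nonneg.2 hs2) (sub_nonneg.2 hz01.2),
        mul_nonneg (sq_nonneg s) (sub_nonneg.2 hξ01.2)]
  obtain ⟨T, hT, hzT, hfr⟩ := exists_tri_frequently_of_tendsto (K := K) hmem hlim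
  obtain ⟨T₀, hT₀, hzT₀⟩ := mem_nodes.1 hz
  replace hzT := vertex_mem_of_mem_convexHull hT₀ hT hzT₀ hzT
  refine ⟨T, hT, ?_⟩
  rcases hK.shape_cases hT hzT with ⟨b, w, hsh⟩ | ⟨a, b, hsh⟩
  · obtain ⟨s, hsT, hs⟩ := (hfr.and_eventually self_mem_nhdsWithin).exists
    change 0 < s at hs
    refine ⟨b, w, hsh, hsh.slab.unique hK.mesh1D hξ ?_⟩
    rw [hsh.eq, coe_triple, mem_convexHull_triple] at hsT
    obtain ⟨α, β, γ, hα, hβ, hγ, hsum, hx⟩ := hsT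
    have e0 := congrArg (fun p : Pt => p 0) hx
    simp only [PiLp.add_apply, PiLp.smul_apply, smul_eq_mul] at e0
    rw [c0, ← hsh.base] at e0
    have e1 : γ * (w 0 - z 0) = s ^ 2 * (ξ - z 0) := by linear_combination e0 - z 0 * hsum
    have e2 : γ * ((w 0 - z 0) * (ξ - z 0)) = s ^ 2 * ((ξ - z 0) * (ξ - z 0)) := by
      rw [← mul_assoc, e1]; ring
    have e3 : 0 < s ^ 2 * ((ξ - z 0) * (ξ - z 0)) := mul_pos (by positivity) (mul_self_pos.2 (sub_ne_zero.2 hξz))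
    rw [← e2] at e3
    exact pos_of_mul_pos_right e3 hγ
  · exfalso
    have hw := hsh.width_pos hT
    set B := |a 1 - z 1| + |b 1 - z 1| with hB
    have hev : ∀ᶠ s in 𝓝[>] (0 : ℝ), s * (|ξ - z 0| * B) < |z 0 - a 0| := by
      have h : Continuous fun s : ℝ => s * (|ξ - z 0| * B) := by fun_prop
      have := (h.tendsto 0).mono_left (nhdsWithin_le_nhds (s := Ioi 0))
      rw [zero_mul] at this
      exact this.eventually_lt_const hw
    obtain ⟨s, hsT, hs, hsB⟩ := (hfr.and_eventually ((eventually_mem_nhdsWithin (s := Ioi 0)).and hev)).exists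
    change 0 < s at hs
    rw [hsh.eq, coe_triple, mem_convexHull_triple] at hsT
    obtain ⟨α, β, γ, hα, hβ, hγ, hsum, hx⟩ := hsT
    have e0 := congrArg (fun p : Pt => p 0) hx
    have e1 := congrArg (fun p : Pt => p 1) hx
    simp only [PiLp.add_apply, PiLp.smul_apply, smul_eq_mul] at e0 e1
    rw [c0, ← hsh.base] at e0
    rw [c1] at e1
    have f0 : (α + β) * (z 0 - a 0) = -(s ^ 2 * (ξ - z 0)) := by linear_combination -e0 + z 0 * hsum
    have f1 : s = α * (a 1 - z 1) + β * (b 1 - z 1) := by linear_combination -e1 + z 1 * hsum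
    have g0 : (α + β) * |z 0 - a 0| = s ^ 2 * |ξ - z 0| := by
      have := congrArg abs f0
      rwa [abs_neg, abs_mul, abs_mul, abs_of_nonneg (add_nonneg hα hβ), abs_of_nonneg (sq_nonneg s)] at this
    -- the barycentric weight of the opposite side would have to be of order `s` in the vertical and `s²` in the
    -- horizontal direction
    have g1 : s ≤ (α + β) * B := by
      have h1 := mul_le_mul_of_nonneg_left (le_abs_self (a 1 - z 1)) hα
      have h2 := mul_le_mul_of_nonneg_left (le_abs_self (b 1 - z 1)) hβ
      have h3 := mul_nonneg hα (abs_nonneg (b 1 - z 1))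
      have h4 := mul_nonneg hβ (abs_nonneg (a 1 - z 1))
      rw [hB]; nlinarith
    have g2 : s * |z 0 - a 0| ≤ s * (s * (|ξ - z 0| * B)) := by
      calc s * |z 0 - a 0| ≤ (α + β) * B * |z 0 - a 0| := mul_le_mul_of_nonneg_right g1 (abs_nonneg _)
        _ = s ^ 2 * |ξ - z 0| * B := by rw [← g0]; ring
        _ = _ := by ring
    exact absurd (le_of_mul_le_mul_left g2 hs) (not_le.2 hsB)

end StripMesh

end Mesh

/-! ### The bounded overlap of the regions between edges and horizontal lines -/

/-- A bound on the number of elements of a family of real numbers in a bounded interval whose distinct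
members are spaced, each of them attained at most `D` times. -/
lemma card_le_of_spaced {ι : Type*} (Q : Finset ι) (f : ι → ℝ) {c L δ : ℝ} (hδ : 0 < δ)
    (hf : ∀ i ∈ Q, c ≤ f i ∧ f i ≤ c + L) (hs : ∀ i ∈ Q, ∀ j ∈ Q, f i ≠ f j → δ ≤ |f i - f j|) {D : ℕ}
    (hD : ∀ i ∈ Q, (Q.filter fun j => f j = f i).card ≤ D) : Q.card ≤ D * (⌊L / δ⌋₊ + 1) := by
  refine (Finset.card_le_mul_card_image (f := f) Q D fun y hy => ?_).trans (Nat.mul_le_mul_left D ?_)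
  · obtain ⟨i, hi, rfl⟩ := Finset.mem_image.1 hy
    exact hD i hi
  rw [← Finset.card_range (⌊L / δ⌋₊ + 1)]
  refine Finset.card_le_card_of_injOn (fun y => ⌊(y - c) / δ⌋₊) (fun y hy => ?_) fun y hy y' hy' h => ?_
  · obtain ⟨i, hi, rfl⟩ := Finset.mem_image.1 hy
    rw [Finset.mem_coe, Finset.mem_range, Nat.lt_succ_iff]
    exact Nat.floor_le_floor (div_le_div_of_nonneg_right (by linarith [hf i hi]) hδ.le)
  · obtain ⟨i, hi, rfl⟩ := Finset.mem_image.1 hy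
    obtain ⟨j, hj, rfl⟩ := Finset.mem_image.1 hy'
    by_contra hne
    have h1 := Nat.floor_le (div_nonneg (sub_nonneg.2 (hf i hi).1) hδ.le)
    have h2 := Nat.floor_le (div_nonneg (sub_nonneg.2 (hf j hj).1) hδ.le)
    have h3 := Nat.lt_floor_add_one ((f i - c) / δ)
    have h4 := Nat.lt_floor_add_one ((f j - c) / δ)
    simp only at h
    rw [h] at h1 h3
    have h5 : |f i - f j| < δ := by
      have : |(f i - c) / δ - (f j - c) / δ| < 1 := abs_lt.2 ⟨by linarith, by linarith⟩
      rw [← sub_div, abs_div, abs_of_pos hδ, div_lt_one hδ] at this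
      rwa [sub_sub_sub_cancel_right] at this
    exact absurd (hs i hi j hj hne) (not_le.2 h5)

/-- A family of ordered (noncrossing) intervals `[u i, v i]` with a common point is finite with an absolute
bound, if the lengths are controlled by weights `h i` that are in turn controlled by the gaps between
distinct endpoints. The endpoints are compared with those of an interval of least weight. -/
lemma card_le_of_noncrossing {ι : Type*} (P : Finset ι) (u v h : ι → ℝ) {p B : ℝ} (hB : 0 < B) {D : ℕ}
    (hpos : ∀ i ∈ P, 0 < h i) (hu : ∀ i ∈ P, u i ≤ p) (hv : ∀ i ∈ P, p ≤ v i)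
    (hlen : ∀ i ∈ P, v i - u i ≤ B * h i)
    (hsu : ∀ i ∈ P, ∀ j ∈ P, u i ≠ u j → h i ≤ B * |u i - u j|)
    (hsv : ∀ i ∈ P, ∀ j ∈ P, v i ≠ v j → h i ≤ B * |v i - v j|)
    (hmono : ∀ i ∈ P, ∀ j ∈ P, u i < u j → v i ≤ v j)
    (hDu : ∀ i ∈ P, (P.filter fun j => u j = u i).card ≤ D)
    (hDv : ∀ i ∈ P, (P.filter fun j => v j = v i).card ≤ D) :
    P.card ≤ 2 * (D * (⌊B ^ 2⌋₊ + 1)) := by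
  rcases P.eq_empty_or_nonempty with rfl | hne
  · simp
  obtain ⟨k, hk, hmin⟩ := P.exists_min_image h hne
  have hδ : 0 < h k / B := div_pos (hpos k hk) hB
  have hL : B * h k / (h k / B) = B ^ 2 := by have := (hpos k hk).ne'; field_simp
  -- intervals that begin after that of least weight have their left endpoints in it; the others end before
  -- its right endpoint, by monotonicity
  have h1 := card_le_of_spaced (P.filter fun i => u k ≤ u i) u (c := u k) (L := B * h k) hδ (D := D)
    (fun i hi => by
      obtain ⟨hi, hki⟩ := Finset.mem_filter.1 hi
      exact ⟨hki, by linarith [hu i hi, hv k hk, hlen k hk]⟩)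
    (fun i hi j hj hij => by
      rw [div_le_iff₀ hB, mul_comm]
      exact (hmin i (Finset.mem_filter.1 hi).1).trans
        (hsu i (Finset.mem_filter.1 hi).1 j (Finset.mem_filter.1 hj).1 hij))
    (fun i hi => (Finset.card_le_card (Finset.filter_subset_filter _ (Finset.filter_subset _ _))).trans
      (hDu i (Finset.mem_filter.1 hi).1))
  have h2 := card_le_of_spaced (P.filter fun i => ¬ u k ≤ u i) v (c := p) (L := B * h k) hδ (D := D)
    (fun i hi => by
      obtain ⟨hi, hki⟩ := Finset.mem_filter.1 hi
      exact ⟨hv i hi, by linarith [hmono i hi k hk (not_le.1 hki), hu k hk, hlen k hk]⟩)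
    (fun i hi j hj hij => by
      rw [div_le_iff₀ hB, mul_comm]
      exact (hmin i (Finset.mem_filter.1 hi).1).trans
        (hsv i (Finset.mem_filter.1 hi).1 j (Finset.mem_filter.1 hj).1 hij))
    (fun i hi => (Finset.card_le_card (Finset.filter_subset_filter _ (Finset.filter_subset _ _))).trans
      (hDv i (Finset.mem_filter.1 hi).1))
  rw [hL] at h1 h2
  rw [← Finset.card_filter_add_card_filter_not (s := P) (fun i => u k ≤ u i)]
  omega

namespace Mesh

variable {K : Mesh} {n : ℕ} {X : ℕ → ℝ} {A : ℝ} {M : ℕ}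

/-- The point on the horizontal line through `z` with the abscissa of `z'`. -/
noncomputable def foot (z z' : Pt) : Pt := !₂[z' 0, z 1]

@[simp] lemma foot_zero (z z' : Pt) : foot z z' 0 = z' 0 := by simp [foot]
@[simp] lemma foot_one (z z' : Pt) : foot z z' 1 = z 1 := by simp [foot]

/-- The triangle between the edge `zz'` and the horizontal line through `z`. -/
def region (z z' : Pt) : Set Pt := convexHull ℝ {z, foot z z', z'}

lemma foot_mem {z z' : Pt} (hz : z ∈ closure Ω) (hz' : z' ∈ closure Ω) : foot z z' ∈ closure Ω := by
  rw [mem_closure_Ω] at *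
  simp only [foot_zero, foot_one]
  exact ⟨hz'.1, hz.2⟩

lemma region_subset {z z' : Pt} (hz : z ∈ closure Ω) (hz' : z' ∈ closure Ω) : region z z' ⊆ closure Ω := by
  refine convexHull_min ?_ convex_Ω.closure
  rintro x (rfl | rfl | rfl)
  exacts [hz, foot_mem hz hz', hz']

lemma mem_region {z z' x : Pt} (h : x ∈ region z z') :
    ∃ s ∈ Icc (0 : ℝ) 1, ∃ r ∈ Icc (0 : ℝ) 1, x 0 = z 0 + s * (z' 0 - z 0) ∧ x 1 = z 1 + r * (z' 1 - z 1) := by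
  obtain ⟨α, β, γ, hα, hβ, hγ, hsum, rfl⟩ := mem_convexHull_triple.1 h
  refine ⟨β + γ, ⟨by linarith, by linarith⟩, γ, ⟨hγ, by linarith⟩, ?_, ?_⟩
  · simp only [PiLp.add_apply, PiLp.smul_apply, smul_eq_mul, foot_zero]
    linear_combination (z 0) * hsum
  · simp only [PiLp.add_apply, PiLp.smul_apply, smul_eq_mul, foot_one]
    linear_combination (z 1) * hsum

/-- The pairs of endpoints of the non-vertical edges. -/
noncomputable def slantPairs (K : Mesh) : Finset (Σ _ : Pt, Pt) :=
  K.nodes.sigma fun z => (K.edgesAt z).filter fun z' => z' 0 ≠ z 0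

lemma mem_slantPairs {p : Σ _ : Pt, Pt} :
    p ∈ K.slantPairs ↔ p.1 ∈ K.nodes ∧ p.2 ∈ K.edgesAt p.1 ∧ p.2 0 ≠ p.1 0 := by
  simp [slantPairs]

/-- The bound for the number of regions that overlap. -/
noncomputable def overlapConst (A : ℝ) (M : ℕ) : ℕ := 4 * (2 * (3 * M * (⌊(A ^ 3) ^ 2⌋₊ + 1)))

namespace StripMesh

variable (hK : StripMesh K n X A M)
include hK

/-- The overlap of the regions to the right (`θ = 1`) or to the left (`θ = -1`) of the nodes and above (`σ = 1`)
or below (`σ = -1`) them. The edges of those that contain `x` join the same two vertical lines and do not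
cross, so that the vertical extents of the regions form an ordered family of intervals. -/
lemma card_regions_le_aux {x : Pt} (hx : ∀ z ∈ K.nodes, z 0 ≠ x 0) {θ σ : ℝ} (hθ : θ = 1 ∨ θ = -1)
    (hσ : σ = 1 ∨ σ = -1) :
    (K.slantPairs.filter fun p => x ∈ region p.1 p.2 ∧ 0 < θ * (x 0 - p.1 0) ∧ 0 ≤ σ * (p.2 1 - p.1 1)).card ≤
      2 * (3 * M * (⌊(A ^ 3) ^ 2⌋₊ + 1)) := by
  set P := K.slantPairs.filter fun p => x ∈ region p.1 p.2 ∧ 0 < θ * (x 0 - p.1 0) ∧ 0 ≤ σ * (p.2 1 - p.1 1)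
    with hP
  have hA := hK.A_pos
  have hσ2 : σ * σ = 1 := by rcases hσ with rfl | rfl <;> norm_num
  have hσabs : |σ| = 1 := by rcases hσ with rfl | rfl <;> norm_num
  have hmem : ∀ p ∈ P, p.1 ∈ K.nodes ∧ p.2 ∈ K.nodes ∧ p.2 ∈ K.edgesAt p.1 ∧ p.2 0 ≠ p.1 0 ∧
      0 < θ * (x 0 - p.1 0) ∧ 0 < θ * (p.2 0 - x 0) ∧ σ * p.1 1 ≤ σ * x 1 ∧ σ * x 1 ≤ σ * p.2 1 := by
    intro p hp
    obtain ⟨hp, hxR, hθp, hσp⟩ := Finset.mem_filter.1 hp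
    obtain ⟨h1, h2, h3⟩ := mem_slantPairs.1 hp
    obtain ⟨-, T, hT, h4, h5⟩ := mem_edgesAt.1 h2
    have h6 := subset_nodes hT h5
    obtain ⟨s, hs, r, hr, e0, e1⟩ := mem_region hxR
    refine ⟨h1, h6, h2, h3, hθp, ?_, ?_, ?_⟩
    · have hne : θ * (p.2 0 - x 0) ≠ 0 := by
        refine mul_ne_zero ?_ (sub_ne_zero.2 (hx _ h6))
        rcases hθ with rfl | rfl <;> norm_num
      refine lt_of_le_of_ne ?_ hne.symm
      have hs0 : 0 < s := by
        refine lt_of_le_of_ne hs.1 fun h => ?_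
        rw [← h, zero_mul, add_zero] at e0
        exact hx _ h1 e0.symm
      have e2 : θ * (x 0 - p.1 0) = s * (θ * (p.2 0 - p.1 0)) := by rw [e0]; ring
      rw [e2] at hθp
      have e3 : θ * (p.2 0 - x 0) = (1 - s) * (θ * (p.2 0 - p.1 0)) := by rw [e0]; ring
      rw [e3]
      exact mul_nonneg (by linarith [hs.2]) (pos_of_mul_pos_right hθp hs.1).le
    · rw [e1]
      have := mul_nonneg hr.1 hσp
      linarith
    · rw [e1]
      have := mul_nonneg (sub_nonneg.2 hr.2) hσp
      linarith
  have hNb : ∀ p ∈ P, Neighbor n X (p.1 0) (p.2 0) ∧ |p.2 1 - p.1 1| ≤ A * K.hz p.1 := fun p hp => by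
    obtain ⟨-, -, h1, h2, -⟩ := hmem p hp
    rcases hK.edge_cases h1 with h | h
    · exact absurd h.1 h2
    · exact ⟨h.1, h.2.2.2⟩
  have hsame : ∀ p ∈ P, ∀ q ∈ P, p.1 0 = q.1 0 ∧ p.2 0 = q.2 0 := fun p hp q hq => by
    obtain ⟨-, -, -, -, h1, h2, -⟩ := hmem p hp
    obtain ⟨-, -, -, -, h3, h4, -⟩ := hmem q hq
    rcases hθ with rfl | rfl
    · exact (hNb p hp).1.eq_of_mem hK.mesh1D (hNb q hq).1 (p := x 0) (by linarith) (by linarith) (by linarith)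
        (by linarith)
    · exact ((hNb p hp).1.symm.eq_of_mem hK.mesh1D (hNb q hq).1.symm (p := x 0) (by linarith) (by linarith)
        (by linarith) (by linarith)).symm
  have hA3 : A ≤ A ^ 3 := by nlinarith [hK.one_le, mul_self_nonneg A, mul_pos hA hA]
  have habs : ∀ a b : ℝ, |σ * a - σ * b| = |b - a| := fun a b => by
    rw [← mul_sub, abs_mul, hσabs, one_mul, abs_sub_comm]
  refine card_le_of_noncrossing P (fun p => σ * p.1 1) (fun p => σ * p.2 1) (fun p => K.hz p.1) (p := σ * x 1)
    (B := A ^ 3) (by positivity) (fun p hp => hK.hz_pos (hmem p hp).1) (fun p hp => (hmem p hp).2.2.2.2.2.2.1)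
    (fun p hp => (hmem p hp).2.2.2.2.2.2.2) (fun p hp => ?_) (fun p hp q hq hne => ?_) (fun p hp q hq hne => ?_)
    (fun p hp q hq hlt => ?_) (fun p hp => ?_) (fun p hp => ?_)
  · have h1 : σ * p.2 1 - σ * p.1 1 ≤ |p.2 1 - p.1 1| := by
      rw [abs_sub_comm, ← habs]; exact le_abs_self _
    exact (h1.trans (hNb p hp).2).trans (mul_le_mul_of_nonneg_right hA3 (hK.hz_pos (hmem p hp).1).le)
  · simp only at hne ⊢
    rw [habs]
    refine (hK.hz_le_dist (hmem p hp).1 (hmem q hq).1 (hsame p hp q hq).1 fun h => hne (by rw [h])).trans ?_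
    exact mul_le_mul_of_nonneg_right hA3 (abs_nonneg _)
  · simp only at hne ⊢
    rw [habs]
    obtain ⟨-, T, hT, h4, h5⟩ := mem_edgesAt.1 (hmem p hp).2.2.1
    have h1 := hK.hz_le_hz hT h4 h5
    have h2 := hK.hz_le_dist (hmem p hp).2.1 (hmem q hq).2.1 (hsame p hp q hq).2 fun h => hne (by rw [h])
    have h3 := mul_le_mul_of_nonneg_left h2 (sq_nonneg A)
    linarith
  · simp only at hlt ⊢
    have h1 := noncrossing (hmem p hp).2.2.1 (hmem q hq).2.2.1 (hsame p hp q hq).1 (hsame p hp q hq).2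
      (hmem p hp).2.2.2.1.symm
    have h2 : 0 < σ * (q.1 1 - p.1 1) := by linarith
    have h3 : 0 ≤ σ * (q.1 1 - p.1 1) * (σ * (q.2 1 - p.2 1)) := by
      have : σ * (q.1 1 - p.1 1) * (σ * (q.2 1 - p.2 1)) = (σ * σ) * ((q.1 1 - p.1 1) * (q.2 1 - p.2 1)) := by ring
      rw [this, hσ2, one_mul]; exact h1
    have h4 := nonneg_of_mul_nonneg_right h3 h2
    linarith
  · refine le_trans (Finset.card_le_card_of_injOn (t := K.edgesAt p.1) (fun q => q.2) (fun q hq => ?_) fun q hq q' hq' h => ?_)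
      (hK.card_edgesAt_le (hmem p hp).1)
    · obtain ⟨hq, hqe⟩ := Finset.mem_filter.1 hq
      have : q.1 = p.1 := pt_ext (hsame q hq p hp).1 (mul_left_cancel₀ (left_ne_zero_of_mul_eq_one hσ2) hqe)
      rw [← this]; exact (hmem q hq).2.2.1
    · obtain ⟨hq, hqe⟩ := Finset.mem_filter.1 hq
      obtain ⟨hq', hqe'⟩ := Finset.mem_filter.1 hq'
      have : q.1 = q'.1 := pt_ext (hsame q hq q' hq').1
        (mul_left_cancel₀ (left_ne_zero_of_mul_eq_one hσ2) (hqe.trans hqe'.symm))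
      exact Sigma.ext this (heq_of_eq h)
  · refine le_trans (Finset.card_le_card_of_injOn (t := K.edgesAt p.2) (fun q => q.1) (fun q hq => ?_) fun q hq q' hq' h => ?_)
      (hK.card_edgesAt_le (hmem p hp).2.1)
    · obtain ⟨hq, hqe⟩ := Finset.mem_filter.1 hq
      have : q.2 = p.2 := pt_ext (hsame q hq p hp).2 (mul_left_cancel₀ (left_ne_zero_of_mul_eq_one hσ2) hqe)
      rw [← this]; exact edgesAt_symm (hmem q hq).2.2.1
    · obtain ⟨hq, hqe⟩ := Finset.mem_filter.1 hq
      obtain ⟨hq', hqe'⟩ := Finset.mem_filter.1 hq'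
      have : q.2 = q'.2 := pt_ext (hsame q hq q' hq').2
        (mul_left_cancel₀ (left_ne_zero_of_mul_eq_one hσ2) (hqe.trans hqe'.symm))
      exact Sigma.ext h (heq_of_eq this)

lemma card_regions_le {x : Pt} (hx : ∀ z ∈ K.nodes, z 0 ≠ x 0) :
    (K.slantPairs.filter fun p => x ∈ region p.1 p.2).card ≤ overlapConst A M := by
  set Q : ℝ → ℝ → Finset (Σ _ : Pt, Pt) := fun θ σ =>
    K.slantPairs.filter fun p => x ∈ region p.1 p.2 ∧ 0 < θ * (x 0 - p.1 0) ∧ 0 ≤ σ * (p.2 1 - p.1 1) with hQ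
  have hsub : (K.slantPairs.filter fun p => x ∈ region p.1 p.2) ⊆ (Q 1 1 ∪ Q 1 (-1)) ∪ (Q (-1) 1 ∪ Q (-1) (-1)) := by
    intro p hp
    obtain ⟨hp, hxR⟩ := Finset.mem_filter.1 hp
    simp only [hQ, Finset.mem_union, Finset.mem_filter]
    rcases lt_or_gt_of_ne (hx _ (mem_slantPairs.1 hp).1) with h | h <;>
      rcases le_total (p.1 1) (p.2 1) with h' | h'
    · exact Or.inl (Or.inl ⟨hp, hxR, by linarith, by linarith⟩)
    · exact Or.inl (Or.inr ⟨hp, hxR, by linarith, by linarith⟩)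
    · exact Or.inr (Or.inl ⟨hp, hxR, by linarith, by linarith⟩)
    · exact Or.inr (Or.inr ⟨hp, hxR, by linarith, by linarith⟩)
  have h1 := hK.card_regions_le_aux hx (Or.inl rfl) (Or.inl rfl)
  have h2 := hK.card_regions_le_aux hx (Or.inl rfl) (Or.inr rfl)
  have h3 := hK.card_regions_le_aux hx (Or.inr rfl) (Or.inl rfl)
  have h4 := hK.card_regions_le_aux hx (Or.inr rfl) (Or.inr rfl)
  have h5 := Finset.card_le_card hsub
  have h6 := Finset.card_union_le (Q 1 1 ∪ Q 1 (-1)) (Q (-1) 1 ∪ Q (-1) (-1))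
  have h7 := Finset.card_union_le (Q 1 1) (Q 1 (-1))
  have h8 := Finset.card_union_le (Q (-1) 1) (Q (-1) (-1))
  unfold overlapConst
  simp only [hQ] at *
  omega

/-- The regions have bounded overlap, although they are not contained in the patches; the vertical lines through
the nodes, on which the overlap is not controlled, form a null set. -/
lemma sum_region_le {F : Pt → ℝ} (hF : Continuous F) (hF0 : ∀ x, 0 ≤ F x) :
    ∑ z ∈ K.nodes, ∑ z' ∈ (K.edgesAt z).filter (fun z' => z' 0 ≠ z 0), ∫ x in region z z', F x ≤
      overlapConst A M * ∫ x in Ω, F x := by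
  have hsig : ∑ z ∈ K.nodes, ∑ z' ∈ (K.edgesAt z).filter (fun z' => z' 0 ≠ z 0), ∫ x in region z z', F x =
      ∑ p ∈ K.slantPairs, ∫ x in region p.1 p.2, F x := by
    rw [slantPairs, Finset.sum_sigma]
  have hFi : IntegrableOn F (closure Ω) := hF.continuousOn.integrableOn_compact isCompact_closure_Ω
  have hreg : ∀ p ∈ K.slantPairs, region p.1 p.2 ⊆ closure Ω := fun p hp => by
    obtain ⟨h1, h2, -⟩ := mem_slantPairs.1 hp
    obtain ⟨-, T, hT, -, h5⟩ := mem_edgesAt.1 h2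
    exact region_subset (nodes_subset h1) (nodes_subset (subset_nodes hT h5))
  have hmeas : ∀ p : Σ _ : Pt, Pt, MeasurableSet (region p.1 p.2) := fun p =>
    (isCompact_convexHull_triple _ _ _).isClosed.measurableSet
  have hind : ∀ p ∈ K.slantPairs, ∫ x in region p.1 p.2, F x =
      ∫ x in closure Ω, (region p.1 p.2).indicator F x := fun p hp => by
    rw [setIntegral_indicator (hmeas p), inter_eq_self_of_subset_right (hreg p hp)]
  rw [hsig, Finset.sum_congr rfl hind, ← integral_finsetSum _ fun p _ => hFi.indicator (hmeas p),
    ← restrict_closure_Ω, ← integral_const_mul]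
  refine integral_mono_ae (integrable_finsetSum _ fun p _ => hFi.indicator (hmeas p)) (hFi.const_mul _) ?_
  have hae : ∀ᵐ x ∂(volume.restrict (closure Ω) : Measure Pt), ∀ z ∈ K.nodes, z 0 ≠ x 0 := by
    refine ae_restrict_of_ae ?_
    rw [Finset.eventually_all]
    intro z _
    have := volume_vertical_line (z 0)
    rw [← compl_mem_ae_iff] at this
    filter_upwards [this] with x hx h using hx h.symm
  filter_upwards [hae] with x hx
  have h1 : ∑ p ∈ K.slantPairs, (region p.1 p.2).indicator F x =
      (K.slantPairs.filter fun p => x ∈ region p.1 p.2).card * F x := by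
    rw [← nsmul_eq_mul, ← Finset.sum_const, Finset.sum_filter]
    exact Finset.sum_congr rfl fun p _ => by simp only [indicator_apply]
  rw [h1]
  exact mul_le_mul_of_nonneg_right (by exact_mod_cast hK.card_regions_le hx) (hF0 x)

end StripMesh

end Mesh

/-! ### The balance of the normal-derivative jumps at a node -/

namespace Mesh

variable {K : Mesh}

lemma exists_third {T : Finset Pt} (hT : T ∈ K.tri) {z z' : Pt} (hz : z ∈ T) (hz' : z' ∈ T) (hne : z ≠ z') :
    ∃ w, T = {z, z', w} := by
  have h1 : ({z, z'} : Finset Pt) ⊆ T := Finset.insert_subset hz (Finset.singleton_subset_iff.2 hz')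
  have h2 : (T \ {z, z'}).card = 1 := by
    rw [Finset.card_sdiff_of_subset h1, K.card_eq_three T hT, Finset.card_pair hne]
  obtain ⟨w, hw⟩ := Finset.card_eq_one.1 h2
  refine ⟨w, ?_⟩
  have h3 := Finset.sdiff_union_of_subset h1
  rw [hw] at h3
  rw [← h3]; ext; simp; tauto

/-- The midpoint of an interior edge is an interior point of the square. -/
lemma mem_Ω_of_not_subset_frontier {z z' : Pt} (hz : z ∈ closure Ω) (hz' : z' ∈ closure Ω)
    (h : ¬ segment ℝ z z' ⊆ frontier Ω) : AffineMap.lineMap z z' (1 / 2 : ℝ) ∈ Ω := by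
  obtain ⟨x, hx, hxf⟩ := not_subset.1 h
  have hxΩ : x ∈ Ω := by
    by_contra hn
    exact hxf (mem_frontier_of_notMem (convex_Ω.closure.segment_subset hz hz' hx) hn)
  rw [segment_eq_image_lineMap] at hx
  obtain ⟨t, ht, rfl⟩ := hx
  have hint : interior Ω = Ω := isOpen_Ω.interior_eq
  rw [← hint] at hxΩ ⊢
  rcases le_total t (1 / 2) with h1 | h1
  · have := convex_Ω.combo_interior_closure_mem_interior (x := AffineMap.lineMap z z' t) (y := z') hxΩ hz'
      (a := (1 / 2) / (1 - t)) (b := 1 - (1 / 2) / (1 - t)) (div_pos (by norm_num) (by linarith))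
      (by rw [sub_nonneg, div_le_one (by linarith)]; linarith) (by ring)
    convert this using 1
    have h2 : (1 : ℝ) - t ≠ 0 := by linarith
    simp only [AffineMap.lineMap_apply_module]
    match_scalars <;> field_simp <;> ring
  · have := convex_Ω.combo_interior_closure_mem_interior (x := AffineMap.lineMap z z' t) (y := z) hxΩ hz
      (a := (1 / 2) / t) (b := 1 - (1 / 2) / t) (div_pos (by norm_num) (by linarith))
      (by rw [sub_nonneg, div_le_one (by linarith)]; linarith) (by ring)
    convert this using 1
    have h2 : t ≠ 0 := by linarith
    simp only [AffineMap.lineMap_apply_module]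
    match_scalars <;> field_simp; ring

/-- An interior edge has an element on either side. -/
lemma exists_third_of_side {z z' : Pt} (h : z' ∈ K.gammaAt z) {σ : ℝ} (hσ : σ ≠ 0) :
    ∃ w, ({z, z', w} : Finset Pt) ∈ K.tri ∧ 0 < σ * cross (z' - z) (w - z) := by
  obtain ⟨he, hf⟩ := mem_gammaAt.1 h
  obtain ⟨hne, T₀, hT₀, hz, hz'⟩ := mem_edgesAt.1 he
  have hm := mem_Ω_of_not_subset_frontier (nodes_subset (subset_nodes hT₀ hz)) (nodes_subset (subset_nodes hT₀ hz')) hf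
  set m : Pt := AffineMap.lineMap z z' (1 / 2 : ℝ) with hmdef
  set ν : Pt := !₂[-(z' - z) 1, (z' - z) 0] with hν
  set c : ℝ → Pt := fun s => m + (s * σ) • ν with hc
  have hcc : Continuous c := by rw [hc]; fun_prop
  have hlim : Tendsto c (𝓝[>] 0) (𝓝 m) := by
    have := (hcc.tendsto 0).mono_left (nhdsWithin_le_nhds (s := Ioi 0))
    simpa [hc] using this
  have hmem : ∀ᶠ s in 𝓝[>] (0 : ℝ), c s ∈ closure Ω := by
    filter_upwards [hlim.eventually (isOpen_Ω.mem_nhds hm)] with s hs using subset_closure hs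
  obtain ⟨T, hT, hmT, hfr⟩ := exists_tri_frequently_of_tendsto (K := K) hmem hlim
  obtain ⟨s, hsT, hs⟩ := (hfr.and_eventually self_mem_nhdsWithin).exists
  change 0 < s at hs
  have hmT₀ : m ∈ convexHull ℝ (T₀ : Set Pt) := lineMap_mem_tri hz hz' (by norm_num)
  have hzT : z ∈ T := mem_of_lam_ne_zero hT₀ hT hmT₀ hmT (by
    rw [hmdef, AffineMap.apply_lineMap, lam_apply hT₀ hz, lam_apply hT₀ hz', AffineMap.lineMap_apply]
    simp [hne.symm]; norm_num)
  have hzT' : z' ∈ T := mem_of_lam_ne_zero hT₀ hT hmT₀ hmT (by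
    rw [hmdef, AffineMap.apply_lineMap, lam_apply hT₀ hz, lam_apply hT₀ hz', AffineMap.lineMap_apply]
    simp [hne])
  obtain ⟨w, rfl⟩ := exists_third hT hzT hzT' hne.symm
  refine ⟨w, hT, ?_⟩
  rw [coe_triple, mem_convexHull_triple] at hsT
  obtain ⟨α, β, γ, hα, hβ, hγ, hsum, hx⟩ := hsT
  have e1 : γ * cross (z' - z) (w - z) = s * σ * ((z' - z) 0 ^ 2 + (z' - z) 1 ^ 2) := by
    have h1 : cross (z' - z) (c s - z) = γ * cross (z' - z) (w - z) := by
      rw [← hx]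
      obtain rfl : α = 1 - β - γ := by linarith
      simp only [cross, PiLp.sub_apply, PiLp.add_apply, PiLp.smul_apply, smul_eq_mul]; ring
    rw [← h1]
    simp only [cross, hc, hmdef, hν, AffineMap.lineMap_apply_module, PiLp.sub_apply, PiLp.add_apply,
      PiLp.smul_apply, smul_eq_mul]
    simp
    ring
  have e2 : 0 < (z' - z) 0 ^ 2 + (z' - z) 1 ^ 2 := by
    rw [← norm_sq_pt]; exact pow_pos (norm_pos_iff.2 (sub_ne_zero.2 hne)) 2
  have e3 : 0 < γ * (σ * cross (z' - z) (w - z)) := by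
    have : γ * (σ * cross (z' - z) (w - z)) = s * (σ * σ) * ((z' - z) 0 ^ 2 + (z' - z) 1 ^ 2) := by
      linear_combination σ * e1
    rw [this]
    exact mul_pos (mul_pos hs (mul_self_pos.2 hσ)) e2
  exact pos_of_mul_pos_right e3 hγ

/-- An edge has at most one element on each side. -/
lemma third_unique {z z' w w' : Pt} (h : ({z, z', w} : Finset Pt) ∈ K.tri) (h' : ({z, z', w'} : Finset Pt) ∈ K.tri)
    (hpos : 0 < cross (z' - z) (w - z) * cross (z' - z) (w' - z)) : w' = w := by
  have hc := cross_ne_zero h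
  have hc' := cross_ne_zero h'
  set e := z' - z with he
  set γ := cross e (w' - z) / cross e (w - z) with hγ
  have hγ0 : 0 < γ := by
    rw [hγ, ← mul_div_mul_right _ _ hc]
    exact div_pos (by linarith) (mul_self_pos.2 hc)
  set β := cross (w' - z) (w - z) / cross e (w - z) with hβ
  have hw' : w' - z = β • e + γ • (w - z) := by
    refine pt_ext ?_ ?_ <;>
    · simp only [PiLp.add_apply, PiLp.smul_apply, smul_eq_mul, hβ, hγ]
      field_simp
      simp only [cross]; ring
  set s := 1 / (2 * (1 + |β| + γ)) with hs
  have hs0 : 0 < s := by positivity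
  have hsb : s * (1 + |β| + γ) = 1 / 2 := by rw [hs]; field_simp
  have hsβ : |s * β| ≤ s * |β| := by rw [abs_mul, abs_of_pos hs0]
  have hsβ' := abs_le.1 hsβ
  have hs1 : 0 ≤ s * |β| := by positivity
  have hs2 : 0 ≤ s * γ := by positivity
  set x : Pt := z + (1 / 2 : ℝ) • e + s • (w' - z) with hx
  have hx1 : x ∈ convexHull ℝ ((({z, z', w'} : Finset Pt)) : Set Pt) := by
    rw [coe_triple, mem_convexHull_triple]
    refine ⟨1 / 2 - s, 1 / 2, s, by nlinarith, by norm_num, hs0.le, by ring, ?_⟩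
    rw [hx, he]; module
  have hx2 : x ∈ convexHull ℝ ((({z, z', w} : Finset Pt)) : Set Pt) := by
    rw [coe_triple, mem_convexHull_triple]
    refine ⟨1 / 2 - s * β - s * γ, 1 / 2 + s * β, s * γ, by nlinarith, by nlinarith, hs2, by ring, ?_⟩
    rw [hx, hw', he]; module
  by_contra hne
  have hin := mem_convexHull_inter h h' hx2 hx1
  have hsub : ((({z, z', w} ∩ {z, z', w'} : Finset Pt)) : Set Pt) ⊆ {z, z'} := by
    intro y hy
    simp only [Finset.coe_inter, mem_inter_iff, Finset.mem_coe, Finset.mem_insert, Finset.mem_singleton] at hy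
    simp only [mem_insert_iff, mem_singleton_iff]
    rcases hy with ⟨rfl | rfl | rfl, h1 | h1 | h1⟩ <;> tauto
  have hseg := convexHull_mono hsub hin
  rw [convexHull_pair, segment_eq_image_lineMap] at hseg
  obtain ⟨t, -, ht⟩ := hseg
  have h1 : cross e (x - z) = s * cross e (w' - z) := by
    rw [hx]; simp only [cross, PiLp.sub_apply, PiLp.add_apply, PiLp.smul_apply, smul_eq_mul]; ring
  have h2 : cross e (x - z) = 0 := by
    rw [← ht, he]
    simp only [cross, AffineMap.lineMap_apply_module, PiLp.sub_apply, PiLp.add_apply, PiLp.smul_apply, smul_eq_mul]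
    ring
  rw [h2] at h1
  exact mul_ne_zero hs0.ne' hc' h1.symm

/-- The two elements at an interior edge lie on opposite sides of it. -/
lemma sum_sign_eq_zero {z z' : Pt} (h : z' ∈ K.gammaAt z) :
    ∑ w ∈ K.nodes.filter (fun w => ({z, z', w} : Finset Pt) ∈ K.tri),
      ((SignType.sign (cross (z' - z) (w - z)) : SignType) : ℝ) = 0 := by
  obtain ⟨p, hp, hp0⟩ := exists_third_of_side h (σ := 1) one_ne_zero
  obtain ⟨q, hq, hq0⟩ := exists_third_of_side h (σ := -1) (by norm_num)
  rw [one_mul] at hp0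
  have hq1 : cross (z' - z) (q - z) < 0 := by linarith
  have hpq : p ≠ q := fun h => by rw [h] at hp0; exact lt_asymm hp0 hq1
  have hset : K.nodes.filter (fun w => ({z, z', w} : Finset Pt) ∈ K.tri) = {p, q} := by
    ext w
    rw [Finset.mem_filter, Finset.mem_insert, Finset.mem_singleton]
    constructor
    · rintro ⟨-, hw⟩
      rcases lt_or_gt_of_ne (cross_ne_zero hw) with h1 | h1
      · exact Or.inr (third_unique hq hw (mul_pos_of_neg_of_neg hq1 h1))
      · exact Or.inl (third_unique hp hw (mul_pos hp0 h1))
    · rintro (rfl | rfl)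
      · exact ⟨subset_nodes hp (by simp), hp⟩
      · exact ⟨subset_nodes hq (by simp), hq⟩
  rw [hset, Finset.sum_pair hpq, sign_pos hp0, sign_neg hq1]
  norm_num

/-- The jumps on the edges at a node, weighted with the direction cosines, balance: for a piecewise linear
function, `⟦∇v⟧·ν` times the tangent is the rotated jump of the gradient, and the jumps of the
gradient around a node add up to zero. -/
lemma sum_edgesAt_jump {uh : Pt → ℝ} (hu : K.MemSh uh) (z : Pt) :
    ∑ z' ∈ K.edgesAt z, K.jump uh z z' * ((z' 0 - z 0) / dist z z') = 0 := by
  -- in each element at an edge, the normal derivative times the horizontal direction cosine is the vertical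
  -- derivative plus a multiple of the tangential derivative, which cancels across the edge
  set sg : Pt → Pt → ℝ := fun z' w => ((SignType.sign (cross (z' - z) (w - z)) : SignType) : ℝ) with hsg
  have hterm : ∀ z' ∈ K.edgesAt z, K.jump uh z z' * ((z' 0 - z 0) / dist z z') =
      ∑ w ∈ K.nodes.filter (fun w => ({z, z', w} : Finset Pt) ∈ K.tri), -(sg z' w * elemGrad uh {z, z', w} 1) := by
    intro z' hz'
    obtain ⟨hne, -⟩ := mem_edgesAt.1 hz'
    have hd : dist z z' ≠ 0 := dist_ne_zero.2 hne.symm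
    have hd2 : dist z z' ^ 2 = (z' - z) 0 ^ 2 + (z' - z) 1 ^ 2 := by
      rw [dist_comm, dist_eq_norm, norm_sq_pt]
    have hw : ∀ w ∈ K.nodes.filter (fun w => ({z, z', w} : Finset Pt) ∈ K.tri),
        inner ℝ (elemGrad uh {z, z', w}) (outNormal z z' w) * ((z' 0 - z 0) / dist z z') =
          -(sg z' w * elemGrad uh {z, z', w} 1) +
            (z' - z) 1 * (uh z' - uh z) / dist z z' ^ 2 * sg z' w := by
      intro w hw
      have hT := (Finset.mem_filter.1 hw).2
      set v := elemGrad uh {z, z', w} with hv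
      have h1 := dist_mul_inner_outNormal (cross_ne_zero hT) v
      obtain ⟨B, hB⟩ := hu.2.2 _ hT
      have h2 := elemGrad_inner hT hB (x := z) (y := z') (subset_convexHull ℝ _ (by simp))
        (subset_convexHull ℝ _ (by simp))
      rw [← hv, inner_pt] at h2
      rw [← h2, ← mul_left_inj' (pow_ne_zero 2 hd)]
      have e1 : inner ℝ v (outNormal z z' w) * ((z' 0 - z 0) / dist z z') * dist z z' ^ 2 =
          (dist z z' * inner ℝ v (outNormal z z' w)) * (z' 0 - z 0) := by field_simp
      have e2 : (-(sg z' w * v 1) + (z' - z) 1 * (v 0 * (z' - z) 0 + v 1 * (z' - z) 1) / dist z z' ^ 2 * sg z' w) *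
          dist z z' ^ 2 = -(sg z' w * v 1) * dist z z' ^ 2 +
            (z' - z) 1 * (v 0 * (z' - z) 0 + v 1 * (z' - z) 1) * sg z' w := by field_simp
      rw [e1, e2, h1, hd2]
      simp only [hsg, cross, PiLp.sub_apply]; ring
    rw [jump, Finset.sum_mul, Finset.sum_congr rfl hw, Finset.sum_add_distrib, ← Finset.mul_sum, add_eq_left]
    by_cases hg : z' ∈ K.gammaAt z
    · rw [sum_sign_eq_zero hg, mul_zero]
    -- on the boundary the tangential derivative vanishes
    · have hf : segment ℝ z z' ⊆ frontier Ω := by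
        by_contra hf; exact hg (mem_gammaAt.2 ⟨hz', hf⟩)
      rw [hu.2.1 z (hf (left_mem_segment ℝ z z')), hu.2.1 z' (hf (right_mem_segment ℝ z z'))]
      simp
  rw [Finset.sum_congr rfl hterm]
  have hext : ∑ z' ∈ K.edgesAt z, ∑ w ∈ K.nodes.filter (fun w => ({z, z', w} : Finset Pt) ∈ K.tri),
        -(sg z' w * elemGrad uh {z, z', w} 1) =
      ∑ z' ∈ K.nodes, ∑ w ∈ K.nodes, if ({z, z', w} : Finset Pt) ∈ K.tri then
        -(sg z' w * elemGrad uh {z, z', w} 1) else 0 := by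
    simp only [Finset.sum_filter]
    refine Finset.sum_subset (Finset.filter_subset _ _) fun z' _ hz' => Finset.sum_eq_zero fun w _ => ?_
    rw [if_neg]
    intro hT
    exact hz' (mem_edgesAt.2 ⟨(distinct_of_mem_tri hT).1.symm, _, hT, by simp, by simp⟩)
  rw [hext]
  -- exchanging the two vertices opposite to `z` reverses the orientation
  have hanti : ∀ z' w, (if ({z, z', w} : Finset Pt) ∈ K.tri then -(sg z' w * elemGrad uh {z, z', w} 1) else 0) =
      -(if ({z, w, z'} : Finset Pt) ∈ K.tri then -(sg w z' * elemGrad uh {z, w, z'} 1) else 0) := fun z' w => by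
    have h1 : ({z, z', w} : Finset Pt) = {z, w, z'} := by ext; simp; tauto
    have h2 : sg z' w = - sg w z' := by
      simp only [hsg]
      rw [show cross (z' - z) (w - z) = - cross (w - z) (z' - z) by simp only [cross]; ring, Left.sign_neg]
      push_cast; rfl
    rw [h1, h2]
    split_ifs <;> ring
  have hS := Finset.sum_comm (s := K.nodes) (t := K.nodes) (f := fun z' w =>
    if ({z, z', w} : Finset Pt) ∈ K.tri then -(sg z' w * elemGrad uh {z, z', w} 1) else 0)
  have hS' : ∑ z' ∈ K.nodes, ∑ w ∈ K.nodes, (if ({z, z', w} : Finset Pt) ∈ K.tri then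
        -(sg z' w * elemGrad uh {z, z', w} 1) else 0) =
      -∑ w ∈ K.nodes, ∑ z' ∈ K.nodes, (if ({z, w, z'} : Finset Pt) ∈ K.tri then
        -(sg w z' * elemGrad uh {z, w, z'} 1) else 0) := by
    refine hS.trans ?_
    rw [← Finset.sum_neg_distrib]
    refine Finset.sum_congr rfl fun w _ => ?_
    rw [← Finset.sum_neg_distrib]
    exact Finset.sum_congr rfl fun z' _ => hanti z' w
  linarith

/-- The balance of the jumps on the interior edges at a node all of whose boundary edges are vertical. -/
lemma sum_gammaAt_jump {uh : Pt → ℝ} (hu : K.MemSh uh) {z : Pt}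
    (hv : ∀ z' ∈ K.edgesAt z, z' ∉ K.gammaAt z → z' 0 = z 0) :
    ∑ z' ∈ K.gammaAt z, K.jump uh z z' * ((z' 0 - z 0) / dist z z') = 0 := by
  rw [← sum_edgesAt_jump hu z]
  refine Finset.sum_subset (gammaAt_subset z) fun z' h1 h2 => ?_
  rw [hv z' h1 h2, sub_self, zero_div, mul_zero]

end Mesh

/-! ### Weighted means of a smooth function along the edges at a node -/

/-- The mean value of `g` over the segment `zp` with the weight `1 - t` of the hat function at `z`. -/
noncomputable def mean1 (g : Pt → ℝ) (z p : Pt) : ℝ := ∫ t in (0 : ℝ)..1, (1 - t) * g (AffineMap.lineMap z p t)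

/-- The mean value of `g²` over the segment `zp` with the weight `1 - t` of the hat function at `z`. -/
noncomputable def mean2 (g : Pt → ℝ) (z p : Pt) : ℝ := ∫ t in (0 : ℝ)..1, (1 - t) * g (AffineMap.lineMap z p t) ^ 2

lemma integral_one_sub : ∫ t in (0 : ℝ)..1, (1 - t) = 1 / 2 := by
  rw [intervalIntegral.integral_comp_sub_left (fun x => x) (1 : ℝ), integral_id]; norm_num

section Means

variable {g : Pt → ℝ}

lemma continuous_comp_lineMap (hg : Continuous g) (z p : Pt) : Continuous fun t : ℝ => g (AffineMap.lineMap z p t) :=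
  hg.comp AffineMap.lineMap_continuous

lemma continuous_weight_mul (hg : Continuous g) (z p : Pt) :
    Continuous fun t : ℝ => (1 - t) * g (AffineMap.lineMap z p t) :=
  (continuous_const.sub continuous_id).mul (continuous_comp_lineMap hg z p)

lemma continuous_weight_mul_sq (hg : Continuous g) (z p : Pt) :
    Continuous fun t : ℝ => (1 - t) * g (AffineMap.lineMap z p t) ^ 2 :=
  (continuous_const.sub continuous_id).mul ((continuous_comp_lineMap hg z p).pow 2)

lemma mean2_nonneg (g : Pt → ℝ) (z p : Pt) : 0 ≤ mean2 g z p :=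
  intervalIntegral.integral_nonneg zero_le_one fun t ht => mul_nonneg (by linarith [ht.2]) (sq_nonneg _)

lemma sq_integral_weight_le {f : ℝ → ℝ} (hf : Continuous f) :
    (∫ t in (0 : ℝ)..1, (1 - t) * f t) ^ 2 ≤ ∫ t in (0 : ℝ)..1, (1 - t) * f t ^ 2 := by
  have hw : Continuous fun t : ℝ => max (1 - t) 0 := by fun_prop
  have hi : ∀ {φ : ℝ → ℝ}, Continuous φ → Integrable φ (volume.restrict (Ioc (0 : ℝ) 1)) := fun hφ =>
    (hφ.integrableOn_Icc (a := 0) (b := 1)).mono_set Ioc_subset_Icc_self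
  have e : ∀ φ : ℝ → ℝ, ∫ t in (0 : ℝ)..1, (1 - t) * φ t = ∫ t in Ioc (0 : ℝ) 1, φ t * max (1 - t) 0 := fun φ => by
    rw [intervalIntegral.integral_of_le zero_le_one]
    refine setIntegral_congr_fun measurableSet_Ioc fun t ht => ?_
    rw [max_eq_left (by linarith [ht.2]), mul_comm]
  rw [e, e fun t => f t ^ 2]
  refine sq_integral_mul_le (fun t => le_max_right _ _) (hi hw) (hi (hf.mul hw)) (hi ((hf.pow 2).mul hw)) ?_
  have h1 := e fun _ => 1
  simp only [one_mul, mul_one] at h1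
  rw [← h1, integral_one_sub]
  norm_num

lemma mean1_sq_le (hg : Continuous g) (z p : Pt) : mean1 g z p ^ 2 ≤ mean2 g z p :=
  sq_integral_weight_le (continuous_comp_lineMap hg z p)

lemma mean1_sub_sq_le (hg : Continuous g) (z p q : Pt) :
    (mean1 g z p - mean1 g z q) ^ 2 ≤
      ∫ t in (0 : ℝ)..1, (g (AffineMap.lineMap z p t) - g (AffineMap.lineMap z q t)) ^ 2 := by
  have h1 := continuous_comp_lineMap hg z p
  have h2 := continuous_comp_lineMap hg z q
  have hc : Continuous fun t : ℝ => 1 - t := by fun_prop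
  have e : mean1 g z p - mean1 g z q =
      ∫ t in (0 : ℝ)..1, (1 - t) * (g (AffineMap.lineMap z p t) - g (AffineMap.lineMap z q t)) := by
    unfold mean1
    rw [← intervalIntegral.integral_sub ((continuous_weight_mul hg z p).intervalIntegrable _ _)
      ((continuous_weight_mul hg z q).intervalIntegrable _ _)]
    simp only [mul_sub]
  rw [e]
  refine (sq_integral_weight_le (h1.sub h2)).trans ?_
  refine intervalIntegral.integral_mono_on zero_le_one ((hc.mul ((h1.sub h2).pow 2)).intervalIntegrable _ _)
    (((h1.sub h2).pow 2).intervalIntegrable _ _) fun t ht => ?_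
  exact mul_le_of_le_one_left (sq_nonneg _) (by linarith [ht.1])

lemma mean2_le (hg : Continuous g) (z p q : Pt) :
    mean2 g z p ≤ 2 * mean2 g z q +
      2 * ∫ t in (0 : ℝ)..1, (g (AffineMap.lineMap z p t) - g (AffineMap.lineMap z q t)) ^ 2 := by
  have h1 := continuous_comp_lineMap hg z p
  have h2 := continuous_comp_lineMap hg z q
  have hc : Continuous fun t : ℝ => 1 - t := by fun_prop
  have c1 : Continuous fun t : ℝ => 2 * ((1 - t) * g (AffineMap.lineMap z q t) ^ 2) :=
    continuous_const.mul (hc.mul (h2.pow 2))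
  have c2 : Continuous fun t : ℝ => 2 * (g (AffineMap.lineMap z p t) - g (AffineMap.lineMap z q t)) ^ 2 :=
    continuous_const.mul ((h1.sub h2).pow 2)
  unfold mean2
  rw [← intervalIntegral.integral_const_mul, ← intervalIntegral.integral_const_mul,
    ← intervalIntegral.integral_add (c1.intervalIntegrable _ _) (c2.intervalIntegrable _ _)]
  refine intervalIntegral.integral_mono_on zero_le_one ((hc.mul (h1.pow 2)).intervalIntegrable _ _)
    ((c1.add c2).intervalIntegrable _ _) fun t ht => ?_
  set a := g (AffineMap.lineMap z p t)
  set b := g (AffineMap.lineMap z q t)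
  have h3 : (1 - t) * a ^ 2 ≤ (1 - t) * (2 * b ^ 2 + 2 * (a - b) ^ 2) :=
    mul_le_mul_of_nonneg_left (by nlinarith [sq_nonneg (a - 2 * b)]) (by linarith [ht.2])
  have h4 := mul_nonneg ht.1 (sq_nonneg (a - b))
  linarith

lemma abs_mean2_sub_le (hg : Continuous g) (z p q : Pt) :
    |mean2 g z p - mean2 g z q| ≤
      ∫ t in (0 : ℝ)..1, |g (AffineMap.lineMap z p t) ^ 2 - g (AffineMap.lineMap z q t) ^ 2| := by
  have h1 := continuous_comp_lineMap hg z p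
  have h2 := continuous_comp_lineMap hg z q
  have hc : Continuous fun t : ℝ => 1 - t := by fun_prop
  unfold mean2
  rw [← intervalIntegral.integral_sub ((continuous_weight_mul_sq hg z p).intervalIntegrable _ _)
    ((continuous_weight_mul_sq hg z q).intervalIntegrable _ _)]
  refine (intervalIntegral.abs_integral_le_integral_abs zero_le_one).trans ?_
  refine intervalIntegral.integral_mono_on zero_le_one
    (((hc.mul (h1.pow 2)).sub (hc.mul (h2.pow 2))).abs.intervalIntegrable _ _)
    ((((h1.pow 2)).sub (h2.pow 2)).abs.intervalIntegrable _ _) fun t ht => ?_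
  rw [← mul_sub, abs_mul, abs_of_nonneg (by linarith [ht.2] : (0 : ℝ) ≤ 1 - t)]
  exact mul_le_of_le_one_left (abs_nonneg _) (by linarith [ht.1])

lemma trace_mean2_le (hg : ContDiff ℝ 1 g) (z p q : Pt) :
    |cross (z - p) (q - p)| * mean2 g z p ≤
      (∫ x in convexHull ℝ ({p, z, q} : Set Pt), g x ^ 2) +
        ‖q - z‖ * ∫ x in convexHull ℝ ({p, z, q} : Set Pt), 2 * (|g x| * ‖fderiv ℝ g x‖) := by
  have h := trace_le hg p z q
  have e : mean2 g z p = ∫ t in (0 : ℝ)..1, t * g (AffineMap.lineMap p z t) ^ 2 := by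
    have := intervalIntegral.integral_comp_sub_left (a := 0) (b := 1)
      (fun t => t * g (AffineMap.lineMap p z t) ^ 2) (1 : ℝ)
    simp only [sub_zero, sub_self, AffineMap.lineMap_apply_one_sub] at this
    exact this
  rw [e]
  exact h

end Means

namespace Mesh

variable {K : Mesh} {n : ℕ} {X : ℕ → ℝ} {A : ℝ} {M : ℕ}

/-- The integral over an edge in the term `I` in terms of a weighted mean; the hat function has the mean `1 / 2`. -/
lemma edgeIntegral_hat {g : Pt → ℝ} (hg : Continuous g) {z z' : Pt} (h : z' ∈ K.gammaAt z) (c J : ℝ) :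
    edgeIntegral z z' (fun x => (g x - c) * K.hat z x * J) = dist z z' * J * (mean1 g z z' - c / 2) := by
  obtain ⟨hne, T, hT, hz, hz'⟩ := mem_edgesAt.1 (gammaAt_subset z h)
  have h1 := continuous_comp_lineMap hg z z'
  have hc : Continuous fun t : ℝ => 1 - t := by fun_prop
  have e : ∫ t in (0 : ℝ)..1, (g (AffineMap.lineMap z z' t) - c) * K.hat z (AffineMap.lineMap z z' t) * J =
      ∫ t in (0 : ℝ)..1, (J * ((1 - t) * g (AffineMap.lineMap z z' t)) - J * c * (1 - t)) := by
    refine intervalIntegral.integral_congr fun t ht => ?_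
    rw [uIcc_of_le zero_le_one] at ht
    simp only [hat_lineMap hT hz hz' hne.symm ht]
    ring
  have c1 : Continuous fun t : ℝ => J * ((1 - t) * g (AffineMap.lineMap z z' t)) := continuous_const.mul (hc.mul h1)
  have c2 : Continuous fun t : ℝ => J * c * (1 - t) := continuous_const.mul hc
  unfold edgeIntegral
  rw [e, intervalIntegral.integral_sub (c1.intervalIntegrable _ _) (c2.intervalIntegrable _ _),
    intervalIntegral.integral_const_mul, intervalIntegral.integral_const_mul]
  rw [integral_one_sub]; unfold mean1; ring

/-- The part of `Θ` at a node: the contributions of the patch and of the regions between the edges at the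
node and the horizontal line. -/
noncomputable def localTheta (K : Mesh) (ε : ℝ) (g : Pt → ℝ) (z : Pt) : ℝ :=
  (∑ T ∈ K.triAt z, (ε ^ 2 * (∫ x in convexHull ℝ (T : Set Pt), ‖fderiv ℝ g x‖ ^ 2) +
    (1 + ε ^ 2 * ((K.Hz z)⁻¹) ^ 2) * ∫ x in convexHull ℝ (T : Set Pt), g x ^ 2)) +
  ∑ z' ∈ (K.edgesAt z).filter (fun z' => z' 0 ≠ z 0),
    ∫ x in region z z', (ε ^ 2 * ‖fderiv ℝ g x‖ ^ 2 + g x ^ 2)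

lemma tri_term_nonneg (K : Mesh) (ε : ℝ) (g : Pt → ℝ) (z : Pt) (s : Set Pt) :
    0 ≤ ε ^ 2 * (∫ x in s, ‖fderiv ℝ g x‖ ^ 2) + (1 + ε ^ 2 * ((K.Hz z)⁻¹) ^ 2) * ∫ x in s, g x ^ 2 := by
  have h1 : 0 ≤ ∫ x in s, ‖fderiv ℝ g x‖ ^ 2 := integral_nonneg fun _ => sq_nonneg _
  have h2 : 0 ≤ ∫ x in s, g x ^ 2 := integral_nonneg fun _ => sq_nonneg _
  positivity

lemma region_term_nonneg (ε : ℝ) (g : Pt → ℝ) (s : Set Pt) :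
    0 ≤ ∫ x in s, (ε ^ 2 * ‖fderiv ℝ g x‖ ^ 2 + g x ^ 2) := integral_nonneg fun _ => by positivity

lemma localTheta_nonneg (ε : ℝ) (g : Pt → ℝ) (z : Pt) : 0 ≤ K.localTheta ε g z :=
  add_nonneg (Finset.sum_nonneg fun _ _ => tri_term_nonneg _ _ _ _ _)
    (Finset.sum_nonneg fun _ _ => region_term_nonneg _ _ _)

lemma tri_le_localTheta (ε : ℝ) (g : Pt → ℝ) {z : Pt} {T : Finset Pt} (hT : T ∈ K.tri) (hz : z ∈ T) :
    ε ^ 2 * (∫ x in convexHull ℝ (T : Set Pt), ‖fderiv ℝ g x‖ ^ 2) +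
      (1 + ε ^ 2 * ((K.Hz z)⁻¹) ^ 2) * (∫ x in convexHull ℝ (T : Set Pt), g x ^ 2) ≤ K.localTheta ε g z := by
  have h1 := Finset.single_le_sum (f := fun T : Finset Pt =>
    ε ^ 2 * (∫ x in convexHull ℝ (T : Set Pt), ‖fderiv ℝ g x‖ ^ 2) +
      (1 + ε ^ 2 * ((K.Hz z)⁻¹) ^ 2) * (∫ x in convexHull ℝ (T : Set Pt), g x ^ 2))
    (fun _ _ => tri_term_nonneg _ _ _ _ _) (mem_triAt.2 ⟨hT, hz⟩)
  exact h1.trans (le_add_of_nonneg_right (Finset.sum_nonneg fun _ _ => region_term_nonneg _ _ _))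

lemma region_le_localTheta (ε : ℝ) (g : Pt → ℝ) {z z' : Pt} (h : z' ∈ K.edgesAt z) (hne : z' 0 ≠ z 0) :
    ∫ x in region z z', (ε ^ 2 * ‖fderiv ℝ g x‖ ^ 2 + g x ^ 2) ≤ K.localTheta ε g z := by
  have h1 := Finset.single_le_sum (f := fun z' : Pt => ∫ x in region z z', (ε ^ 2 * ‖fderiv ℝ g x‖ ^ 2 + g x ^ 2))
    (s := (K.edgesAt z).filter fun z' => z' 0 ≠ z 0)
    (fun _ _ => region_term_nonneg _ _ _) (Finset.mem_filter.2 ⟨h, hne⟩)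
  exact h1.trans (le_add_of_nonneg_left (Finset.sum_nonneg fun _ _ => tri_term_nonneg _ _ _ _ _))

lemma integrableOn_triple {F : Pt → ℝ} (hF : Continuous F) (a b c : Pt) :
    IntegrableOn F (convexHull ℝ ({a, b, c} : Set Pt)) :=
  hF.continuousOn.integrableOn_compact (isCompact_convexHull_triple a b c)

/-- The trace inequality with the weights of `Θ`, where `μ = min {H_z, ε}`. -/
lemma trace_localTheta {ε : ℝ} (hε : 0 < ε) {g : Pt → ℝ} (hg : ContDiff ℝ 1 g) {z p q : Pt} {T : Finset Pt}
    (hT : T ∈ K.tri) (heq : T = {p, z, q}) (hH : 0 < K.Hz z) :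
    ε ^ 2 * (|cross (z - p) (q - p)| * mean2 g z p) ≤
      min (K.Hz z) ε * (min (K.Hz z) ε + ‖q - z‖) * K.localTheta ε g z := by
  have hz : z ∈ T := by rw [heq]; simp
  have hQ := tri_le_localTheta ε g hT hz
  set Q := K.localTheta ε g z
  have hset : ((T : Finset Pt) : Set Pt) = {p, z, q} := by rw [heq, coe_triple]
  rw [hset] at hQ
  have htr := trace_mean2_le hg z p q
  set N0 := ∫ x in convexHull ℝ ({p, z, q} : Set Pt), g x ^ 2 with hN0
  set N1 := ∫ x in convexHull ℝ ({p, z, q} : Set Pt), ‖fderiv ℝ g x‖ ^ 2 with hN1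
  set μ := min (K.Hz z) ε with hμ
  have hμ0 : 0 < μ := lt_min hH hε
  have hN0' : 0 ≤ N0 := integral_nonneg fun _ => sq_nonneg _
  have hN1' : 0 ≤ N1 := integral_nonneg fun _ => sq_nonneg _
  have hw : ε ^ 2 / μ ^ 2 ≤ 1 + ε ^ 2 * ((K.Hz z)⁻¹) ^ 2 := by
    rcases le_total (K.Hz z) ε with h | h
    · rw [hμ, min_eq_left h, inv_pow, div_eq_mul_inv]; linarith
    · rw [hμ, min_eq_right h, div_self (by positivity)]
      have : 0 ≤ ε ^ 2 * ((K.Hz z)⁻¹) ^ 2 := by positivity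
      linarith
  have h1 : ε ^ 2 / μ ^ 2 * N0 + ε ^ 2 * N1 ≤ Q := by
    have := mul_le_mul_of_nonneg_right hw hN0'
    linarith
  have h2 : ε ^ 2 * N0 ≤ μ ^ 2 * Q := by
    have h3 : ε ^ 2 / μ ^ 2 * N0 ≤ Q := by
      have : 0 ≤ ε ^ 2 * N1 := by positivity
      linarith
    have := mul_le_mul_of_nonneg_left h3 (sq_nonneg μ)
    calc ε ^ 2 * N0 = μ ^ 2 * (ε ^ 2 / μ ^ 2 * N0) := by field_simp
      _ ≤ _ := this
  have hc2 : Continuous fun x => 2 * (|g x| * ‖fderiv ℝ g x‖) :=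
    continuous_const.mul (hg.continuous.abs.mul (continuous_norm_fderiv hg))
  have hc0 : Continuous fun x => μ⁻¹ * g x ^ 2 := continuous_const.mul (hg.continuous.pow 2)
  have hc1 : Continuous fun x => μ * ‖fderiv ℝ g x‖ ^ 2 := continuous_const.mul ((continuous_norm_fderiv hg).pow 2)
  have h4 : ∫ x in convexHull ℝ ({p, z, q} : Set Pt), 2 * (|g x| * ‖fderiv ℝ g x‖) ≤ μ⁻¹ * N0 + μ * N1 := by
    rw [hN0, hN1, ← integral_const_mul, ← integral_const_mul,
      ← integral_add (integrableOn_triple hc0 _ _ _) (integrableOn_triple hc1 _ _ _)]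
    refine integral_mono (integrableOn_triple hc2 _ _ _)
      ((integrableOn_triple hc0 _ _ _).add (integrableOn_triple hc1 _ _ _)) fun x => ?_
    simp only
    have h5 : 0 ≤ μ⁻¹ * (|g x| - μ * ‖fderiv ℝ g x‖) ^ 2 := by positivity
    have h6 : μ⁻¹ * (|g x| - μ * ‖fderiv ℝ g x‖) ^ 2 =
        μ⁻¹ * g x ^ 2 + μ * ‖fderiv ℝ g x‖ ^ 2 - 2 * (|g x| * ‖fderiv ℝ g x‖) := by
      rw [← sq_abs (g x)]; field_simp; ring
    linarith
  have h7 : ε ^ 2 * (μ⁻¹ * N0 + μ * N1) ≤ μ * Q := by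
    have := mul_le_mul_of_nonneg_left h1 hμ0.le
    calc ε ^ 2 * (μ⁻¹ * N0 + μ * N1) = μ * (ε ^ 2 / μ ^ 2 * N0 + ε ^ 2 * N1) := by field_simp
      _ ≤ _ := this
  calc ε ^ 2 * (|cross (z - p) (q - p)| * mean2 g z p)
      ≤ ε ^ 2 * (N0 + ‖q - z‖ * (μ⁻¹ * N0 + μ * N1)) :=
        mul_le_mul_of_nonneg_left (htr.trans (add_le_add_right (mul_le_mul_of_nonneg_left h4 (norm_nonneg _)) _))
          (sq_nonneg ε)
    _ = ε ^ 2 * N0 + ‖q - z‖ * (ε ^ 2 * (μ⁻¹ * N0 + μ * N1)) := by ring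
    _ ≤ μ ^ 2 * Q + ‖q - z‖ * (μ * Q) := add_le_add h2 (mul_le_mul_of_nonneg_left h7 (norm_nonneg _))
    _ = _ := by ring

lemma norm_sub_foot (z z' : Pt) : ‖z' - foot z z'‖ = |z' 1 - z 1| := by
  rw [← abs_of_nonneg (norm_nonneg (z' - foot z z')), ← sq_eq_sq_iff_abs_eq_abs, norm_sq_pt]; simp

/-- The difference of the weighted means of `g²` over an edge and over its horizontal projection is controlled by
the region between them, since `2 ε |g| |∇g| ≤ ε² |∇g|² + g²`. -/
lemma mean2_sub_foot_le {ε : ℝ} (hε : 0 < ε) {g : Pt → ℝ} (hg : ContDiff ℝ 1 g) {z z' : Pt}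
    (h : z' ∈ K.edgesAt z) (hne : z' 0 ≠ z 0) :
    ε * (|z' 0 - z 0| * |mean2 g z z' - mean2 g z (foot z z')|) ≤ K.localTheta ε g z := by
  refine le_trans ?_ (region_le_localTheta ε g h hne)
  have h1 := integral_abs_sq_sub_sq_le hg (P := z) (A := foot z z') (B := z') (by simp)
  rw [foot_zero] at h1
  have h2 := mul_le_mul_of_nonneg_left (abs_mean2_sub_le hg.continuous z z' (foot z z')) (abs_nonneg (z' 0 - z 0))
  refine (mul_le_mul_of_nonneg_left (h2.trans h1) hε.le).trans ?_
  have hc2 : Continuous fun x => ε * (2 * (|g x| * ‖fderiv ℝ g x‖)) :=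
    continuous_const.mul (continuous_const.mul (hg.continuous.abs.mul (continuous_norm_fderiv hg)))
  have hc : Continuous fun x => ε ^ 2 * ‖fderiv ℝ g x‖ ^ 2 + g x ^ 2 :=
    (continuous_const.mul ((continuous_norm_fderiv hg).pow 2)).add (hg.continuous.pow 2)
  rw [← integral_const_mul]
  refine integral_mono (integrableOn_triple hc2 _ _ _) (integrableOn_triple hc _ _ _) fun x => ?_
  simp only
  rw [← sq_abs (g x)]
  nlinarith [sq_nonneg (ε * ‖fderiv ℝ g x‖ - |g x|)]

/-- The squared difference of `g` on an edge and on its horizontal projection gains the factor `|z'_y - z_y|`. -/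
lemma integral_sub_foot_le {ε : ℝ} {g : Pt → ℝ} (hg : ContDiff ℝ 1 g) {z z' : Pt}
    (h : z' ∈ K.edgesAt z) (hne : z' 0 ≠ z 0) :
    ε ^ 2 * (|z' 0 - z 0| *
      ∫ t in (0 : ℝ)..1, (g (AffineMap.lineMap z z' t) - g (AffineMap.lineMap z (foot z z') t)) ^ 2) ≤
      |z' 1 - z 1| * K.localTheta ε g z := by
  have h1 := integral_sq_sub_le hg (P := z) (A := foot z z') (B := z') (by simp)
  rw [foot_zero, norm_sub_foot] at h1
  have h2 := mul_le_mul_of_nonneg_left h1 (sq_nonneg ε)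
  refine h2.trans ?_
  rw [mul_left_comm]
  refine mul_le_mul_of_nonneg_left ?_ (abs_nonneg _)
  refine le_trans ?_ (region_le_localTheta ε g h hne)
  have hc1 : Continuous fun x => ε ^ 2 * ‖fderiv ℝ g x‖ ^ 2 := continuous_const.mul ((continuous_norm_fderiv hg).pow 2)
  have hc : Continuous fun x => ε ^ 2 * ‖fderiv ℝ g x‖ ^ 2 + g x ^ 2 := hc1.add (hg.continuous.pow 2)
  rw [← integral_const_mul]
  refine integral_mono (integrableOn_triple hc1 _ _ _) (integrableOn_triple hc _ _ _) fun x => ?_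
  simp only
  linarith [sq_nonneg (g x)]

end Mesh

/-! ### Traces at a node in terms of the local part of `Θ` -/

/-- The comparison of two weighted means, either through the difference of the squares (small `ε`) or through
the square of the difference (large `ε`). -/
lemma compare_means {ε h H A Δ δ Q a b D : ℝ} (hε : 0 < ε) (hh : 0 < h) (hH : 0 < H) (hA : 1 ≤ A) (hQ : 0 ≤ Q)
    (hD : 0 ≤ D) (hb : 0 ≤ b)
    (h1 : ε * (Δ * |a - b|) ≤ Q) (h2 : ε ^ 2 * (Δ * D) ≤ δ * Q) (h3 : a ≤ 2 * b + 2 * D) (hδ : δ ≤ A * h)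
    (hHΔ : H ≤ A * Δ) (hhH : h ≤ A * H) :
    ε ^ 2 * (h * H * a) ≤ 2 * (ε ^ 2 * (h * H * b)) + 2 * A ^ 3 * (min H ε * (min H ε + h)) * Q := by
  have hμ : 0 < min H ε := lt_min hH hε
  set μ := min H ε with hμd
  have hA0 : 0 < A := by linarith
  have hμA : min (A * H) (A * ε) = A * μ := by rw [hμd, mul_min_of_nonneg _ _ hA0.le]
  have hfin : A ^ 2 * (A * μ * h) * Q ≤ A ^ 3 * (μ * (μ + h)) * Q := by
    refine mul_le_mul_of_nonneg_right ?_ hQ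
    have : 0 ≤ A ^ 3 * (μ * μ) := by positivity
    nlinarith
  have hpos : 0 ≤ A ^ 3 * (μ * (μ + h)) * Q := by positivity
  rcases le_total ε h with hc | hc
  · have hεμ : ε ≤ A * μ := by
      rw [← hμA]; exact le_min (hc.trans hhH) (le_mul_of_one_le_left hε.le hA)
    have h4 : a ≤ b + |a - b| := by linarith [le_abs_self (a - b)]
    have h5 : ε * (H * |a - b|) ≤ A * Q := by
      calc ε * (H * |a - b|) ≤ ε * (A * Δ * |a - b|) :=
            mul_le_mul_of_nonneg_left (mul_le_mul_of_nonneg_right hHΔ (abs_nonneg _)) hε.le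
        _ = A * (ε * (Δ * |a - b|)) := by ring
        _ ≤ A * Q := mul_le_mul_of_nonneg_left h1 hA0.le
    have h6 : ε ^ 2 * (h * H * a) ≤ ε ^ 2 * (h * H * b) + A * ε * h * Q := by
      calc ε ^ 2 * (h * H * a) ≤ ε ^ 2 * (h * H * (b + |a - b|)) := by gcongr
        _ = ε ^ 2 * (h * H * b) + ε * h * (ε * (H * |a - b|)) := by ring
        _ ≤ ε ^ 2 * (h * H * b) + ε * h * (A * Q) := by gcongr
        _ = _ := by ring
    have h7 : A * ε * h * Q ≤ A ^ 2 * (A * μ * h) * Q := by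
      refine mul_le_mul_of_nonneg_right ?_ hQ
      have : A * ε * h ≤ A * (A * μ) * h := by gcongr
      have h8 : A * (A * μ) * h ≤ A * (A * (A * μ) * h) := by
        rw [mul_comm A (A * μ), mul_assoc]
        have : 0 ≤ A * μ * (A * h) := by positivity
        nlinarith
      linarith
    have h9 : 0 ≤ ε ^ 2 * (h * H * b) := by positivity
    linarith
  · have hhμ : h ≤ A * μ := by
      rw [← hμA]; exact le_min hhH (hc.trans (le_mul_of_one_le_left hε.le hA))
    have h5 : ε ^ 2 * (h * H * D) ≤ A ^ 2 * h ^ 2 * Q := by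
      calc ε ^ 2 * (h * H * D) ≤ ε ^ 2 * (h * (A * Δ) * D) := by gcongr
        _ = A * h * (ε ^ 2 * (Δ * D)) := by ring
        _ ≤ A * h * (δ * Q) := by gcongr
        _ ≤ A * h * (A * h * Q) := by gcongr
        _ = _ := by ring
    have h6 : A ^ 2 * h ^ 2 * Q ≤ A ^ 2 * (A * μ * h) * Q := by
      refine mul_le_mul_of_nonneg_right (mul_le_mul_of_nonneg_left ?_ (sq_nonneg A)) hQ
      rw [sq]; exact mul_le_mul_of_nonneg_right hhμ hh.le
    have h7 : ε ^ 2 * (h * H * a) ≤ ε ^ 2 * (h * H * (2 * b + 2 * D)) := by gcongr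
    linarith

namespace Mesh

variable {K : Mesh} {n : ℕ} {X : ℕ → ℝ} {A : ℝ} {M : ℕ}

lemma mean_eq_zero_of_horizontal {g : Pt → ℝ} (hg : IsTestFun g) {z q : Pt} (h1 : z 1 = 0 ∨ z 1 = 1)
    (hq : q 1 = z 1) : mean1 g z q = 0 ∧ mean2 g z q = 0 := by
  have h : ∀ t : ℝ, g (AffineMap.lineMap z q t) = 0 := fun t => by
    refine hg.eq_zero fun hm => ?_
    have h2 : AffineMap.lineMap z q t 1 = z 1 := by simp [AffineMap.lineMap_apply, hq]
    have h3 := (mem_Ω.1 hm).2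
    rw [h2] at h3
    rcases h1 with h1 | h1 <;> rw [h1] at h3 <;> linarith [h3.1, h3.2]
  unfold mean1 mean2
  simp [h]

lemma foot_eq {z z' : Pt} {ξ : ℝ} (h : z' 0 = ξ) : foot z z' = !₂[ξ, z 1] := by rw [← h]; rfl

/-- The values `ḡ_z` vanish at the boundary nodes; at an interior node the weighted means of `g - ḡ_z` over the
two horizontal segments at `z` balance. -/
structure IsLineAverage (K : Mesh) (n : ℕ) (X : ℕ → ℝ) (g gbar : Pt → ℝ) : Prop where
  boundary : ∀ z ∈ K.nodes, z ∈ frontier Ω → gbar z = 0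
  interior : ∀ z ∈ K.nodes, z ∉ frontier Ω → ∀ ξ ξ' : ℝ, Neighbor n X (z 0) ξ → Neighbor n X (z 0) ξ' →
    ξ < z 0 → z 0 < ξ' →
    (ξ' - z 0) * (mean1 g z !₂[ξ', z 1] - gbar z / 2) + (z 0 - ξ) * (mean1 g z !₂[ξ, z 1] - gbar z / 2) = 0

/-- A point of the mesh `X` in the open unit interval has neighbours on both sides. -/
lemma Neighbor.exists_two_sided (hX : IsMesh1D n X) {s t : ℝ} (h : Neighbor n X s t) (h0 : 0 < s) (h1 : s < 1) :
    ∃ ξ ξ', Neighbor n X s ξ ∧ Neighbor n X s ξ' ∧ ξ < s ∧ s < ξ' := by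
  have key : ∀ i ≤ n, s = X i → ∃ ξ ξ', Neighbor n X s ξ ∧ Neighbor n X s ξ' ∧ ξ < s ∧ s < ξ' := by
    intro i hi hs
    have hi0 : i ≠ 0 := fun h => by rw [h, hX.left] at hs; exact h0.ne' hs
    have hin : i ≠ n := fun h => by rw [h, hX.right] at hs; exact h1.ne hs
    obtain ⟨j, rfl⟩ := Nat.exists_eq_succ_of_ne_zero hi0
    refine ⟨X j, X (j + 1 + 1), ⟨j, by omega, Or.inr ⟨hs, rfl⟩⟩, ⟨j + 1, by omega, Or.inl ⟨hs, rfl⟩⟩, ?_, ?_⟩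
    · rw [hs]; exact hX.lt j (by omega)
    · rw [hs]; exact hX.lt (j + 1) (by omega)
  obtain ⟨i, hi, h | h⟩ := h
  · exact key i hi.le h.1
  · exact key (i + 1) hi h.1

namespace StripMesh

variable (hK : StripMesh K n X A M)
include hK

lemma exists_neighbor {z : Pt} (hz : z ∈ K.nodes) : ∃ ξ, Neighbor n X (z 0) ξ := by
  obtain ⟨T, hT, hzT⟩ := mem_nodes.1 hz
  rcases hK.shape_cases hT hzT with ⟨b, w, hs⟩ | ⟨a, b, hs⟩
  · exact ⟨_, hs.slab⟩
  · exact ⟨_, hs.slab.symm⟩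

variable {ε : ℝ} (hε : 0 < ε) {g : Pt → ℝ} (hg : IsTestFun g)
include hε hg

/-- The weighted means of `g²` over an edge and over its horizontal projection are comparable up to the local part
of `Θ`. -/
lemma mean2_foot_compare {z z' : Pt} (hz : z ∈ K.nodes) (h : z' ∈ K.edgesAt z) (hne : z' 0 ≠ z 0) :
    ε ^ 2 * (K.hz z * K.Hz z * mean2 g z z') ≤ 2 * (ε ^ 2 * (K.hz z * K.Hz z * mean2 g z (foot z z'))) +
      2 * A ^ 3 * (min (K.Hz z) ε * (min (K.Hz z) ε + K.hz z)) * K.localTheta ε g z ∧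
    ε ^ 2 * (K.hz z * K.Hz z * mean2 g z (foot z z')) ≤ 2 * (ε ^ 2 * (K.hz z * K.Hz z * mean2 g z z')) +
      2 * A ^ 3 * (min (K.Hz z) ε * (min (K.Hz z) ε + K.hz z)) * K.localTheta ε g z := by
  have hc := hg.continuous
  have h1 := mean2_sub_foot_le hε hg.contDiff h hne
  have h2 := integral_sub_foot_le (ε := ε) hg.contDiff h hne
  have h3 := mean2_le hc z z' (foot z z')
  have h4 := mean2_le hc z (foot z z') z'
  have hsymm : ∫ t in (0 : ℝ)..1, (g (AffineMap.lineMap z (foot z z') t) - g (AffineMap.lineMap z z' t)) ^ 2 =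
      ∫ t in (0 : ℝ)..1, (g (AffineMap.lineMap z z' t) - g (AffineMap.lineMap z (foot z z') t)) ^ 2 :=
    intervalIntegral.integral_congr fun t _ => by ring
  rw [hsymm] at h4
  have hD : 0 ≤ ∫ t in (0 : ℝ)..1, (g (AffineMap.lineMap z z' t) - g (AffineMap.lineMap z (foot z z') t)) ^ 2 :=
    intervalIntegral.integral_nonneg zero_le_one fun _ _ => sq_nonneg _
  rcases hK.edge_cases h with h0 | ⟨-, hHΔ, -, hδ⟩
  · exact absurd h0.1 hne
  have hQ := localTheta_nonneg (K := K) ε g z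
  exact ⟨compare_means hε (hK.hz_pos hz) (hK.Hz_pos hz) hK.one_le hQ hD (mean2_nonneg _ _ _) h1 h2 h3 hδ hHΔ
      (hK.hz_le_Hz z hz),
    compare_means hε (hK.hz_pos hz) (hK.Hz_pos hz) hK.one_le hQ hD (mean2_nonneg _ _ _)
      (by rw [abs_sub_comm (mean2 g z (foot z z'))]; exact h1) h2 h4 hδ hHΔ (hK.hz_le_Hz z hz)⟩

/-- The weighted mean of `g²` over a horizontal segment at a node. It is compared with the mean over the slanted
side of an element whose vertical side originates at the node, for which the trace inequality is available;
nodes on the horizontal sides of the square have no such element, but there `g` vanishes on the segment. -/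
lemma mean2_horizontal_le {z : Pt} (hz : z ∈ K.nodes) {ξ : ℝ} (hξ : Neighbor n X (z 0) ξ) :
    ε ^ 2 * (K.hz z * K.Hz z * mean2 g z !₂[ξ, z 1]) ≤
      4 * A ^ 3 * (min (K.Hz z) ε * (min (K.Hz z) ε + K.hz z)) * K.localTheta ε g z := by
  have hQ := localTheta_nonneg (K := K) ε g z
  have hA := hK.A_pos
  have hh := hK.hz_pos hz
  have hH := hK.Hz_pos hz
  have hμ : 0 < min (K.Hz z) ε := lt_min hH hε
  have hz1 := (mem_closure_Ω.1 (nodes_subset hz)).2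
  by_cases hb : z 1 = 0 ∨ z 1 = 1
  · rw [(mean_eq_zero_of_horizontal hg hb (q := !₂[ξ, z 1]) (by simp)).2, mul_zero, mul_zero]
    positivity
  rw [not_or] at hb
  obtain ⟨T, hT, b, w, hs, hw⟩ := hK.exists_base hz (lt_of_le_of_ne hz1.1 (Ne.symm hb.1))
    (lt_of_le_of_ne hz1.2 hb.2) hξ
  have hzT : z ∈ T := by rw [hs.eq]; simp
  have hwT : w ∈ T := by rw [hs.eq]; simp
  have hΔ := hs.width_pos hT
  have hw0 : w 0 ≠ z 0 := fun h => by rw [h, sub_self, abs_zero] at hΔ; exact lt_irrefl _ hΔ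
  have hwe : w ∈ K.edgesAt z := mem_edgesAt.2 ⟨fun h => hw0 (by rw [h]), T, hT, hzT, hwT⟩
  have hcmp := (hK.mean2_foot_compare hε hg hz hwe hw0).2
  rw [foot_eq hw] at hcmp
  have htr := trace_localTheta hε hg.contDiff (z := z) (p := w) (q := b) hT
    (by rw [hs.eq]; ext; simp; tauto) hH
  have hcr : |cross (z - w) (b - w)| = |b 1 - z 1| * |w 0 - z 0| := by
    rw [← hs.abs_cross]; congr 1; simp only [cross, PiLp.sub_apply]; ring
  have hnb : ‖b - z‖ = |b 1 - z 1| := by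
    rw [← abs_of_nonneg (norm_nonneg (b - z)), ← sq_eq_sq_iff_abs_eq_abs, norm_sq_pt]; simp [hs.base]
  rw [hcr, hnb] at htr
  set μ := min (K.Hz z) ε
  set Q := K.localTheta ε g z
  have hm := mean2_nonneg g z w
  have h1 : K.hz z * K.Hz z ≤ A ^ 2 * (|b 1 - z 1| * |w 0 - z 0|) := by
    calc K.hz z * K.Hz z ≤ (A * |b 1 - z 1|) * (A * |w 0 - z 0|) :=
          mul_le_mul (hs.hz_le z hzT) (hs.Hz_le z hzT) hH.le (by positivity)
      _ = _ := by ring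
  have h2 : ε ^ 2 * (K.hz z * K.Hz z * mean2 g z w) ≤ A ^ 3 * (μ * (μ + K.hz z)) * Q := by
    calc ε ^ 2 * (K.hz z * K.Hz z * mean2 g z w)
        ≤ ε ^ 2 * (A ^ 2 * (|b 1 - z 1| * |w 0 - z 0|) * mean2 g z w) := by gcongr
      _ = A ^ 2 * (ε ^ 2 * (|b 1 - z 1| * |w 0 - z 0| * mean2 g z w)) := by ring
      _ ≤ A ^ 2 * (μ * (μ + |b 1 - z 1|) * Q) := by gcongr
      _ ≤ A ^ 2 * (μ * (A * μ + A * K.hz z) * Q) := by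
          gcongr
          · exact le_mul_of_one_le_left hμ.le hK.one_le
          · exact hs.le_hz z hzT
      _ = _ := by ring
  linarith

lemma mean2_slant_le {z z' : Pt} (hz : z ∈ K.nodes) (h : z' ∈ K.edgesAt z) (hne : z' 0 ≠ z 0) :
    ε ^ 2 * (K.hz z * K.Hz z * mean2 g z z') ≤
      10 * A ^ 3 * (min (K.Hz z) ε * (min (K.Hz z) ε + K.hz z)) * K.localTheta ε g z := by
  rcases hK.edge_cases h with h0 | ⟨hξ, -⟩
  · exact absurd h0.1 hne
  have h1 := (hK.mean2_foot_compare hε hg hz h hne).1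
  have h2 := hK.mean2_horizontal_le hε hg hz hξ
  rw [foot_eq rfl] at h1
  linarith

/-- The weighted mean of `g²` over a vertical edge, by the trace inequality in an element with this side. -/
lemma mean2_vertical_le {z z' : Pt} (hz : z ∈ K.nodes) (h : z' ∈ K.edgesAt z) (h0 : z' 0 = z 0) :
    ε ^ 2 * (K.hz z * mean2 g z z') ≤ 3 * A ^ 4 * min (K.Hz z) ε * K.localTheta ε g z := by
  have hQ := localTheta_nonneg (K := K) ε g z
  have hA := hK.A_pos
  have hh := hK.hz_pos hz
  have hH := hK.Hz_pos hz
  have hμ : 0 < min (K.Hz z) ε := lt_min hH hε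
  rcases hK.edge_cases h with ⟨-, T, hT, w, hs⟩ | ⟨hξ, -⟩
  swap
  · exact absurd h0 (hξ.ne hK.mesh1D)
  have hzT : z ∈ T := by rw [hs.eq]; simp
  have htr := trace_localTheta hε hg.contDiff (z := z) (p := z') (q := w) hT
    (by rw [hs.eq]; ext; simp; tauto) hH
  have hcr : |cross (z - z') (w - z')| = |z' 1 - z 1| * |w 0 - z 0| := by
    rw [← hs.abs_cross, cross_swap, abs_neg]
  have hnw : ‖w - z‖ ≤ 2 * A ^ 2 * K.Hz z := by
    have h1 := hs.le_Hz z hzT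
    have h2 := hs.left_le z hzT
    have h3 := mul_le_mul_of_nonneg_left (hK.hz_le_Hz z hz) hA.le
    have h4 : A * K.Hz z ≤ A * (A * K.Hz z) :=
      mul_le_mul_of_nonneg_left (le_mul_of_one_le_left hH.le hK.one_le) hA.le
    refine (norm_le_abs_add_abs _).trans ?_
    rw [PiLp.sub_apply, PiLp.sub_apply]
    linarith
  rw [hcr] at htr
  have hμH : min (K.Hz z) ε ≤ K.Hz z := min_le_left _ _
  set μ := min (K.Hz z) ε
  set Q := K.localTheta ε g z
  have hm := mean2_nonneg g z z'
  have h1 : K.hz z * K.Hz z ≤ A ^ 2 * (|z' 1 - z 1| * |w 0 - z 0|) := by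
    calc K.hz z * K.Hz z ≤ (A * |z' 1 - z 1|) * (A * |w 0 - z 0|) :=
          mul_le_mul (hs.hz_le z hzT) (hs.Hz_le z hzT) hH.le (by positivity)
      _ = _ := by ring
  have hA2 : 1 ≤ A ^ 2 := one_le_pow₀ hK.one_le
  have h2 : K.Hz z * (ε ^ 2 * (K.hz z * mean2 g z z')) ≤ K.Hz z * (3 * A ^ 4 * μ * Q) := by
    calc K.Hz z * (ε ^ 2 * (K.hz z * mean2 g z z')) = ε ^ 2 * (K.hz z * K.Hz z * mean2 g z z') := by ring
      _ ≤ ε ^ 2 * (A ^ 2 * (|z' 1 - z 1| * |w 0 - z 0|) * mean2 g z z') := by gcongr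
      _ = A ^ 2 * (ε ^ 2 * (|z' 1 - z 1| * |w 0 - z 0| * mean2 g z z')) := by ring
      _ ≤ A ^ 2 * (μ * (μ + ‖w - z‖) * Q) := by gcongr
      _ ≤ A ^ 2 * (μ * (A ^ 2 * K.Hz z + 2 * A ^ 2 * K.Hz z) * Q) := by
          gcongr
          exact hμH.trans (le_mul_of_one_le_left hH.le hA2)
      _ = _ := by ring
  exact le_of_mul_le_mul_left h2 hH

variable {gbar : Pt → ℝ} (hgb : K.IsLineAverage n X g gbar)
include hgb

/-- The average `ḡ_z` is controlled by the traces of `g` on the horizontal segments at `z`. -/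
lemma gbar_sq_le {z : Pt} (hz : z ∈ K.nodes) :
    ε ^ 2 * (K.hz z * K.Hz z * gbar z ^ 2) ≤
      32 * A ^ 3 * (min (K.Hz z) ε * (min (K.Hz z) ε + K.hz z)) * K.localTheta ε g z := by
  have hQ := localTheta_nonneg (K := K) ε g z
  have hA := hK.A_pos
  have hh := hK.hz_pos hz
  have hH := hK.Hz_pos hz
  have hμ : 0 < min (K.Hz z) ε := lt_min hH hε
  by_cases hb : z ∈ frontier Ω
  · rw [hgb.boundary z hz hb]
    simp only [ne_eq, OfNat.ofNat_ne_zero, not_false_eq_true, zero_pow, mul_zero]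
    positivity
  have hzΩ : z ∈ Ω := by
    by_contra h; exact hb (mem_frontier_of_notMem (nodes_subset hz) h)
  obtain ⟨ξ₀, hξ₀⟩ := hK.exists_neighbor hz
  obtain ⟨ξ, ξ', h1, h2, h3, h4⟩ := hξ₀.exists_two_sided hK.mesh1D (mem_Ω.1 hzΩ).1.1 (mem_Ω.1 hzΩ).1.2
  have heq := hgb.interior z hz hb ξ ξ' h1 h2 h3 h4
  have b1 := hK.mean2_horizontal_le hε hg hz h1
  have b2 := hK.mean2_horizontal_le hε hg hz h2
  have s1 := mean1_sq_le hg.continuous z !₂[ξ, z 1]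
  have s2 := mean1_sq_le hg.continuous z !₂[ξ', z 1]
  set m := mean1 g z !₂[ξ, z 1]
  set m' := mean1 g z !₂[ξ', z 1]
  set c := gbar z / 2 with hc
  -- `ḡ_z / 2` lies between the two weighted means
  have hbetween : 0 ≤ (m' - c) * (c - m) := by
    have h5 : (ξ' - z 0) * ((m' - c) * (c - m)) = (z 0 - ξ) * (c - m) ^ 2 := by
      linear_combination (c - m) * heq
    have h6 : 0 ≤ (ξ' - z 0) * ((m' - c) * (c - m)) := by
      rw [h5]; exact mul_nonneg (by linarith) (sq_nonneg _)
    exact nonneg_of_mul_nonneg_right h6 (by linarith)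
  have hcsq : c ^ 2 ≤ m ^ 2 + m' ^ 2 := by nlinarith [sq_nonneg (c - (m + m'))]
  have hgsq : gbar z ^ 2 ≤ 4 * (mean2 g z !₂[ξ, z 1] + mean2 g z !₂[ξ', z 1]) := by
    have : gbar z = 2 * c := by rw [hc]; ring
    rw [this]; nlinarith
  have h7 : ε ^ 2 * (K.hz z * K.Hz z * gbar z ^ 2) ≤
      ε ^ 2 * (K.hz z * K.Hz z * (4 * (mean2 g z !₂[ξ, z 1] + mean2 g z !₂[ξ', z 1]))) := by gcongr
  linarith

omit hε in
/-- The weighted means of `g - ḡ_z` over the horizontal segments at `z`, multiplied by their signed lengths,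
have a common value. It vanishes at the nodes with a boundary edge that is not vertical. -/
lemma exists_common_value {z : Pt} (hz : z ∈ K.nodes) :
    ∃ B : ℝ, (∀ ξ, Neighbor n X (z 0) ξ → (ξ - z 0) * (mean1 g z !₂[ξ, z 1] - gbar z / 2) = B) ∧
      (B = 0 ∨ ∀ z' ∈ K.edgesAt z, z' ∉ K.gammaAt z → z' 0 = z 0) := by
  have hzc := mem_closure_Ω.1 (nodes_subset hz)
  have hX := hK.mesh1D
  by_cases h1 : z 1 = 0 ∨ z 1 = 1
  · have hb : gbar z = 0 := hgb.boundary z hz (mem_frontier_of_notMem (nodes_subset hz) fun h => by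
      have := (mem_Ω.1 h).2
      rcases h1 with h1 | h1 <;> rw [h1] at this <;> linarith [this.1, this.2])
    refine ⟨0, fun ξ _ => ?_, Or.inl rfl⟩
    rw [hb, (mean_eq_zero_of_horizontal hg h1 (q := !₂[ξ, z 1]) (by simp)).1]; simp
  have hz1 : 0 < z 1 ∧ z 1 < 1 := by
    rw [not_or] at h1
    exact ⟨lt_of_le_of_ne hzc.2.1 (Ne.symm h1.1), lt_of_le_of_ne hzc.2.2 h1.2⟩
  -- the midpoint of an edge to another vertical line is an interior point of the square
  have hvert : ∀ z' ∈ K.edgesAt z, z' ∉ K.gammaAt z → z' 0 = z 0 := by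
    intro z' he hg'
    by_contra hne
    obtain ⟨-, T, hT, -, hz'T⟩ := mem_edgesAt.1 he
    have hz'c := mem_closure_Ω.1 (nodes_subset (subset_nodes hT hz'T))
    have hf : segment ℝ z z' ⊆ frontier Ω := by
      by_contra hf; exact hg' (mem_gammaAt.2 ⟨he, hf⟩)
    have hm : AffineMap.lineMap z z' (1 / 2 : ℝ) ∈ segment ℝ z z' := by
      rw [segment_eq_image_lineMap]; exact ⟨1 / 2, by norm_num, rfl⟩
    refine notMem_frontier ?_ (hf hm)
    rw [mem_Ω]
    simp only [AffineMap.lineMap_apply_module, PiLp.add_apply, PiLp.smul_apply, smul_eq_mul]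
    rcases lt_or_gt_of_ne hne with h | h
    · exact ⟨⟨by linarith [hz'c.1.1], by linarith [hzc.1.2]⟩, by linarith [hz'c.2.1], by linarith [hz'c.2.2]⟩
    · exact ⟨⟨by linarith [hzc.1.1], by linarith [hz'c.1.2]⟩, by linarith [hz'c.2.1], by linarith [hz'c.2.2]⟩
  suffices h : ∀ ξ ξ', Neighbor n X (z 0) ξ → Neighbor n X (z 0) ξ' →
      (ξ - z 0) * (mean1 g z !₂[ξ, z 1] - gbar z / 2) = (ξ' - z 0) * (mean1 g z !₂[ξ', z 1] - gbar z / 2) by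
    obtain ⟨ξ₀, hξ₀⟩ := hK.exists_neighbor hz
    exact ⟨_, fun ξ hξ => h ξ ξ₀ hξ hξ₀, Or.inr hvert⟩
  intro ξ ξ' hξ hξ'
  rcases lt_or_ge 0 ((ξ - z 0) * (ξ' - z 0)) with hpos | hneg
  · rw [hξ.unique hX hξ' hpos]
  have hne : (ξ - z 0) * (ξ' - z 0) < 0 := lt_of_le_of_ne hneg
    (mul_ne_zero (sub_ne_zero.2 (hξ.ne hX)) (sub_ne_zero.2 (hξ'.ne hX)))
  have b1 := hξ.mem_Icc hX
  have b2 := hξ'.mem_Icc hX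
  have hzΩ : z ∈ Ω := by
    rw [mem_Ω]
    rcases mul_neg_iff.1 hne with ⟨h2, h3⟩ | ⟨h2, h3⟩
    · exact ⟨⟨by linarith [b2.1], by linarith [b1.2]⟩, hz1⟩
    · exact ⟨⟨by linarith [b1.1], by linarith [b2.2]⟩, hz1⟩
  rcases mul_neg_iff.1 hne with ⟨h2, h3⟩ | ⟨h2, h3⟩
  · have := hgb.interior z hz (notMem_frontier hzΩ) ξ' ξ hξ' hξ (by linarith) (by linarith)
    linarith
  · have := hgb.interior z hz (notMem_frontier hzΩ) ξ ξ' hξ hξ' (by linarith) (by linarith)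
    linarith

end StripMesh

end Mesh

/-! ### The contribution of a node to the edge term -/

namespace Mesh

variable {K : Mesh} {n : ℕ} {X : ℕ → ℝ} {A : ℝ} {M : ℕ}

/-- The contribution of a node to the jump estimator, without the factor `ε²`. -/
noncomputable def localJump (K : Mesh) (c ε : ℝ) (uh : Pt → ℝ) (z : Pt) : ℝ :=
  min (K.patchArea z) (ε * K.hz z) * K.Jshort c uh z ^ 2 + min (K.patchArea z) (ε * K.Hz z) * K.Jlong c uh z ^ 2

lemma jumpEstimator_eq (c ε : ℝ) (uh : Pt → ℝ) :
    K.jumpEstimator c ε uh = ∑ z ∈ K.nodes, ε ^ 2 * K.localJump c ε uh z :=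
  Finset.sum_congr rfl fun z _ => by unfold localJump; ring

lemma abs_jump_le_Jshort {c : ℝ} (uh : Pt → ℝ) {z z' : Pt} (h : z' ∈ K.shortAt c z) :
    |K.jump uh z z'| ≤ K.Jshort c uh z := by
  have := Finset.le_sup (f := fun z' => ‖K.jump uh z z'‖₊) h
  exact_mod_cast this

lemma abs_jump_le_Jlong {c : ℝ} (uh : Pt → ℝ) {z z' : Pt} (h : z' ∈ K.longAt c z) :
    |K.jump uh z z'| ≤ K.Jlong c uh z := by
  have := Finset.le_sup (f := fun z' => ‖K.jump uh z z'‖₊) h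
  exact_mod_cast this

lemma abs_mul_le_sqrt {a y J W Q C₁ C₂ : ℝ} (hQ : 0 ≤ Q) (hC₁ : 0 ≤ C₁) (h1 : a ^ 2 ≤ C₁ * y * Q)
    (h2 : y * J ^ 2 ≤ C₂ * W) : |a * J| ≤ Real.sqrt (C₁ * C₂ * (W * Q)) := by
  refine Real.abs_le_sqrt ?_
  calc (a * J) ^ 2 = a ^ 2 * J ^ 2 := by ring
    _ ≤ C₁ * y * Q * J ^ 2 := mul_le_mul_of_nonneg_right h1 (sq_nonneg J)
    _ = C₁ * Q * (y * J ^ 2) := by ring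
    _ ≤ C₁ * Q * (C₂ * W) := mul_le_mul_of_nonneg_left h2 (mul_nonneg hC₁ hQ)
    _ = _ := by ring

lemma sq_mean_sub_le {g : Pt → ℝ} (hg : Continuous g) (z p : Pt) (c : ℝ) :
    (mean1 g z p - c / 2) ^ 2 ≤ 2 * (mean2 g z p + c ^ 2) := by
  nlinarith [mean1_sq_le hg z p, sq_nonneg (mean1 g z p + c / 2), sq_nonneg c]

namespace StripMesh

variable (hK : StripMesh K n X A M)
include hK

lemma localJump_nonneg {c ε : ℝ} (hε : 0 < ε) (uh : Pt → ℝ) {z : Pt} (hz : z ∈ K.nodes) :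
    0 ≤ K.localJump c ε uh z := by
  have hh := hK.hz_pos hz
  have hH := hK.Hz_pos hz
  unfold localJump
  rw [hK.patchArea_eq hz]
  positivity

/-- Every edge at a node satisfies the bound appropriate for short edges. -/
lemma short_weight_le {c ε : ℝ} (hc : 0 < c) (hε : 0 < ε) (uh : Pt → ℝ) {z z' : Pt} (h : z' ∈ K.gammaAt z) :
    K.hz z * min (K.Hz z) ε * K.jump uh z z' ^ 2 ≤ (A + 1 + A * c) * K.localJump c ε uh z := by
  have hz := (mem_nodes_of_mem_gammaAt h).1
  have hh := hK.hz_pos hz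
  have hH := hK.Hz_pos hz
  have hA := hK.A_pos
  have hW := hK.localJump_nonneg (c := c) hε uh hz
  have e1 : K.hz z * min (K.Hz z) ε = min (K.patchArea z) (ε * K.hz z) := by
    rw [hK.patchArea_eq hz, mul_min_of_nonneg _ _ hh.le, mul_comm ε]
  have hAc : 0 < A * c := mul_pos hA hc
  by_cases hs : z' ∈ K.shortAt c z
  · have hJ := pow_le_pow_left₀ (abs_nonneg _) (abs_jump_le_Jshort uh hs) 2
    rw [sq_abs] at hJ
    have h1 : K.hz z * min (K.Hz z) ε * K.jump uh z z' ^ 2 ≤ K.localJump c ε uh z := by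
      unfold localJump
      rw [← e1, hK.patchArea_eq hz]
      have h2 : 0 ≤ min (K.hz z * K.Hz z) (ε * K.Hz z) * K.Jlong c uh z ^ 2 := by positivity
      have h3 := mul_le_mul_of_nonneg_left hJ (by positivity : 0 ≤ K.hz z * min (K.Hz z) ε)
      linarith
    have h4 : 0 ≤ (A + A * c) * K.localJump c ε uh z := by positivity
    linarith
  · have hl : z' ∈ K.longAt c z := Finset.mem_sdiff.2 ⟨h, hs⟩
    have hJ := pow_le_pow_left₀ (abs_nonneg _) (abs_jump_le_Jlong uh hl) 2
    rw [sq_abs] at hJ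
    have h1 : K.hz z * min (K.Hz z) ε ≤ A * min (K.patchArea z) (ε * K.Hz z) := by
      rw [e1, hK.patchArea_eq hz, mul_min_of_nonneg _ _ hA.le]
      refine min_le_min (le_mul_of_one_le_left (by positivity) hK.one_le) ?_
      have := mul_le_mul_of_nonneg_left (hK.hz_le_Hz z hz) hε.le
      linarith
    have h2 : K.hz z * min (K.Hz z) ε * K.jump uh z z' ^ 2 ≤ A * K.localJump c ε uh z := by
      unfold localJump
      have h3 : 0 ≤ min (K.patchArea z) (ε * K.hz z) * K.Jshort c uh z ^ 2 := by rw [← e1]; positivity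
      have h5 : 0 ≤ min (K.patchArea z) (ε * K.Hz z) := by rw [hK.patchArea_eq hz]; positivity
      have h4 := mul_le_mul h1 hJ (sq_nonneg _) (by positivity)
      have := mul_nonneg hA.le h3
      linarith
    have h4 : 0 ≤ (1 + A * c) * K.localJump c ε uh z := by positivity
    linarith

/-- Slanted edges satisfy the bound for long edges, since a slanted edge can be short only if `H_z` is of
order `h_z`. -/
lemma long_weight_le {c ε : ℝ} (hc : 0 < c) (hε : 0 < ε) (uh : Pt → ℝ) {z z' : Pt} (h : z' ∈ K.gammaAt z)
    (hne : z' 0 ≠ z 0) :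
    K.Hz z * min (K.hz z) ε * K.jump uh z z' ^ 2 ≤ (A + 1 + A * c) * K.localJump c ε uh z := by
  have hz := (mem_nodes_of_mem_gammaAt h).1
  have hh := hK.hz_pos hz
  have hH := hK.Hz_pos hz
  have hA := hK.A_pos
  have hW := hK.localJump_nonneg (c := c) hε uh hz
  have e1 : K.Hz z * min (K.hz z) ε = min (K.patchArea z) (ε * K.Hz z) := by
    rw [hK.patchArea_eq hz, mul_min_of_nonneg _ _ hH.le, mul_comm ε, mul_comm (K.Hz z)]
  have hAc : 0 < A * c := mul_pos hA hc
  by_cases hs : z' ∈ K.shortAt c z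
  · have hJ := pow_le_pow_left₀ (abs_nonneg _) (abs_jump_le_Jshort uh hs) 2
    rw [sq_abs] at hJ
    have hd : dist z z' ≤ c * K.hz z := (Finset.mem_filter.1 hs).2
    rcases hK.edge_cases (gammaAt_subset z h) with h0 | ⟨-, hHΔ, -⟩
    · exact absurd h0.1 hne
    have hΔ : |z' 0 - z 0| ≤ dist z z' := by
      rw [dist_comm, dist_eq_norm]; exact abs_coord_le_norm (z' - z) 0
    have hHh : K.Hz z ≤ A * c * K.hz z := by
      have := mul_le_mul_of_nonneg_left (hΔ.trans hd) hA.le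
      linarith
    have h1 : K.Hz z * min (K.hz z) ε ≤ (1 + A * c) * min (K.patchArea z) (ε * K.hz z) := by
      rw [e1, hK.patchArea_eq hz, mul_min_of_nonneg _ _ (by positivity : 0 ≤ 1 + A * c)]
      refine min_le_min (le_mul_of_one_le_left (by positivity) (by linarith)) ?_
      have h2 := mul_le_mul_of_nonneg_left hHh hε.le
      have h3 : 0 ≤ ε * K.hz z := by positivity
      linarith
    have h2 : K.Hz z * min (K.hz z) ε * K.jump uh z z' ^ 2 ≤ (1 + A * c) * K.localJump c ε uh z := by
      unfold localJump
      have h3 : 0 ≤ min (K.patchArea z) (ε * K.Hz z) * K.Jlong c uh z ^ 2 := by rw [← e1]; positivity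
      have h5 : 0 ≤ min (K.patchArea z) (ε * K.hz z) := by rw [hK.patchArea_eq hz]; positivity
      have h4 := mul_le_mul h1 hJ (sq_nonneg _) (by positivity)
      have := mul_nonneg (by positivity : 0 ≤ 1 + A * c) h3
      linarith
    have h4 : 0 ≤ A * K.localJump c ε uh z := by positivity
    linarith
  · have hl : z' ∈ K.longAt c z := Finset.mem_sdiff.2 ⟨h, hs⟩
    have hJ := pow_le_pow_left₀ (abs_nonneg _) (abs_jump_le_Jlong uh hl) 2
    rw [sq_abs] at hJ
    have h1 : K.Hz z * min (K.hz z) ε * K.jump uh z z' ^ 2 ≤ K.localJump c ε uh z := by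
      unfold localJump
      rw [← e1, hK.patchArea_eq hz]
      have h2 : 0 ≤ min (K.hz z * K.Hz z) (ε * K.hz z) * K.Jshort c uh z ^ 2 := by positivity
      have h3 := mul_le_mul_of_nonneg_left hJ (by positivity : 0 ≤ K.Hz z * min (K.hz z) ε)
      linarith
    have h4 : 0 ≤ (A + A * c) * K.localJump c ε uh z := by positivity
    linarith

lemma dist_slant_le {z z' : Pt} (hz : z ∈ K.nodes) (h : z' ∈ K.edgesAt z) (hne : z' 0 ≠ z 0) :
    dist z z' ≤ 2 * A ^ 2 * K.Hz z := by
  rcases hK.edge_cases h with h0 | ⟨-, -, h1, h2⟩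
  · exact absurd h0.1 hne
  have hA := hK.A_pos
  have hH := hK.Hz_pos hz
  have h3 := mul_le_mul_of_nonneg_left (hK.hz_le_Hz z hz) hA.le
  have h4 : A * K.Hz z ≤ A * (A * K.Hz z) :=
    mul_le_mul_of_nonneg_left (le_mul_of_one_le_left hH.le hK.one_le) hA.le
  rw [dist_comm, dist_eq_norm]
  refine (norm_le_abs_add_abs _).trans ?_
  rw [PiLp.sub_apply, PiLp.sub_apply]
  linarith

variable {ε : ℝ} (hε : 0 < ε) {g : Pt → ℝ} (hg : IsTestFun g)
include hε hg

/-- The replacement of the mean over a slanted edge with the mean over its horizontal projection. -/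
lemma slant_difference_le {z z' : Pt} (hz : z ∈ K.nodes) (h : z' ∈ K.edgesAt z) (hne : z' 0 ≠ z 0) :
    (ε * (dist z z' * (mean1 g z z' - mean1 g z (foot z z')))) ^ 2 ≤
      4 * A ^ 6 * (K.Hz z * K.hz z) * K.localTheta ε g z := by
  have hA := hK.A_pos
  have hH := hK.Hz_pos hz
  have hh := hK.hz_pos hz
  have hQ := localTheta_nonneg (K := K) ε g z
  have hd := hK.dist_slant_le hz h hne
  have h1 := mean1_sub_sq_le hg.continuous z z' (foot z z')
  have h2 := integral_sub_foot_le (ε := ε) hg.contDiff h hne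
  rcases hK.edge_cases h with h0 | ⟨-, hHΔ, -, hδ⟩
  · exact absurd h0.1 hne
  have hD0 : 0 ≤ ∫ t in (0 : ℝ)..1, (g (AffineMap.lineMap z z' t) - g (AffineMap.lineMap z (foot z z') t)) ^ 2 :=
    intervalIntegral.integral_nonneg zero_le_one fun _ _ => sq_nonneg _
  set D := ∫ t in (0 : ℝ)..1, (g (AffineMap.lineMap z z' t) - g (AffineMap.lineMap z (foot z z') t)) ^ 2
  set Q := K.localTheta ε g z
  calc (ε * (dist z z' * (mean1 g z z' - mean1 g z (foot z z')))) ^ 2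
      = ε ^ 2 * (dist z z' ^ 2 * (mean1 g z z' - mean1 g z (foot z z')) ^ 2) := by ring
    _ ≤ ε ^ 2 * ((2 * A ^ 2 * K.Hz z) ^ 2 * D) := by gcongr
    _ = 4 * A ^ 4 * K.Hz z * (ε ^ 2 * (K.Hz z * D)) := by ring
    _ ≤ 4 * A ^ 4 * K.Hz z * (ε ^ 2 * (A * |z' 0 - z 0| * D)) := by gcongr
    _ = 4 * A ^ 5 * K.Hz z * (ε ^ 2 * (|z' 0 - z 0| * D)) := by ring
    _ ≤ 4 * A ^ 5 * K.Hz z * (|z' 1 - z 1| * Q) := by gcongr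
    _ ≤ 4 * A ^ 5 * K.Hz z * (A * K.hz z * Q) := by gcongr
    _ = _ := by ring

variable {gbar : Pt → ℝ} (hgb : K.IsLineAverage n X g gbar)
include hgb

/-- The contribution of a vertical edge. -/
lemma vertical_le {z z' : Pt} (hz : z ∈ K.nodes) (h : z' ∈ K.edgesAt z) (h0 : z' 0 = z 0) :
    (ε * (dist z z' * (mean1 g z z' - gbar z / 2))) ^ 2 ≤
      134 * A ^ 6 * (K.hz z * min (K.Hz z) ε) * K.localTheta ε g z := by
  have hA := hK.A_pos
  have hH := hK.Hz_pos hz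
  have hh := hK.hz_pos hz
  have hQ := localTheta_nonneg (K := K) ε g z
  have hd : dist z z' ≤ A * K.hz z := by
    rcases hK.edge_cases h with ⟨-, T, hT, w, hs⟩ | ⟨hξ, -⟩
    · refine le_trans (le_of_eq ?_) (hs.le_hz z (by rw [hs.eq]; simp))
      rw [dist_comm, dist_eq_norm, ← abs_of_nonneg (norm_nonneg (z' - z)), ← sq_eq_sq_iff_abs_eq_abs, norm_sq_pt]
      simp [h0]
    · exact absurd h0 (hξ.ne hK.mesh1D)
  have h1 := sq_mean_sub_le hg.continuous z z' (gbar z)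
  have h2 := hK.mean2_vertical_le hε hg hz h h0
  have h3 := hK.gbar_sq_le hε hg hgb hz
  have hm := mean2_nonneg g z z'
  have hμH : min (K.Hz z) ε ≤ K.Hz z := min_le_left _ _
  have hμ : 0 < min (K.Hz z) ε := lt_min hH hε
  set μ := min (K.Hz z) ε
  set Q := K.localTheta ε g z
  have h4 : ε ^ 2 * (K.hz z * gbar z ^ 2) ≤ 64 * A ^ 4 * μ * Q := by
    refine le_of_mul_le_mul_left ?_ hH
    calc K.Hz z * (ε ^ 2 * (K.hz z * gbar z ^ 2)) = ε ^ 2 * (K.hz z * K.Hz z * gbar z ^ 2) := by ring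
      _ ≤ 32 * A ^ 3 * (μ * (μ + K.hz z)) * Q := h3
      _ ≤ 32 * A ^ 3 * (μ * (A * K.Hz z + A * K.Hz z)) * Q := by
          gcongr
          · exact hμH.trans (le_mul_of_one_le_left hH.le hK.one_le)
          · exact hK.hz_le_Hz z hz
      _ = _ := by ring
  calc (ε * (dist z z' * (mean1 g z z' - gbar z / 2))) ^ 2
      = ε ^ 2 * (dist z z' ^ 2 * (mean1 g z z' - gbar z / 2) ^ 2) := by ring
    _ ≤ ε ^ 2 * ((A * K.hz z) ^ 2 * (2 * (mean2 g z z' + gbar z ^ 2))) := by gcongr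
    _ = 2 * A ^ 2 * K.hz z * (ε ^ 2 * (K.hz z * mean2 g z z') + ε ^ 2 * (K.hz z * gbar z ^ 2)) := by ring
    _ ≤ 2 * A ^ 2 * K.hz z * (3 * A ^ 4 * μ * Q + 64 * A ^ 4 * μ * Q) := by gcongr
    _ = _ := by ring

/-- The contribution of a slanted edge in the case `ε ≤ h_z`, where no cancellation is needed. -/
lemma slant_le_of_le {z z' : Pt} (hz : z ∈ K.nodes) (h : z' ∈ K.edgesAt z) (hne : z' 0 ≠ z 0) (hεh : ε ≤ K.hz z) :
    (ε * (dist z z' * (mean1 g z z' - gbar z / 2))) ^ 2 ≤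
      672 * A ^ 7 * (K.Hz z * ε) * K.localTheta ε g z := by
  have hA := hK.A_pos
  have hH := hK.Hz_pos hz
  have hh := hK.hz_pos hz
  have hQ := localTheta_nonneg (K := K) ε g z
  have hd := hK.dist_slant_le hz h hne
  have h1 := sq_mean_sub_le hg.continuous z z' (gbar z)
  have h2 := hK.mean2_slant_le hε hg hz h hne
  have h3 := hK.gbar_sq_le hε hg hgb hz
  have hm := mean2_nonneg g z z'
  have hμε : min (K.Hz z) ε ≤ ε := min_le_right _ _
  have hμ : 0 < min (K.Hz z) ε := lt_min hH hε
  set μ := min (K.Hz z) ε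
  set Q := K.localTheta ε g z
  refine le_of_mul_le_mul_left ?_ hh
  calc K.hz z * (ε * (dist z z' * (mean1 g z z' - gbar z / 2))) ^ 2
      = K.hz z * (ε ^ 2 * (dist z z' ^ 2 * (mean1 g z z' - gbar z / 2) ^ 2)) := by ring
    _ ≤ K.hz z * (ε ^ 2 * ((2 * A ^ 2 * K.Hz z) ^ 2 * (2 * (mean2 g z z' + gbar z ^ 2)))) := by gcongr
    _ = 8 * A ^ 4 * K.Hz z * (ε ^ 2 * (K.hz z * K.Hz z * mean2 g z z') +
          ε ^ 2 * (K.hz z * K.Hz z * gbar z ^ 2)) := by ring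
    _ ≤ 8 * A ^ 4 * K.Hz z * (10 * A ^ 3 * (μ * (μ + K.hz z)) * Q + 32 * A ^ 3 * (μ * (μ + K.hz z)) * Q) := by
        gcongr
    _ = 336 * A ^ 7 * K.Hz z * (μ * (μ + K.hz z)) * Q := by ring
    _ ≤ 336 * A ^ 7 * K.Hz z * (ε * (K.hz z + K.hz z)) * Q := by
        gcongr
        exact hμε.trans hεh
    _ = _ := by ring

/-- The part of the contribution of a slanted edge that does not cancel: `B` is the common value of the means over
the horizontal segments, and the difference of the length ratio and the direction cosine is the small factor. -/
lemma slant_common_le {z z' : Pt} (hz : z ∈ K.nodes) (h : z' ∈ K.edgesAt z) (hne : z' 0 ≠ z 0) {B : ℝ}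
    (hB : (z' 0 - z 0) * (mean1 g z (foot z z') - gbar z / 2) = B) :
    (ε * (B * (dist z z' / (z' 0 - z 0) - (z' 0 - z 0) / dist z z'))) ^ 2 ≤
      144 * A ^ 16 * (K.Hz z * K.hz z) * K.localTheta ε g z := by
  have hA := hK.A_pos
  have hH := hK.Hz_pos hz
  have hh := hK.hz_pos hz
  have hQ := localTheta_nonneg (K := K) ε g z
  rcases hK.edge_cases h with h0 | ⟨hξ, hHΔ, hΔH, hδ⟩
  · exact absurd h0.1 hne
  have h1 := sq_mean_sub_le hg.continuous z (foot z z') (gbar z)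
  have h2 := hK.mean2_horizontal_le hε hg hz hξ
  have h3 := hK.gbar_sq_le hε hg hgb hz
  rw [← foot_eq (z := z) (z' := z') rfl] at h2
  have hm := mean2_nonneg g z (foot z z')
  have hμH : min (K.Hz z) ε ≤ K.Hz z := min_le_left _ _
  have hμ : 0 < min (K.Hz z) ε := lt_min hH hε
  have hhH := hK.hz_le_Hz z hz
  set μ := min (K.Hz z) ε
  set Q := K.localTheta ε g z
  have hd2 : dist z z' ^ 2 = (z' 0 - z 0) ^ 2 + (z' 1 - z 1) ^ 2 := by
    rw [dist_comm, dist_eq_norm, norm_sq_pt]; simp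
  set e0 := z' 0 - z 0 with he0
  set e1 := z' 1 - z 1 with he1
  have he0' : e0 ≠ 0 := sub_ne_zero.2 hne
  have hd0 : 0 < dist z z' := by
    refine lt_of_le_of_ne dist_nonneg fun h' => ?_
    rw [← h'] at hd2
    have : 0 < e0 ^ 2 := by positivity
    nlinarith [sq_nonneg e1]
  have hde : |e0| ≤ dist z z' := by
    refine abs_le_of_sq_le_sq ?_ hd0.le
    rw [hd2]; nlinarith [sq_nonneg e1]
  set f := dist z z' / e0 - e0 / dist z z' with hf
  have hfeq : |f| = e1 ^ 2 / (|e0| * dist z z') := by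
    have : f = e1 ^ 2 / (e0 * dist z z') := by
      rw [hf]; field_simp; rw [hd2]; ring
    rw [this, abs_div, abs_mul, abs_of_nonneg (sq_nonneg e1), abs_of_pos hd0]
  have habs0 : 0 < |e0| := abs_pos.2 he0'
  -- the square of the sine of the angle of an edge is of order `(h_z / H_z)²`
  have hfle : K.Hz z ^ 2 * |f| ≤ A ^ 4 * K.hz z ^ 2 := by
    rw [hfeq, mul_div_assoc', div_le_iff₀ (by positivity)]
    have h4 : K.Hz z ^ 2 ≤ A ^ 2 * (|e0| * dist z z') := by
      calc K.Hz z ^ 2 ≤ (A * |e0|) ^ 2 := by gcongr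
        _ = A ^ 2 * (|e0| * |e0|) := by ring
        _ ≤ _ := by gcongr
    have h5 : e1 ^ 2 ≤ A ^ 2 * K.hz z ^ 2 := by
      rw [← sq_abs, ← mul_pow]; gcongr
    calc K.Hz z ^ 2 * e1 ^ 2 ≤ A ^ 2 * (|e0| * dist z z') * (A ^ 2 * K.hz z ^ 2) := by gcongr
      _ = _ := by ring
  have hf2 : K.Hz z ^ 4 * f ^ 2 ≤ A ^ 8 * K.hz z ^ 4 := by
    have := pow_le_pow_left₀ (by positivity) hfle 2
    rw [mul_pow, sq_abs] at this
    calc K.Hz z ^ 4 * f ^ 2 = (K.Hz z ^ 2) ^ 2 * f ^ 2 := by ring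
      _ ≤ (A ^ 4 * K.hz z ^ 2) ^ 2 := this
      _ = _ := by ring
  have hBsq : B ^ 2 ≤ A ^ 2 * K.Hz z ^ 2 * (2 * (mean2 g z (foot z z') + gbar z ^ 2)) := by
    rw [← hB, mul_pow, ← sq_abs e0, ← mul_pow A]
    gcongr
  have hB2 : ε ^ 2 * K.hz z * B ^ 2 ≤ 144 * A ^ 6 * K.Hz z ^ 3 * Q := by
    refine le_of_mul_le_mul_left ?_ hH
    calc K.Hz z * (ε ^ 2 * K.hz z * B ^ 2)
        ≤ K.Hz z * (ε ^ 2 * K.hz z * (A ^ 2 * K.Hz z ^ 2 * (2 * (mean2 g z (foot z z') + gbar z ^ 2)))) := by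
          gcongr
      _ = 2 * A ^ 2 * K.Hz z ^ 2 * (ε ^ 2 * (K.hz z * K.Hz z * mean2 g z (foot z z')) +
            ε ^ 2 * (K.hz z * K.Hz z * gbar z ^ 2)) := by ring
      _ ≤ 2 * A ^ 2 * K.Hz z ^ 2 * (4 * A ^ 3 * (μ * (μ + K.hz z)) * Q + 32 * A ^ 3 * (μ * (μ + K.hz z)) * Q) := by
          gcongr
      _ = 72 * A ^ 5 * K.Hz z ^ 2 * (μ * (μ + K.hz z)) * Q := by ring
      _ ≤ 72 * A ^ 5 * K.Hz z ^ 2 * (K.Hz z * (A * K.Hz z + A * K.Hz z)) * Q := by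
          gcongr
          exact hμH.trans (le_mul_of_one_le_left hH.le hK.one_le)
      _ = _ := by ring
  refine le_of_mul_le_mul_left ?_ (by positivity : 0 < K.hz z * K.Hz z ^ 4)
  calc K.hz z * K.Hz z ^ 4 * (ε * (B * f)) ^ 2
      = (ε ^ 2 * K.hz z * B ^ 2) * (K.Hz z ^ 4 * f ^ 2) := by ring
    _ ≤ (144 * A ^ 6 * K.Hz z ^ 3 * Q) * (A ^ 8 * K.hz z ^ 4) := by gcongr
    _ = 144 * A ^ 14 * K.Hz z ^ 3 * Q * K.hz z ^ 2 * K.hz z ^ 2 := by ring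
    _ ≤ 144 * A ^ 14 * K.Hz z ^ 3 * Q * K.hz z ^ 2 * (A * K.Hz z) ^ 2 := by gcongr
    _ = _ := by ring

/-- The contribution of a node. For `h_z ≤ ε` the means over the slanted edges are replaced with those over the
horizontal line, where the leading part cancels by the balance of the jumps. -/
lemma node_estimate {c : ℝ} (hc : 0 < c) {uh : Pt → ℝ} (hu : K.MemSh uh) {z : Pt} (hz : z ∈ K.nodes) :
    ε * |∑ z' ∈ K.gammaAt z, dist z z' * K.jump uh z z' * (mean1 g z z' - gbar z / 2)| ≤
      6 * M * Real.sqrt (672 * A ^ 16 * (A + 1 + A * c) * (K.localJump c ε uh z * K.localTheta ε g z)) := by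
  have hA := hK.A_pos
  have hH := hK.Hz_pos hz
  have hh := hK.hz_pos hz
  have hQ := localTheta_nonneg (K := K) ε g z
  set Q := K.localTheta ε g z with hQdef
  set W := K.localJump c ε uh z
  set C₁ := 672 * A ^ 16 with hC₁
  have hC₁0 : 0 ≤ C₁ := by positivity
  set R := Real.sqrt (C₁ * (A + 1 + A * c) * (W * Q)) with hR
  have hR0 : 0 ≤ R := Real.sqrt_nonneg _
  have hconst : ∀ {a : ℝ} {k : ℕ} {y : ℝ}, a ≤ 672 → 0 ≤ a → k ≤ 16 → 0 ≤ y → a * A ^ k * y * Q ≤ C₁ * y * Q :=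
    fun {a k y} ha ha0 hk hy => by
      have h1 : a * A ^ k ≤ C₁ := mul_le_mul ha (pow_le_pow_right₀ hK.one_le hk) (by positivity) (by norm_num)
      gcongr
  have hcard : ((K.gammaAt z).card : ℝ) ≤ 3 * M := by
    exact_mod_cast (Finset.card_le_card (gammaAt_subset z)).trans (hK.card_edgesAt_le hz)
  have hvert : ∀ z' ∈ K.gammaAt z, z' 0 = z 0 →
      ε * |dist z z' * K.jump uh z z' * (mean1 g z z' - gbar z / 2)| ≤ R := fun z' h h0 => by
    have h1 := abs_mul_le_sqrt hQ hC₁0 ((hK.vertical_le hε hg hgb hz (gammaAt_subset z h) h0).trans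
      (hconst (by norm_num) (by norm_num) (by norm_num) (by positivity))) (hK.short_weight_le hc hε uh h)
    have he : ε * |dist z z' * K.jump uh z z' * (mean1 g z z' - gbar z / 2)| =
        |ε * (dist z z' * (mean1 g z z' - gbar z / 2)) * K.jump uh z z'| := by
      rw [show ε * (dist z z' * (mean1 g z z' - gbar z / 2)) * K.jump uh z z' =
        ε * (dist z z' * K.jump uh z z' * (mean1 g z z' - gbar z / 2)) by ring, abs_mul ε, abs_of_pos hε]
    exact he.trans_le h1
  -- it suffices to bound the summands up to a multiple of the terms in the balance of the jumps
  suffices hred : ∃ B : ℝ, B * ∑ z' ∈ K.gammaAt z, K.jump uh z z' * ((z' 0 - z 0) / dist z z') = 0 ∧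
      ∀ z' ∈ K.gammaAt z, ε * |dist z z' * K.jump uh z z' * (mean1 g z z' - gbar z / 2) -
        B * (K.jump uh z z' * ((z' 0 - z 0) / dist z z'))| ≤ 2 * R by
    obtain ⟨B, hB, hb⟩ := hred
    have h1 : ∑ z' ∈ K.gammaAt z, dist z z' * K.jump uh z z' * (mean1 g z z' - gbar z / 2) =
        ∑ z' ∈ K.gammaAt z, (dist z z' * K.jump uh z z' * (mean1 g z z' - gbar z / 2) -
          B * (K.jump uh z z' * ((z' 0 - z 0) / dist z z'))) := by
      rw [Finset.sum_sub_distrib, ← Finset.mul_sum, hB, sub_zero]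
    rw [h1]
    calc _ ≤ ε * ∑ z' ∈ K.gammaAt z, |dist z z' * K.jump uh z z' * (mean1 g z z' - gbar z / 2) -
          B * (K.jump uh z z' * ((z' 0 - z 0) / dist z z'))| :=
          mul_le_mul_of_nonneg_left (Finset.abs_sum_le_sum_abs _ _) hε.le
      _ ≤ ∑ z' ∈ K.gammaAt z, 2 * R := by rw [Finset.mul_sum]; exact Finset.sum_le_sum hb
      _ = (K.gammaAt z).card * (2 * R) := by rw [Finset.sum_const, nsmul_eq_mul]
      _ ≤ 3 * M * (2 * R) := by gcongr
      _ = _ := by ring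
  rcases le_total ε (K.hz z) with hcase | hcase
  · refine ⟨0, by rw [zero_mul], fun z' h => ?_⟩
    rw [zero_mul, sub_zero]
    by_cases h0 : z' 0 = z 0
    · linarith [hvert z' h h0]
    have hw := hK.long_weight_le hc hε uh h h0
    rw [min_eq_right hcase] at hw
    have h1 := abs_mul_le_sqrt hQ hC₁0 ((hK.slant_le_of_le hε hg hgb hz (gammaAt_subset z h) h0 hcase).trans
      (hconst (by norm_num) (by norm_num) (by norm_num) (by positivity))) hw
    have h2 : ε * |dist z z' * K.jump uh z z' * (mean1 g z z' - gbar z / 2)| ≤ R := by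
      have he : ε * |dist z z' * K.jump uh z z' * (mean1 g z z' - gbar z / 2)| =
          |ε * (dist z z' * (mean1 g z z' - gbar z / 2)) * K.jump uh z z'| := by
        rw [show ε * (dist z z' * (mean1 g z z' - gbar z / 2)) * K.jump uh z z' =
          ε * (dist z z' * K.jump uh z z' * (mean1 g z z' - gbar z / 2)) by ring, abs_mul ε, abs_of_pos hε]
      exact he.trans_le h1
    linarith
  · obtain ⟨B, hB, hB0⟩ := hK.exists_common_value hg hgb hz
    refine ⟨B, ?_, fun z' h => ?_⟩
    · rcases hB0 with hB0 | hv
      · rw [hB0, zero_mul]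
      · rw [sum_gammaAt_jump hu hv, mul_zero]
    by_cases h0 : z' 0 = z 0
    · rw [h0, sub_self, zero_div, mul_zero, mul_zero, sub_zero]
      linarith [hvert z' h h0]
    have he := gammaAt_subset z h
    have hNb : Neighbor n X (z 0) (z' 0) := by
      rcases hK.edge_cases he with h' | h'
      · exact absurd h'.1 h0
      · exact h'.1
    have hBz := hB _ hNb
    rw [← foot_eq (z := z) (z' := z') rfl] at hBz
    have hw := hK.long_weight_le hc hε uh h h0
    rw [min_eq_left hcase] at hw
    have h1 := abs_mul_le_sqrt hQ hC₁0 ((hK.slant_difference_le hε hg hz he h0).trans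
      (hconst (by norm_num) (by norm_num) (by norm_num) (by positivity))) hw
    have h2 := abs_mul_le_sqrt hQ hC₁0 ((hK.slant_common_le hε hg hgb hz he h0 hBz).trans
      (hconst (by norm_num) (by norm_num) (by norm_num) (by positivity))) hw
    have he0 : z' 0 - z 0 ≠ 0 := sub_ne_zero.2 h0
    have hsplit : ε * (dist z z' * K.jump uh z z' * (mean1 g z z' - gbar z / 2) -
        B * (K.jump uh z z' * ((z' 0 - z 0) / dist z z'))) =
        ε * (dist z z' * (mean1 g z z' - mean1 g z (foot z z'))) * K.jump uh z z' +
          ε * (B * (dist z z' / (z' 0 - z 0) - (z' 0 - z 0) / dist z z')) * K.jump uh z z' := by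
      have h3 : dist z z' * (mean1 g z (foot z z') - gbar z / 2) = B * (dist z z' / (z' 0 - z 0)) := by
        rw [← hBz]; field_simp
      linear_combination ε * K.jump uh z z' * h3
    calc _ = |ε * (dist z z' * K.jump uh z z' * (mean1 g z z' - gbar z / 2) -
        B * (K.jump uh z z' * ((z' 0 - z 0) / dist z z')))| := by rw [abs_mul, abs_of_pos hε]
      _ ≤ R + R := by rw [hsplit]; exact (abs_add_le _ _).trans (add_le_add h1 h2)
      _ = 2 * R := by ring

end StripMesh

end Mesh

/-! ### The sum over the nodes -/

namespace Mesh

variable {K : Mesh} {n : ℕ} {X : ℕ → ℝ} {A : ℝ} {M : ℕ}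

lemma sum_nodes_sum_triAt (K : Mesh) (F : Finset Pt → ℝ) :
    ∑ z ∈ K.nodes, ∑ T ∈ K.triAt z, F T = 3 * ∑ T ∈ K.tri, F T := by
  rw [Finset.sum_comm' (t' := K.tri) (s' := fun T => T) fun z T => ?_, Finset.mul_sum]
  · refine Finset.sum_congr rfl fun T hT => ?_
    rw [Finset.sum_const, K.card_eq_three T hT, nsmul_eq_mul]
    norm_num
  · rw [mem_triAt]
    exact ⟨fun h => ⟨h.2.2, h.2.1⟩, fun h => ⟨subset_nodes h.2 h.1, h.2, h.1⟩⟩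

lemma setIntegral_tri_le_patch {g : Pt → ℝ} (hg : Continuous g) {z : Pt} {T : Finset Pt} (hT : T ∈ K.triAt z) :
    ∫ x in convexHull ℝ (T : Set Pt), g x ^ 2 ≤ ∫ x in K.patch z, g x ^ 2 :=
  setIntegral_mono_set (((hg.pow 2).continuousOn.integrableOn_compact isCompact_closure_Ω).mono_set (patch_subset z))
    (ae_of_all _ fun _ => sq_nonneg _)
    (LE.le.eventuallyLE (subset_biUnion_of_mem (u := fun T : Finset Pt => convexHull ℝ (T : Set Pt)) hT))

/-- The constant in the comparison of the sum of `localTheta` with `Θ`. -/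
noncomputable def thetaConst (A : ℝ) (M : ℕ) : ℝ := 3 + M + overlapConst A M * (1 + M)

lemma thetaConst_nonneg (A : ℝ) (M : ℕ) : 0 ≤ thetaConst A M := by unfold thetaConst; positivity

/-- The quantity `Θ` of a continuously differentiable function. -/
noncomputable def smoothTheta (K : Mesh) (ε : ℝ) (g : Pt → ℝ) : ℝ :=
  ε ^ 2 * (∫ x in Ω, ‖fderiv ℝ g x‖ ^ 2)
    + ∑ z ∈ K.nodes, (1 + ε ^ 2 * ((K.Hz z)⁻¹) ^ 2) * ∫ x in K.patch z, g x ^ 2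

/-- The constant in the bound for the edge term. -/
noncomputable def edgeConst (A : ℝ) (M : ℕ) (c : ℝ) : ℝ :=
  6 * M * (Real.sqrt (672 * A ^ 16 * (A + 1 + A * c)) * Real.sqrt (thetaConst A M))

namespace StripMesh

variable (hK : StripMesh K n X A M) {ε : ℝ} {g : Pt → ℝ} (hg : IsTestFun g)
include hK hg

lemma sum_localTheta_le : ∑ z ∈ K.nodes, K.localTheta ε g z ≤ thetaConst A M * K.smoothTheta ε g := by
  have hgc := hg.continuous
  have hdc : Continuous fun x => ‖fderiv ℝ g x‖ ^ 2 := hg.continuous_fderiv.norm.pow 2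
  have hint : ∀ {F : Pt → ℝ}, Continuous F → IntegrableOn F Ω := fun hF => integrableOn_of_continuousOn hF.continuousOn
  have h3 : ∑ z ∈ K.nodes, ∑ T ∈ K.triAt z, ∫ x in convexHull ℝ (T : Set Pt), ‖fderiv ℝ g x‖ ^ 2 =
      3 * ∫ x in Ω, ‖fderiv ℝ g x‖ ^ 2 := by
    rw [sum_nodes_sum_triAt, setIntegral_eq_sum_tri (hint hdc)]
  have hnn : ∀ s : Set Pt, 0 ≤ ∫ x in s, g x ^ 2 := fun s => integral_nonneg fun _ => sq_nonneg _
  have hcz : ∀ z, 1 ≤ 1 + ε ^ 2 * ((K.Hz z)⁻¹) ^ 2 := fun z => le_add_of_nonneg_right (by positivity)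
  have hpatch : ∀ z ∈ K.nodes, (∑ T ∈ K.triAt z, ∫ x in convexHull ℝ (T : Set Pt), g x ^ 2) ≤
      M * ∫ x in K.patch z, g x ^ 2 := fun z hz => by
    calc _ ≤ ∑ T ∈ K.triAt z, ∫ x in K.patch z, g x ^ 2 :=
          Finset.sum_le_sum fun T hT => setIntegral_tri_le_patch hgc hT
      _ = (K.triAt z).card * ∫ x in K.patch z, g x ^ 2 := by rw [Finset.sum_const, nsmul_eq_mul]
      _ ≤ _ := mul_le_mul_of_nonneg_right (by exact_mod_cast hK.valence z hz) (hnn _)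
  set D := ∫ x in Ω, ‖fderiv ℝ g x‖ ^ 2 with hD
  set S := ∑ z ∈ K.nodes, (1 + ε ^ 2 * ((K.Hz z)⁻¹) ^ 2) * ∫ x in K.patch z, g x ^ 2 with hS
  have hD0 : 0 ≤ D := integral_nonneg fun _ => sq_nonneg _
  have hS0 : 0 ≤ S := Finset.sum_nonneg fun z _ => mul_nonneg (zero_le_one.trans (hcz z)) (hnn _)
  -- every element belongs to the patches of its three vertices, and each patch has at most `M` elements
  have hS1 : ∑ z ∈ K.nodes, (1 + ε ^ 2 * ((K.Hz z)⁻¹) ^ 2) *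
      ∑ T ∈ K.triAt z, ∫ x in convexHull ℝ (T : Set Pt), g x ^ 2 ≤ M * S := by
    rw [hS, Finset.mul_sum]
    refine Finset.sum_le_sum fun z hz => ?_
    calc _ ≤ (1 + ε ^ 2 * ((K.Hz z)⁻¹) ^ 2) * (M * ∫ x in K.patch z, g x ^ 2) :=
          mul_le_mul_of_nonneg_left (hpatch z hz) (zero_le_one.trans (hcz z))
      _ = _ := by ring
  have hi2 : IntegrableOn (fun x => g x ^ 2) Ω := hint (hgc.pow 2)
  have hΩ : ∫ x in Ω, g x ^ 2 ≤ M * S := by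
    have h1 : ∑ z ∈ K.nodes, ∑ T ∈ K.triAt z, ∫ x in convexHull ℝ (T : Set Pt), g x ^ 2 =
        3 * ∫ x in Ω, g x ^ 2 := by
      rw [sum_nodes_sum_triAt, setIntegral_eq_sum_tri hi2]
    have h2 : ∑ z ∈ K.nodes, ∑ T ∈ K.triAt z, ∫ x in convexHull ℝ (T : Set Pt), g x ^ 2 ≤
        ∑ z ∈ K.nodes, (1 + ε ^ 2 * ((K.Hz z)⁻¹) ^ 2) *
          ∑ T ∈ K.triAt z, ∫ x in convexHull ℝ (T : Set Pt), g x ^ 2 :=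
      Finset.sum_le_sum fun z _ => le_mul_of_one_le_left (Finset.sum_nonneg fun T _ => hnn _) (hcz z)
    linarith [hnn Ω]
  have hreg := hK.sum_region_le (F := fun x => ε ^ 2 * ‖fderiv ℝ g x‖ ^ 2 + g x ^ 2)
    ((continuous_const.mul hdc).add (hgc.pow 2)) (fun x => by positivity)
  rw [integral_add (f := fun x => ε ^ 2 * ‖fderiv ℝ g x‖ ^ 2) (hint (continuous_const.mul hdc)) hi2,
    integral_const_mul] at hreg
  have hsum : ∑ z ∈ K.nodes, K.localTheta ε g z = ε ^ 2 * (3 * D) +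
      (∑ z ∈ K.nodes, (1 + ε ^ 2 * ((K.Hz z)⁻¹) ^ 2) *
        ∑ T ∈ K.triAt z, ∫ x in convexHull ℝ (T : Set Pt), g x ^ 2) +
      ∑ z ∈ K.nodes, ∑ z' ∈ (K.edgesAt z).filter (fun z' => z' 0 ≠ z 0),
        ∫ x in region z z', (ε ^ 2 * ‖fderiv ℝ g x‖ ^ 2 + g x ^ 2) := by
    rw [← h3, Finset.mul_sum, ← Finset.sum_add_distrib, ← Finset.sum_add_distrib]
    refine Finset.sum_congr rfl fun z _ => ?_
    rw [localTheta, Finset.sum_add_distrib, Finset.mul_sum, Finset.mul_sum]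
  have hN : (0 : ℝ) ≤ overlapConst A M := Nat.cast_nonneg _
  have hM : (0 : ℝ) ≤ M := Nat.cast_nonneg _
  have h4 := mul_le_mul_of_nonneg_left (add_le_add_right hΩ (ε ^ 2 * D)) hN
  have hεD : 0 ≤ ε ^ 2 * D := by positivity
  have h5 : thetaConst A M * K.smoothTheta ε g = 3 * (ε ^ 2 * D) + M * S +
      overlapConst A M * (ε ^ 2 * D + M * S) +
      (3 * S + M * (ε ^ 2 * D) + overlapConst A M * (M * (ε ^ 2 * D) + S)) := by
    unfold thetaConst smoothTheta; ring
  have h6 : 0 ≤ 3 * S + M * (ε ^ 2 * D) + overlapConst A M * (M * (ε ^ 2 * D) + S) := by positivity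
  rw [hsum, h5]
  linarith

/-- The bound for the edge term for test functions. -/
lemma abs_termI_le_of_isTestFun (hε : 0 < ε) {gbar : Pt → ℝ} (hgb : IsLineAverage K n X g gbar) {c : ℝ}
    (hc : 0 < c) {uh : Pt → ℝ} (hu : K.MemSh uh) :
    |K.termI ε uh g gbar| ≤ edgeConst A M c * Real.sqrt (K.smoothTheta ε g * K.jumpEstimator c ε uh) := by
  have hA := hK.A_pos
  have hJ : ∀ z ∈ K.nodes, 0 ≤ K.localJump c ε uh z := fun z hz => hK.localJump_nonneg hε uh hz
  set C₂ := 672 * A ^ 16 * (A + 1 + A * c) with hC₂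
  have hC₂0 : 0 ≤ C₂ := by positivity
  have hE0 : 0 ≤ K.jumpEstimator c ε uh := by
    rw [jumpEstimator_eq]; exact Finset.sum_nonneg fun z hz => mul_nonneg (sq_nonneg _) (hJ z hz)
  have hterm : ∀ z ∈ K.nodes, |ε ^ 2 * ∑ z' ∈ K.gammaAt z,
      edgeIntegral z z' (fun x => (g x - gbar z) * K.hat z x * K.jump uh z z')| ≤
      6 * M * Real.sqrt C₂ * (Real.sqrt (ε ^ 2 * K.localJump c ε uh z) * Real.sqrt (K.localTheta ε g z)) := by
    intro z hz
    rw [Finset.sum_congr rfl fun z' h => edgeIntegral_hat hg.continuous h (gbar z) (K.jump uh z z'),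
      abs_mul, abs_of_nonneg (sq_nonneg ε), sq, mul_assoc]
    refine (mul_le_mul_of_nonneg_left (hK.node_estimate hε hg hgb hc hu hz) hε.le).trans (le_of_eq ?_)
    rw [Real.sqrt_mul hC₂0, Real.sqrt_mul (hJ z hz), ← sq, Real.sqrt_mul (sq_nonneg ε), Real.sqrt_sq hε.le]
    ring
  have hCS : ∑ z ∈ K.nodes, Real.sqrt (ε ^ 2 * K.localJump c ε uh z) * Real.sqrt (K.localTheta ε g z) ≤
      Real.sqrt (K.jumpEstimator c ε uh) * Real.sqrt (∑ z ∈ K.nodes, K.localTheta ε g z) := by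
    refine (Real.sum_mul_le_sqrt_mul_sqrt _ _ _).trans (le_of_eq ?_)
    rw [jumpEstimator_eq, Finset.sum_congr rfl fun z hz => Real.sq_sqrt (mul_nonneg (sq_nonneg ε) (hJ z hz)),
      Finset.sum_congr rfl fun z _ => Real.sq_sqrt (localTheta_nonneg ε g z)]
  calc |K.termI ε uh g gbar| ≤ ∑ z ∈ K.nodes, |ε ^ 2 * ∑ z' ∈ K.gammaAt z,
        edgeIntegral z z' (fun x => (g x - gbar z) * K.hat z x * K.jump uh z z')| :=
        Finset.abs_sum_le_sum_abs _ _
    _ ≤ ∑ z ∈ K.nodes, 6 * M * Real.sqrt C₂ *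
        (Real.sqrt (ε ^ 2 * K.localJump c ε uh z) * Real.sqrt (K.localTheta ε g z)) := Finset.sum_le_sum hterm
    _ ≤ 6 * M * Real.sqrt C₂ *
        (Real.sqrt (K.jumpEstimator c ε uh) * Real.sqrt (thetaConst A M * K.smoothTheta ε g)) := by
        rw [← Finset.mul_sum]
        refine mul_le_mul_of_nonneg_left (hCS.trans ?_) (by positivity)
        exact mul_le_mul_of_nonneg_left (Real.sqrt_le_sqrt (hK.sum_localTheta_le hg)) (Real.sqrt_nonneg _)
    _ = _ := by
        rw [Real.sqrt_mul (thetaConst_nonneg A M), mul_comm (K.smoothTheta ε g), Real.sqrt_mul hE0, edgeConst]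
        ring

end StripMesh

end Mesh

/-! ### Passage to the limit -/

lemma continuousOn_comp_lineMap {g : Pt → ℝ} (hg : ContinuousOn g (closure Ω)) {z p : Pt} (hz : z ∈ closure Ω)
    (hp : p ∈ closure Ω) : ContinuousOn (fun t : ℝ => g (AffineMap.lineMap z p t)) (uIcc 0 1) := by
  have hl : Continuous fun t : ℝ => (AffineMap.lineMap z p t : Pt) := AffineMap.lineMap_continuous
  refine hg.comp hl.continuousOn fun t ht => ?_
  rw [uIcc_of_le zero_le_one] at ht
  exact convex_Ω.closure.lineMap_mem hz hp ht

lemma tendsto_mean1 {w : ℕ → Pt → ℝ} {v : Pt → ℝ} (hw : ∀ n, ContinuousOn (w n) (closure Ω))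
    (hu : TendstoUniformlyOn w v atTop (closure Ω)) {z p : Pt} (hz : z ∈ closure Ω) (hp : p ∈ closure Ω) :
    Tendsto (fun n => mean1 (w n) z p) atTop (𝓝 (mean1 v z p)) := by
  have hc : Continuous fun t : ℝ => 1 - t := by fun_prop
  refine TendstoUniformlyOn.tendsto_intervalIntegral_of_continuousOn
    (Eventually.of_forall fun n => hc.continuousOn.mul (continuousOn_comp_lineMap (hw n) hz hp)) ?_
  rw [Metric.tendstoUniformlyOn_iff] at hu ⊢
  intro δ hδ
  filter_upwards [hu δ hδ] with n hn t ht
  rw [uIcc_of_le zero_le_one] at ht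
  have h1 := hn _ (convex_Ω.closure.lineMap_mem hz hp ht)
  rw [Real.dist_eq] at h1 ⊢
  rw [← mul_sub, abs_mul, abs_of_nonneg (by linarith [ht.2] : (0 : ℝ) ≤ 1 - t)]
  exact (mul_le_of_le_one_left (abs_nonneg _) (by linarith [ht.1])).trans_lt h1

/-- The value `c` for which the weighted means of `g - c` over the horizontal segments from `z` to the
lines `x = ξ` and `x = ξ'` balance. -/
noncomputable def lineMean (g : Pt → ℝ) (z : Pt) (ξ ξ' : ℝ) : ℝ :=
  2 * ((ξ' - z 0) * mean1 g z !₂[ξ', z 1] + (z 0 - ξ) * mean1 g z !₂[ξ, z 1]) / (ξ' - ξ)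

lemma line_balance_iff {g : Pt → ℝ} {z : Pt} {ξ ξ' c : ℝ} (h : ξ < ξ') :
    (ξ' - z 0) * (mean1 g z !₂[ξ', z 1] - c / 2) + (z 0 - ξ) * (mean1 g z !₂[ξ, z 1] - c / 2) = 0 ↔
      c = lineMean g z ξ ξ' := by
  have h' : ξ' - ξ ≠ 0 := (sub_pos.2 h).ne'
  rw [lineMean, eq_div_iff h']
  constructor <;> intro h1 <;> linarith

/-- The substitution `x = z 0 + t (ξ - z 0)` in the weighted integral over a horizontal segment. -/
lemma integral_horizontal {g : Pt → ℝ} (hg : ContinuousOn g (closure Ω)) {z : Pt} {ξ : ℝ} (hz : z ∈ closure Ω)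
    (hξ : !₂[ξ, z 1] ∈ closure Ω) (c : ℝ) {φ : ℝ → ℝ}
    (hφ : ∀ t ∈ Icc (0 : ℝ) 1, φ (z 0 + (ξ - z 0) * t) = 1 - t) :
    ∫ x in (z 0)..ξ, (g !₂[x, z 1] - c) * φ x = (ξ - z 0) * (mean1 g z !₂[ξ, z 1] - c / 2) := by
  have h := intervalIntegral.smul_integral_comp_add_mul (a := 0) (b := 1)
    (fun x => (g !₂[x, z 1] - c) * φ x) (ξ - z 0) (z 0)
  rw [mul_zero, add_zero, mul_one, add_sub_cancel, smul_eq_mul] at h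
  rw [← h]
  congr 1
  have hc : Continuous fun t : ℝ => 1 - t := by fun_prop
  have e : ∫ t in (0 : ℝ)..1, (g !₂[z 0 + (ξ - z 0) * t, z 1] - c) * φ (z 0 + (ξ - z 0) * t) =
      ∫ t in (0 : ℝ)..1, ((1 - t) * g (AffineMap.lineMap z !₂[ξ, z 1] t) - c * (1 - t)) := by
    refine intervalIntegral.integral_congr fun t ht => ?_
    rw [uIcc_of_le zero_le_one] at ht
    have hp : (!₂[z 0 + (ξ - z 0) * t, z 1] : Pt) = AffineMap.lineMap z !₂[ξ, z 1] t := by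
      refine pt_ext ?_ ?_
      · simp [AffineMap.lineMap_apply]; ring
      · simp [AffineMap.lineMap_apply]
    simp only [hφ t ht, hp]
    ring
  rw [e, intervalIntegral.integral_sub (f := fun t : ℝ => (1 - t) * g (AffineMap.lineMap z !₂[ξ, z 1] t))
    (g := fun t => c * (1 - t)) (hc.continuousOn.mul (continuousOn_comp_lineMap hg hz hξ)).intervalIntegrable
    ((continuous_const.mul hc).intervalIntegrable _ _), intervalIntegral.integral_const_mul, integral_one_sub, mean1]
  ring

lemma horizontal_mem {x y : ℝ} (hx : x ∈ Icc (0 : ℝ) 1) (hy : y ∈ Icc (0 : ℝ) 1) : !₂[x, y] ∈ closure Ω := by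
  rw [mem_closure_Ω]
  simp only [Matrix.cons_val_zero, Matrix.cons_val_one]
  exact ⟨hx, hy⟩

lemma continuousOn_horizontal {g : Pt → ℝ} (hg : ContinuousOn g (closure Ω)) {y : ℝ} (hy : y ∈ Icc (0 : ℝ) 1) :
    ContinuousOn (fun x : ℝ => g !₂[x, y]) (Icc 0 1) := by
  have hl : Continuous fun x : ℝ => (!₂[x, y] : Pt) := by fun_prop
  exact hg.comp hl.continuousOn fun x hx => horizontal_mem hx hy

namespace Mesh

variable {K : Mesh} {n : ℕ} {X : ℕ → ℝ} {A : ℝ} {M : ℕ}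

lemma continuous_hat1D (X : ℕ → ℝ) (i : ℕ) : Continuous (hat1D X i) := by
  unfold hat1D; fun_prop

/-- The averages defined by the one-dimensional hat functions have the two-sided form of `lineMean`. -/
lemma IsHatAverage.eq_lineMean {g gbar : Pt → ℝ} (h : K.IsHatAverage n X g gbar) (hX : IsMesh1D n X)
    (hg : ContinuousOn g (closure Ω)) {z : Pt} (hz : z ∈ K.nodes) (hz' : z ∉ frontier Ω) {ξ ξ' : ℝ}
    (hξ : Neighbor n X (z 0) ξ) (hξ' : Neighbor n X (z 0) ξ') (hlt : ξ < z 0) (hlt' : z 0 < ξ') :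
    gbar z = lineMean g z ξ ξ' := by
  have hzΩ := nodes_subset hz
  have hy := (mem_closure_Ω.1 hzΩ).2
  have hm := hξ.mem_Icc hX
  have hm' := hξ'.mem_Icc hX
  obtain ⟨i, hi, hx, rfl⟩ : ∃ i < n, z 0 = X (i + 1) ∧ ξ = X i := by
    obtain ⟨i, hi, h | h⟩ := hξ
    · have := hX.lt i hi
      rw [← h.1, ← h.2] at this; linarith
    · exact ⟨i, hi, h⟩
  obtain ⟨j, hj, hx', rfl⟩ : ∃ j < n, z 0 = X j ∧ ξ' = X (j + 1) := by
    obtain ⟨i, hi, h | h⟩ := hξ'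
    · exact ⟨i, hi, h⟩
    · have := hX.lt i hi
      rw [← h.1, ← h.2] at this; linarith
  obtain rfl : j = i + 1 := hX.inj (by omega) (by omega) (hx'.symm.trans hx)
  have hint := h z hz hz' (i + 1) (by omega) (by omega) hx
  rw [Nat.add_sub_cancel] at hint
  have hd : 0 < z 0 - X i := sub_pos.2 hlt
  have hd' : 0 < X (i + 1 + 1) - z 0 := sub_pos.2 hlt'
  have hmem : ∀ x ∈ Icc (0 : ℝ) 1, !₂[x, z 1] ∈ closure Ω := fun x hx => horizontal_mem hx hy
  have hφ : ∀ t ∈ Icc (0 : ℝ) 1, hat1D X (i + 1) (z 0 + (X i - z 0) * t) = 1 - t := fun t ht => by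
    have e1 : (z 0 + (X i - z 0) * t - X i) / (z 0 - X i) = 1 - t := by field_simp; ring
    have e2 : 1 ≤ (X (i + 1 + 1) - (z 0 + (X i - z 0) * t)) / (X (i + 1 + 1) - z 0) := by
      rw [le_div_iff₀ hd']; nlinarith [ht.1]
    rw [hat1D, Nat.add_sub_cancel, ← hx, e1, min_eq_left (by linarith [ht.1]), max_eq_right (by linarith [ht.2])]
  have hφ' : ∀ t ∈ Icc (0 : ℝ) 1, hat1D X (i + 1) (z 0 + (X (i + 1 + 1) - z 0) * t) = 1 - t := fun t ht => by
    have e1 : 1 ≤ (z 0 + (X (i + 1 + 1) - z 0) * t - X i) / (z 0 - X i) := by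
      rw [le_div_iff₀ hd]; nlinarith [ht.1]
    have e2 : (X (i + 1 + 1) - (z 0 + (X (i + 1 + 1) - z 0) * t)) / (X (i + 1 + 1) - z 0) = 1 - t := by
      field_simp; ring
    rw [hat1D, Nat.add_sub_cancel, ← hx, e2, min_eq_right (by linarith [ht.1]), max_eq_right (by linarith [ht.2])]
  have hcont : ContinuousOn (fun x => (g !₂[x, z 1] - gbar z) * hat1D X (i + 1) x) (Icc 0 1) :=
    ((continuousOn_horizontal hg hy).sub continuousOn_const).mul (continuous_hat1D _ _).continuousOn
  have hz0 := (mem_closure_Ω.1 hzΩ).1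
  have i1 : IntervalIntegrable (fun x => (g !₂[x, z 1] - gbar z) * hat1D X (i + 1) x) volume (X i) (z 0) :=
    (hcont.mono (uIcc_subset_Icc hm hz0)).intervalIntegrable
  have i2 : IntervalIntegrable (fun x => (g !₂[x, z 1] - gbar z) * hat1D X (i + 1) x) volume (z 0)
      (X (i + 1 + 1)) := (hcont.mono (uIcc_subset_Icc hz0 hm')).intervalIntegrable
  rw [← intervalIntegral.integral_add_adjacent_intervals i1 i2, intervalIntegral.integral_symm,
    integral_horizontal hg hzΩ (hmem _ hm) _ hφ, integral_horizontal hg hzΩ (hmem _ hm') _ hφ'] at hint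
  rw [← line_balance_iff (hlt.trans hlt'), ← hint]
  ring

/-- The bound for the edge term: the bound for test functions carries over by uniform approximation, since the
Dirichlet norms of the approximations do not exceed that of `g`. -/
lemma StripMesh.abs_termI_le (hK : StripMesh K n X A M) {ε : ℝ} (hε : 0 < ε) {g gbar : Pt → ℝ} (hg : MemH10C g)
    (hgb0 : ∀ z ∈ K.nodes, z ∈ frontier Ω → gbar z = 0) (hgb : K.IsHatAverage n X g gbar) {c : ℝ}
    (hc : 0 < c) {uh : Pt → ℝ} (hu : K.MemSh uh) :
    |K.termI ε uh g gbar| ≤ edgeConst A M c * Real.sqrt (K.Theta ε g * K.jumpEstimator c ε uh) := by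
  obtain ⟨w, hw, hunif, hgrad, -⟩ := hg.exists_seq
  have hwc : ∀ k, ContinuousOn (w k) (closure Ω) := fun k => (hw k).continuous.continuousOn
  have hex : ∀ z : Pt, ∃ ξ ξ' : ℝ, z ∈ K.nodes → z ∉ frontier Ω →
      Neighbor n X (z 0) ξ ∧ Neighbor n X (z 0) ξ' ∧ ξ < z 0 ∧ z 0 < ξ' := fun z => by
    by_cases h : z ∈ K.nodes ∧ z ∉ frontier Ω
    · have hzΩ : z ∈ Ω := by
        by_contra hn
        exact h.2 (mem_frontier_of_notMem (nodes_subset h.1) hn)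
      obtain ⟨ξ, hξ⟩ := hK.exists_neighbor h.1
      obtain ⟨a, b, hab⟩ := hξ.exists_two_sided hK.mesh1D (mem_Ω.1 hzΩ).1.1 (mem_Ω.1 hzΩ).1.2
      exact ⟨a, b, fun _ _ => hab⟩
    · exact ⟨0, 0, fun h1 h2 => absurd ⟨h1, h2⟩ h⟩
  choose a b hab using hex
  -- the averages of the approximations
  set β : ℕ → Pt → ℝ := fun k z => if z ∈ frontier Ω then 0 else lineMean (w k) z (a z) (b z) with hβ
  have hline : ∀ k, IsLineAverage K n X (w k) (β k) := fun k => by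
    refine ⟨fun z _ h => if_pos h, fun z hz h ξ ξ' hξ hξ' hlt hlt' => ?_⟩
    obtain ⟨h1, h2, h3, h4⟩ := hab z hz h
    have e1 : ξ = a z := hξ.unique hK.mesh1D h1 (mul_pos_of_neg_of_neg (by linarith) (by linarith))
    have e2 : ξ' = b z := hξ'.unique hK.mesh1D h2 (mul_pos (by linarith) (by linarith))
    rw [line_balance_iff (hlt.trans hlt'), e1, e2]
    exact if_neg h
  have hmem : ∀ z ∈ K.nodes, ∀ ξ : ℝ, Neighbor n X (z 0) ξ → !₂[ξ, z 1] ∈ closure Ω := fun z hz ξ hξ =>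
    horizontal_mem (hξ.mem_Icc hK.mesh1D) (mem_closure_Ω.1 (nodes_subset hz)).2
  have hβlim : ∀ z ∈ K.nodes, Tendsto (fun k => β k z) atTop (𝓝 (gbar z)) := fun z hz => by
    by_cases h : z ∈ frontier Ω
    · rw [hgb0 z hz h]
      simp only [hβ, if_pos h]
      exact tendsto_const_nhds
    · obtain ⟨h1, h2, h3, h4⟩ := hab z hz h
      rw [hgb.eq_lineMean hK.mesh1D hg.1 hz h h1 h2 h3 h4]
      simp only [hβ, if_neg h]
      have t1 := tendsto_mean1 hwc hunif (nodes_subset hz) (hmem z hz _ h1)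
      have t2 := tendsto_mean1 hwc hunif (nodes_subset hz) (hmem z hz _ h2)
      exact ((((t2.const_mul _).add (t1.const_mul _)).const_mul _).div_const _)
  have hI : Tendsto (fun k => |K.termI ε uh (w k) (β k)|) atTop (𝓝 |K.termI ε uh g gbar|) := by
    refine Tendsto.abs ?_
    unfold termI
    refine tendsto_finsetSum _ fun z hz => Tendsto.const_mul _ (tendsto_finsetSum _ fun z' hz' => ?_)
    simp only [mul_assoc]
    exact tendsto_edgeIntegral hwc hg.1 hunif (hβlim z hz) ((continuousOn_hat z).mul continuousOn_const)
      (nodes_subset hz) (nodes_subset (mem_nodes_of_mem_gammaAt hz').2)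
  set S : (Pt → ℝ) → ℝ := fun v => ε ^ 2 * (∫ x in Ω, ‖weakGrad g x‖ ^ 2) +
    ∑ z ∈ K.nodes, (1 + ε ^ 2 * ((K.Hz z)⁻¹) ^ 2) * ∫ x in K.patch z, v x ^ 2 with hS
  have hSlim : Tendsto (fun k => S (w k)) atTop (𝓝 (S g)) := by
    refine tendsto_const_nhds.add (tendsto_finsetSum _ fun z _ => Tendsto.const_mul _ ?_)
    exact tendsto_setIntegral_of_uniform hwc hg.1 hunif (Φ := fun _ s => s ^ 2)
      (Continuous.continuousOn (by fun_prop)) (isClosed_patch z).measurableSet (patch_subset z)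
  have hE0 : 0 ≤ K.jumpEstimator c ε uh := by
    rw [jumpEstimator_eq]
    exact Finset.sum_nonneg fun z hz => mul_nonneg (sq_nonneg _) (hK.localJump_nonneg hε uh hz)
  have hC0 : 0 ≤ edgeConst A M c := by unfold edgeConst; positivity
  refine le_of_tendsto_of_tendsto hI
    (((hSlim.mul_const (K.jumpEstimator c ε uh)).sqrt).const_mul (edgeConst A M c)) (Eventually.of_forall fun k => ?_)
  refine (hK.abs_termI_le_of_isTestFun (hw k) hε (hline k) hc hu).trans
    (mul_le_mul_of_nonneg_left (Real.sqrt_le_sqrt (mul_le_mul_of_nonneg_right ?_ hE0)) hC0)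
  simp only [hS, smoothTheta]
  exact add_le_add_left (mul_le_mul_of_nonneg_left (hgrad k) (sq_nonneg ε)) _

lemma one_le_shapeConst {κ α₁ c₀ : ℝ} (hκ : 0 < κ) (hα₁ : 0 < α₁) (hc₀ : 0 < c₀) : 1 ≤ shapeConst κ α₁ c₀ := by
  have h1 : 0 ≤ (1 + α₁) ^ 2 := sq_nonneg _
  have h2 : 1 ≤ (1 + κ) * (1 + α₁) * (1 + 2 * (1 + α₁) ^ 2) :=
    one_le_mul_of_one_le_of_one_le (one_le_mul_of_one_le_of_one_le (by linarith) (by linarith)) (by linarith)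
  unfold shapeConst
  linarith

lemma c₀_le_shapeConst {κ α₁ c₀ : ℝ} (hκ : 0 < κ) (hα₁ : 0 < α₁) : c₀ ≤ shapeConst κ α₁ c₀ := by
  have : 0 ≤ (1 + κ) * (1 + α₁) * (1 + 2 * (1 + α₁) ^ 2) := by positivity
  unfold shapeConst
  linarith

/-- The mesh conditions yield the structural assumptions of the estimates. -/
lemma stripMesh {κ α₀ α₁ c₀ : ℝ} (hκ : 0 < κ) (hα₁ : 0 < α₁) (hc₀ : 0 < c₀) (hst : K.Standing κ α₀ M)
    (hX : IsMesh1D n X) (h1 : K.CondA1 n X) (h2 : K.CondA2 κ c₀) (h3 : K.CondA3 α₁) :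
    StripMesh K n X (shapeConst κ α₁ c₀) M where
  mesh1D := hX
  one_le := one_le_shapeConst hκ hα₁ hc₀
  shape _ hT := exists_shape hκ hα₁ hc₀ h1 h2 h3 hT
  valence := hst.valence
  hz_le_Hz z hz := (h2 z hz).1.le.trans
    (mul_le_mul_of_nonneg_right (c₀_le_shapeConst hκ hα₁) Metric.diam_nonneg)

end Mesh

end AnisoFE

theorem mainTheorem2
    -- the constants in the mesh assumptions and in the definition of the short edges
    (κ α₀ α₁ c₀ cS : ℝ) (M : ℕ) (hκ : 0 < κ) (hα₀ : 0 < α₀) (hα₀' : α₀ < Real.pi)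
    (hα₁ : 0 < α₁) (hc₀ : 0 < c₀) (hcS : 0 < cS) :
    ∃ C : ℝ, 0 < C ∧
      ∀ (ε : ℝ) (f : AnisoFE.Pt → ℝ → ℝ) (Cf : ℝ) (u : AnisoFE.Pt → ℝ)
        (K : AnisoFE.Mesh) (uh G Gh g gbar : AnisoFE.Pt → ℝ),
        0 < ε → ε ≤ 1 → AnisoFE.IsReaction f Cf → 1 ≤ Cf + ε ^ 2 →
        AnisoFE.IsSolution ε f u →
        K.IsDiscreteSolution ε f uh →
        0 < AnisoFE.energyNorm ε (fun x => uh x - u x) →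
        G = (fun x => (uh x - u x) / AnisoFE.energyNorm ε (fun y => uh y - u y)) →
        K.MemSh Gh →
        g = (fun x => G x - Gh x) →
        (∀ z ∈ K.nodes, z ∈ frontier AnisoFE.Ω → gbar z = 0) →
        AnisoFE.energyNorm ε (fun x => uh x - u x)
            ≤ C * (K.termI ε uh g gbar + K.termII f uh g gbar + K.termQuad f uh G) ∧
        ∀ (n : ℕ) (X : ℕ → ℝ),
          K.Standing κ α₀ M →
          AnisoFE.Mesh.IsMesh1D n X → K.CondA1 n X → K.CondA2 κ c₀ → K.CondA3 α₁ →
          K.IsHatAverage n X g gbar →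
          |K.termI ε uh g gbar|
            ≤ C * Real.sqrt (K.Theta ε g * K.jumpEstimator cS ε uh) := by
  -- the energy norm bound holds with the constant `2`
  set A := AnisoFE.Mesh.shapeConst κ α₁ c₀
  set C := max 2 (AnisoFE.Mesh.edgeConst A M cS)
  have hC2 : 2 ≤ C := le_max_left _ _
  refine ⟨C, by linarith, ?_⟩
  intro ε f Cf u K uh G Gh g gbar hε _ hf hCf hu huh hpos hG hGh hg hgbar
  refine ⟨?_, fun n X hst hX h1 h2 h3 havg => ?_⟩
  · have h := AnisoFE.energyNorm_le hf hCf hu huh hpos hG hGh hg hgbar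
    refine h.trans (mul_le_mul_of_nonneg_right hC2 ?_)
    linarith
  · have hgH : AnisoFE.MemH10C g := by
      have hge : g = fun x => 1 * G x + (-1) * Gh x := by rw [hg]; ext x; ring
      have hGe : G = fun x => (AnisoFE.energyNorm ε fun y => uh y - u y)⁻¹ * uh x +
          (-(AnisoFE.energyNorm ε fun y => uh y - u y)⁻¹) * u x := by
        rw [hG]; ext x; simp only [div_eq_mul_inv]; ring
      have hGH : AnisoFE.MemH10C G := by rw [hGe]; exact huh.1.memH10C.linear_comb hu.1 _ _
      rw [hge]; exact hGH.linear_comb hGh.memH10C _ _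
    have hK := AnisoFE.Mesh.stripMesh hκ hα₁ hc₀ hst hX h1 h2 h3
    exact (hK.abs_termI_le hε hgH hgbar havg hcS huh.1).trans
      (mul_le_mul_of_nonneg_right (le_max_right _ _) (Real.sqrt_nonneg _))
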